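/- Let $M$ be a smooth $7$-manifold with a closed $3$-form $\lambda$ which on every tangent space is linearly equivalent to the standard $G_2$-form $e^{123}+e^{145}+e^{167}+e^{246}-e^{257}-e^{347}-e^{356}$ on $\mathbb R^7$ (in particular, $M$ may be any Riemannian $7$-manifold with holonomy in $G_2$). A singular knot is a smooth immersion $\gamma:S^1\to M$ which is an embedding off a finite set $A\subset S^1$ and whose branches at distinct points of $A$ are tangent to at most finite order; singular knots are considered up to orientation preserving diffeomorphisms of $S^1$. Let $\Sigma_1,\Sigma_2\subset M$ be embedded $4$-dimensional submanifolds with $\lambda|_{\Sigma_1}=0$, $\lambda|_{\Sigma_2}=0$, which intersect transversally (such submanifolds are automatically orientable), and let $\gamma_1,\gamma_2$ be singular knots contained in $\Sigma_1\cap\Sigma_2$. *Connecting squares.* A connecting square is a map $u:[0,1]^2\times S^1\to M$, $(a,b,z)\mapsto u(a,b,z)$, such that every $u(a,b,\cdot)$ is a singular knot; the map $(a,b,z)\mapsto e:=\partial_z u(a,b,z)\in TM$ is continuous; $u(a,0,z)\in\Sigma_1$ and $u(a,1,z)\in\Sigma_2$; and $u(0,b,\cdot)$, $u(1,b,\cdot)$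 do not depend on $b$ and are parametrizations of $\gamma_2$ and $\gamma_1$, respectively. Suppose that a connecting square exists. *Trivializations.* Given $u$, let $I_u$ be the rank $6$ bundle over $[0,1]^2\times S^1$ with fibres $T_{u}M/\mathbb R e$ and symplectic form $\lambda(e,\cdot,\cdot)$; where $u$ lies in $\Sigma_j$ and $e$ is tangent to it, let $L_j=T\Sigma_j/\mathbb R e\subset I_u$. An admissible trivialization is a trivialization $\Phi:I_u\to\mathbb C^3$ carrying the symplectic form to the standard one, not depending on $b$ over $a=0$ and over $a=1$, and satisfying $\Phi(L_1)=i\,\Phi(L_2)$ there. It defines a map from the torus $\partial[0,1]^2\times S^1$ to the Lagrangian Grassmannian $\Lambda_3$ of $\mathbb C^3$: $$(a,0,z)\mapsto\Phi(L_1),\quad (1,b,z)\mapsto e^{i\pi b/2}\Phi(L_1),\quad (a,1,z)\mapsto\Phi(L_2),\quad (0,b,z)\mapsto e^{-i\pi(1-b)/2}\Phi(L_2).$$ Let $\mu\in H^1(\Lambda_3;\mathbb Z)$ be the Maslov class (the degree of $\det^2$), pulled back to the torus, and $S=\{(0,0)\}\times S^1$. The trivialization is normalized if $\mu(S)=0$.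 *Claim.* For every connecting square $u$ there is a normalized admissible trivialization. There is exactly one integer $m(\gamma_1,\gamma_2)$, the relative Maslov index, such that $\mu(P)=m(\gamma_1,\gamma_2)$ for every connecting square $u$, every normalized admissible trivialization $\Phi$ of $I_u$ and every integral $1$-cycle $P$ of the torus with intersection number one with $S$ (that is, whose projection to $\partial[0,1]^2$, oriented counterclockwise, has degree one); such cycles exist. -/

import Mathlib

open Set Manifold Topology Bundle
open scoped ContDiff unitInterval

noncomputable section

namespace G2Loop

/-- The circle `ℝ/ℤ`. -/
abbrev S1 : Type := UnitAddCircle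

/-- The model space of 7-manifolds. -/
abbrev E7 : Type := EuclideanSpace ℝ (Fin 7)

/-- The model fibre `ℂ³`. -/
abbrev C3 : Type := Fin 3 → ℂ

/-! ### G₂-forms -/

/-- The elementary 3-form `e^i ∧ e^j ∧ e^k` on `ℝ⁷`. -/
def elem3 (i j k : Fin 7) (u v w : Fin 7 → ℝ) : ℝ :=
  Matrix.det !![u i, u j, u k; v i, v j, v k; w i, w j, w k]

/-- The standard 3-form on `ℝ⁷ = Im 𝕆`, i.e. `⟨a * b, c⟩ = ½ ⟨[a, b], c⟩`, in a standard basis: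
`e¹²³ + e¹⁴⁵ + e¹⁶⁷ + e²⁴⁶ - e²⁵⁷ - e³⁴⁷ - e³⁵⁶` (the indices below start at `0`). -/
def stdG2Form (u v w : Fin 7 → ℝ) : ℝ :=
  elem3 0 1 2 u v w + elem3 0 3 4 u v w + elem3 0 5 6 u v w + elem3 1 3 5 u v w
    - elem3 1 4 6 u v w - elem3 2 3 6 u v w - elem3 2 4 5 u v w

section Manifold

variable {M : Type*} [TopologicalSpace M] [ChartedSpace E7 M]

/-- A (not necessarily continuous) field of alternating 3-forms on the tangent spaces of `M`. -/
abbrev ThreeForm (M : Type*) [TopologicalSpace M] [ChartedSpace E7 M] : Type _ :=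
  ∀ x : M, (TangentSpace (𝓡 7) x) [⋀^Fin 3]→L[ℝ] ℝ

/-- The expression of a 3-form in the preferred chart around `x₀`: the pullback of the form by the
inverse of the chart. -/
def ThreeForm.inChart (lam : ThreeForm M) (x₀ : M) (y : E7) : E7 [⋀^Fin 3]→L[ℝ] ℝ :=
  (lam ((extChartAt (𝓡 7) x₀).symm y)).compContinuousLinearMap
    (mfderiv 𝓘(ℝ, E7) (𝓡 7) (extChartAt (𝓡 7) x₀).symm y)

/-- `lam` is a G₂-form: a smooth closed 3-form, which on each tangent space is linearly equivalent
to the standard form. -/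
structure IsG2Form (lam : ThreeForm M) : Prop where
  smooth : ∀ x₀ : M, ContDiffOn ℝ ∞ (lam.inChart x₀) (extChartAt (𝓡 7) x₀).target
  closed : ∀ x₀ : M, ∀ y ∈ (extChartAt (𝓡 7) x₀).target, extDeriv (lam.inChart x₀) y = 0
  pointwise : ∀ x : M, ∃ A : TangentSpace (𝓡 7) x ≃ₗ[ℝ] (Fin 7 → ℝ),
    ∀ u v w : TangentSpace (𝓡 7) x, lam x ![u, v, w] = stdG2Form (A u) (A v) (A w)

/-! ### Loops -/

/-- The velocity of a loop. -/
def velocity (γ : S1 → M) (z : S1) : TangentSpace (𝓡 7) (γ z) :=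
  (mfderiv 𝓘(ℝ, ℝ) (𝓡 7) (fun s : ℝ => γ (z + (s : S1))) 0 (1 : ℝ) : E7)

/-- The branches of `γ` at `z₁` and at `z₂` have contact of order at least `k`: after a
change of parameter of one of them, they have the same `k`-jet. Jets of curves in `M` are
compared by means of smooth functions on `M`. -/
def ContactAtLeast (γ : S1 → M) (z₁ z₂ : S1) (k : ℕ) : Prop :=
  ∃ φ : ℝ → ℝ, ContDiff ℝ ∞ φ ∧ φ 0 = 0 ∧ deriv φ 0 ≠ 0 ∧
    ∀ f : M → ℝ, ContMDiff (𝓡 7) 𝓘(ℝ, ℝ) ∞ f → ∀ j ≤ k,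
      iteratedDeriv j (fun s : ℝ => f (γ (z₁ + (s : S1)))) 0 =
        iteratedDeriv j (fun s : ℝ => f (γ (z₂ + (φ s : S1)))) 0

/-- The parametrized singular knots: smooth immersed loops which are embeddings off a finite set
`A`, whose branches at distinct points of `A` have at most a tangency of finite order. -/
structure IsSingularKnot (γ : S1 → M) : Prop where
  smooth : ContMDiff 𝓘(ℝ, ℝ) (𝓡 7) ∞ (fun s : ℝ => γ (s : S1))
  immersed : ∀ z, velocity γ z ≠ 0
  generic : ∃ A : Set S1, A.Finite ∧ IsEmbedding (Aᶜ.domRestrict γ) ∧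
    ∀ z₁ ∈ A, ∀ z₂ ∈ A, z₁ ≠ z₂ → γ z₁ = γ z₂ → ∃ k, ¬ ContactAtLeast γ z₁ z₂ k

/-- `γ'` arises from `γ` by an orientation preserving diffeomorphism of the circle, i.e. the two
parametrized loops define the same non-parametrized loop. -/
def SameKnot (γ γ' : S1 → M) : Prop :=
  ∃ φ : ℝ → ℝ, ContDiff ℝ ∞ φ ∧ (∀ s, 0 < deriv φ s) ∧ (∀ s, φ (s + 1) = φ s + 1) ∧
    ∀ s : ℝ, γ' (s : S1) = γ (φ s : S1)

/-! ### Embedded isotropic 4-submanifolds -/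

section Submanifold

variable {N : Type*} [TopologicalSpace N] [ChartedSpace (EuclideanSpace ℝ (Fin 4)) N]

/-- The tangent space at `x` of the submanifold `i : N → M`; it is the image of the differential of
`i` at the point over `x` (and `0` if `x` is not in the image; `i` is injective in all uses). -/
def tangentAt (i : N → M) (x : M) : Submodule ℝ (TangentSpace (𝓡 7) x) :=
  ⨆ (y : N) (_ : i y = x),
    ((mfderiv (𝓡 4) (𝓡 7) i y).toLinearMap.range : Submodule ℝ E7)

/-- `i : N → M` is a smooth embedding of a 4-manifold on which the 3-form vanishes identically. -/
structure IsIsotropicEmbedding (lam : ThreeForm M) (i : N → M) : Prop where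
  embedding : IsSmoothEmbedding (𝓡 4) (𝓡 7) ∞ i
  isotropic : ∀ (y : N) (v : Fin 3 → TangentSpace (𝓡 4) y),
    lam (i y) (fun j => mfderiv (𝓡 4) (𝓡 7) i y (v j)) = 0

end Submanifold

/-- Transversality of two 4-submanifolds. -/
def Transversal {N₁ N₂ : Type*}
    [TopologicalSpace N₁] [ChartedSpace (EuclideanSpace ℝ (Fin 4)) N₁]
    [TopologicalSpace N₂] [ChartedSpace (EuclideanSpace ℝ (Fin 4)) N₂]
    (i₁ : N₁ → M) (i₂ : N₂ → M) : Prop :=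
  ∀ x ∈ range i₁ ∩ range i₂, tangentAt i₁ x ⊔ tangentAt i₂ x = ⊤

/-! ### The bundle `I = p^*TM / O` over the complement of the zero section of `TM` -/

/-- The fibre of `I` over the point `(x, e)` of `TM`. -/
abbrev FiberI (x : M) (e : TangentSpace (𝓡 7) x) : Type :=
  TangentSpace (𝓡 7) x ⧸ Submodule.span ℝ {e}

/-- The fibre over `(x, e)`, `e` tangent to the submanifold, of the Lagrangian subbundle of `I`
defined by the submanifold: the image of its tangent space in `T_x M / ℝ e`. -/
def lagr {N : Type*} [TopologicalSpace N] [ChartedSpace (EuclideanSpace ℝ (Fin 4)) N]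
    (i : N → M) (x : M) (e : TangentSpace (𝓡 7) x) : Submodule ℝ (FiberI x e) :=
  (tangentAt i x).map (Submodule.mkQ (Submodule.span ℝ {e}))

/-! ### Connecting squares -/

variable [IsManifold (𝓡 7) ∞ M]

/-- A square of singular knots, written as a map `[0,1]² × S¹ → M`, joining an arc of loops in the
first submanifold (second coordinate `0`) to an arc of loops in the second one (second
coordinate `1`); it is constant on the remaining two sides, where it is (a parametrization of)
`γ₂` (first coordinate `0`), respectively `γ₁` (first coordinate `1`). -/
structure ConnectingSquare {N₁ N₂ : Type*} (i₁ : N₁ → M) (i₂ : N₂ → M) (γ₁ γ₂ : S1 → M) where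
  /-- the map -/
  map : I × I × S1 → M
  knot : ∀ a b : I, IsSingularKnot (fun z => map (a, b, z))
  /-- the induced map to the tangent bundle is continuous -/
  continuous : Continuous fun p : I × I × S1 =>
    (⟨map p, velocity (fun z => map (p.1, p.2.1, z)) p.2.2⟩ : TangentBundle (𝓡 7) M)
  side₁ : ∀ a z, map (a, 0, z) ∈ range i₁
  side₂ : ∀ a z, map (a, 1, z) ∈ range i₂
  const_zero : ∀ b z, map (0, b, z) = map (0, 0, z)
  const_one : ∀ b z, map (1, b, z) = map (1, 0, z)
  end_zero : SameKnot γ₂ (fun z => map (0, 0, z))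
  end_one : SameKnot γ₁ (fun z => map (1, 0, z))

section Square

variable {N₁ N₂ : Type*} {i₁ : N₁ → M} {i₂ : N₂ → M} {γ₁ γ₂ : S1 → M}

/-- The velocity, in the circle direction, of a connecting square. -/
def ConnectingSquare.vel (u : ConnectingSquare i₁ i₂ γ₁ γ₂) (p : I × I × S1) :
    TangentSpace (𝓡 7) (u.map p) :=
  velocity (fun z => u.map (p.1, p.2.1, z)) p.2.2

/-- The fibre of the pullback of `I` by the map `[0,1]² × S¹ → TM` induced by the square. -/
abbrev ConnectingSquare.Fiber (u : ConnectingSquare i₁ i₂ γ₁ γ₂) (p : I × I × S1) : Type :=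
  FiberI (u.map p) (u.vel p)

end Square

/-- The standard symplectic form `⟨i x, y⟩ = Im ∑ conj(x_j) y_j` of `ℂ³`. -/
def stdSymp (x y : C3) : ℝ := (∑ j, starRingEnd ℂ (x j) * y j).im

/-- Multiplication of a real subspace of `ℂ³` by a complex number. -/
def cmul (c : ℂ) (L : Submodule ℝ C3) : Submodule ℝ C3 :=
  L.map ((LinearMap.lsmul ℂ C3 c).restrictScalars ℝ)

section Trivialization

variable {N₁ N₂ : Type*}
  [TopologicalSpace N₁] [ChartedSpace (EuclideanSpace ℝ (Fin 4)) N₁]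
  [TopologicalSpace N₂] [ChartedSpace (EuclideanSpace ℝ (Fin 4)) N₂]
  {i₁ : N₁ → M} {i₂ : N₂ → M} {γ₁ γ₂ : S1 → M}

/-- A trivialization of the pullback of `I` by a connecting square which maps the symplectic form
`λ(e, ·, ·)` to the standard one, is constant on the two sides where the square is constant, and
which maps there the two Lagrangian subspaces to subspaces differing by multiplication by `i`. -/
structure SympTrivialization (lam : ThreeForm M) (u : ConnectingSquare i₁ i₂ γ₁ γ₂) where
  /-- the trivialization on each fibre -/
  equiv : ∀ p : I × I × S1, u.Fiber p ≃ₗ[ℝ] C3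
  /-- continuity, on the total space of the pullback of the tangent bundle -/
  continuous : Continuous fun q : TotalSpace E7
      (u.map *ᵖ (TangentSpace (𝓡 7) : M → Type)) =>
    equiv q.proj (Submodule.Quotient.mk (q.snd : TangentSpace (𝓡 7) (u.map q.proj)))
  symplectic : ∀ (p : I × I × S1) (v w : TangentSpace (𝓡 7) (u.map p)),
    stdSymp (equiv p (Submodule.Quotient.mk v)) (equiv p (Submodule.Quotient.mk w)) =
      lam (u.map p) ![u.vel p, v, w]
  const_zero : ∀ (b : I) (z : S1) (v : E7),
    equiv (0, b, z) (Submodule.Quotient.mk (v : TangentSpace (𝓡 7) (u.map (0, b, z)))) =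
      equiv (0, 0, z) (Submodule.Quotient.mk (v : TangentSpace (𝓡 7) (u.map (0, 0, z))))
  const_one : ∀ (b : I) (z : S1) (v : E7),
    equiv (1, b, z) (Submodule.Quotient.mk (v : TangentSpace (𝓡 7) (u.map (1, b, z)))) =
      equiv (1, 0, z) (Submodule.Quotient.mk (v : TangentSpace (𝓡 7) (u.map (1, 0, z))))
  ends : ∀ p : I × I × S1, p.1 = 0 ∨ p.1 = 1 →
    (lagr i₁ (u.map p) (u.vel p)).map (equiv p).toLinearMap =
      cmul Complex.I ((lagr i₂ (u.map p) (u.vel p)).map (equiv p).toLinearMap)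

end Trivialization

end Manifold

/-! ### The Maslov class -/

/-- A nowhere vanishing path `f` in `ℂ` has a continuous choice of argument, which changes by
`2πk`. -/
def HasWinding (f : I → ℂ) (k : ℤ) : Prop :=
  (∀ t, f t ≠ 0) ∧ ∃ θ : I → ℝ, Continuous θ ∧
    (∀ t, f t = (‖f t‖ : ℂ) * Complex.exp (2 * Real.pi * θ t * Complex.I)) ∧
    θ 1 - θ 0 = k

/-- The value of the Maslov class on the loop `ℓ` in the Lagrangian Grassmannian of `ℂ³` is `k`.
The loop, run through from `0` to `1`, is the span of the columns of a continuous family of complex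
matrices `B t`, and `k` is the winding number of `(det B t)²` (which up to a positive factor depends
only on the subspace `ℓ t`). -/
def IsMaslov (ℓ : S1 → Submodule ℝ C3) (k : ℤ) : Prop :=
  (∀ z, ∀ x ∈ ℓ z, ∀ y ∈ ℓ z, stdSymp x y = 0) ∧
  ∃ B : I → Matrix (Fin 3) (Fin 3) ℂ, Continuous B ∧
    (∀ t : I, Submodule.span ℝ (range (B t).transpose) = ℓ ((t : ℝ) : S1)) ∧
    HasWinding (fun t => (B t).det ^ 2) k

/-! ### The torus `∂[0,1]² × S¹` and its 1-cycles -/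

/-- The boundary of the unit square. -/
abbrev Bdry : Type := {p : I × I // p.1 = 0 ∨ p.1 = 1 ∨ p.2 = 0 ∨ p.2 = 1}

/-- The torus `∂[0,1]² × S¹`. -/
abbrev Torus : Type := Bdry × S1

/-- The distinguished loop `S = {0} × {0} × S¹`. -/
def loopS : C(S1, Torus) := ⟨fun z => (⟨(0, 0), Or.inl rfl⟩, z), by fun_prop⟩

/-- An integral 1-cycle of the torus, as a formal combination of loops. -/
structure OneCycle where
  /-- the number of loops -/
  size : ℕ
  /-- the loops -/
  loop : Fin size → C(S1, Torus)
  /-- the coefficients -/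
  coeff : Fin size → ℤ

/-- The intersection number of the cycle `P` with `S = {(0,0)} × S¹` is `k`. For a loop, it is the
degree of its projection to `∂[0,1]²` (oriented counterclockwise), i.e. the winding number of the
projection about the centre of the square. -/
def OneCycle.PairsWithS (P : OneCycle) (k : ℤ) : Prop :=
  ∃ d : Fin P.size → ℤ, (∀ j, HasWinding (fun t : I =>
      (((P.loop j ((t : ℝ) : S1)).1.1.1 : ℝ) - 1 / 2 : ℂ) +
        (((P.loop j ((t : ℝ) : S1)).1.1.2 : ℝ) - 1 / 2 : ℂ) * Complex.I) (d j)) ∧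
    ∑ j, P.coeff j * d j = k

/-- The pairing with the cycle `P` of the pullback of the Maslov class by a map `ℓ` from the torus
to the Lagrangian Grassmannian is `k`. -/
def OneCycle.MaslovPairing (P : OneCycle) (ℓ : Torus → Submodule ℝ C3) (k : ℤ) : Prop :=
  ∃ m : Fin P.size → ℤ, (∀ j, IsMaslov (fun z => ℓ (P.loop j z)) (m j)) ∧
    ∑ j, P.coeff j * m j = k

/-! ### The relative index -/

section Index

variable {M : Type*} [TopologicalSpace M] [ChartedSpace E7 M] [IsManifold (𝓡 7) ∞ M]
  {N₁ N₂ : Type*}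
  [TopologicalSpace N₁] [ChartedSpace (EuclideanSpace ℝ (Fin 4)) N₁]
  [TopologicalSpace N₂] [ChartedSpace (EuclideanSpace ℝ (Fin 4)) N₂]
  {i₁ : N₁ → M} {i₂ : N₂ → M} {γ₁ γ₂ : S1 → M} {lam : ThreeForm M}
  {u : ConnectingSquare i₁ i₂ γ₁ γ₂}

/-- The image in `ℂ³` of the Lagrangian subspace of the first submanifold. -/
def SympTrivialization.lagr₁ (Φ : SympTrivialization lam u) (p : I × I × S1) : Submodule ℝ C3 :=
  (lagr i₁ (u.map p) (u.vel p)).map (Φ.equiv p).toLinearMap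

/-- The image in `ℂ³` of the Lagrangian subspace of the second submanifold. -/
def SympTrivialization.lagr₂ (Φ : SympTrivialization lam u) (p : I × I × S1) : Submodule ℝ C3 :=
  (lagr i₂ (u.map p) (u.vel p)).map (Φ.equiv p).toLinearMap

open Classical in
/-- The map from `∂[0,1]² × S¹` to the Lagrangian Grassmannian. It is given by the two submanifolds
over the sides `b = 0` and `b = 1`, by `e^{iπb/2} Φ(L₁)` over the side `a = 1`, and by
`e^{-iπs/2} Φ(L₂)`, `s = 1 - b`, over the side `a = 0`; here `s` is the time on this side when the
boundary is run through counterclockwise. -/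
def SympTrivialization.boundaryMap (Φ : SympTrivialization lam u) (q : Torus) : Submodule ℝ C3 :=
  let a : I := q.1.1.1
  let b : I := q.1.1.2
  let p : I × I × S1 := (a, b, q.2)
  if b = 0 then Φ.lagr₁ p
  else if b = 1 then Φ.lagr₂ p
  else if a = 1 then cmul (Complex.exp (Complex.I * Real.pi / 2 * (b : ℝ))) (Φ.lagr₁ p)
  else cmul (Complex.exp (-(Complex.I * Real.pi / 2 * (1 - (b : ℝ))))) (Φ.lagr₂ p)

/-- The trivialization is normalized: the Maslov class vanishes on `S`. -/
def SympTrivialization.Normalized (Φ : SympTrivialization lam u) : Prop :=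
  IsMaslov (fun z => Φ.boundaryMap (loopS z)) 0

/-- The relative Maslov index computed from the connecting square `u`, the (normalized)
trivialization `Φ` and the cycle `P` (of intersection number one with `S`) is `m`. -/
def IsRelativeIndex (u : ConnectingSquare i₁ i₂ γ₁ γ₂) (Φ : SympTrivialization lam u)
    (P : OneCycle) (m : ℤ) : Prop :=
  P.MaslovPairing Φ.boundaryMap m

end Index

end G2Loop

end

open Set Manifold Topology Bundle
open scoped ContDiff unitInterval

noncomputable section

set_option linter.unusedSectionVars false

namespace G2Loop

section

/-! ### The cross product of `ℝ⁷` -/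

open Matrix

/-! A nonzero vector e of a G₂-vector space turns its orthogonal complement into a complex 3-space.
The map J v = e × v / |e| is a complex structure compatible with the symplectic form λ(e,·,·), and
the restriction of λ is the real part of a complex volume form Ω (`gVol`). If λ vanishes on a
4-dimensional subspace containing e, its image modulo e is not only Lagrangian but special
Lagrangian: Re Ω vanishes on it (`gVol_re_eq_zero`). So L₁ and L₂ both have constant phase with
respect to Ω, and the Maslov class only sees how the trivialization differs from a complex linear
one, and the rotations over the sides a = 0 and a = 1.

Comparison with Ω. For a symplectic map T to ℂ³ the maps T − s i T J, 0 ≤ s ≤ 1, join T to a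
J-linear map, and their determinants on a basis of a Lagrangian subspace never vanish
(`linDet_ne_zero`). At s = 1 the determinant is a multiple of Ω, with a factor (`volRatio`) which
depends on T but on no subspace (`linDet_one`). Let θⱼ be the continuous argument of the determinant
on Lⱼ divided by its value at s = 1, which is 0 at s = 1, evaluated at s = 0. Then det² of Φ(Lⱼ) has
the argument 2θⱼ + α + π, where α is an argument of the square of the factor
(`SympTrivialization.isArg_det_sq`). That factor is a nonvanishing continuous function on all of
[0,1]² × S¹; normalization says that its square does not wind along S, so α exists globally
(`SympTrivialization.exists_arg_ratio`).

The ends. Where L₁ = i L₂ one has θ₂ − θ₁ = ±π/2, and the sign depends only on λ, e and the two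
subspaces, not on T (`exists_arg_linDet_ratio`, `arg_sub_arg_linDet`). Write θ₂ − θ₁ = (3 − 2n)π/2
with n = 1 or 2 (`endIndex`). From b = 0 to b = 1 the rotation adds 3π to the argument of det²,
while 2(θ₂ − θ₁) accounts for (3 − 2n)π only; the excess is 2πn. Counterclockwise, the side a = 1 is
run upwards and the side a = 0 downwards, so the index is `endIndex` of γ₁ minus `endIndex` of γ₂
(`SympTrivialization.isMaslov_iff`, `isRelativeIndex_iff`). Each term is computed at one point of
its knot, and neither the square nor the trivialization nor the cycle enters.

Existence. Im Ω orients L₁, so L₁ has a frame over the side b = 0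
(`ConnectingSquare.exists_frame₁`). A J-linear transport extends it to a complex frame over the
whole square (`ConnectingSquare.exists_complex_frame`), and Gram–Schmidt makes it unitary. After
multiplication by i, L₁ becomes iℝ³ over b = 0 and over the ends. By transversality L₂ is over the
ends the graph of a symmetric matrix over ℝ³, and a shear fixing iℝ³ straightens it to ℝ³; the two
shears are interpolated linearly in a. Since L₁ is constant along S, the result is normalized.
Continuity of J rests on the fact that the metric of a G₂-form depends continuously on the form
(`continuousAt_transpose_mul_self`). -/

lemma elem3_eq (i j k : Fin 7) (u v w : Fin 7 → ℝ) :
    elem3 i j k u v w = u i * (v j * w k - v k * w j) - u j * (v i * w k - v k * w i)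
      + u k * (v i * w j - v j * w i) := by
  simp [elem3, Matrix.det_fin_three]; ring

/-- The matrix of `y ↦ x × y`, where `x × y` is the cross product of `ℝ⁷ = Im 𝕆`. -/
def crossMat (x : Fin 7 → ℝ) : Matrix (Fin 7) (Fin 7) ℝ :=
  !![0, -x 2, x 1, -x 4, x 3, -x 6, x 5;
     x 2, 0, -x 0, -x 5, x 6, x 3, -x 4;
     -x 1, x 0, 0, x 6, x 5, -x 4, -x 3;
     x 4, x 5, -x 6, 0, -x 0, -x 1, x 2;
     -x 3, -x 6, -x 5, x 0, 0, x 2, x 1;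
     x 6, -x 3, x 4, x 1, -x 2, 0, -x 0;
     -x 5, x 4, x 3, -x 2, -x 1, x 0, 0]

/-- The cross product of `ℝ⁷ = Im 𝕆`. -/
def cross (x y : Fin 7 → ℝ) : Fin 7 → ℝ := crossMat x *ᵥ y

lemma cross_dot (x y z : Fin 7 → ℝ) : cross x y ⬝ᵥ z = stdG2Form x y z := by
  simp [cross, crossMat, Matrix.mulVec, dotProduct, Fin.sum_univ_succ, stdG2Form, elem3_eq,
    Fin.succ]
  ring

lemma crossMat_transpose (x : Fin 7 → ℝ) : (crossMat x)ᵀ = -crossMat x := by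
  ext i j
  fin_cases i <;> fin_cases j <;> simp [crossMat]

/-- This is alternativity of the octonions: left multiplication by an imaginary octonion x squares
to −|x|². The cross product drops the real part of the product, which accounts for the rank one
term. -/
lemma crossMat_mul_self (x : Fin 7 → ℝ) :
    crossMat x * crossMat x = -((x ⬝ᵥ x) • (1 : Matrix (Fin 7) (Fin 7) ℝ)) + vecMulVec x x := by
  ext i j
  fin_cases i <;> fin_cases j <;>
    simp [crossMat, Matrix.mul_apply, dotProduct, Fin.sum_univ_succ, vecMulVec, Fin.succ] <;> ring

lemma cross_cross (x y : Fin 7 → ℝ) :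
    cross x (cross x y) = -((x ⬝ᵥ x) • y) + (x ⬝ᵥ y) • x := by
  simp only [cross, Matrix.mulVec_mulVec, crossMat_mul_self, Matrix.add_mulVec, Matrix.neg_mulVec,
    Matrix.smul_mulVec, Matrix.one_mulVec, Matrix.vecMulVec_mulVec]
  simp

lemma cross_self (x : Fin 7 → ℝ) : cross x x = 0 := by
  ext i
  fin_cases i <;> simp [cross, crossMat, Matrix.mulVec, dotProduct, Fin.sum_univ_succ, Fin.succ] <;>
    ring

lemma cross_smul (x : Fin 7 → ℝ) (c : ℝ) (y : Fin 7 → ℝ) : cross x (c • y) = c • cross x y :=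
  Matrix.mulVec_smul _ _ _

lemma smul_cross (x : Fin 7 → ℝ) (c : ℝ) (y : Fin 7 → ℝ) : cross (c • x) y = c • cross x y := by
  ext i
  fin_cases i <;> simp [cross, crossMat, Matrix.mulVec, dotProduct, Fin.sum_univ_succ, Fin.succ] <;>
    ring

lemma stdG2Form_swap12 (x y z : Fin 7 → ℝ) : stdG2Form y x z = -stdG2Form x y z := by
  simp only [stdG2Form, elem3_eq]; ring

lemma stdG2Form_swap23 (x y z : Fin 7 → ℝ) : stdG2Form x z y = -stdG2Form x y z := by
  simp only [stdG2Form, elem3_eq]; ring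

/-- The right side vanishes if x, y and z are orthogonal to e. This is what makes the form on the
complement of e the real part of a complex trilinear form. -/
lemma stdG2Form_cross_comm (e x y z : Fin 7 → ℝ) :
    stdG2Form (cross e x) y z - stdG2Form x (cross e y) z =
      (e ⬝ᵥ x) * (y ⬝ᵥ z) + (e ⬝ᵥ y) * (x ⬝ᵥ z) - 2 * (x ⬝ᵥ y) * (e ⬝ᵥ z) := by
  simp [cross, crossMat, dotProduct, Fin.sum_univ_succ, stdG2Form, elem3_eq,
    Fin.succ]
  ring

end

section

/-! ### The metric of a `G₂`-form depends continuously on the form -/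

open Matrix

lemma crossMat_mulVec_self (x : Fin 7 → ℝ) : crossMat x *ᵥ x = 0 := cross_self x

lemma vecMul_crossMat_self (x : Fin 7 → ℝ) : x ᵥ* crossMat x = 0 := by
  rw [← Matrix.mulVec_transpose, crossMat_transpose, Matrix.neg_mulVec, crossMat_mulVec_self,
    neg_zero]

/-- The product of the matrix with its transpose is |f|² times a rank one perturbation of the
identity, to which the matrix determinant lemma applies. Squaring makes the sign of the determinant
irrelevant. -/
lemma det_crossMat_add_self_sq (f : Fin 7 → ℝ) (hf : f ⬝ᵥ f ≠ 0) (c : ℝ) :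
    (crossMat f + c • vecMulVec f f).det ^ 2 = c ^ 2 * (f ⬝ᵥ f) ^ 8 := by
  have h1 : (crossMat f + c • vecMulVec f f) * (crossMat f + c • vecMulVec f f)ᵀ =
      (f ⬝ᵥ f) • (1 + replicateCol Unit f *
        replicateRow Unit (((c ^ 2 * (f ⬝ᵥ f) - 1) * (f ⬝ᵥ f)⁻¹) • f)) := by
    have h2 : crossMat f * vecMulVec f f = 0 := by
      rw [Matrix.mul_vecMulVec, crossMat_mulVec_self]; ext; simp [vecMulVec]
    have h3 : vecMulVec f f * crossMat f = 0 := by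
      rw [Matrix.vecMulVec_mul, vecMul_crossMat_self]; ext; simp [vecMulVec]
    have h4 : vecMulVec f f * vecMulVec f f = (f ⬝ᵥ f) • vecMulVec f f := by
      rw [Matrix.vecMulVec_mul_vecMulVec]
      ext i j; simp [vecMulVec_apply]; ring
    have h5 : (replicateCol Unit f *
        replicateRow Unit (((c ^ 2 * (f ⬝ᵥ f) - 1) * (f ⬝ᵥ f)⁻¹) • f)) =
        ((c ^ 2 * (f ⬝ᵥ f) - 1) * (f ⬝ᵥ f)⁻¹) • vecMulVec f f := by
      rw [← Matrix.vecMulVec_eq]; ext i j; simp [vecMulVec_apply]; ring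
    rw [h5, Matrix.transpose_add, crossMat_transpose, Matrix.transpose_smul,
      Matrix.transpose_vecMulVec, add_mul, mul_add, mul_add, mul_neg, crossMat_mul_self]
    simp only [Matrix.mul_smul, Matrix.smul_mul, h2, h3, h4, mul_neg]
    ext i j
    simp [vecMulVec_apply]
    field_simp
    ring
  have h6 := congrArg Matrix.det h1
  rw [Matrix.det_mul, Matrix.det_transpose, Matrix.det_smul,
    Matrix.det_one_add_replicateCol_mul_replicateRow] at h6
  rw [sq, h6]
  simp
  field_simp
  ring

/-- The determinant does not depend on the choice of the covector η with η(f) = 1. This freedom is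
essential, because such a covector can be chosen without knowing the metric. -/
lemma det_crossMat_add_sq (f η : Fin 7 → ℝ) (hf : f ⬝ᵥ f ≠ 0) (hη : η ⬝ᵥ f = 1) :
    (crossMat f + vecMulVec η η).det ^ 2 = (f ⬝ᵥ f) ^ 4 := by
  set q := f ⬝ᵥ f with hq
  -- `η = Sᵀ (q⁻¹ f)` for a unipotent `S` which preserves `crossMat f`
  set ξ : Fin 7 → ℝ := η - q⁻¹ • f with hξ
  set S : Matrix (Fin 7) (Fin 7) ℝ := 1 + replicateCol Unit f * replicateRow Unit ξ with hS
  have hξf : ξ ⬝ᵥ f = 0 := by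
    rw [hξ, sub_dotProduct, hη, smul_dotProduct, ← hq, smul_eq_mul, inv_mul_cancel₀ hf, sub_self]
  have hdet : S.det = 1 := by
    rw [hS, Matrix.det_one_add_replicateCol_mul_replicateRow, hξf, add_zero]
  have hS' : S = 1 + vecMulVec f ξ := by rw [hS, ← Matrix.vecMulVec_eq]
  have h1 : Sᵀ * (crossMat f + (q⁻¹ ^ 2) • vecMulVec f f) * S = crossMat f + vecMulVec η η := by
    have a1 : crossMat f * S = crossMat f := by
      rw [hS', mul_add, mul_one, Matrix.mul_vecMulVec, crossMat_mulVec_self]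
      ext; simp [vecMulVec]
    have a2 : Sᵀ * crossMat f = crossMat f := by
      rw [hS', Matrix.transpose_add, Matrix.transpose_one, add_mul, one_mul,
        Matrix.transpose_vecMulVec, Matrix.vecMulVec_mul, vecMul_crossMat_self]
      ext; simp [vecMulVec]
    have a3 : Sᵀ *ᵥ f = q • η := by
      rw [hS', Matrix.transpose_add, Matrix.transpose_one, Matrix.add_mulVec, Matrix.one_mulVec,
        Matrix.transpose_vecMulVec, Matrix.vecMulVec_mulVec, ← hq, hξ]
      ext i
      simp
      field_simp
      ring
    have a4 : f ᵥ* S = q • η := by rw [← Matrix.mulVec_transpose, a3]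
    rw [mul_add Sᵀ, a2, add_mul (crossMat f), a1, Matrix.mul_smul, Matrix.smul_mul, Matrix.mul_vecMulVec,
      Matrix.vecMulVec_mul, a3, a4]
    congr 1
    ext i j
    simp [vecMulVec_apply]
    field_simp
  have h2 := congrArg (fun m => Matrix.det m ^ 2) h1
  simp only [Matrix.det_mul, Matrix.det_transpose, hdet, one_mul, mul_one] at h2
  rw [← h2, det_crossMat_add_self_sq f hf]
  rw [← hq]
  field_simp

lemma transpose_mul_crossMat_mul_apply (A : Matrix (Fin 7) (Fin 7) ℝ) (f : Fin 7 → ℝ) (i j : Fin 7) :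
    (Aᵀ * crossMat f * A) i j =
      stdG2Form f (A *ᵥ Pi.single j 1) (A *ᵥ Pi.single i 1) := by
  rw [← cross_dot, cross, Matrix.mulVec_mulVec, dotProduct_comm, ← Matrix.dotProduct_transpose_mulVec,
    Matrix.mulVec_mulVec]
  have : Aᵀ * (crossMat f)ᵀ * A = (Aᵀ * crossMat f * A)ᵀ := by
    simp [Matrix.transpose_mul, mul_assoc]
  have h (m : Matrix (Fin 7) (Fin 7) ℝ) : Pi.single j 1 ⬝ᵥ mᵀ *ᵥ Pi.single i 1 = m i j := by simp
  rw [Matrix.transpose_mul, this, h]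

lemma dotProduct_self_pos' {f : Fin 7 → ℝ} (hf : f ≠ 0) : 0 < f ⬝ᵥ f := by
  have h : 0 ≤ f ⬝ᵥ f := Finset.sum_nonneg fun i _ => mul_self_nonneg _
  exact lt_of_le_of_ne h fun h' => hf (dotProduct_self_eq_zero.1 h'.symm)

/-- The metric is recovered from the form up to a volume factor: by
`transpose_mul_crossMat_mul_apply` the right side involves A only through values of the pulled-back
form, and the covector added there depends only on f and the fixed coordinates. -/
lemma det_mul_normSq_eq (A : Matrix (Fin 7) (Fin 7) ℝ) (hA : A.det ≠ 0) (f : Fin 7 → ℝ)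
    (hf : f ≠ 0) :
    |A.det| * ((A *ᵥ f) ⬝ᵥ (A *ᵥ f)) = Real.sqrt (Real.sqrt ((Aᵀ * crossMat (A *ᵥ f) * A +
      vecMulVec ((f ⬝ᵥ f)⁻¹ • f) ((f ⬝ᵥ f)⁻¹ • f)).det ^ 2)) := by
  have hAu : IsUnit A.det := isUnit_iff_ne_zero.2 hA
  set η := (f ⬝ᵥ f)⁻¹ • f with hη
  have hηf : η ⬝ᵥ f = 1 := by
    rw [hη, smul_dotProduct, smul_eq_mul, inv_mul_cancel₀ (dotProduct_self_pos' hf).ne']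
  set g := A *ᵥ f with hg
  have hg0 : g ≠ 0 := by
    intro h
    apply hf
    have := congrArg (A⁻¹ *ᵥ ·) h
    simpa [hg, Matrix.mulVec_mulVec, Matrix.nonsing_inv_mul _ hAu] using this
  -- The covector η transported by A, so that η'(A f) = η(f) = 1.
  set η' := (A⁻¹)ᵀ *ᵥ η with hη'
  have h1 : Aᵀ *ᵥ η' = η := by
    rw [hη', Matrix.mulVec_mulVec, ← Matrix.transpose_mul, Matrix.nonsing_inv_mul _ hAu]; simp
  have h2 : η' ⬝ᵥ g = 1 := by
    rw [hg, ← Matrix.transpose_transpose A, Matrix.dotProduct_transpose_mulVec, h1,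
      dotProduct_comm, hηf]
  have h3 : Aᵀ * crossMat g * A + vecMulVec η η = Aᵀ * (crossMat g + vecMulVec η' η') * A := by
    rw [mul_add, add_mul, Matrix.mul_vecMulVec, Matrix.vecMulVec_mul, h1, ← Matrix.mulVec_transpose,
      h1]
  rw [h3, Matrix.det_mul, Matrix.det_mul, Matrix.det_transpose]
  have h4 := det_crossMat_add_sq g η' (dotProduct_self_pos' hg0).ne' h2
  have h5 : (A.det * (crossMat g + vecMulVec η' η').det * A.det) ^ 2 =
      ((|A.det| * (g ⬝ᵥ g)) ^ 2) ^ 2 := by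
    have : |A.det| ^ 4 = A.det ^ 4 := by rw [← abs_pow, abs_of_nonneg (by positivity)]
    calc _ = A.det ^ 4 * (crossMat g + vecMulVec η' η').det ^ 2 := by ring
      _ = |A.det| ^ 4 * (g ⬝ᵥ g) ^ 4 := by rw [h4, this]
      _ = _ := by ring
  rw [h5, Real.sqrt_sq (by positivity), Real.sqrt_sq]
  exact mul_nonneg (abs_nonneg _) (dotProduct_self_pos' hg0).le

lemma continuousAt_det {R Y n : Type*} [CommRing R] [TopologicalSpace R] [IsTopologicalRing R]
    [TopologicalSpace Y] [Fintype n] [DecidableEq n]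
    {f : Y → Matrix n n R} {y₀ : Y} (h : ContinuousAt f y₀) :
    ContinuousAt (fun y => (f y).det) y₀ := by
  have hdet : Continuous fun m : Matrix n n R => m.det := continuous_id.matrix_det
  exact hdet.continuousAt.tendsto.comp h

/-- If the pullbacks of the standard form by the matrices `A y` depend continuously on `y`, so do
the pullbacks of the standard metric. -/
theorem continuousAt_transpose_mul_self {Y : Type*} [TopologicalSpace Y] {y₀ : Y}
    (A : Y → Matrix (Fin 7) (Fin 7) ℝ) (hA : ∀ y, (A y).det ≠ 0)
    (hφ : ∀ u v w : Fin 7 → ℝ,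
      ContinuousAt (fun y => stdG2Form (A y *ᵥ u) (A y *ᵥ v) (A y *ᵥ w)) y₀) :
    ContinuousAt (fun y => (A y)ᵀ * A y) y₀ := by
  have h1 : ∀ f : Fin 7 → ℝ,
      ContinuousAt (fun y => |(A y).det| * ((A y *ᵥ f) ⬝ᵥ (A y *ᵥ f))) y₀ := by
    intro f
    by_cases hf : f = 0
    · subst hf; simpa using continuousAt_const
    · simp_rw [fun y => det_mul_normSq_eq (A y) (hA y) f hf]
      refine (Real.continuous_sqrt.comp Real.continuous_sqrt).continuousAt.comp ?_
      refine ContinuousAt.pow ?_ 2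
      have : ContinuousAt (fun y => (A y)ᵀ * crossMat (A y *ᵥ f) * A y +
          vecMulVec ((f ⬝ᵥ f)⁻¹ • f) ((f ⬝ᵥ f)⁻¹ • f)) y₀ := by
        refine ContinuousAt.add ?_ continuousAt_const
        refine continuousAt_pi.2 fun i => continuousAt_pi.2 fun j => ?_
        simp_rw [transpose_mul_crossMat_mul_apply]
        exact hφ _ _ _
      exact continuousAt_det this
  -- Polarization: the quadratic forms in `h1` determine all entries of |det A| AᵀA.
  have hpol : ∀ y i j, |(A y).det| * ((A y)ᵀ * A y) i j =
      (|(A y).det| * ((A y *ᵥ (Pi.single i 1 + Pi.single j 1)) ⬝ᵥ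
          (A y *ᵥ (Pi.single i 1 + Pi.single j 1)))
        - |(A y).det| * ((A y *ᵥ Pi.single i 1) ⬝ᵥ (A y *ᵥ Pi.single i 1))
        - |(A y).det| * ((A y *ᵥ Pi.single j 1) ⬝ᵥ (A y *ᵥ Pi.single j 1))) / 2 := by
    intro y i j
    have h : ((A y)ᵀ * A y) i j = (A y *ᵥ Pi.single i 1) ⬝ᵥ (A y *ᵥ Pi.single j 1) := by
      simp [Matrix.mul_apply, dotProduct]
    rw [h, Matrix.mulVec_add, dotProduct_add, add_dotProduct, add_dotProduct,
      dotProduct_comm (A y *ᵥ Pi.single j 1) (A y *ᵥ Pi.single i 1)]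
    ring
  have h2 : ContinuousAt (fun y => |(A y).det| • ((A y)ᵀ * A y)) y₀ := by
    refine continuousAt_pi.2 fun i => continuousAt_pi.2 fun j => ?_
    simp_rw [Matrix.smul_apply, smul_eq_mul, hpol]
    exact (((h1 _).sub (h1 _)).sub (h1 _)).div_const 2
  -- In dimension seven the scalar contributes |det A|⁷ and AᵀA contributes |det A|², so a ninth
  -- root recovers |det A|, which can then be divided out.
  have hd : ∀ y, (|(A y).det| • ((A y)ᵀ * A y)).det = |(A y).det| ^ 9 := by
    intro y
    rw [Matrix.det_smul, Matrix.det_mul, Matrix.det_transpose, ← abs_mul_abs_self (A y).det]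
    simp only [Fintype.card_fin]
    ring
  have h3 : ContinuousAt (fun y => |(A y).det|) y₀ := by
    have h4 : ∀ y, |(A y).det| = ((|(A y).det| • ((A y)ᵀ * A y)).det) ^ ((9 : ℝ)⁻¹) := by
      intro y
      rw [hd]
      exact (Real.pow_rpow_inv_natCast (abs_nonneg (A y).det) (by norm_num : (9 : ℕ) ≠ 0)).symm
    rw [funext h4]
    refine ContinuousAt.rpow_const (f := fun y => (|(A y).det| • ((A y)ᵀ * A y)).det)
      (continuousAt_det h2) (Or.inr ?_)
    norm_num
  have h5 : (fun y => (A y)ᵀ * A y) =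
      fun y => |(A y).det|⁻¹ • (|(A y).det| • ((A y)ᵀ * A y)) := by
    ext1 y
    rw [smul_smul, inv_mul_cancel₀ (abs_ne_zero.2 (hA y)), one_smul]
  rw [h5]
  exact (h3.inv₀ (abs_ne_zero.2 (hA y₀))).smul h2

end

section

/-! ### The complex structure on the normal space of a vector in a `G₂`-vector space -/

open Matrix

section Algebra

variable {V : Type*} [AddCommGroup V] [Module ℝ V] (A : V ≃ₗ[ℝ] (Fin 7 → ℝ)) (e : V)

/-- The endomorphism `v ↦ (e × v) / |e|`, for the cross product transported by `A`. -/
def gJ : V →ₗ[ℝ] V :=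
  A.symm.toLinearMap ∘ₗ ((√(A e ⬝ᵥ A e))⁻¹ • (crossMat (A e)).mulVecLin) ∘ₗ A.toLinearMap

/-- The three-form of `V`. -/
def gForm (u v w : V) : ℝ := stdG2Form (A u) (A v) (A w)

/-- The orthogonal projection to the complement of `e`. -/
def gProj : V →ₗ[ℝ] V := -(gJ A e ∘ₗ gJ A e)

variable {A e}

lemma apply_gJ (v : V) : A (gJ A e v) = (√(A e ⬝ᵥ A e))⁻¹ • cross (A e) (A v) := by
  simp [gJ, cross]

@[simp] lemma gJ_self : gJ A e e = 0 := by
  apply A.injective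
  rw [apply_gJ, cross_self, smul_zero, map_zero]

lemma gJ_smul {c : ℝ} (hc : 0 < c) : gJ A (c • e) = gJ A e := by
  ext v
  apply A.injective
  rw [apply_gJ, apply_gJ, map_smul, smul_cross, smul_dotProduct, dotProduct_smul, smul_smul,
    smul_eq_mul, smul_eq_mul, ← mul_assoc, Real.sqrt_mul (by positivity),
    Real.sqrt_mul_self hc.le]
  congr 1
  field_simp

lemma dot_pos (he : e ≠ 0) : 0 < A e ⬝ᵥ A e :=
  dotProduct_self_pos' (by simpa using he)

lemma gJ_gJ (he : e ≠ 0) (v : V) :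
    gJ A e (gJ A e v) = -v + ((A e ⬝ᵥ A e)⁻¹ * (A e ⬝ᵥ A v)) • e := by
  have hq := dot_pos (A := A) he
  apply A.injective
  rw [apply_gJ, apply_gJ, cross_smul, smul_smul, cross_cross, ← mul_inv,
    Real.mul_self_sqrt hq.le, smul_add, smul_neg, smul_smul, smul_smul, inv_mul_cancel₀ hq.ne']
  simp

lemma gProj_apply (he : e ≠ 0) (v : V) :
    gProj A e v = v - ((A e ⬝ᵥ A e)⁻¹ * (A e ⬝ᵥ A v)) • e := by
  simp [gProj, gJ_gJ he, sub_eq_add_neg, add_comm]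

lemma gProj_eq (v : V) : gProj A e v = -gJ A e (gJ A e v) := rfl

lemma sub_gProj_mem (he : e ≠ 0) (v : V) : v - gProj A e v ∈ Submodule.span ℝ {e} := by
  rw [gProj_apply he, sub_sub_cancel]
  exact Submodule.smul_mem _ _ (Submodule.mem_span_singleton_self e)

lemma gJ_gProj (he : e ≠ 0) (v : V) : gJ A e (gProj A e v) = gJ A e v := by
  rw [gProj_apply he, map_sub, map_smul, gJ_self, smul_zero, sub_zero]

lemma gProj_gJ (he : e ≠ 0) (v : V) : gProj A e (gJ A e v) = gJ A e v := by
  rw [gProj_eq, ← map_neg, ← gProj_eq, gJ_gProj he]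

lemma gProj_gProj (he : e ≠ 0) (v : V) : gProj A e (gProj A e v) = gProj A e v := by
  rw [gProj_eq (gProj A e v), gJ_gProj he, ← gProj_eq]

lemma dot_gProj (he : e ≠ 0) (v : V) : A e ⬝ᵥ A (gProj A e v) = 0 := by
  rw [gProj_apply he, map_sub, map_smul, dotProduct_sub, dotProduct_smul, smul_eq_mul]
  field_simp [(dot_pos (A := A) he).ne']
  ring

lemma gJ_eq_zero (he : e ≠ 0) {v : V} (h : gJ A e v = 0) : v ∈ Submodule.span ℝ {e} := by
  have h1 := gJ_gJ (A := A) he v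
  rw [h, map_zero] at h1
  rw [Submodule.mem_span_singleton]
  exact ⟨_, (neg_add_eq_zero.1 h1.symm).symm⟩

lemma gForm_swap12 (x y z : V) : gForm A y x z = -gForm A x y z := stdG2Form_swap12 _ _ _

lemma gForm_swap23 (x y z : V) : gForm A x z y = -gForm A x y z := stdG2Form_swap23 _ _ _

lemma gForm_eq (x y z : V) : gForm A x y z = cross (A x) (A y) ⬝ᵥ A z := (cross_dot _ _ _).symm

lemma gForm_add3 (x y z z' : V) : gForm A x y (z + z') = gForm A x y z + gForm A x y z' := by
  simp [gForm_eq, dotProduct_add]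

lemma gForm_smul3 (x y z : V) (c : ℝ) : gForm A x y (c • z) = c * gForm A x y z := by
  simp [gForm_eq, dotProduct_smul]

lemma gForm_add1 (x x' y z : V) : gForm A (x + x') y z = gForm A x y z + gForm A x' y z := by
  have h (x : V) : gForm A x y z = gForm A y z x := by
    rw [gForm_swap12 y x z, gForm_swap23 y z x, neg_neg]
  rw [h, h x, h x', gForm_add3]

lemma gForm_smul1 (x y z : V) (c : ℝ) : gForm A (c • x) y z = c * gForm A x y z := by
  have h (x : V) : gForm A x y z = gForm A y z x := by
    rw [gForm_swap12 y x z, gForm_swap23 y z x, neg_neg]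
  rw [h, h x, gForm_smul3]

lemma gForm_neg1 (x y z : V) : gForm A (-x) y z = -gForm A x y z := by
  simpa using gForm_smul1 (A := A) x y z (-1)

lemma gForm_gJ_right (he : e ≠ 0) (v w : V) :
    gForm A e v (gJ A e w) = √(A e ⬝ᵥ A e) * (A (gJ A e v) ⬝ᵥ A (gJ A e w)) := by
  have hq := Real.sqrt_pos.2 (dot_pos (A := A) he)
  rw [gForm_eq, apply_gJ v, smul_dotProduct, smul_eq_mul, mul_inv_cancel_left₀ hq.ne']

lemma gForm_gJ_comm (he : e ≠ 0) (v w : V) :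
    gForm A e v (gJ A e w) = gForm A e w (gJ A e v) := by
  rw [gForm_gJ_right he, gForm_gJ_right he, dotProduct_comm (A (gJ A e v))]

lemma gForm_gJ_left (he : e ≠ 0) (v w : V) :
    gForm A e (gJ A e v) w = -gForm A e v (gJ A e w) := by
  rw [gForm_swap23 e w, gForm_gJ_comm he]

lemma gForm_self_left (v : V) : gForm A e e v = 0 := by
  rw [gForm_eq, cross_self, zero_dotProduct]

lemma gForm_gJ_gJ (he : e ≠ 0) (v w : V) :
    gForm A e (gJ A e v) (gJ A e w) = gForm A e v w := by
  rw [gForm_gJ_left he, gJ_gJ he, gForm_add3, gForm_smul3, gForm_swap23 e e v, gForm_self_left,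
    ← neg_one_smul ℝ w, gForm_smul3]
  ring

lemma gForm_gJ_pos (he : e ≠ 0) {v : V} (hv : v ∉ Submodule.span ℝ {e}) :
    0 < gForm A e v (gJ A e v) := by
  rw [gForm_gJ_right he]
  refine mul_pos (Real.sqrt_pos.2 (dot_pos he)) (dot_pos fun h => hv (gJ_eq_zero he h))

/-- Moving `J` between the arguments of the restriction of the form to the complement of `e`. -/
lemma gForm_gJ_shift (he : e ≠ 0) (x y z : V) :
    gForm A (gJ A e x) (gProj A e y) (gProj A e z) =
      gForm A (gProj A e x) (gJ A e y) (gProj A e z) := by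
  have h := stdG2Form_cross_comm (A e) (A (gProj A e x)) (A (gProj A e y)) (A (gProj A e z))
  rw [dot_gProj he, dot_gProj he, dot_gProj he] at h
  simp only [zero_mul, mul_zero, add_zero, sub_zero] at h
  have hs := sub_eq_zero.1 h
  rw [← gJ_gProj he x, ← gJ_gProj he y]
  have key (x : V) : gJ A e x = (√(A e ⬝ᵥ A e))⁻¹ • A.symm (cross (A e) (A x)) := by
    apply A.injective; rw [apply_gJ]; simp
  rw [key, key, gForm_smul1, gForm_swap12 ((√(A e ⬝ᵥ A e))⁻¹ • _), gForm_smul1,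
    gForm_swap12 (gProj A e x)]
  simp only [gForm, LinearEquiv.apply_symm_apply, neg_neg, mul_neg]
  rw [hs]

/-- The complex volume form on the complement of `e`. -/
def gVol (A : V ≃ₗ[ℝ] (Fin 7 → ℝ)) (e x y z : V) : ℂ :=
  ⟨gForm A (gProj A e x) (gProj A e y) (gProj A e z),
    -gForm A (gJ A e x) (gProj A e y) (gProj A e z)⟩

/-- Only the imaginary part needs an argument: there J sits in the first slot, and `gForm_gJ_shift`
moves it to the second. -/
lemma gVol_swap12 (he : e ≠ 0) (x y z : V) : gVol A e y x z = -gVol A e x y z := by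
  apply Complex.ext
  · simp [gVol, gForm_swap12 (gProj A e x)]
  · simp only [gVol, Complex.neg_im, neg_neg]
    rw [gForm_gJ_shift he, gForm_swap12 (gJ A e x), neg_neg]

lemma gVol_swap23 (x y z : V) : gVol A e x z y = -gVol A e x y z := by
  apply Complex.ext <;> simp [gVol, gForm_swap23 _ (gProj A e y)]

lemma gVol_add1 (x x' y z : V) : gVol A e (x + x') y z = gVol A e x y z + gVol A e x' y z := by
  apply Complex.ext
  · simp [gVol, gForm_add1]
  · simp [gVol, gForm_add1]; ring

lemma gVol_smul1 (c : ℝ) (x y z : V) : gVol A e (c • x) y z = c * gVol A e x y z := by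
  apply Complex.ext <;> simp [gVol, gForm_smul1]

/-- Complex linearity in the first slot suffices; the two antisymmetries carry it to the others. -/
lemma gVol_gJ (he : e ≠ 0) (x y z : V) :
    gVol A e (gJ A e x) y z = Complex.I * gVol A e x y z := by
  apply Complex.ext
  · simp [gVol, gProj_gJ he]
  · simp only [gVol, Complex.mul_im, Complex.I_re, Complex.I_im]
    rw [← neg_neg (gJ A e (gJ A e x)), ← gProj_eq, gForm_neg1]
    ring

/-- The special Lagrangian condition. Since e lies in W, the projection along e preserves W, so all
arguments of the form remain in W. -/
lemma gVol_re_eq_zero (he : e ≠ 0) {W : Submodule ℝ V} (heW : e ∈ W)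
    (hW : ∀ x ∈ W, ∀ y ∈ W, ∀ z ∈ W, gForm A x y z = 0) {x y z : V} (hx : x ∈ W) (hy : y ∈ W)
    (hz : z ∈ W) : (gVol A e x y z).re = 0 := by
  have h {v : V} (hv : v ∈ W) : gProj A e v ∈ W := by
    rw [gProj_apply he]; exact W.sub_mem hv (W.smul_mem _ heW)
  exact hW _ (h hx) _ (h hy) _ (h hz)

/-- Take x orthogonal to e, then y orthogonal to e, x and J x, and z = x × y. Here the real part is
|x × y|², and x × y = 0 would give |x|² y = 0 by `cross_cross`. -/
lemma exists_gVol_ne_zero (he : e ≠ 0) : ∃ x y z : V, gVol A e x y z ≠ 0 := by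
  by_contra! hcon
  have h0 (x y z : V) : gForm A (gProj A e x) (gProj A e y) (gProj A e z) = 0 :=
    congrArg Complex.re (hcon x y z)
  have hfin : Module.Finite ℝ V := Module.Finite.equiv A.symm
  have hrank : Module.finrank ℝ V = 7 := by rw [A.finrank_eq]; simp
  -- a vector `x` orthogonal to `e`, and `y` orthogonal to `e`, `x` and `e × x`
  have hex (s : Submodule ℝ V) (hs : Module.finrank ℝ s < 7) :
      ∃ v : V, v ≠ 0 ∧ ∀ w ∈ s, A w ⬝ᵥ A v = 0 := by
    have : ∃ v : V, v ≠ 0 ∧ ∀ i, A (Module.finBasis ℝ s i : V) ⬝ᵥ A v = 0 := by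
      let f : V →ₗ[ℝ] (Fin (Module.finrank ℝ s) → ℝ) :=
        LinearMap.pi fun i => (dotProductBilin ℝ ℝ (A (Module.finBasis ℝ s i : V))) ∘ₗ A.toLinearMap
      have hker : LinearMap.ker f ≠ ⊥ := by
        apply LinearMap.ker_ne_bot_of_finrank_lt
        simpa [hrank] using hs
      obtain ⟨v, hv, hv0⟩ := Submodule.exists_mem_ne_zero_of_ne_bot hker
      exact ⟨v, hv0, fun i => congrFun (LinearMap.mem_ker.1 hv) i⟩
    obtain ⟨v, hv0, hv⟩ := this
    refine ⟨v, hv0, fun w hw => ?_⟩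
    have h1 : (⟨w, hw⟩ : s) = ∑ i, (Module.finBasis ℝ s).repr ⟨w, hw⟩ i • Module.finBasis ℝ s i :=
      ((Module.finBasis ℝ s).sum_repr _).symm
    have h2 : w = ∑ i, (Module.finBasis ℝ s).repr ⟨w, hw⟩ i • (Module.finBasis ℝ s i : V) := by
      have h3 := congrArg Subtype.val h1
      rwa [Submodule.coe_sum] at h3
    rw [h2, map_sum, sum_dotProduct]
    refine Finset.sum_eq_zero fun i _ => ?_
    rw [map_smul, smul_dotProduct, hv, smul_zero]
  obtain ⟨x, hx0, hx⟩ := hex (Submodule.span ℝ {e}) ((finrank_span_singleton he).trans_lt (by norm_num))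
  have hex' : e ∈ Submodule.span ℝ {e} := Submodule.mem_span_singleton_self e
  obtain ⟨y, hy0, hy⟩ := hex (Submodule.span ℝ (Set.range ![e, x, gJ A e x]))
    ((finrank_range_le_card _).trans_lt (by simp))
  have hye : A e ⬝ᵥ A y = 0 := hy e (Submodule.subset_span ⟨0, rfl⟩)
  have hyx : A x ⬝ᵥ A y = 0 := hy x (Submodule.subset_span ⟨1, rfl⟩)
  have hyJ : A (gJ A e x) ⬝ᵥ A y = 0 := hy _ (Submodule.subset_span ⟨2, rfl⟩)
  have hpx : gProj A e x = x := by rw [gProj_apply he, hx e hex']; simp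
  have hpy : gProj A e y = y := by rw [gProj_apply he, hye]; simp
  set z := A.symm (cross (A x) (A y)) with hz
  have hAz : A z = cross (A x) (A y) := by simp [hz]
  -- Orthogonality of y to J x is needed exactly here: the product of e with x × y is the product of
  -- e × x with y.
  have hze : A e ⬝ᵥ A z = 0 := by
    have h1 : cross (A x) (A y) ⬝ᵥ A e = gForm A e x y := by
      rw [← gForm_eq, ← neg_neg (gForm A x y e), ← gForm_swap23, ← gForm_swap12]
    rw [dotProduct_comm, hAz, h1, gForm_eq]
    rw [apply_gJ, smul_dotProduct, smul_eq_mul] at hyJ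
    exact (mul_eq_zero.1 hyJ).resolve_left (inv_ne_zero (Real.sqrt_pos.2 (dot_pos he)).ne')
  have hpz : gProj A e z = z := by rw [gProj_apply he, hze]; simp
  have h1 := h0 x y z
  rw [hpx, hpy, hpz, gForm_eq, hAz] at h1
  have h2 : cross (A x) (A y) = 0 := dotProduct_self_eq_zero.1 h1
  have h3 := cross_cross (A x) (A y)
  rw [h2, hyx] at h3
  simp only [cross, mulVec_zero, zero_smul, add_zero] at h3
  have h4 : (A x ⬝ᵥ A x) • A y = 0 := neg_eq_zero.1 h3.symm
  rcases smul_eq_zero.1 h4 with h | h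
  · exact (dot_pos hx0).ne' h
  · exact hy0 (by simpa using h)

end Algebra

/-- Alternating `ℂ`-trilinear functions on `ℂ³` are multiples of the determinant. -/
lemma trilinear_eq_det (F : C3 → C3 → C3 → ℂ)
    (hadd : ∀ a a' b c, F (a + a') b c = F a b c + F a' b c)
    (hsmul : ∀ (t : ℂ) a b c, F (t • a) b c = t * F a b c)
    (h12 : ∀ a b c, F b a c = -F a b c) (h23 : ∀ a b c, F a c b = -F a b c) (v : Fin 3 → C3) :
    F (v 0) (v 1) (v 2) =
      F (Pi.single 0 1) (Pi.single 1 1) (Pi.single 2 1) * (Matrix.of v).det := by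
  have h13 (a b c) : F c b a = -F a b c := by rw [h12, h23, h12, neg_neg]
  have h11 (a c) : F a a c = 0 := self_eq_neg.1 (h12 a a c)
  have h22 (a c) : F c a a = 0 := self_eq_neg.1 (h23 c a a)
  have h33 (a c) : F a c a = 0 := self_eq_neg.1 (h13 a c a)
  have hexp (a : C3) : a = a 0 • Pi.single 0 1 + a 1 • Pi.single 1 1 + a 2 • Pi.single 2 1 := by
    ext i; fin_cases i <;> simp
  have e1 (a b c) : F a b c = a 0 * F (Pi.single 0 1) b c + a 1 * F (Pi.single 1 1) b c
      + a 2 * F (Pi.single 2 1) b c := by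
    conv_lhs => rw [hexp a]
    rw [hadd, hadd, hsmul, hsmul, hsmul]
  have e2 (a b c) : F a b c = b 0 * F a (Pi.single 0 1) c + b 1 * F a (Pi.single 1 1) c
      + b 2 * F a (Pi.single 2 1) c := by
    rw [h12, e1 b a c, h12 a, h12 a, h12 a]; ring
  have e3 (a b c) : F a b c = c 0 * F a b (Pi.single 0 1) + c 1 * F a b (Pi.single 1 1)
      + c 2 * F a b (Pi.single 2 1) := by
    rw [h23, e2 a c b, h23 _ b, h23 _ b, h23 _ b]; ring
  rw [e1 (v 0)]
  simp only [e2 _ (v 1)]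
  simp only [e3 _ _ (v 2), h11, h22, h33]
  rw [h12 (Pi.single 0 1) (Pi.single 1 1), h23 (Pi.single 0 1) (Pi.single 1 1),
    h13 (Pi.single 0 1) (Pi.single 1 1),
    show F (Pi.single 1 1) (Pi.single 2 1) (Pi.single 0 1) =
      F (Pi.single 0 1) (Pi.single 1 1) (Pi.single 2 1) by
        rw [h23 (Pi.single 1 1) (Pi.single 0 1), h12 (Pi.single 0 1) (Pi.single 1 1), neg_neg],
    show F (Pi.single 2 1) (Pi.single 0 1) (Pi.single 1 1) =
      F (Pi.single 0 1) (Pi.single 1 1) (Pi.single 2 1) by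
        rw [h12 (Pi.single 0 1) (Pi.single 2 1), h23 (Pi.single 0 1) (Pi.single 1 1), neg_neg],
    Matrix.det_fin_three]
  simp only [Matrix.of_apply]
  ring

end

section

/-! ### Continuity of the complex structure along continuous vector fields -/

open Matrix

lemma gJ_conj {V V' : Type*} [AddCommGroup V] [Module ℝ V] [AddCommGroup V'] [Module ℝ V']
    (A : V ≃ₗ[ℝ] (Fin 7 → ℝ)) (L : V ≃ₗ[ℝ] V') (e v : V) :
    gJ (L.symm.trans A) (L e) (L v) = L (gJ A e v) := by
  apply (L.symm.trans A).injective
  rw [apply_gJ]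
  simp [apply_gJ]

lemma continuousAt_inv_matrix {Y n : Type*} [TopologicalSpace Y] [Fintype n] [DecidableEq n]
    {G : Y → Matrix n n ℝ} {y₀ : Y} (hG : ContinuousAt G y₀) (h0 : (G y₀).det ≠ 0) :
    ContinuousAt (fun y => (G y)⁻¹) y₀ := by
  have h1 : ContinuousAt (fun y => ((G y).det)⁻¹ • (G y).adjugate) y₀ := by
    refine ContinuousAt.smul ((continuousAt_det hG).inv₀ h0) ?_
    have : Continuous fun m : Matrix n n ℝ => m.adjugate := continuous_id.matrix_adjugate
    exact this.continuousAt.tendsto.comp hG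
  refine h1.congr (Filter.Eventually.of_forall fun y => ?_)
  simp only
  rw [Matrix.inv_def, Ring.inverse_eq_inv']

/-- Evaluation of a continuous family of alternating 3-forms at moving vectors. -/
lemma continuousAt_alternating_eval {Y : Type*} [TopologicalSpace Y] {y₀ : Y}
    {φ : Y → E7 [⋀^Fin 3]→L[ℝ] ℝ} (hφ : ContinuousAt φ y₀) {u v w : Y → E7}
    (hu : ContinuousAt u y₀) (hv : ContinuousAt v y₀) (hw : ContinuousAt w y₀) :
    ContinuousAt (fun y => φ y ![u y, v y, w y]) y₀ := by
  have h1 : ContinuousAt (fun y => (φ y).toContinuousMultilinearMap) y₀ :=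
    (ContinuousAlternatingMap.toContinuousMultilinearMapCLM ℝ).continuous.continuousAt.tendsto.comp
      hφ
  have h2 : ContinuousAt (fun y => ![u y, v y, w y]) y₀ := by
    refine continuousAt_pi.2 fun i => ?_
    fin_cases i
    · exact hu
    · exact hv
    · exact hw
  have h3 : ContinuousAt (fun y => (φ y).toContinuousMultilinearMap ![u y, v y, w y]) y₀ := by
    have := (ContinuousEval.continuous_eval
      (F := ContinuousMultilinearMap ℝ (fun _ : Fin 3 => E7) ℝ)
      (X := Fin 3 → E7) (Y := ℝ)).continuousAt.tendsto.comp (h1.prodMk h2)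
    exact this
  exact h3

/-- The complex structure depends continuously on the `G₂`-form and on the vector. -/
theorem continuousAt_gJ {Y : Type*} [TopologicalSpace Y] {y₀ : Y}
    (A : Y → (E7 ≃ₗ[ℝ] (Fin 7 → ℝ))) (φ : Y → E7 [⋀^Fin 3]→L[ℝ] ℝ)
    (hA : ∀ᶠ y in 𝓝 y₀, ∀ u v w, φ y ![u, v, w] = gForm (A y) u v w)
    (hφ : ContinuousAt φ y₀) {e s : Y → E7} (he : ContinuousAt e y₀) (hs : ContinuousAt s y₀)
    (he0 : e y₀ ≠ 0) : ContinuousAt (fun y => gJ (A y) (e y) (s y)) y₀ := by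
  let W := WithLp.linearEquiv 2 ℝ (Fin 7 → ℝ)
  have hWc : Continuous W := PiLp.continuous_ofLp 2 _
  have hWc' : Continuous W.symm := PiLp.continuous_toLp 2 _
  let L : Y → ((Fin 7 → ℝ) ≃ₗ[ℝ] (Fin 7 → ℝ)) := fun y => W.symm.trans (A y)
  let m : Y → Matrix (Fin 7) (Fin 7) ℝ := fun y => LinearMap.toMatrix' (L y).toLinearMap
  have hm : ∀ y v, m y *ᵥ v = L y v := fun y v => by simp [m]
  have hdet : ∀ y, (m y).det ≠ 0 := fun y => by
    have := (L y).isUnit_det'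
    simpa [m] using this.ne_zero
  have hφ' : ∀ {u v w : Y → Fin 7 → ℝ}, ContinuousAt u y₀ → ContinuousAt v y₀ →
      ContinuousAt w y₀ →
      ContinuousAt (fun y => stdG2Form (m y *ᵥ u y) (m y *ᵥ v y) (m y *ᵥ w y)) y₀ := by
    intro u v w hu hv hw
    have h := continuousAt_alternating_eval hφ (hWc'.continuousAt.tendsto.comp hu)
      (hWc'.continuousAt.tendsto.comp hv) (hWc'.continuousAt.tendsto.comp hw)
    refine h.congr (hA.mono fun y hy => ?_)
    simp only [hm]
    exact hy _ _ _
  set G : Y → Matrix (Fin 7) (Fin 7) ℝ := fun y => (m y)ᵀ * m y with hGdef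
  have hG : ContinuousAt G y₀ := continuousAt_transpose_mul_self m hdet fun u v w =>
    hφ' continuousAt_const continuousAt_const continuousAt_const
  have hGd : ∀ y, IsUnit (G y).det := fun y => by
    rw [hGdef, Matrix.det_mul, Matrix.det_transpose]
    exact isUnit_iff_ne_zero.2 (mul_ne_zero (hdet y) (hdet y))
  have hGinv := continuousAt_inv_matrix hG (hGd y₀).ne_zero
  have hWe : ContinuousAt (fun y => W (e y)) y₀ := hWc.continuousAt.tendsto.comp he
  have hWs : ContinuousAt (fun y => W (s y)) y₀ := hWc.continuousAt.tendsto.comp hs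
  -- the norm of `e`
  have hn : ContinuousAt (fun y => √(A y (e y) ⬝ᵥ A y (e y))) y₀ := by
    have h1 : ∀ y, A y (e y) ⬝ᵥ A y (e y) = W (e y) ⬝ᵥ (G y *ᵥ W (e y)) := by
      intro y
      have : A y (e y) = m y *ᵥ W (e y) := by rw [hm]; simp [L]
      rw [this, hGdef, ← Matrix.mulVec_mulVec, Matrix.dotProduct_transpose_mulVec]
    simp_rw [h1]
    refine Real.continuous_sqrt.continuousAt.tendsto.comp ?_
    have h2 : Continuous fun q : (Fin 7 → ℝ) × Matrix (Fin 7) (Fin 7) ℝ => q.1 ⬝ᵥ (q.2 *ᵥ q.1) :=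
      continuous_fst.dotProduct (continuous_snd.matrix_mulVec continuous_fst)
    exact h2.continuousAt.tendsto.comp (hWe.prodMk hG)
  have hn0 : √(A y₀ (e y₀) ⬝ᵥ A y₀ (e y₀)) ≠ 0 := (Real.sqrt_pos.2 (dot_pos he0)).ne'
  -- the vector `G (J s)`
  have hv : ContinuousAt (fun y => (m y)ᵀ *ᵥ cross (m y *ᵥ W (e y)) (m y *ᵥ W (s y))) y₀ := by
    refine continuousAt_pi.2 fun i => ?_
    have h1 : ∀ y, ((m y)ᵀ *ᵥ cross (m y *ᵥ W (e y)) (m y *ᵥ W (s y))) i =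
        stdG2Form (m y *ᵥ W (e y)) (m y *ᵥ W (s y)) (m y *ᵥ Pi.single i 1) := by
      intro y
      rw [← cross_dot, ← Matrix.dotProduct_transpose_mulVec (m y)]
      exact (single_one_dotProduct i _).symm
    simp_rw [h1]
    exact hφ' hWe hWs continuousAt_const
  -- The coordinates `A y` need not be continuous in y. The metric G and the covector G (J s) are,
  -- being determined by the form, and J s is recovered from these two.
  have key : ∀ y, gJ (A y) (e y) (s y) = W.symm ((G y)⁻¹ *ᵥ
      ((√(A y (e y) ⬝ᵥ A y (e y)))⁻¹ •
        ((m y)ᵀ *ᵥ cross (m y *ᵥ W (e y)) (m y *ᵥ W (s y))))) := by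
    intro y
    have h1 : ∀ v, m y *ᵥ W v = A y v := fun v => by rw [hm]; simp [L]
    rw [h1, h1, ← Matrix.mulVec_smul, ← apply_gJ, ← h1, Matrix.mulVec_mulVec, Matrix.mulVec_mulVec,
      mul_assoc, Matrix.nonsing_inv_mul _ (hGd y), Matrix.one_mulVec, LinearEquiv.symm_apply_apply]
  rw [funext key]
  refine hWc'.continuousAt.tendsto.comp ?_
  have h2 : Continuous fun q : Matrix (Fin 7) (Fin 7) ℝ × (Fin 7 → ℝ) => q.1 *ᵥ q.2 :=
    continuous_fst.matrix_mulVec continuous_snd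
  exact h2.continuousAt.tendsto.comp (hGinv.prodMk ((hn.inv₀ hn0).smul hv))

section Sections

variable {M : Type*} [TopologicalSpace M] [ChartedSpace E7 M] {lam : ThreeForm M}

/-- A linear equivalence of the tangent space with `ℝ⁷` which maps the form to the standard one. -/
def IsG2Form.coordAt (hlam : IsG2Form lam) (x : M) : E7 ≃ₗ[ℝ] (Fin 7 → ℝ) :=
  (hlam.pointwise x).choose

lemma IsG2Form.lam_eq (hlam : IsG2Form lam) (x : M) (u v w : E7) :
    lam x ![u, v, w] = gForm (hlam.coordAt x) u v w :=
  (hlam.pointwise x).choose_spec u v w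

/-- The complex structure on the complement of the tangent vector `e` at `x`. -/
def IsG2Form.J (hlam : IsG2Form lam) (x : M) (e : E7) : E7 →ₗ[ℝ] E7 := gJ (hlam.coordAt x) e

variable [IsManifold (𝓡 7) ∞ M] {Y : Type*} [TopologicalSpace Y] {f : Y → M} {y₀ : Y}

/-- A tangent vector as an element of the tangent bundle. -/
abbrev tb (x : M) (v : E7) : TangentBundle (𝓡 7) M := ⟨x, v⟩

instance : IsManifold (𝓡 7) 1 M := IsManifold.of_le (n := ∞) (by simp)

/-- The trivialization of the tangent bundle around `x₀`, as a linear map at `x`. -/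
def trivAt (x₀ x : M) : E7 →L[ℝ] E7 :=
  (trivializationAt E7 (TangentSpace (𝓡 7) : M → Type) x₀).continuousLinearMapAt ℝ x

/-- The inverse trivialization of the tangent bundle around `x₀`, as a linear map at `x`. -/
def trivSymm (x₀ x : M) : E7 →L[ℝ] E7 :=
  (trivializationAt E7 (TangentSpace (𝓡 7) : M → Type) x₀).symmL ℝ x

lemma mem_baseSet_iff {x₀ x : M} :
    x ∈ (trivializationAt E7 (TangentSpace (𝓡 7) : M → Type) x₀).baseSet ↔
      x ∈ (chartAt E7 x₀).source := by simp

lemma trivAt_apply {x₀ x : M} (hx : x ∈ (chartAt E7 x₀).source) (v : E7) :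
    trivAt x₀ x v = (trivializationAt E7 (TangentSpace (𝓡 7) : M → Type) x₀ (tb x v)).2 :=
  Bundle.Trivialization.continuousLinearMapAt_apply_of_mem ℝ
    (trivializationAt E7 (TangentSpace (𝓡 7) : M → Type) x₀) (mem_baseSet_iff.2 hx) v

lemma trivSymm_trivAt {x₀ x : M} (hx : x ∈ (chartAt E7 x₀).source) (v : E7) :
    trivSymm x₀ x (trivAt x₀ x v) = v :=
  Bundle.Trivialization.symmL_continuousLinearMapAt
    (trivializationAt E7 (TangentSpace (𝓡 7) : M → Type) x₀) (mem_baseSet_iff.2 hx) v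

lemma trivAt_trivSymm {x₀ x : M} (hx : x ∈ (chartAt E7 x₀).source) (v : E7) :
    trivAt x₀ x (trivSymm x₀ x v) = v :=
  Bundle.Trivialization.continuousLinearMapAt_symmL
    (trivializationAt E7 (TangentSpace (𝓡 7) : M → Type) x₀) (mem_baseSet_iff.2 hx) v

lemma eventually_mem_chart (hf : ContinuousAt f y₀) :
    ∀ᶠ y in 𝓝 y₀, f y ∈ (chartAt E7 (f y₀)).source :=
  hf.eventually_mem ((chartAt E7 (f y₀)).open_source.mem_nhds (mem_chart_source _ _))

lemma continuousAt_tb_iff {s : Y → E7} :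
    ContinuousAt (fun y => tb (f y) (s y)) y₀ ↔
      ContinuousAt f y₀ ∧ ContinuousAt (fun y => trivAt (f y₀) (f y) (s y)) y₀ := by
  rw [FiberBundle.continuousAt_totalSpace]
  refine and_congr_right fun hf => ?_
  refine continuousAt_congr ((eventually_mem_chart hf).mono fun y hy => ?_)
  exact (trivAt_apply hy _).symm

/-- The trivialization of the tangent bundle around `x₀`, as a linear equivalence. -/
def trivEquiv (x₀ x : M) (hx : x ∈ (chartAt E7 x₀).source) : E7 ≃ₗ[ℝ] E7 :=
  LinearEquiv.ofLinearMap (trivAt x₀ x).toLinearMap (trivSymm x₀ x).toLinearMap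
    (LinearMap.ext (trivAt_trivSymm hx)) (LinearMap.ext (trivSymm_trivAt hx))

lemma trivEquiv_apply (x₀ x : M) (hx : x ∈ (chartAt E7 x₀).source) (v : E7) :
    trivEquiv x₀ x hx v = trivAt x₀ x v := rfl

/-- The trivialization of the tangent bundle around x₀ is inverse to the derivative of the inverse
chart, by which the form is pulled back. -/
lemma inChart_trivAt (x₀ x : M) (hx : x ∈ (chartAt E7 x₀).source) (u v w : E7) :
    lam.inChart x₀ (extChartAt (𝓡 7) x₀ x) ![trivAt x₀ x u, trivAt x₀ x v, trivAt x₀ x w] =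
      lam x ![u, v, w] := by
  have h1 : (extChartAt (𝓡 7) x₀).symm (extChartAt (𝓡 7) x₀ x) = x :=
    (extChartAt (𝓡 7) x₀).left_inv (by simpa using hx)
  have h3 : (trivializationAt E7 (TangentSpace (𝓡 7) : M → Type) x₀).symmL ℝ x = _ :=
    TangentBundle.symmL_trivializationAt (𝕜 := ℝ) hx
  rw [ModelWithCorners.range_eq_univ, mfderivWithin_univ] at h3
  have h2 (v : E7) : (mfderiv 𝓘(ℝ, E7) (𝓡 7) (extChartAt (𝓡 7) x₀).symm (extChartAt (𝓡 7) x₀ x) :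
      E7 → E7) (trivAt x₀ x v) = v :=
    (DFunLike.congr_fun h3 (trivAt x₀ x v)).symm.trans (trivSymm_trivAt hx v)
  have h4 : ∀ z : M, z = x → ∀ t : Fin 3 → E7, t = ![u, v, w] →
      lam z t = lam x ![u, v, w] := by rintro z rfl t rfl; rfl
  refine h4 _ h1 (fun i => (mfderiv 𝓘(ℝ, E7) (𝓡 7) (extChartAt (𝓡 7) x₀).symm
    (extChartAt (𝓡 7) x₀ x) : E7 → E7) (![trivAt x₀ x u, trivAt x₀ x v, trivAt x₀ x w] i)) ?_
  ext i : 1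
  fin_cases i
  · exact h2 u
  · exact h2 v
  · exact h2 w

lemma continuousAt_inChart (hlam : IsG2Form lam) (hf : ContinuousAt f y₀) :
    ContinuousAt (fun y => lam.inChart (f y₀) (extChartAt (𝓡 7) (f y₀) (f y))) y₀ := by
  have h1 : ContinuousAt (lam.inChart (f y₀)) (extChartAt (𝓡 7) (f y₀) (f y₀)) :=
    (hlam.smooth (f y₀)).continuousOn.continuousAt (extChartAt_target_mem_nhds (f y₀))
  have h2 : ContinuousAt (fun y => extChartAt (𝓡 7) (f y₀) (f y)) y₀ :=
    (continuousAt_extChartAt (f y₀)).tendsto.comp hf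
  exact h1.tendsto.comp h2

/-- The values of the form on continuous vector fields are continuous. -/
theorem continuousAt_lam (hlam : IsG2Form lam) {u v w : Y → E7}
    (hu : ContinuousAt (fun y => tb (f y) (u y)) y₀)
    (hv : ContinuousAt (fun y => tb (f y) (v y)) y₀)
    (hw : ContinuousAt (fun y => tb (f y) (w y)) y₀) :
    ContinuousAt (fun y => lam (f y) ![u y, v y, w y]) y₀ := by
  rw [continuousAt_tb_iff] at hu hv hw
  have h := continuousAt_alternating_eval (continuousAt_inChart hlam hu.1) hu.2 hv.2 hw.2
  refine h.congr ((eventually_mem_chart hu.1).mono fun y hy => ?_)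
  exact inChart_trivAt _ _ hy _ _ _

/-- The complex structure maps continuous vector fields to continuous vector fields. -/
theorem continuousAt_J (hlam : IsG2Form lam) {e v : Y → E7}
    (he : ContinuousAt (fun y => tb (f y) (e y)) y₀) (he0 : e y₀ ≠ 0)
    (hv : ContinuousAt (fun y => tb (f y) (v y)) y₀) :
    ContinuousAt (fun y => tb (f y) (hlam.J (f y) (e y) (v y))) y₀ := by
  classical
  rw [continuousAt_tb_iff] at he hv ⊢
  refine ⟨he.1, ?_⟩
  -- Off the chart domain the value is irrelevant, since only points near y₀ count.
  let A : Y → (E7 ≃ₗ[ℝ] (Fin 7 → ℝ)) := fun y =>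
    if hy : f y ∈ (chartAt E7 (f y₀)).source then
      (trivEquiv (f y₀) (f y) hy).symm.trans (hlam.coordAt (f y))
    else hlam.coordAt (f y)
  have hA {y : Y} (hy : f y ∈ (chartAt E7 (f y₀)).source) :
      A y = (trivEquiv (f y₀) (f y) hy).symm.trans (hlam.coordAt (f y)) := by
    simp [A, hy]
  have hmem := eventually_mem_chart he.1
  have h := continuousAt_gJ A _ (hmem.mono fun y hy u v w => ?_) (continuousAt_inChart hlam he.1)
    he.2 hv.2 ?_
  · refine h.congr (hmem.mono fun y hy => ?_)
    simp only
    rw [hA hy, ← trivEquiv_apply _ _ hy, ← trivEquiv_apply _ _ hy, ← trivEquiv_apply _ _ hy]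
    exact gJ_conj _ (trivEquiv (f y₀) (f y) hy) _ _
  · set T := trivEquiv (f y₀) (f y) hy with hT
    have h1 (v : E7) : v = trivAt (f y₀) (f y) (T.symm v) := by
      rw [← trivEquiv_apply _ _ hy, ← hT, LinearEquiv.apply_symm_apply]
    rw [h1 u, h1 v, h1 w, inChart_trivAt _ _ hy, hlam.lam_eq, hA hy, ← h1, ← h1, ← h1]
    rfl
  · have hy := mem_chart_source E7 (f y₀)
    rw [← trivEquiv_apply _ _ hy]
    simpa using he0

end Sections

end

/-! ### Embedding the pullback of the tangent bundle in a trivial bundle -/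

section Embedding

variable {M : Type*} [TopologicalSpace M] [ChartedSpace E7 M] [IsManifold (𝓡 7) ∞ M]
  {Y : Type*} [TopologicalSpace Y] {f : Y → M} {y₀ : Y}

lemma continuousAt_tb_add {s t : Y → E7} (hs : ContinuousAt (fun y => tb (f y) (s y)) y₀)
    (ht : ContinuousAt (fun y => tb (f y) (t y)) y₀) :
    ContinuousAt (fun y => tb (f y) (s y + t y)) y₀ := by
  rw [continuousAt_tb_iff] at *
  simp only [map_add]
  exact ⟨hs.1, hs.2.add ht.2⟩

lemma continuousAt_tb_smul {c : Y → ℝ} {s : Y → E7} (hc : ContinuousAt c y₀)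
    (hs : ContinuousAt (fun y => tb (f y) (s y)) y₀) :
    ContinuousAt (fun y => tb (f y) (c y • s y)) y₀ := by
  rw [continuousAt_tb_iff] at *
  simp only [map_smul]
  exact ⟨hs.1, hc.smul hs.2⟩

lemma continuousAt_tb_zero (hf : ContinuousAt f y₀) :
    ContinuousAt (fun y => tb (f y) 0) y₀ := by
  rw [continuousAt_tb_iff]
  simp only [map_zero]
  exact ⟨hf, continuousAt_const⟩

lemma continuousAt_tb_sum {ι : Type*} (S : Finset ι) {s : ι → Y → E7} (hf : ContinuousAt f y₀)
    (hs : ∀ i ∈ S, ContinuousAt (fun y => tb (f y) (s i y)) y₀) :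
    ContinuousAt (fun y => tb (f y) (∑ i ∈ S, s i y)) y₀ := by
  classical
  induction S using Finset.induction_on with
  | empty => simpa using continuousAt_tb_zero hf
  | insert i S hi ih =>
    simp only [Finset.sum_insert hi]
    exact continuousAt_tb_add (hs i (by simp)) (ih fun j hj => hs j (by simp [hj]))

lemma continuousAt_trivAt {x₀ : M} (h : f y₀ ∈ (chartAt E7 x₀).source) {s : Y → E7}
    (hs : ContinuousAt (fun y => tb (f y) (s y)) y₀) :
    ContinuousAt (fun y => trivAt x₀ (f y) (s y)) y₀ := by
  set τ := trivializationAt E7 (TangentSpace (𝓡 7) : M → Type) x₀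
  have hmem : ∀ᶠ y in 𝓝 y₀, f y ∈ (chartAt E7 x₀).source :=
    (continuousAt_tb_iff.1 hs).1.eventually_mem ((chartAt E7 x₀).open_source.mem_nhds h)
  have h1 : ContinuousAt τ (tb (f y₀) (s y₀)) :=
    τ.continuousAt (τ.mem_source.2 (mem_baseSet_iff.2 h))
  have h2 : ContinuousAt (fun y => (τ (tb (f y) (s y))).2) y₀ :=
    continuousAt_snd.tendsto.comp (h1.tendsto.comp hs)
  exact h2.congr (hmem.mono fun y hy => (trivAt_apply hy _).symm)

lemma continuousAt_tb_trivSymm {x₀ : M} (h : f y₀ ∈ (chartAt E7 x₀).source)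
    (hf : ContinuousAt f y₀) {w : Y → E7} (hw : ContinuousAt w y₀) :
    ContinuousAt (fun y => tb (f y) (trivSymm x₀ (f y) (w y))) y₀ := by
  set τ := trivializationAt E7 (TangentSpace (𝓡 7) : M → Type) x₀
  have h1 := τ.continuousOn_symm
  have h2 := h1.continuousAt ((τ.open_baseSet.prod isOpen_univ).mem_nhds
    (show (f y₀, w y₀) ∈ τ.baseSet ×ˢ univ from ⟨mem_baseSet_iff.2 h, mem_univ _⟩))
  have h3 : ContinuousAt (fun y => tb (f y) (τ.symm (f y) (w y))) y₀ :=
    h2.tendsto.comp (hf.prodMk hw)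
  have hmem : ∀ᶠ y in 𝓝 y₀, f y ∈ (chartAt E7 x₀).source :=
    hf.eventually_mem ((chartAt E7 x₀).open_source.mem_nhds h)
  refine h3.congr (hmem.mono fun y hy => ?_)
  exact congrArg (tb (f y)) (τ.symmL_apply (R := ℝ) (mem_baseSet_iff.2 hy) (w y)).symm

/-- A finite partition of unity of `X` and points of `M`, such that `f` maps the supports of the
functions to the preferred charts of the points. -/
structure FinPartition {X : Type*} [TopologicalSpace X] (f : X → M) (n : ℕ) where
  /-- the points -/
  pt : Fin n → M
  /-- the functions -/
  fn : Fin n → C(X, ℝ)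
  nonneg : ∀ i p, 0 ≤ fn i p
  sum_eq : ∀ p, ∑ i, fn i p = 1
  mem_source : ∀ i, ∀ p ∈ tsupport (fn i), f p ∈ (chartAt E7 (pt i)).source

lemma exists_finPartition {X : Type*} [TopologicalSpace X] [CompactSpace X] [T2Space X] {f : X → M}
    (hf : Continuous f) : ∃ n, Nonempty (FinPartition f n) := by
  classical
  have hopen (x : M) : IsOpen (f ⁻¹' (chartAt E7 x).source) :=
    (chartAt E7 x).open_source.preimage hf
  obtain ⟨t, ht⟩ := isCompact_univ.elim_finite_subcover (fun x : M => f ⁻¹' (chartAt E7 x).source)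
    hopen (fun p _ => mem_iUnion.2 ⟨f p, mem_chart_source E7 (f p)⟩)
  let g := t.equivFin.symm
  obtain ⟨ρ, hρ⟩ := PartitionOfUnity.exists_isSubordinate (isClosed_univ (X := X))
    (fun i : Fin t.card => f ⁻¹' (chartAt E7 (g i : M)).source) (fun i => hopen _) (by
      intro p hp
      obtain ⟨x, hx, hpx⟩ := mem_iUnion₂.1 (ht hp)
      exact mem_iUnion.2 ⟨t.equivFin ⟨x, hx⟩, by simpa [g] using hpx⟩)
  refine ⟨t.card, ⟨⟨fun i => g i, ρ, fun i p => ρ.nonneg i p, fun p => ?_, fun i p hp => hρ i hp⟩⟩⟩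
  have := ρ.sum_eq_one (mem_univ p)
  rwa [finsum_eq_sum_of_fintype] at this

variable {X : Type*} [TopologicalSpace X] {F : X → M} {n : ℕ} (P : FinPartition F n)

/-- The embedding of the tangent spaces. -/
def FinPartition.emb (p : X) : E7 →ₗ[ℝ] (Fin n → E7) :=
  LinearMap.pi fun i => √(P.fn i p) • (trivAt (P.pt i) (F p)).toLinearMap

/-- The left inverse of the embedding of the tangent spaces. -/
def FinPartition.ret (p : X) : (Fin n → E7) →ₗ[ℝ] E7 :=
  ∑ i, √(P.fn i p) • (trivSymm (P.pt i) (F p)).toLinearMap ∘ₗ LinearMap.proj i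

lemma FinPartition.emb_apply (p : X) (v : E7) (i : Fin n) :
    P.emb p v i = √(P.fn i p) • trivAt (P.pt i) (F p) v := rfl

lemma FinPartition.ret_apply (p : X) (w : Fin n → E7) :
    P.ret p w = ∑ i, √(P.fn i p) • trivSymm (P.pt i) (F p) (w i) := by
  simp [FinPartition.ret]

/-- The square roots in the two maps multiply to the functions of the partition, which add up to
one. -/
lemma FinPartition.ret_emb (p : X) (v : E7) : P.ret p (P.emb p v) = v := by
  rw [P.ret_apply]
  have h (i : Fin n) : √(P.fn i p) • trivSymm (P.pt i) (F p) (P.emb p v i) = P.fn i p • v := by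
    rw [P.emb_apply, map_smul, smul_smul, Real.mul_self_sqrt (P.nonneg i p)]
    by_cases hp : P.fn i p = 0
    · rw [hp, zero_smul, zero_smul]
    · rw [trivSymm_trivAt (P.mem_source i p (subset_tsupport _ hp))]
  rw [Finset.sum_congr rfl fun i _ => h i, ← Finset.sum_smul, P.sum_eq, one_smul]

/-- At points of the closed support the trivialization is continuous; elsewhere the component
vanishes nearby, so the values of `trivAt` outside its chart do not matter. -/
lemma FinPartition.continuousAt_emb {g : Y → X} (hg : ContinuousAt g y₀) {s : Y → E7}
    (hs : ContinuousAt (fun y => tb (F (g y)) (s y)) y₀) :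
    ContinuousAt (fun y => P.emb (g y) (s y)) y₀ := by
  refine continuousAt_pi.2 fun i => ?_
  simp only [P.emb_apply]
  by_cases hp : g y₀ ∈ tsupport (P.fn i)
  · exact (Real.continuous_sqrt.continuousAt.tendsto.comp
      ((P.fn i).continuous.continuousAt.tendsto.comp hg)).smul
      (continuousAt_trivAt (f := fun y => F (g y)) (P.mem_source i _ hp) hs)
  · have h1 : ∀ᶠ y in 𝓝 y₀, P.fn i (g y) = 0 := by
      have := hg.eventually_mem ((isClosed_tsupport (P.fn i)).isOpen_compl.mem_nhds hp)
      exact this.mono fun y hy => image_eq_zero_of_notMem_tsupport hy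
    refine (continuousAt_const (y := (0 : E7))).congr (h1.mono fun y hy => ?_)
    simp [hy]

lemma FinPartition.continuousAt_ret {g : Y → X} (hg : ContinuousAt g y₀) (hF : Continuous F)
    {w : Y → Fin n → E7} (hw : ContinuousAt w y₀) :
    ContinuousAt (fun y => tb (F (g y)) (P.ret (g y) (w y))) y₀ := by
  simp only [P.ret_apply]
  have hFg : ContinuousAt (fun y => F (g y)) y₀ := hF.continuousAt.tendsto.comp hg
  refine continuousAt_tb_sum (f := fun y => F (g y)) _ hFg fun i _ => ?_
  by_cases hp : g y₀ ∈ tsupport (P.fn i)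
  · exact continuousAt_tb_smul (f := fun y => F (g y))
      (Real.continuous_sqrt.continuousAt.tendsto.comp
        ((P.fn i).continuous.continuousAt.tendsto.comp hg))
      (continuousAt_tb_trivSymm (f := fun y => F (g y)) (P.mem_source i _ hp) hFg
        (continuousAt_pi.1 hw i))
  · have h1 : ∀ᶠ y in 𝓝 y₀, P.fn i (g y) = 0 := by
      have := hg.eventually_mem ((isClosed_tsupport (P.fn i)).isOpen_compl.mem_nhds hp)
      exact this.mono fun y hy => image_eq_zero_of_notMem_tsupport hy
    refine (continuousAt_tb_zero (f := fun y => F (g y)) hFg).congr (h1.mono fun y hy => ?_)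
    simp [hy]

end Embedding

/-! ### Families of subspaces -/

section Families

variable {Y W : Type*} [TopologicalSpace Y] [NormedAddCommGroup W] [NormedSpace ℝ W]

/-- The subspaces `ℓ y` have, locally, continuous bases of `k` elements. -/
def LocFramed (ℓ : Y → Submodule ℝ W) (k : ℕ) : Prop :=
  ∀ y₀, ∃ b : Fin k → Y → W, (∀ j, ContinuousAt (b j) y₀) ∧
    ∀ᶠ y in 𝓝 y₀, LinearIndependent ℝ (fun j => b j y) ∧
      Submodule.span ℝ (range fun j => b j y) = ℓ y

lemma LocFramed.finrank_eq {ℓ : Y → Submodule ℝ W} {k : ℕ} (h : LocFramed ℓ k) (y : Y) :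
    Module.finrank ℝ (ℓ y) = k := by
  obtain ⟨b, -, hb⟩ := h y
  obtain ⟨h1, h2⟩ := hb.self_of_nhds
  rw [← h2, finrank_span_eq_card h1, Fintype.card_fin]

lemma LocFramed.exists_frame {ℓ : Y → Submodule ℝ W} {k : ℕ} (h : LocFramed ℓ k) (y : Y) :
    ∃ b : Fin k → W, LinearIndependent ℝ b ∧ Submodule.span ℝ (range b) = ℓ y := by
  obtain ⟨b, -, hb⟩ := h y
  exact ⟨_, hb.self_of_nhds⟩

lemma LocFramed.comp {Z : Type*} [TopologicalSpace Z] {ℓ : Y → Submodule ℝ W} {k : ℕ}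
    (h : LocFramed ℓ k) {g : Z → Y} (hg : Continuous g) : LocFramed (fun z => ℓ (g z)) k := by
  intro z
  obtain ⟨b, hb, hb'⟩ := h (g z)
  exact ⟨fun j z => b j (g z), fun j => (hb j).tendsto.comp hg.continuousAt,
    hg.continuousAt.eventually hb'⟩

/-- A basis is mapped to a basis by a map which is injective on its span. -/
lemma frame_map [FiniteDimensional ℝ W] {k : ℕ} {L L' : Submodule ℝ W} {b : Fin k → W}
    (hb : LinearIndependent ℝ b) (hL : Submodule.span ℝ (range b) = L)
    (hL' : Module.finrank ℝ L' = k) (R : W →ₗ[ℝ] W) (hR : ∀ x ∈ L, R x ∈ L')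
    (hinj : ∀ x ∈ L, R x = 0 → x = 0) :
    LinearIndependent ℝ (fun j => R (b j)) ∧ Submodule.span ℝ (range fun j => R (b j)) = L' := by
  have h1 : LinearIndependent ℝ (fun j => R (b j)) := by
    refine hb.map (f := R) ?_
    rw [hL, Submodule.disjoint_def]
    exact fun x hx hx' => hinj x hx (LinearMap.mem_ker.1 hx')
  refine ⟨h1, Submodule.eq_of_le_of_finrank_eq ?_ ?_⟩
  · rw [Submodule.span_le]
    rintro _ ⟨j, rfl⟩
    exact hR _ (hL ▸ Submodule.subset_span ⟨j, rfl⟩)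
  · rw [finrank_span_eq_card h1, hL', Fintype.card_fin]

section Projector

variable {E : Type*} [NormedAddCommGroup E] [InnerProductSpace ℝ E] [FiniteDimensional ℝ E]

/-- The coefficients solve the normal equations of the Gram matrix. The explicit formula shows
continuous dependence on the basis. -/
lemma starProjection_eq_sum {k : ℕ} {b : Fin k → E} (hb : LinearIndependent ℝ b) (x : E) :
    (Submodule.span ℝ (range b)).starProjection x =
      ∑ j, (((Matrix.gram ℝ b)⁻¹).mulVec fun i => inner ℝ (b i) x) j • b j := by
  have hdet : IsUnit (Matrix.gram ℝ b).det :=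
    isUnit_iff_ne_zero.2 (Matrix.det_gram_ne_zero_iff_linearIndependent.2 hb)
  refine Submodule.eq_starProjection_of_mem_of_inner_eq_zero ?_ ?_
  · exact Submodule.sum_mem _ fun j _ => Submodule.smul_mem _ _ (Submodule.subset_span ⟨j, rfl⟩)
  · intro w hw
    induction hw using Submodule.span_induction with
    | mem w hw =>
      obtain ⟨i, rfl⟩ := hw
      rw [inner_sub_left, sum_inner, sub_eq_zero, real_inner_comm]
      have h := congrFun (congrArg (fun m => Matrix.mulVec m fun i => inner ℝ (b i) x)
        (Matrix.mul_nonsing_inv _ hdet)) i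
      simp only [Matrix.one_mulVec, ← Matrix.mulVec_mulVec] at h
      rw [← h, Matrix.mulVec, dotProduct]
      refine Finset.sum_congr rfl fun j _ => ?_
      rw [Matrix.gram_apply, real_inner_smul_left, mul_comm, real_inner_comm]
    | zero => simp
    | add x y _ _ hx hy => rw [inner_add_right, hx, hy, add_zero]
    | smul c x _ hx => rw [inner_smul_right, hx, mul_zero]

end Projector

/-- A locally framed family of subspaces is the image of a continuous family of projections. -/
theorem LocFramed.exists_projector [FiniteDimensional ℝ W] {ℓ : Y → Submodule ℝ W} {k : ℕ}
    (h : LocFramed ℓ k) : ∃ P : Y → W →L[ℝ] W, Continuous P ∧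
      ∀ y, (∀ x, P y x ∈ ℓ y) ∧ ∀ x ∈ ℓ y, P y x = x := by
  -- W is only normed. An auxiliary Euclidean structure gives projections which depend on the
  -- subspace alone, so local frames yield a globally defined continuous family.
  let T := toEuclidean (E := W)
  let Q : Y → (W →L[ℝ] W) := fun y => T.symm.toContinuousLinearMap ∘L
    ((ℓ y).map T.toLinearEquiv.toLinearMap).starProjection ∘L T.toContinuousLinearMap
  refine ⟨Q, ?_, fun y => ⟨fun x => ?_, fun x hx => ?_⟩⟩
  · rw [continuous_iff_continuousAt]
    intro y₀
    rw [continuousAt_clm_apply]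
    intro x
    obtain ⟨b, hb, hb'⟩ := h y₀
    have hTb (j) : ContinuousAt (fun y => T (b j y)) y₀ :=
      T.continuous.continuousAt.tendsto.comp (hb j)
    have hli {y : Y} (hy : LinearIndependent ℝ fun j => b j y) :
        LinearIndependent ℝ fun j => T (b j y) :=
      hy.map' T.toLinearEquiv.toLinearMap (LinearEquiv.ker _)
    have h1 : ∀ᶠ y in 𝓝 y₀, T.symm (∑ j, (((Matrix.gram ℝ fun j => T (b j y))⁻¹).mulVec
        fun i => inner ℝ (T (b i y)) (T x)) j • T (b j y)) = Q y x := by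
      filter_upwards [hb'] with y hy
      have h2 : (ℓ y).map T.toLinearEquiv.toLinearMap =
          Submodule.span ℝ (range fun j => T (b j y)) := by
        rw [← hy.2, Submodule.map_span, ← range_comp]; rfl
      change _ = T.symm (((ℓ y).map T.toLinearEquiv.toLinearMap).starProjection (T x))
      simp only [h2]
      rw [starProjection_eq_sum (hli hy.1)]
    refine ContinuousAt.congr ?_ h1
    refine T.symm.continuous.continuousAt.tendsto.comp ?_
    have hG : ContinuousAt (fun y => (Matrix.gram ℝ fun j => T (b j y))) y₀ :=
      continuousAt_pi.2 fun i => continuousAt_pi.2 fun j => (hTb i).inner (hTb j)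
    have hG' := continuousAt_inv_matrix hG
      (Matrix.det_gram_ne_zero_iff_linearIndependent.2 (hli hb'.self_of_nhds.1))
    have hv : ContinuousAt (fun y => ((Matrix.gram ℝ fun j => T (b j y))⁻¹).mulVec
        fun i => inner ℝ (T (b i y)) (T x)) y₀ := by
      have h3 : Continuous fun q : Matrix (Fin k) (Fin k) ℝ × (Fin k → ℝ) => q.1.mulVec q.2 :=
        continuous_fst.matrix_mulVec continuous_snd
      exact h3.continuousAt.tendsto.comp (hG'.prodMk
        (continuousAt_pi.2 fun i => (hTb i).inner continuousAt_const))
    exact tendsto_finsetSum _ fun j _ => (continuousAt_pi.1 hv j).smul (hTb j)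
  · have h1 : ((ℓ y).map T.toLinearEquiv.toLinearMap).starProjection (T x) ∈
        (ℓ y).map T.toLinearEquiv.toLinearMap := Submodule.starProjection_apply_mem _ _
    obtain ⟨w, hw, hw'⟩ := h1
    have : Q y x = w := by
      change T.symm (((ℓ y).map T.toLinearEquiv.toLinearMap).starProjection (T x)) = w
      exact (T.symm_apply_eq).2 hw'.symm
    rwa [this]
  · change T.symm (((ℓ y).map T.toLinearEquiv.toLinearMap).starProjection (T x)) = x
    have h1 : T x ∈ (ℓ y).map T.toLinearEquiv.toLinearMap := ⟨x, hx, rfl⟩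
    rw [Submodule.starProjection_eq_self_iff.2 h1, T.symm_apply_apply]

/-! ### Transport -/

/-- Transport along paths: the composition of a large number of short steps. -/
theorem exists_transport [CompactSpace Y] (K : Y → I → I → (W →L[ℝ] W))
    (hK : Continuous fun q : Y × I × I => K q.1 q.2.1 q.2.2) (ℓ : Y → I → Submodule ℝ W)
    (hmem : ∀ y t s, ∀ x ∈ ℓ y s, K y t s x ∈ ℓ y t) (hid : ∀ y t, ∀ x ∈ ℓ y t, K y t t x = x) :
    ∃ R : Y → (W →L[ℝ] W), Continuous R ∧ (∀ y, ∀ x ∈ ℓ y 0, R y x ∈ ℓ y 1) ∧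
      (∀ y, ∀ x ∈ ℓ y 0, R y x = 0 → x = 0) ∧
      (∀ y, (∀ t s, K y t s = K y 0 0) → ∀ x ∈ ℓ y 0, R y x = x) ∧
      ∀ y (j : I → W → W), (∀ t s, ∀ x ∈ ℓ y s, K y t s (j s x) = j t (K y t s x)) →
        ∀ x ∈ ℓ y 0, R y (j 0 x) = j 1 (R y x) := by
  -- a step size for which `K` is close to the identity
  obtain ⟨δ, hδ, hδK⟩ : ∃ δ > 0, ∀ y t s, dist t s < δ → ‖K y t s - K y s s‖ < 1 := by
    let f : Y × I × I → ℝ := fun q => ‖K q.1 q.2.1 q.2.2 - K q.1 q.2.2 q.2.2‖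
    have hf : Continuous f := by
      refine (hK.sub (hK.comp (?_ : Continuous fun q : Y × I × I => (q.1, q.2.2, q.2.2)))).norm
      fun_prop
    let C : Set (Y × I × I) := {q | 1 ≤ f q}
    have hC : IsCompact C := (isClosed_le continuous_const hf).isCompact
    by_cases hne : C.Nonempty
    · obtain ⟨q, hq, hmin⟩ := hC.exists_isMinOn hne
        (f := fun q : Y × I × I => dist q.2.1 q.2.2) (by fun_prop)
      refine ⟨dist q.2.1 q.2.2, ?_, fun y t s hts => ?_⟩
      · refine dist_pos.2 fun h => ?_
        have : (1 : ℝ) ≤ f q := hq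
        simp only [f, h, sub_self, norm_zero] at this
        linarith
      · by_contra hcon
        exact absurd (hmin (show (y, t, s) ∈ C from not_lt.1 hcon)) (not_le.2 hts)
    · refine ⟨1, one_pos, fun y t s _ => ?_⟩
      by_contra hcon
      exact hne ⟨(y, t, s), not_lt.1 hcon⟩
  obtain ⟨n, hn⟩ := exists_nat_one_div_lt hδ
  -- A subdivision into n + 1 equal steps shorter than δ; the projection to [0,1] only serves to
  -- make it defined for every natural number.
  let τ : ℕ → I := fun i => projIcc 0 1 zero_le_one ((i : ℝ) / (n + 1))
  have hτ0 : τ 0 = 0 := by simp [τ]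
  have hτ1 : τ (n + 1) = 1 := by
    have : ((n + 1 : ℕ) : ℝ) / (n + 1) = 1 := by push_cast; field_simp
    simp only [τ, this, projIcc_right]; rfl
  have hτd (i : ℕ) : dist (τ (i + 1)) (τ i) < δ := by
    refine lt_of_le_of_lt ?_ hn
    rw [Subtype.dist_eq, Real.dist_eq]
    refine (abs_projIcc_sub_projIcc zero_le_one).trans ?_
    push_cast
    rw [← sub_div, add_sub_cancel_left, abs_of_pos (by positivity)]
  obtain ⟨R, hR0, hRs⟩ : ∃ R : ℕ → Y → (W →L[ℝ] W), (∀ y, R 0 y = ContinuousLinearMap.id ℝ W) ∧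
      ∀ m y, R (m + 1) y = K y (τ (m + 1)) (τ m) ∘L R m y :=
    ⟨fun m => Nat.rec (fun _ => ContinuousLinearMap.id ℝ W)
      (fun i r y => K y (τ (i + 1)) (τ i) ∘L r y) m, fun _ => rfl, fun _ _ => rfl⟩
  have hRmem (m y) : ∀ x ∈ ℓ y 0, R m y x ∈ ℓ y (τ m) := by
    induction m with
    | zero => intro x hx; rw [hR0, hτ0]; exact hx
    | succ m ih => intro x hx; rw [hRs]; exact hmem _ _ _ _ (ih x hx)
  refine ⟨R (n + 1), ?_, fun y x hx => hτ1 ▸ hRmem (n + 1) y x hx, fun y x hx h0 => ?_,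
    fun y hc x hx => ?_, fun y j hj x hx => ?_⟩
  · have : ∀ m, Continuous (R m) := by
      intro m
      induction m with
      | zero => rw [funext hR0]; exact continuous_const
      | succ m ih =>
        have h1 : Continuous fun y => K y (τ (m + 1)) (τ m) :=
          hK.comp (by fun_prop : Continuous fun y : Y => (y, τ (m + 1), τ m))
        rw [funext (hRs m)]; exact h1.clm_comp ih
    exact this _
  -- Injectivity of one step: it differs by less than one in norm from a map fixing the subspace, so
  -- w with image 0 would satisfy ‖w‖ ≤ c ‖w‖ with c < 1.
  · have : ∀ m, R m y x = 0 → x = 0 := by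
      intro m
      induction m with
      | zero => intro h; simpa [hR0] using h
      | succ m ih =>
        intro h
        apply ih
        rw [hRs, ContinuousLinearMap.comp_apply] at h
        have hw0 := hid _ _ _ (hRmem m y x hx)
        generalize R m y x = w at *
        have h1 : w = -((K y (τ (m + 1)) (τ m) - K y (τ m) (τ m)) w) := by
          rw [sub_apply, h, hw0, zero_sub, neg_neg]
        have h2 : ‖w‖ ≤ ‖K y (τ (m + 1)) (τ m) - K y (τ m) (τ m)‖ * ‖w‖ := by
          conv_lhs => rw [h1, norm_neg]
          exact ContinuousLinearMap.le_opNorm _ _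
        by_contra hw
        have h3 : 0 < ‖w‖ := norm_pos_iff.2 hw
        have h4 := hδK y _ _ (hτd m)
        nlinarith
    exact this _ h0
  · have : ∀ m, R m y x = x := by
      intro m
      induction m with
      | zero => rw [hR0]; rfl
      | succ m ih => rw [hRs, ContinuousLinearMap.comp_apply, ih, hc, hid _ _ _ hx]
    exact this _
  · have : ∀ m, R m y (j 0 x) = j (τ m) (R m y x) := by
      intro m
      induction m with
      | zero => rw [hR0, hτ0]; rfl
      | succ m ih =>
        rw [hRs, ContinuousLinearMap.comp_apply, ih, hj _ _ _ (hRmem m y x hx)]; rfl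
    rw [this, hτ1]

/-- A locally framed family over `[0, 1]` has a continuous basis. -/
theorem LocFramed.exists_path_frame [FiniteDimensional ℝ W] {ℓ : I → Submodule ℝ W} {k : ℕ}
    (h : LocFramed ℓ k) {b₀ : Fin k → W} (hb : LinearIndependent ℝ b₀)
    (hb' : Submodule.span ℝ (range b₀) = ℓ 0) :
    ∃ b : I → Fin k → W, Continuous b ∧ b 0 = b₀ ∧ ∀ t, LinearIndependent ℝ (b t) ∧
      Submodule.span ℝ (range (b t)) = ℓ t := by
  obtain ⟨P, hP, hP'⟩ := h.exists_projector
  -- The path is scaled by the parameter y: transport along t ↦ ℓ (t y) leads from ℓ 0 to ℓ y,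
  -- depends continuously on y, and is the identity on ℓ 0 for y = 0.
  obtain ⟨R, hR, hRm, hRi, hRc, -⟩ := exists_transport (Y := I) (fun y t _ => P (t * y))
    (by fun_prop) (fun y t => ℓ (t * y)) (fun y t s x _ => (hP' _).1 x)
    (fun y t x hx => (hP' _).2 x hx)
  have hR0 (j) : R 0 (b₀ j) = b₀ j :=
    hRc 0 (by simp) _ (by rw [mul_zero, ← hb']; exact Submodule.subset_span ⟨j, rfl⟩)
  refine ⟨fun t j => R t (b₀ j), ?_, funext hR0, fun t => ?_⟩
  · exact continuous_pi fun j => hR.clm_apply continuous_const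
  · refine frame_map hb hb' (h.finrank_eq t) (R t).toLinearMap (fun x hx => ?_) (fun x hx h0 => ?_)
    · simpa using hRm t x (by simpa using hx)
    · exact hRi t x (by simpa using hx) h0

end Families

/-! ### Frames over the circle -/

/-- A path whose ends agree descends to the circle. -/
lemma exists_circle_descent {B : Type*} [TopologicalSpace B] {f : I → B} (hf : Continuous f)
    (h : f 0 = f 1) : ∃ g : S1 → B, Continuous g ∧ ∀ t : I, g ((t : ℝ) : S1) = f t := by
  let F : ℝ → B := fun t => f (projIcc 0 1 zero_le_one t)
  have hF0 : F 0 = f 0 := by simp only [F, projIcc_left]; rfl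
  have hF1 : F 1 = f 1 := by simp only [F, projIcc_right]; rfl
  refine ⟨AddCircle.liftIco 1 0 F, AddCircle.liftIco_zero_continuous (by rw [hF0, hF1, h])
    (hf.comp continuous_projIcc).continuousOn, fun t => ?_⟩
  by_cases ht : (t : ℝ) < 1
  · rw [AddCircle.liftIco_zero_coe_apply ⟨t.2.1, ht⟩]
    simp only [F, projIcc_val]
  · have ht1 : t = 1 := Subtype.ext (le_antisymm t.2.2 (not_lt.1 ht))
    have h1 : ((t : ℝ) : S1) = ((0 : ℝ) : S1) := by
      rw [ht1]; exact AddCircle.coe_period 1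
    rw [h1, AddCircle.liftIco_zero_coe_apply (by simp), hF0, h, ht1]

lemma exists_unitInterval_coe (z : S1) : ∃ t : I, ((t : ℝ) : S1) = z := by
  obtain ⟨x, hx⟩ := QuotientAddGroup.mk_surjective z
  have h : ((Int.fract x : ℝ) : S1) = (x : S1) := by
    rw [← Int.self_sub_floor, AddCircle.coe_sub]
    have : ((⌊x⌋ : ℝ) : S1) = 0 := by
      rw [AddCircle.coe_eq_zero_iff]; exact ⟨⌊x⌋, by simp⟩
    rw [this, sub_zero]
  exact ⟨⟨Int.fract x, Int.fract_nonneg x, (Int.fract_lt_one x).le⟩, h.trans hx⟩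

/-! ### Connectedness of the matrices of positive determinant. -/

section Matrices

/-- The invertible real matrices of size three. -/
abbrev GLset : Set (Matrix (Fin 3) (Fin 3) ℝ) := {m | m.det ≠ 0}

lemma joinedIn_mul {a b c d : Matrix (Fin 3) (Fin 3) ℝ} (h : JoinedIn GLset a b)
    (h' : JoinedIn GLset c d) : JoinedIn GLset (a * c) (b * d) := by
  obtain ⟨γ, hγ⟩ := h
  obtain ⟨γ', hγ'⟩ := h'
  refine ⟨⟨⟨fun t => γ t * γ' t, by fun_prop⟩, by simp, by simp⟩, fun t => ?_⟩
  change (γ t * γ' t).det ≠ 0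
  rw [Matrix.det_mul]
  exact mul_ne_zero (hγ t) (hγ' t)

/-- A convex combination of a nonzero real number and its sign never vanishes. -/
lemma joinedIn_diagonal_sign {D : Fin 3 → ℝ} (hD : ∀ i, D i ≠ 0) :
    JoinedIn GLset (Matrix.diagonal D) (Matrix.diagonal fun i => (SignType.sign (D i) : ℝ)) := by
  refine ⟨⟨⟨fun t => Matrix.diagonal fun i => (1 - (t : ℝ)) * D i + t * SignType.sign (D i),
    by fun_prop⟩, by simp, by simp⟩, fun t => ?_⟩
  change (Matrix.diagonal _).det ≠ 0
  rw [Matrix.det_diagonal, Finset.prod_ne_zero_iff]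
  intro i _
  have h0 := t.2.1
  have h1 := t.2.2
  rcases lt_or_gt_of_ne (hD i) with h | h
  · simp only [sign_neg h, SignType.coe_neg_one]
    refine ne_of_lt ?_
    rcases h0.eq_or_lt with h' | h'
    · rw [← h']; simpa using h
    · nlinarith
  · simp only [sign_pos h, SignType.coe_one]
    refine ne_of_gt ?_
    rcases h0.eq_or_lt with h' | h'
    · rw [← h']; simpa using h
    · nlinarith

lemma joinedIn_of_rotation {R : ℝ → Matrix (Fin 3) (Fin 3) ℝ} (hR : Continuous R)
    (hdet : ∀ t, (R t).det = 1) (h0 : R 0 = 1) : JoinedIn GLset 1 (R Real.pi) := by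
  refine ⟨⟨⟨fun t => R (t * Real.pi), by fun_prop⟩, by simp [h0], by simp⟩, fun t => ?_⟩
  change (R _).det ≠ 0
  rw [hdet]
  exact one_ne_zero

/-- After reduction to signs, an even number of entries is −1, and a pair of entries −1 is the end
of a rotation by π in a coordinate plane. -/
lemma joinedIn_diagonal {D : Fin 3 → ℝ} (hD : 0 < (Matrix.diagonal D).det) :
    JoinedIn GLset 1 (Matrix.diagonal D) := by
  rw [Matrix.det_diagonal] at hD
  have hD0 : ∀ i, D i ≠ 0 := fun i h => hD.ne' (Finset.prod_eq_zero (Finset.mem_univ i) h)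
  refine JoinedIn.trans ?_ (joinedIn_diagonal_sign hD0).symm
  have h01 := joinedIn_of_rotation
    (R := fun t => !![Real.cos t, -Real.sin t, 0; Real.sin t, Real.cos t, 0; 0, 0, 1])
    (by refine continuous_matrix fun i j => ?_; fin_cases i <;> fin_cases j <;> simp <;> fun_prop)
    (fun t => by rw [Matrix.det_fin_three]; simp; nlinarith [Real.sin_sq_add_cos_sq t])
    (by ext i j; fin_cases i <;> fin_cases j <;> simp)
  have h02 := joinedIn_of_rotation
    (R := fun t => !![Real.cos t, 0, -Real.sin t; 0, 1, 0; Real.sin t, 0, Real.cos t])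
    (by refine continuous_matrix fun i j => ?_; fin_cases i <;> fin_cases j <;> simp <;> fun_prop)
    (fun t => by rw [Matrix.det_fin_three]; simp; nlinarith [Real.sin_sq_add_cos_sq t])
    (by ext i j; fin_cases i <;> fin_cases j <;> simp)
  have h12 := joinedIn_of_rotation
    (R := fun t => !![1, 0, 0; 0, Real.cos t, -Real.sin t; 0, Real.sin t, Real.cos t])
    (by refine continuous_matrix fun i j => ?_; fin_cases i <;> fin_cases j <;> simp <;> fun_prop)
    (fun t => by rw [Matrix.det_fin_three]; simp; nlinarith [Real.sin_sq_add_cos_sq t])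
    (by ext i j; fin_cases i <;> fin_cases j <;> simp)
  have h1 : JoinedIn GLset 1 1 := JoinedIn.refl (by simp [GLset])
  rw [Fin.prod_univ_three] at hD
  have key (a b c : ℝ) (ha : SignType.sign (D 0) = a) (hb : SignType.sign (D 1) = b)
      (hc : SignType.sign (D 2) = c) : (Matrix.diagonal fun i => (SignType.sign (D i) : ℝ)) =
        !![a, 0, 0; 0, b, 0; 0, 0, c] := by
    ext i j; fin_cases i <;> fin_cases j <;> simp [ha, hb, hc]
  rcases lt_or_gt_of_ne (hD0 0) with a | a <;> rcases lt_or_gt_of_ne (hD0 1) with b | b <;>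
    rcases lt_or_gt_of_ne (hD0 2) with c | c
  · exact absurd hD (not_lt.2 (mul_nonpos_of_nonneg_of_nonpos (mul_pos_of_neg_of_neg a b).le c.le))
  · rw [key (-1) (-1) 1 (by simp [a]) (by simp [b]) (by simp [c])]
    convert h01 using 1
    ext i j; fin_cases i <;> fin_cases j <;> simp
  · rw [key (-1) 1 (-1) (by simp [a]) (by simp [b]) (by simp [c])]
    convert h02 using 1
    ext i j; fin_cases i <;> fin_cases j <;> simp
  · exact absurd hD (not_lt.2 (mul_neg_of_neg_of_pos (mul_neg_of_neg_of_pos a b) c).le)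
  · rw [key 1 (-1) (-1) (by simp [a]) (by simp [b]) (by simp [c])]
    convert h12 using 1
    ext i j; fin_cases i <;> fin_cases j <;> simp
  · exact absurd hD (not_lt.2 (mul_neg_of_neg_of_pos (mul_neg_of_pos_of_neg a b) c).le)
  · exact absurd hD (not_lt.2 (mul_neg_of_pos_of_neg (mul_pos a b) c).le)
  · rw [key 1 1 1 (by simp [a]) (by simp [b]) (by simp [c])]
    convert h1 using 1
    ext i j; fin_cases i <;> fin_cases j <;> simp

/-- The matrices of positive determinant are joined to `1` by paths of invertible matrices. -/
theorem joinedIn_of_det_pos {m : Matrix (Fin 3) (Fin 3) ℝ} (hm : 0 < m.det) :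
    JoinedIn GLset 1 m := by
  have key : ∃ D : Fin 3 → ℝ, JoinedIn GLset (Matrix.diagonal D) m ∧
      (Matrix.diagonal D).det = m.det := by
    -- Gaussian elimination. A transvection is joined to 1 by scaling its off-diagonal entry, so
    -- that only the diagonal factor remains.
    obtain ⟨L, L', D, h⟩ := Matrix.Pivot.exists_list_transvec_mul_diagonal_mul_list_transvec m
    have hL (L : List (Matrix.TransvectionStruct (Fin 3) ℝ)) :
        JoinedIn GLset 1 (L.map Matrix.TransvectionStruct.toMatrix).prod := by
      induction L with
      | nil => exact JoinedIn.refl (by simp [GLset])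
      | cons t L ih =>
        rw [List.map_cons, List.prod_cons, ← one_mul (1 : Matrix (Fin 3) (Fin 3) ℝ)]
        refine joinedIn_mul ?_ ih
        refine ⟨⟨⟨fun s => Matrix.transvection t.i t.j (s * t.c), ?_⟩, by simp, by
          simp [Matrix.TransvectionStruct.toMatrix]⟩, fun s => ?_⟩
        · unfold Matrix.transvection
          refine continuous_const.add (continuous_matrix fun i j => ?_)
          simp only [Matrix.single_apply]
          split_ifs <;> fun_prop
        · change (Matrix.transvection _ _ _).det ≠ 0
          rw [Matrix.det_transvection_of_ne _ _ t.hij]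
          exact one_ne_zero
    have hdet : (Matrix.diagonal D).det = m.det := by
      rw [h, Matrix.det_mul, Matrix.det_mul]
      simp
    refine ⟨D, ?_, hdet⟩
    have hD : JoinedIn GLset (Matrix.diagonal D) (Matrix.diagonal D) :=
      JoinedIn.refl (by change _ ≠ _; rw [hdet]; exact hm.ne')
    have := joinedIn_mul (joinedIn_mul (hL L) hD) (hL L')
    rwa [one_mul, mul_one, ← h] at this
  obtain ⟨D, h1, h2⟩ := key
  exact (joinedIn_diagonal (h2 ▸ hm)).trans h1

end Matrices

/-! ### Real changes of frame. -/

section Frames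

variable {W : Type*} [AddCommGroup W] [Module ℝ W]

/-- The family with coordinates the columns of `g` with respect to `b`. -/
def frameMul (b : Fin 3 → W) (g : Matrix (Fin 3) (Fin 3) ℝ) : Fin 3 → W :=
  fun j => ∑ i, g i j • b i

lemma frameMul_mul (b : Fin 3 → W) (g h : Matrix (Fin 3) (Fin 3) ℝ) :
    frameMul (frameMul b g) h = frameMul b (g * h) := by
  ext j
  simp only [frameMul, Matrix.mul_apply, Finset.smul_sum, Finset.sum_smul, smul_smul]
  rw [Finset.sum_comm]
  refine Finset.sum_congr rfl fun i _ => Finset.sum_congr rfl fun k _ => ?_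
  rw [mul_comm]

lemma frameMul_one (b : Fin 3 → W) : frameMul b 1 = b := by
  ext j
  simp [frameMul, Matrix.one_apply]

lemma span_frameMul_le (b : Fin 3 → W) (g : Matrix (Fin 3) (Fin 3) ℝ) :
    Submodule.span ℝ (range (frameMul b g)) ≤ Submodule.span ℝ (range b) := by
  rw [Submodule.span_le]
  rintro _ ⟨j, rfl⟩
  exact Submodule.sum_mem _ fun i _ => Submodule.smul_mem _ _ (Submodule.subset_span ⟨i, rfl⟩)

lemma span_frameMul (b : Fin 3 → W) {g : Matrix (Fin 3) (Fin 3) ℝ} (hg : g.det ≠ 0) :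
    Submodule.span ℝ (range (frameMul b g)) = Submodule.span ℝ (range b) := by
  refine le_antisymm (span_frameMul_le b g) ?_
  conv_lhs => rw [← frameMul_one b, ← Matrix.mul_nonsing_inv g (isUnit_iff_ne_zero.2 hg),
    ← frameMul_mul]
  exact span_frameMul_le _ _

lemma linearIndependent_frameMul {b : Fin 3 → W} (hb : LinearIndependent ℝ b)
    {g : Matrix (Fin 3) (Fin 3) ℝ} (hg : g.det ≠ 0) : LinearIndependent ℝ (frameMul b g) := by
  rw [linearIndependent_iff_card_eq_finrank_span] at hb ⊢
  rwa [Set.finrank, span_frameMul b hg]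

lemma exists_frameMul_eq {b c : Fin 3 → W} (h : ∀ j, c j ∈ Submodule.span ℝ (range b)) :
    ∃ g, c = frameMul b g := by
  have hex (j) : ∃ x : Fin 3 → ℝ, ∑ i, x i • b i = c j := by
    simpa [Submodule.mem_span_range_iff_exists_fun] using h j
  choose x hx using hex
  exact ⟨Matrix.of fun i j => x j i, funext fun j => (hx j).symm⟩

end Frames

/-- An oriented family of three-dimensional subspaces over the circle has a continuous basis. -/
theorem exists_circle_frame {W : Type*} [NormedAddCommGroup W] [NormedSpace ℝ W]
    [FiniteDimensional ℝ W] {ℓ : S1 → Submodule ℝ W} (h : LocFramed ℓ 3)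
    (o : S1 → (Fin 3 → W) → ℝ)
    (hne : ∀ z b, LinearIndependent ℝ b → Submodule.span ℝ (range b) = ℓ z → o z b ≠ 0)
    (hdet : ∀ z b g, o z (frameMul b g) = g.det * o z b)
    (ho : ∀ b : I → Fin 3 → W, Continuous b → Continuous fun t : I => o ((t : ℝ) : S1) (b t)) :
    ∃ b : S1 → Fin 3 → W, Continuous b ∧
      ∀ z, LinearIndependent ℝ (b z) ∧ Submodule.span ℝ (range (b z)) = ℓ z := by
  have hc : Continuous fun t : I => ((t : ℝ) : S1) :=
    (AddCircle.continuous_mk' 1).comp continuous_subtype_val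
  have h' := h.comp hc
  obtain ⟨b₀, hb₀, hb₀'⟩ := h'.exists_frame 0
  obtain ⟨b, hb, -, hbf⟩ := h'.exists_path_frame hb₀ hb₀'
  have h01 : (((1 : I) : ℝ) : S1) = (((0 : I) : ℝ) : S1) := AddCircle.coe_period 1
  obtain ⟨g, hg⟩ : ∃ g, b 0 = frameMul (b 1) g := by
    refine exists_frameMul_eq fun j => ?_
    rw [(hbf 1).2, h01, ← (hbf 0).2]
    exact Submodule.subset_span ⟨j, rfl⟩
  -- The function o is continuous and nowhere zero along the path frame, hence has equal signs at
  -- both ends; the two end frames of the same subspace differ by the factor det g.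
  have hgdet : 0 < g.det := by
    have h1 := ho b hb
    have h2 : ∀ t : I, o ((t : ℝ) : S1) (b t) ≠ 0 := fun t => hne _ _ (hbf t).1 (hbf t).2
    have h3 : o (((0 : I) : ℝ) : S1) (b 0) = g.det * o (((1 : I) : ℝ) : S1) (b 1) := by
      rw [← hdet, ← hg, h01]
    rcases lt_or_gt_of_ne (h2 0) with h4 | h4 <;> rcases lt_or_gt_of_ne (h2 1) with h5 | h5
    · rw [h3] at h4; nlinarith
    · obtain ⟨t, ht⟩ := mem_range_of_exists_le_of_exists_ge h1 ⟨0, h4.le⟩ ⟨1, h5.le⟩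
      exact absurd ht (h2 t)
    · obtain ⟨t, ht⟩ := mem_range_of_exists_le_of_exists_ge h1 ⟨1, h5.le⟩ ⟨0, h4.le⟩
      exact absurd ht (h2 t)
    · rw [h3] at h4; nlinarith
  -- Twisting the path frame by a path of matrices from 1 to g makes its ends agree.
  obtain ⟨γ, hγ⟩ := joinedIn_of_det_pos hgdet
  obtain ⟨c, hc1, hc2⟩ := exists_circle_descent (f := fun t => frameMul (b t) (γ t))
    (by
      refine continuous_pi fun j => continuous_finsetSum _ fun i _ => ?_
      have h1 : Continuous fun t => γ t i j := by fun_prop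
      exact h1.smul ((continuous_apply i).comp hb))
    (by rw [γ.source, γ.target, ← hg, frameMul_one])
  refine ⟨c, hc1, fun z => ?_⟩
  obtain ⟨t, rfl⟩ := exists_unitInterval_coe z
  rw [hc2]
  exact ⟨linearIndependent_frameMul (hbf t).1 (hγ t), (span_frameMul _ (hγ t)).trans (hbf t).2⟩

/-- A basis over a compact space extends over its product with `[0, 1]`. -/
theorem LocFramed.exists_frame_extension {Y W : Type*} [TopologicalSpace Y] [CompactSpace Y]
    [NormedAddCommGroup W] [NormedSpace ℝ W] [FiniteDimensional ℝ W]
    {ℓ : I × Y → Submodule ℝ W} {k : ℕ} (h : LocFramed ℓ k) {b₀ : Y → Fin k → W}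
    (hb : Continuous b₀) (hb' : ∀ y, LinearIndependent ℝ (b₀ y) ∧
      Submodule.span ℝ (range (b₀ y)) = ℓ (0, y)) :
    ∃ b : I × Y → Fin k → W, Continuous b ∧ ∀ q, LinearIndependent ℝ (b q) ∧
      Submodule.span ℝ (range (b q)) = ℓ q := by
  obtain ⟨P, hP, hP'⟩ := h.exists_projector
  obtain ⟨R, hR, hRm, hRi, -⟩ := exists_transport (Y := I × Y) (fun y t _ => P (t * y.1, y.2))
    (by fun_prop) (fun y t => ℓ (t * y.1, y.2)) (fun y t s x _ => (hP' _).1 x)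
    (fun y t x hx => (hP' _).2 x hx)
  refine ⟨fun q j => R q (b₀ q.2 j), ?_, fun q => ?_⟩
  · exact continuous_pi fun j => hR.clm_apply (by fun_prop)
  · refine frame_map (hb' q.2).1 (hb' q.2).2 (h.finrank_eq q) (R q).toLinearMap
      (fun x hx => ?_) (fun x hx h0 => ?_)
    · simpa using hRm q x (by simpa using hx)
    · exact hRi q x (by simpa using hx) h0

/-! ### Submanifolds -/

section Submanifold

variable {M : Type*} [TopologicalSpace M] [ChartedSpace E7 M] [IsManifold (𝓡 7) ∞ M]
  {N : Type*} [TopologicalSpace N] [ChartedSpace (EuclideanSpace ℝ (Fin 4)) N]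
  [IsManifold (𝓡 4) ∞ N] {lam : ThreeForm M} {i : N → M}

/-- The differential, as a linear map between the model spaces. -/
def dif (i : N → M) (y : N) : EuclideanSpace ℝ (Fin 4) →L[ℝ] E7 := mfderiv (𝓡 4) (𝓡 7) i y

/-- The tangent space of a submanifold, as a subspace of the model space. -/
def tanE (i : N → M) (x : M) : Submodule ℝ E7 := tangentAt i x

/-- In the normal form of an immersion the projection to the first factor, followed by the inverse
chart of N, is a local left inverse of i; the chain rule gives the claim. -/
lemma dif_injective (hi : IsImmersion (𝓡 4) (𝓡 7) ∞ i) (y : N) : Function.Injective (dif i y) := by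
  have h := hi.isImmersionAt y
  let F : M → EuclideanSpace ℝ (Fin 4) := fun x => (h.equiv.symm (h.codChart x)).1
  let G : M → N := fun x => h.domChart.symm (F x)
  have hFi : ∀ y' ∈ h.domChart.source, F (i y') = h.domChart y' := by
    intro y' hy'
    have h0 : h.domChart y' ∈ (h.domChart.extend (𝓡 4)).target := by
      simpa using h.domChart.map_source hy'
    have h1 := h.writtenInCharts h0
    have h2 : h.codChart (i (h.domChart.symm (h.domChart y'))) = h.equiv (h.domChart y', 0) := h1
    rw [h.domChart.left_inv hy'] at h2
    simp only [F, h2, ContinuousLinearEquiv.symm_apply_apply]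
  have hF : MDifferentiableAt (𝓡 7) 𝓘(ℝ, EuclideanSpace ℝ (Fin 4)) F (i y) := by
    have h1 : MDifferentiableAt (𝓡 7) (𝓡 7) h.codChart (i y) :=
      (contMDiffAt_of_mem_maximalAtlas h.codChart_mem_maximalAtlas
        h.mem_codChart_source).mdifferentiableAt (by simp)
    have h2 : DifferentiableAt ℝ (fun w : E7 => (h.equiv.symm w).1) (h.codChart (i y)) := by
      fun_prop
    exact h2.mdifferentiableAt.comp (i y) h1
  have hG : MDifferentiableAt (𝓡 7) (𝓡 4) G (i y) := by
    have h1 : MDifferentiableAt (𝓡 4) (𝓡 4) h.domChart.symm (F (i y)) := by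
      rw [hFi y h.mem_domChart_source]
      exact (contMDiffAt_symm_of_mem_maximalAtlas h.domChart_mem_maximalAtlas
        (h.domChart.map_source h.mem_domChart_source)).mdifferentiableAt (by simp)
    exact h1.comp (i y) hF
  have hi' : MDifferentiableAt (𝓡 4) (𝓡 7) i y := h.contMDiffAt.mdifferentiableAt (by simp)
  have hGi : G ∘ i =ᶠ[𝓝 y] id := by
    filter_upwards [h.domChart.open_source.mem_nhds h.mem_domChart_source] with y' hy'
    simp only [Function.comp, G, hFi y' hy', h.domChart.left_inv hy', id]
  have h3 : mfderiv (𝓡 4) (𝓡 4) (G ∘ i) y = (mfderiv (𝓡 7) (𝓡 4) G (i y)).comp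
      (mfderiv (𝓡 4) (𝓡 7) i y) := mfderiv_comp y hG hi'
  rw [hGi.mfderiv_eq, mfderiv_id] at h3
  intro v w hvw
  have h4 (v : EuclideanSpace ℝ (Fin 4)) : v = (mfderiv (𝓡 7) (𝓡 4) G (i y) :
      E7 → EuclideanSpace ℝ (Fin 4)) (dif i y v) := DFunLike.congr_fun h3 v
  rw [h4 v, h4 w, hvw]

lemma tanE_eq (hi : Function.Injective i) (y : N) :
    tanE i (i y) = LinearMap.range (dif i y).toLinearMap := by
  refine le_antisymm ?_ ?_
  · refine iSup₂_le fun y' hy' => ?_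
    obtain rfl := hi hy'
    exact le_rfl
  · exact le_iSup₂_of_le (f := fun (y' : N) (_ : i y' = i y) =>
      (LinearMap.range (dif i y').toLinearMap)) y rfl le_rfl

lemma IsIsotropicEmbedding.gForm_eq_zero (hlam : IsG2Form lam) (hi : IsIsotropicEmbedding lam i)
    {x : M} (hx : x ∈ range i) {u v w : E7} (hu : u ∈ tanE i x) (hv : v ∈ tanE i x)
    (hw : w ∈ tanE i x) : gForm (hlam.coordAt x) u v w = 0 := by
  obtain ⟨y, rfl⟩ := hx
  rw [tanE_eq hi.embedding.isEmbedding.injective] at hu hv hw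
  obtain ⟨u, rfl⟩ := hu
  obtain ⟨v, rfl⟩ := hv
  obtain ⟨w, rfl⟩ := hw
  rw [← hlam.lam_eq]
  have h := hi.isotropic y ![u, v, w]
  rw [← h]
  congr 1
  ext j : 1
  fin_cases j <;> rfl

/-- The loop lifts to N. The lift is continuous because i is a topological embedding and then smooth
because i is an immersion, so the velocity is in the image of the differential. -/
lemma velocity_mem_tanE (hi : IsIsotropicEmbedding lam i) {γ : S1 → M}
    (hγ : ContMDiff 𝓘(ℝ, ℝ) (𝓡 7) ∞ (fun s : ℝ => γ (s : S1))) (h : ∀ z, γ z ∈ range i) (z : S1) :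
    (velocity γ z : E7) ∈ tanE i (γ z) := by
  obtain ⟨s₀, rfl⟩ := QuotientAddGroup.mk_surjective z
  choose g hg using fun s : ℝ => h (s : S1)
  have hig : i ∘ g = fun s : ℝ => γ (s : S1) := funext hg
  have hgs : ContMDiff 𝓘(ℝ, ℝ) (𝓡 4) ∞ g := by
    rw [ContMDiff.iff_comp_isImmersion hi.embedding.isImmersion, hig]
    refine ⟨?_, hγ⟩
    rw [hi.embedding.isEmbedding.continuous_iff, hig]
    exact hγ.continuous
  have hg' : MDifferentiableAt 𝓘(ℝ, ℝ) (𝓡 4) (fun s : ℝ => g (s₀ + s)) 0 := by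
    have h1 : MDifferentiableAt 𝓘(ℝ, ℝ) 𝓘(ℝ, ℝ) (fun s : ℝ => s₀ + s) 0 :=
      (by fun_prop : DifferentiableAt ℝ (fun s : ℝ => s₀ + s) 0).mdifferentiableAt
    exact (hgs.mdifferentiableAt (by simp)).comp (0 : ℝ) h1
  have hi' : MDifferentiableAt (𝓡 4) (𝓡 7) i (g (s₀ + 0)) :=
    hi.embedding.contMDiff.mdifferentiableAt (by simp)
  have h2 := mfderiv_comp (0 : ℝ) (g := i) (f := fun s : ℝ => g (s₀ + s)) hi' hg'
  have h3 : (i ∘ fun s : ℝ => g (s₀ + s)) = fun s : ℝ => γ ((s₀ : S1) + (s : S1)) := by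
    ext s
    rw [← AddCircle.coe_add]
    exact hg (s₀ + s)
  have h4 : (mfderiv 𝓘(ℝ, ℝ) (𝓡 7) (fun s : ℝ => γ ((s₀ : S1) + (s : S1))) 0 : ℝ → E7) 1 ∈
      LinearMap.range (dif i (g (s₀ + 0))).toLinearMap := by
    rw [← h3, h2]
    exact ⟨_, rfl⟩
  have h5 : tanE i (γ (s₀ : S1)) = LinearMap.range (dif i (g (s₀ + 0))).toLinearMap := by
    rw [← tanE_eq hi.embedding.isEmbedding.injective, hg, add_zero]
  change _ ∈ tanE i (γ (s₀ : S1))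
  rw [h5]
  exact h4

/-- The tangent spaces of a submanifold have local bases of continuous vector fields. -/
lemma exists_local_frame_tanE (hi : IsIsotropicEmbedding lam i) {Y : Type*} [TopologicalSpace Y]
    {f : Y → M} (hf : Continuous f) (h : ∀ y, f y ∈ range i) (y₀ : Y) :
    ∃ b : Fin 4 → Y → E7, (∀ k, ContinuousAt (fun y => tb (f y) (b k y)) y₀) ∧
      ∀ᶠ y in 𝓝 y₀, LinearIndependent ℝ (fun k => b k y) ∧
        Submodule.span ℝ (range fun k => b k y) = tanE i (f y) := by
  choose g hg using h
  obtain rfl : f = i ∘ g := (funext hg).symm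
  have hgc : Continuous g := hi.embedding.isEmbedding.continuous_iff.2 hf
  let E4 := EuclideanSpace ℝ (Fin 4)
  have : IsManifold (𝓡 4) 1 N := IsManifold.of_le (n := ∞) (by simp)
  let T := trivializationAt E4 (TangentSpace (𝓡 4) : N → Type) (g y₀)
  let S : Y → E4 →L[ℝ] E4 := fun y => T.symmL ℝ (g y)
  have hbase : ∀ᶠ y in 𝓝 y₀, g y ∈ T.baseSet := hgc.continuousAt.eventually_mem
    (T.open_baseSet.mem_nhds (mem_baseSet_trivializationAt _ _ _))
  let β := EuclideanSpace.basisFun (Fin 4) ℝ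
  refine ⟨fun k y => dif i (g y) (S y (β k)), fun k => ?_, ?_⟩
  · have h1 : ContinuousAt (fun y => (⟨g y, S y (β k)⟩ : TangentBundle (𝓡 4) N)) y₀ := by
      rw [FiberBundle.continuousAt_totalSpace]
      refine ⟨hgc.continuousAt, ?_⟩
      refine (continuousAt_const (y := β k)).congr ?_
      filter_upwards [hbase] with y hy
      have h2 := T.continuousLinearMapAt_symmL (R := ℝ) hy (β k)
      rw [Bundle.Trivialization.continuousLinearMapAt_apply_of_mem ℝ T hy] at h2
      exact h2.symm
    have h2 : Continuous (tangentMap (𝓡 4) (𝓡 7) i) :=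
      hi.embedding.contMDiff.continuous_tangentMap (by simp)
    exact h2.continuousAt.tendsto.comp h1
  · filter_upwards [hbase] with y hy
    have hSinj : Function.Injective (S y) := fun v w hvw => by
      have h2 (v : E4) := T.continuousLinearMapAt_symmL (R := ℝ) hy v
      have h3 (v : E4) : (T.continuousLinearMapAt ℝ (g y) : E4 → E4) (S y v) = v := h2 v
      rw [← h3 v, ← h3 w, hvw]
    let L : E4 →ₗ[ℝ] E7 := (dif i (g y)).toLinearMap ∘ₗ (S y).toLinearMap
    have hL : Function.Injective L := (dif_injective hi.embedding.isImmersion _).comp hSinj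
    have hLβ : (fun k => dif i (g y) (S y (β k))) = L ∘ β.toBasis := by
      ext k : 1; simp [L]
    refine ⟨?_, ?_⟩
    · rw [hLβ]; exact β.toBasis.linearIndependent.map' L (LinearMap.ker_eq_bot.2 hL)
    have h4 : Submodule.span ℝ (range fun k => dif i (g y) (S y (β k))) = LinearMap.range L := by
      have h5 : (range fun k => dif i (g y) (S y (β k))) = L '' range β.toBasis := by
        rw [← range_comp, hLβ]
      rw [h5, ← Submodule.map_span, β.toBasis.span_eq, Submodule.map_top]
    have hSsurj : Function.Surjective (S y) :=
      LinearMap.injective_iff_surjective (f := (S y).toLinearMap).1 hSinj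
    rw [h4, Function.comp_apply, tanE_eq hi.embedding.isEmbedding.injective]
    exact LinearMap.range_comp_of_range_eq_top _ (LinearMap.range_eq_top.2 hSsurj)

end Submanifold

/-! ### Complex frames -/

section ComplexFrames

variable {V : Type*} [AddCommGroup V] [Module ℝ V] {A : V ≃ₗ[ℝ] (Fin 7 → ℝ)} {e : V}

lemma gProj_self : gProj A e e = 0 := by rw [gProj_eq, gJ_self, map_zero, neg_zero]

lemma ker_gProj (he : e ≠ 0) : LinearMap.ker (gProj A e) = Submodule.span ℝ {e} := by
  refine le_antisymm (fun v hv => ?_) ?_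
  · have := sub_gProj_mem (A := A) he v
    rwa [LinearMap.mem_ker.1 hv, sub_zero] at this
  · rw [Submodule.span_singleton_le_iff_mem]
    exact gProj_self

lemma finrank_range_gProj (he : e ≠ 0) : Module.finrank ℝ (LinearMap.range (gProj A e)) = 6 := by
  have hfin : Module.Finite ℝ V := Module.Finite.equiv A.symm
  have h := LinearMap.finrank_range_add_finrank_ker (gProj A e)
  rw [ker_gProj he, finrank_span_singleton he, A.finrank_eq] at h
  simpa using h

lemma gProj_mem_span_iff (he : e ≠ 0) {v : V} (hv : gProj A e v = v) :
    v ∈ Submodule.span ℝ {e} ↔ v = 0 := by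
  rw [← ker_gProj (A := A) he, LinearMap.mem_ker, hv]

lemma gVol_gProj_gProj_gProj (he : e ≠ 0) (x y z : V) :
    gVol A e (gProj A e x) (gProj A e y) (gProj A e z) = gVol A e x y z := by
  simp only [gVol, gProj_gProj he, gJ_gProj he]

lemma gVol_smul_complex (he : e ≠ 0) (t : ℂ) (x y z : V) :
    gVol A e (t.re • x + t.im • gJ A e x) y z = t * gVol A e x y z := by
  rw [gVol_add1, gVol_smul1, gVol_smul1, gVol_gJ he]
  conv_rhs => rw [← Complex.re_add_im t]
  ring

variable (A e) in
/-- The complex linear combinations of a family of three vectors. -/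
def cplx (y : Fin 3 → V) : C3 →ₗ[ℝ] V where
  toFun c := ∑ k, ((c k).re • y k + (c k).im • gJ A e (y k))
  map_add' c d := by
    rw [← Finset.sum_add_distrib]
    refine Finset.sum_congr rfl fun k _ => ?_
    simp only [Pi.add_apply, Complex.add_re, Complex.add_im, add_smul]
    abel
  map_smul' r c := by
    rw [RingHom.id_apply, Finset.smul_sum]
    refine Finset.sum_congr rfl fun k _ => ?_
    simp [smul_smul]

lemma cplx_apply (y : Fin 3 → V) (c : C3) :
    cplx A e y c = ∑ k, ((c k).re • y k + (c k).im • gJ A e (y k)) := rfl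

lemma cplx_single (y : Fin 3 → V) (j : Fin 3) : cplx A e y (Pi.single j 1) = y j := by
  rw [cplx_apply, Finset.sum_eq_single j]
  · simp
  · intro k _ hk; simp [hk]
  · simp

lemma gJ_gJ_of_gProj {v : V} (hv : gProj A e v = v) : gJ A e (gJ A e v) = -v := by
  conv_rhs => rw [← hv, gProj_eq, neg_neg]

lemma gProj_cplx (he : e ≠ 0) {y : Fin 3 → V} (hy : ∀ k, gProj A e (y k) = y k) (c : C3) :
    gProj A e (cplx A e y c) = cplx A e y c := by
  simp [cplx_apply, hy, gProj_gJ he]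

lemma cplx_smul {y : Fin 3 → V} (hy : ∀ k, gProj A e (y k) = y k) (t : ℂ) (c : C3) :
    cplx A e y (t • c) = t.re • cplx A e y c + t.im • gJ A e (cplx A e y c) := by
  simp only [cplx_apply, map_sum, map_add, map_smul, gJ_gJ_of_gProj (hy _), Finset.smul_sum]
  rw [← Finset.sum_add_distrib]
  refine Finset.sum_congr rfl fun k _ => ?_
  simp only [Pi.smul_apply, smul_eq_mul, Complex.mul_re, Complex.mul_im]
  module

/-- Pulled back to ℂ³ by `cplx`, the volume form becomes alternating and complex trilinear, hence a
multiple of the determinant. -/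
lemma gVol_cplx (he : e ≠ 0) {y : Fin 3 → V} (hy : ∀ k, gProj A e (y k) = y k) (v : Fin 3 → C3) :
    gVol A e (cplx A e y (v 0)) (cplx A e y (v 1)) (cplx A e y (v 2)) =
      gVol A e (y 0) (y 1) (y 2) * (Matrix.of v).det := by
  have h := trilinear_eq_det
    (fun a b c => gVol A e (cplx A e y a) (cplx A e y b) (cplx A e y c))
    (fun a a' b c => by simp only [map_add, gVol_add1])
    (fun t a b c => by simp only [cplx_smul hy, gVol_smul_complex he])
    (fun a b c => gVol_swap12 he _ _ _) (fun a b c => gVol_swap23 _ _ _) v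
  simpa only [cplx_single] using h

lemma cplx_injective_of_gVol_ne_zero (he : e ≠ 0) {y : Fin 3 → V}
    (hy : ∀ k, gProj A e (y k) = y k) (h : gVol A e (y 0) (y 1) (y 2) ≠ 0) :
    Function.Injective (cplx A e y) := by
  rw [injective_iff_map_eq_zero]
  intro c hc
  by_contra hc0
  obtain ⟨k, hk⟩ : ∃ k, c k ≠ 0 := by
    by_contra! h0
    exact hc0 (funext h0)
  -- The identity with the k-th row replaced by c. Its determinant is c k ≠ 0, while the volume form
  -- vanishes on the image of its rows, one of which is mapped to 0.
  let m : Matrix (Fin 3) (Fin 3) ℂ := (1 : Matrix (Fin 3) (Fin 3) ℂ).updateRow k c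
  have hm : m.det ≠ 0 := by
    have : m.det = c k := by
      have h1 := Matrix.cramer_transpose_apply (1 : Matrix (Fin 3) (Fin 3) ℂ) c k
      rw [Matrix.transpose_one, Matrix.cramer_one] at h1
      simpa using h1.symm
    rwa [this]
  have h1 := gVol_cplx he hy (fun i => m i)
  have h2 : (Matrix.of fun i => m i) = m := rfl
  rw [h2] at h1
  have h3 : gVol A e (cplx A e y (m 0)) (cplx A e y (m 1)) (cplx A e y (m 2)) = 0 := by
    have hz (a b : V) : gVol A e 0 a b = 0 := by simpa using gVol_smul1 (A := A) (e := e) 0 0 a b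
    have hmk : cplx A e y (m k) = 0 := by
      simp only [m, Matrix.updateRow_self]; exact hc
    fin_cases k
    · exact (congrArg (fun w => gVol A e w _ _) hmk).trans (hz _ _)
    · rw [gVol_swap12 he]
      exact neg_eq_zero.2 ((congrArg (fun w => gVol A e w _ _) hmk).trans (hz _ _))
    · rw [gVol_swap23, gVol_swap12 he, neg_neg]
      exact (congrArg (fun w => gVol A e w _ _) hmk).trans (hz _ _)
  exact mul_ne_zero h hm (h1.symm.trans h3)

lemma range_cplx (he : e ≠ 0) {y : Fin 3 → V} (hy : ∀ k, gProj A e (y k) = y k)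
    (h : Function.Injective (cplx A e y)) :
    LinearMap.range (cplx A e y) = LinearMap.range (gProj A e) := by
  have hfin : Module.Finite ℝ V := Module.Finite.equiv A.symm
  refine Submodule.eq_of_le_of_finrank_eq ?_ ?_
  · rintro _ ⟨c, rfl⟩
    exact ⟨_, gProj_cplx he hy c⟩
  · rw [LinearMap.finrank_range_of_inj h, finrank_range_gProj he]
    rw [Module.finrank_pi_fintype]
    simp [Complex.finrank_real_complex]

/-- A basis of a Lagrangian subspace is a complex basis. -/
lemma cplx_injective_of_lagrangian (he : e ≠ 0) {y : Fin 3 → V}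
    (hy : ∀ k, gProj A e (y k) = y k) (hli : LinearIndependent ℝ y)
    (hlag : ∀ v ∈ Submodule.span ℝ (range y), ∀ w ∈ Submodule.span ℝ (range y),
      gForm A e v w = 0) :
    Function.Injective (cplx A e y) := by
  rw [injective_iff_map_eq_zero]
  intro c hc
  have hmem (r : Fin 3 → ℝ) : ∑ k, r k • y k ∈ Submodule.span ℝ (range y) :=
    Submodule.sum_mem _ fun k _ => Submodule.smul_mem _ _ (Submodule.subset_span ⟨k, rfl⟩)
  have hpr (r : Fin 3 → ℝ) : gProj A e (∑ k, r k • y k) = ∑ k, r k • y k := by simp [hy]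
  have hvw : ∑ k, (c k).re • y k + gJ A e (∑ k, (c k).im • y k) = 0 := by
    rw [cplx_apply, Finset.sum_add_distrib] at hc
    simpa using hc
  set v := ∑ k, (c k).re • y k with hv
  set w := ∑ k, (c k).im • y k with hw
  have hw0 : w = 0 := by
    by_contra hw0
    have h1 := gForm_gJ_pos (A := A) he (v := w)
      (fun h => hw0 ((gProj_mem_span_iff he (hpr _)).1 h))
    have h2 : gJ A e w = (-1 : ℝ) • v := by
      rw [neg_one_smul]; exact eq_neg_of_add_eq_zero_right hvw
    rw [h2, gForm_smul3, hlag _ (hmem _) _ (hmem _)] at h1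
    simp at h1
  have hv0 : v = 0 := by simpa [hw0] using hvw
  have h3 := Fintype.linearIndependent_iff.1 hli _ (hv.symm.trans hv0)
  have h4 := Fintype.linearIndependent_iff.1 hli _ (hw.symm.trans hw0)
  exact funext fun k => Complex.ext (h3 k) (h4 k)

/-- A complex volume form which is 0 on a complex basis is identically 0, contrary to
`exists_gVol_ne_zero`. -/
lemma gVol_ne_zero (he : e ≠ 0) {y : Fin 3 → V} (hy : ∀ k, gProj A e (y k) = y k)
    (h : Function.Injective (cplx A e y)) : gVol A e (y 0) (y 1) (y 2) ≠ 0 := by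
  intro h0
  obtain ⟨a, b, c, habc⟩ := exists_gVol_ne_zero (A := A) he
  have hex (x : V) : ∃ t, cplx A e y t = gProj A e x := by
    have : gProj A e x ∈ LinearMap.range (cplx A e y) := by
      rw [range_cplx he hy h]; exact ⟨x, rfl⟩
    exact this
  obtain ⟨a', ha⟩ := hex a
  obtain ⟨b', hb⟩ := hex b
  obtain ⟨c', hc⟩ := hex c
  have h1 := gVol_cplx he hy ![a', b', c']
  simp only [Matrix.cons_val_zero, Matrix.cons_val_one, Matrix.cons_val_two, Matrix.tail_cons,
    Matrix.head_cons, ha, hb, hc, h0, zero_mul] at h1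
  apply habc
  rw [← h1, gVol_gProj_gProj_gProj he]

/-- Two complex volume forms are proportional. -/
lemma det_mul_gVol (he : e ≠ 0) {T : V →ₗ[ℝ] C3} (hTJ : ∀ v, T (gJ A e v) = Complex.I • T v)
    {y : Fin 3 → V} (hy : ∀ k, gProj A e (y k) = y k)
    (hvol : gVol A e (y 0) (y 1) (y 2) ≠ 0) (x : Fin 3 → V) :
    (Matrix.of fun k => T (x k)).det * gVol A e (y 0) (y 1) (y 2) =
      (Matrix.of fun k => T (y k)).det * gVol A e (x 0) (x 1) (x 2) := by
  have hTP (v : V) : T (gProj A e v) = T v := by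
    rw [gProj_eq, map_neg, hTJ, hTJ, smul_smul, Complex.I_mul_I, neg_one_smul, neg_neg]
  have hinj := cplx_injective_of_gVol_ne_zero he hy hvol
  have hex (x : V) : ∃ t, cplx A e y t = gProj A e x := by
    have : gProj A e x ∈ LinearMap.range (cplx A e y) := by
      rw [range_cplx he hy hinj]; exact ⟨x, rfl⟩
    exact this
  choose c hc using fun k => hex (x k)
  have h1 := gVol_cplx he hy c
  have h2 : gVol A e (x 0) (x 1) (x 2) = gVol A e (y 0) (y 1) (y 2) * (Matrix.of c).det := by
    rw [← h1, hc, hc, hc, gVol_gProj_gProj_gProj he]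
  have h3 : (Matrix.of fun k => T (x k)) = Matrix.of c * Matrix.of fun k => T (y k) := by
    ext j l
    have h4 : T (x j) = ∑ k, c j k • T (y k) := by
      rw [← hTP, ← hc, cplx_apply, map_sum]
      refine Finset.sum_congr rfl fun k _ => ?_
      rw [map_add, map_smul, map_smul, hTJ]
      conv_rhs => rw [← Complex.re_add_im (c j k)]
      rw [add_smul, mul_smul]
      simp
    rw [Matrix.mul_apply]
    simp [h4]
  rw [h2, h3, Matrix.det_mul]
  ring

end ComplexFrames

/-! ### Subbundles of the tangent bundle along a map -/

section Subbundles

variable {M : Type*} [TopologicalSpace M] [ChartedSpace E7 M] [IsManifold (𝓡 7) ∞ M]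
  {Y : Type*} [TopologicalSpace Y] {f : Y → M} {y₀ : Y}

/-- The subspaces `ℓ y` of the tangent spaces have local bases of continuous vector fields. -/
def SecFramed (f : Y → M) (ℓ : Y → Submodule ℝ E7) (k : ℕ) : Prop :=
  ∀ y₀, ∃ b : Fin k → Y → E7, (∀ j, ContinuousAt (fun y => tb (f y) (b j y)) y₀) ∧
    ∀ᶠ y in 𝓝 y₀, LinearIndependent ℝ (fun j => b j y) ∧
      Submodule.span ℝ (range fun j => b j y) = ℓ y

lemma SecFramed.map {W : Type*} [NormedAddCommGroup W] [NormedSpace ℝ W]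
    {ℓ : Y → Submodule ℝ E7} {k : ℕ} (h : SecFramed f ℓ k) (T : Y → E7 →ₗ[ℝ] W)
    (hT : ∀ (s : Y → E7) y₀, ContinuousAt (fun y => tb (f y) (s y)) y₀ →
      ContinuousAt (fun y => T y (s y)) y₀)
    (hinj : ∀ y, ∀ x ∈ ℓ y, T y x = 0 → x = 0) : LocFramed (fun y => (ℓ y).map (T y)) k := by
  intro y₀
  obtain ⟨b, hb, hb'⟩ := h y₀
  refine ⟨fun j y => T y (b j y), fun j => hT _ _ (hb j), hb'.mono fun y hy => ⟨?_, ?_⟩⟩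
  · refine hy.1.map (f := T y) ?_
    rw [hy.2, Submodule.disjoint_def]
    exact fun x hx hx' => hinj y x hx (LinearMap.mem_ker.1 hx')
  · change _ = (ℓ y).map (T y)
    rw [← hy.2, Submodule.map_span, ← range_comp]; rfl

lemma SecFramed.exists_frame {ℓ : Y → Submodule ℝ E7} {k : ℕ} (h : SecFramed f ℓ k) (y : Y) :
    ∃ b : Fin k → E7, LinearIndependent ℝ b ∧ Submodule.span ℝ (range b) = ℓ y := by
  obtain ⟨b, -, hb⟩ := h y
  exact ⟨_, hb.self_of_nhds⟩

lemma eventually_linearIndependent {k : ℕ} {b : Fin k → Y → E7}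
    (hb : ∀ j, ContinuousAt (fun y => tb (f y) (b j y)) y₀)
    (h0 : LinearIndependent ℝ fun j => b j y₀) :
    ∀ᶠ y in 𝓝 y₀, LinearIndependent ℝ fun j => b j y := by
  have h1 : ContinuousAt (fun y => fun j => trivAt (f y₀) (f y) (b j y)) y₀ :=
    continuousAt_pi.2 fun j => (continuousAt_tb_iff.1 (hb j)).2
  have h2 : LinearIndependent ℝ fun j => trivAt (f y₀) (f y₀) (b j y₀) :=
    h0.map' (trivEquiv (f y₀) (f y₀) (mem_chart_source _ _)).toLinearMap (LinearEquiv.ker _)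
  filter_upwards [h1.eventually_mem (isOpen_setOfPred_linearIndependent.mem_nhds h2)] with y hy
  exact LinearIndependent.of_comp (trivAt (f y₀) (f y)).toLinearMap hy

end Subbundles

/-! ### The Lagrangian spaces of a submanifold, inside the complement of the velocity. -/

section Horizontal

variable {M : Type*} [TopologicalSpace M] [ChartedSpace E7 M] [IsManifold (𝓡 7) ∞ M]
  {N : Type*} [TopologicalSpace N] [ChartedSpace (EuclideanSpace ℝ (Fin 4)) N]
  [IsManifold (𝓡 4) ∞ N] {lam : ThreeForm M} {i : N → M}
  {Y : Type*} [TopologicalSpace Y] {f : Y → M} {e : Y → E7} {y₀ : Y}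

/-- The orthogonal complement of `e` in the tangent space of the submanifold. -/
def horL (hlam : IsG2Form lam) (i : N → M) (x : M) (e : E7) : Submodule ℝ E7 :=
  (tanE i x).map (gProj (hlam.coordAt x) e)

lemma gProj_of_mem_horL (hlam : IsG2Form lam) {x : M} {e v : E7} (he : e ≠ 0)
    (hv : v ∈ horL hlam i x e) : gProj (hlam.coordAt x) e v = v := by
  obtain ⟨w, -, rfl⟩ := hv
  exact gProj_gProj he w

lemma gProj_mem_tanE (hlam : IsG2Form lam) {x : M} {e v : E7} (he : e ≠ 0) (hmem : e ∈ tanE i x)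
    (hv : v ∈ tanE i x) : gProj (hlam.coordAt x) e v ∈ tanE i x := by
  rw [gProj_apply he]
  exact Submodule.sub_mem _ hv (Submodule.smul_mem _ _ hmem)

lemma horL_le (hlam : IsG2Form lam) {x : M} {e : E7} (he : e ≠ 0) (hmem : e ∈ tanE i x) :
    horL hlam i x e ≤ tanE i x := by
  rintro _ ⟨w, hw, rfl⟩
  exact gProj_mem_tanE hlam he hmem hw

lemma gForm_horL (hlam : IsG2Form lam) (hi : IsIsotropicEmbedding lam i) {x : M} {e : E7}
    (hx : x ∈ range i) (he : e ≠ 0) (hmem : e ∈ tanE i x) {v w : E7} (hv : v ∈ horL hlam i x e)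
    (hw : w ∈ horL hlam i x e) : gForm (hlam.coordAt x) e v w = 0 :=
  hi.gForm_eq_zero hlam hx hmem (horL_le hlam he hmem hv) (horL_le hlam he hmem hw)

lemma gVol_re_horL (hlam : IsG2Form lam) (hi : IsIsotropicEmbedding lam i) {x : M} {e : E7}
    (hx : x ∈ range i) (he : e ≠ 0) (hmem : e ∈ tanE i x) {u v w : E7}
    (hu : u ∈ horL hlam i x e) (hv : v ∈ horL hlam i x e) (hw : w ∈ horL hlam i x e) :
    (gVol (hlam.coordAt x) e u v w).re = 0 :=
  gVol_re_eq_zero he hmem (fun _ hx' _ hy _ hz => hi.gForm_eq_zero hlam hx hx' hy hz)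
    (horL_le hlam he hmem hu) (horL_le hlam he hmem hv) (horL_le hlam he hmem hw)

lemma continuousAt_gProj (hlam : IsG2Form lam) {v : Y → E7}
    (he : ContinuousAt (fun y => tb (f y) (e y)) y₀) (he0 : e y₀ ≠ 0)
    (hv : ContinuousAt (fun y => tb (f y) (v y)) y₀) :
    ContinuousAt (fun y => tb (f y) (gProj (hlam.coordAt (f y)) (e y) (v y))) y₀ := by
  have h1 := continuousAt_J hlam he he0 (continuousAt_J hlam he he0 hv)
  have h2 := continuousAt_tb_smul (continuousAt_const (y := (-1 : ℝ))) h1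
  refine h2.congr (Filter.Eventually.of_forall fun y => ?_)
  change tb (f y) ((-1 : ℝ) • gJ _ (e y) (gJ _ (e y) (v y))) = tb (f y) _
  rw [neg_one_smul, gProj_eq]

lemma finrank_horL (hlam : IsG2Form lam) (hi : IsIsotropicEmbedding lam i) {x : M} {e : E7}
    (hx : x ∈ range i) (he : e ≠ 0) (hmem : e ∈ tanE i x) :
    Module.finrank ℝ (horL hlam i x e) = 3 := by
  have h4 : Module.finrank ℝ (tanE i x) = 4 := by
    obtain ⟨b, -, hb⟩ := exists_local_frame_tanE hi (f := fun _ : Unit => x) continuous_const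
      (fun _ => hx) ()
    obtain ⟨h1, h2⟩ := hb.self_of_nhds
    rw [← h2, finrank_span_eq_card h1, Fintype.card_fin]
  let T : tanE i x →ₗ[ℝ] E7 := (gProj (hlam.coordAt x) e).domRestrict (tanE i x)
  have h := LinearMap.finrank_range_add_finrank_ker T
  have hr : LinearMap.range T = horL hlam i x e := by
    rw [horL, LinearMap.range_domRestrict]
  have hk : LinearMap.ker T = Submodule.span ℝ {(⟨e, hmem⟩ : tanE i x)} := by
    ext v
    rw [LinearMap.mem_ker, LinearMap.domRestrict_apply, ← LinearMap.mem_ker, ker_gProj he,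
      Submodule.mem_span_singleton, Submodule.mem_span_singleton]
    simp [Subtype.ext_iff]
  rw [hr, hk, finrank_span_singleton (by simpa [Subtype.ext_iff] using he), h4] at h
  omega

/-- The projections of a local frame of the tangent spaces are four spanning sections. Three
combinations with constant coefficients which form a basis at y₀ stay independent nearby, and span
for reasons of dimension. -/
lemma secFramed_horL (hlam : IsG2Form lam) (hi : IsIsotropicEmbedding lam i)
    (he : Continuous (fun y => tb (f y) (e y))) (he0 : ∀ y, e y ≠ 0) (h : ∀ y, f y ∈ range i)
    (hmem : ∀ y, e y ∈ tanE i (f y)) :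
    SecFramed f (fun y => horL hlam i (f y) (e y)) 3 := by
  intro y₀
  have hf : Continuous f := (FiberBundle.continuous_proj E7 (TangentSpace (𝓡 7) : M → Type)).comp he
  obtain ⟨b, hb, hb'⟩ := exists_local_frame_tanE hi hf h y₀
  let P : Y → E7 →ₗ[ℝ] E7 := fun y => gProj (hlam.coordAt (f y)) (e y)
  have hrank := finrank_horL hlam hi (h y₀) (he0 y₀) (hmem y₀)
  let β := Module.finBasisOfFinrankEq ℝ (horL hlam i (f y₀) (e y₀)) hrank
  have hm (j : Fin 3) : ∃ m : Fin 4 → ℝ, P y₀ (∑ k, m k • b k y₀) = β j := by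
    obtain ⟨v, hv, hv'⟩ := (β j).2
    rw [SetLike.mem_coe, ← hb'.self_of_nhds.2, Submodule.mem_span_range_iff_exists_fun] at hv
    obtain ⟨m, hm⟩ := hv
    exact ⟨m, by rw [hm]; exact hv'⟩
  choose m hm using hm
  let c : Fin 3 → Y → E7 := fun j y => P y (∑ k, m j k • b k y)
  have hc (j) : ContinuousAt (fun y => tb (f y) (c j y)) y₀ :=
    continuousAt_gProj hlam he.continuousAt (he0 y₀) (continuousAt_tb_sum _ hf.continuousAt
      fun k _ => continuousAt_tb_smul continuousAt_const (hb k))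
  have hli : LinearIndependent ℝ fun j => c j y₀ := by
    have h1 : (fun j => c j y₀) = (Submodule.subtype _) ∘ β := funext hm
    rw [h1]
    exact β.linearIndependent.map' _ (Submodule.ker_subtype _)
  refine ⟨c, hc, ?_⟩
  filter_upwards [eventually_linearIndependent hc hli, hb'] with y hy hby
  refine ⟨hy, Submodule.eq_of_le_of_finrank_eq ?_ ?_⟩
  · rw [Submodule.span_le]
    rintro _ ⟨j, rfl⟩
    refine ⟨_, ?_, rfl⟩
    rw [← hby.2]
    exact Submodule.sum_mem _ fun k _ => Submodule.smul_mem _ _ (Submodule.subset_span ⟨k, rfl⟩)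
  · rw [finrank_span_eq_card hy, finrank_horL hlam hi (h y) (he0 y) (hmem y), Fintype.card_fin]

end Horizontal

/-! ### Orthogonalization of complex frames -/

section Hermitian

variable {V : Type*} [AddCommGroup V] [Module ℝ V] {A : V ≃ₗ[ℝ] (Fin 7 → ℝ)} {e : V}

variable (A e) in
/-- The Hermitian form whose imaginary part is the symplectic form. -/
def hForm (v : V) : V →ₗ[ℝ] ℂ where
  toFun w := ⟨gForm A e v (gJ A e w), gForm A e v w⟩
  map_add' w w' := by apply Complex.ext <;> simp [gForm_add3]
  map_smul' c w := by apply Complex.ext <;> simp [gForm_smul3]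

lemma hForm_re (v w : V) : (hForm A e v w).re = gForm A e v (gJ A e w) := rfl

lemma hForm_im (v w : V) : (hForm A e v w).im = gForm A e v w := rfl

lemma hForm_gJ (he : e ≠ 0) (v w : V) : hForm A e v (gJ A e w) = Complex.I * hForm A e v w := by
  apply Complex.ext
  · rw [hForm_re, gForm_gJ_comm he, gForm_gJ_gJ he, gForm_swap23]
    simp [hForm_im]
  · simp [hForm_re, hForm_im]

lemma hForm_conj (he : e ≠ 0) (v w : V) :
    hForm A e w v = starRingEnd ℂ (hForm A e v w) := by
  apply Complex.ext
  · rw [Complex.conj_re, hForm_re, hForm_re, gForm_gJ_comm he]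
  · rw [Complex.conj_im, hForm_im, hForm_im, gForm_swap23]

lemma hForm_gProj (he : e ≠ 0) (v w : V) : hForm A e v (gProj A e w) = hForm A e v w := by
  rw [gProj_eq, map_neg, hForm_gJ he, hForm_gJ he, ← mul_assoc, Complex.I_mul_I]
  ring

lemma hForm_self (v : V) : hForm A e v v = ((hForm A e v v).re : ℂ) := by
  apply Complex.ext
  · simp
  · rw [hForm_im, Complex.ofReal_im]
    exact self_eq_neg.1 (gForm_swap23 e v v)

lemma hForm_self_pos (he : e ≠ 0) {v : V} (hv : gProj A e v = v) (h0 : v ≠ 0) :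
    0 < (hForm A e v v).re :=
  gForm_gJ_pos he fun h => h0 ((gProj_mem_span_iff he hv).1 h)

variable (A e) in
/-- Multiplication by a complex number. -/
def csmul (t : ℂ) (v : V) : V := t.re • v + t.im • gJ A e v

lemma hForm_csmul (he : e ≠ 0) (v : V) (t : ℂ) (w : V) :
    hForm A e v (csmul A e t w) = t * hForm A e v w := by
  rw [csmul, map_add, map_smul, map_smul, hForm_gJ he]
  conv_rhs => rw [← Complex.re_add_im t]
  simp only [Complex.real_smul]
  ring

lemma hForm_cplx (he : e ≠ 0) (v : V) (y : Fin 3 → V) (c : C3) :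
    hForm A e v (cplx A e y c) = ∑ k, c k * hForm A e v (y k) := by
  rw [cplx_apply, map_sum]
  exact Finset.sum_congr rfl fun k _ => hForm_csmul he v (c k) (y k)

variable (A e) in
/-- The orthogonalization of the second vector. -/
def gs₁ (y : Fin 3 → V) : V :=
  y 1 - csmul A e (hForm A e (y 0) (y 1) / hForm A e (y 0) (y 0)) (y 0)

variable (A e) in
/-- The orthogonalization of the third vector. -/
def gs₂ (y : Fin 3 → V) : V :=
  y 2 - csmul A e (hForm A e (y 0) (y 2) / hForm A e (y 0) (y 0)) (y 0) -
    csmul A e (hForm A e (gs₁ A e y) (y 2) / hForm A e (gs₁ A e y) (gs₁ A e y)) (gs₁ A e y)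

variable (A e) in
/-- The orthogonalization of a frame. -/
def gs (y : Fin 3 → V) : Fin 3 → V := ![y 0, gs₁ A e y, gs₂ A e y]

/-- Gram–Schmidt is unipotent: the coefficient of the k-th vector in its orthogonalization is 1.
Hence the new vectors are nonzero and stay in the complement of e. -/
lemma gs_eq_cplx {y : Fin 3 → V} (hy : ∀ k, gProj A e (y k) = y k) (k : Fin 3) :
    ∃ c : C3, c k = 1 ∧ gs A e y k = cplx A e y c := by
  have h0 : y 0 = cplx A e y (Pi.single 0 1) := (cplx_single y 0).symm
  have h1 (c : C3) (t : ℂ) : csmul A e t (cplx A e y c) = cplx A e y (t • c) :=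
    (cplx_smul hy t c).symm
  obtain ⟨c₁, hc₁, hc₁', h2⟩ : ∃ c : C3, c 1 = 1 ∧ c 2 = 0 ∧ gs₁ A e y = cplx A e y c := by
    refine ⟨Pi.single 1 1 - (hForm A e (y 0) (y 1) / hForm A e (y 0) (y 0)) • Pi.single 0 1,
      by simp, by simp, ?_⟩
    rw [map_sub, cplx_single, ← h1, cplx_single]
    rfl
  fin_cases k
  · exact ⟨Pi.single 0 1, by simp, h0⟩
  · exact ⟨c₁, hc₁, h2⟩
  · refine ⟨Pi.single 2 1 - (hForm A e (y 0) (y 2) / hForm A e (y 0) (y 0)) • Pi.single 0 1 -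
      (hForm A e (gs₁ A e y) (y 2) / hForm A e (gs₁ A e y) (gs₁ A e y)) • c₁,
      by simp [hc₁'], ?_⟩
    rw [map_sub, map_sub, cplx_single, ← h1, cplx_single, ← h1, ← h2]
    rfl

lemma gProj_gs (he : e ≠ 0) {y : Fin 3 → V} (hy : ∀ k, gProj A e (y k) = y k) (k : Fin 3) :
    gProj A e (gs A e y k) = gs A e y k := by
  obtain ⟨c, -, hc⟩ := gs_eq_cplx hy k
  rw [hc, gProj_cplx he hy]

lemma gs_ne_zero {y : Fin 3 → V} (hy : ∀ k, gProj A e (y k) = y k)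
    (h : Function.Injective (cplx A e y)) (k : Fin 3) : gs A e y k ≠ 0 := by
  obtain ⟨c, hc1, hc⟩ := gs_eq_cplx hy k
  intro h0
  rw [hc] at h0
  have := h (h0.trans (map_zero _).symm)
  rw [this] at hc1
  exact zero_ne_one hc1

lemma hForm_gs_ne_zero (he : e ≠ 0) {y : Fin 3 → V} (hy : ∀ k, gProj A e (y k) = y k)
    (h : Function.Injective (cplx A e y)) (k : Fin 3) :
    0 < (hForm A e (gs A e y k) (gs A e y k)).re :=
  hForm_self_pos he (gProj_gs he hy k) (gs_ne_zero hy h k)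

lemma hForm_gs_of_ne (he : e ≠ 0) {y : Fin 3 → V} (hy : ∀ k, gProj A e (y k) = y k)
    (h : Function.Injective (cplx A e y)) {j k : Fin 3} (hjk : j ≠ k) :
    hForm A e (gs A e y j) (gs A e y k) = 0 := by
  have hne (k : Fin 3) : hForm A e (gs A e y k) (gs A e y k) ≠ 0 := fun h0 => by
    have := hForm_gs_ne_zero he hy h k
    rw [h0] at this
    simp at this
  have hne0 : hForm A e (y 0) (y 0) ≠ 0 := hne 0
  have hne1 : hForm A e (gs₁ A e y) (gs₁ A e y) ≠ 0 := hne 1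
  have h01 : hForm A e (y 0) (gs₁ A e y) = 0 := by
    conv_lhs => rw [gs₁]
    rw [map_sub, hForm_csmul he, div_mul_cancel₀ _ hne0, sub_self]
  have h10 : hForm A e (gs₁ A e y) (y 0) = 0 := by rw [hForm_conj he, h01, map_zero]
  have h02 : hForm A e (y 0) (gs₂ A e y) = 0 := by
    rw [gs₂, map_sub, map_sub, hForm_csmul he, hForm_csmul he, div_mul_cancel₀ _ hne0, h01]
    ring
  have h12 : hForm A e (gs₁ A e y) (gs₂ A e y) = 0 := by
    rw [gs₂, map_sub, map_sub, hForm_csmul he, hForm_csmul he, div_mul_cancel₀ _ hne1, h10]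
    ring
  fin_cases j <;> fin_cases k
  · exact absurd rfl hjk
  · exact h01
  · exact h02
  · exact h10
  · exact absurd rfl hjk
  · exact h12
  · exact (hForm_conj he _ _).trans ((congrArg (starRingEnd ℂ) h02).trans (map_zero _))
  · exact (hForm_conj he _ _).trans ((congrArg (starRingEnd ℂ) h12).trans (map_zero _))
  · exact absurd rfl hjk

variable (A e) in
/-- The coordinates with respect to the orthonormal frame obtained from `y`. -/
def unitaryCoord (y : Fin 3 → V) : V →ₗ[ℝ] C3 :=
  LinearMap.pi fun k => (√(hForm A e (gs A e y k) (gs A e y k)).re)⁻¹ • hForm A e (gs A e y k)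

lemma unitaryCoord_apply (y : Fin 3 → V) (v : V) (k : Fin 3) :
    unitaryCoord A e y v k =
      (√(hForm A e (gs A e y k) (gs A e y k)).re)⁻¹ • hForm A e (gs A e y k) v := rfl

/-- Parseval's identity in the orthogonal complex basis `gs`. Its imaginary part says that the
coordinates are symplectic. -/
lemma sum_conj_unitaryCoord (he : e ≠ 0) {y : Fin 3 → V} (hy : ∀ k, gProj A e (y k) = y k)
    (h : Function.Injective (cplx A e y)) (v w : V) :
    ∑ k, starRingEnd ℂ (unitaryCoord A e y v k) * unitaryCoord A e y w k = hForm A e v w := by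
  set u := gs A e y with hu
  have hinj : Function.Injective (cplx A e u) := by
    rw [injective_iff_map_eq_zero]
    intro c hc
    ext k
    have h1 := hForm_cplx (A := A) he (u k) u c
    rw [hc, map_zero, Finset.sum_eq_single k] at h1
    · have h2 := hForm_gs_ne_zero he hy h k
      rw [hForm_self, eq_comm, mul_eq_zero, Complex.ofReal_eq_zero] at h1
      exact h1.resolve_right h2.ne'
    · intro j _ hj
      rw [hForm_gs_of_ne he hy h hj.symm, mul_zero]
    · simp
  have hex (x : V) : ∃ t, cplx A e u t = gProj A e x := by
    have : gProj A e x ∈ LinearMap.range (cplx A e u) := by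
      rw [range_cplx he (gProj_gs he hy) hinj]; exact ⟨x, rfl⟩
    exact this
  obtain ⟨c, hc⟩ := hex v
  obtain ⟨d, hd⟩ := hex w
  have hcoord (x : V) (t : C3) (ht : cplx A e u t = gProj A e x) (k : Fin 3) :
      hForm A e (u k) x = t k * (hForm A e (u k) (u k)).re := by
    rw [← hForm_gProj he, ← ht, hForm_cplx he, Finset.sum_eq_single k, ← hForm_self]
    · intro j _ hj
      rw [hForm_gs_of_ne he hy h hj.symm, mul_zero]
    · simp
  rw [← hForm_gProj he v w, ← hd, hForm_cplx he]
  refine Finset.sum_congr rfl fun k _ => ?_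
  rw [unitaryCoord_apply, unitaryCoord_apply, ← hu, hForm_conj he (u k) v, hcoord v c hc k,
    hcoord w d hd k]
  have h2 := hForm_gs_ne_zero he hy h k
  rw [← hu] at h2
  have h3 : ((√(hForm A e (u k) (u k)).re : ℝ) : ℂ) * (√(hForm A e (u k) (u k)).re : ℝ) =
      ((hForm A e (u k) (u k)).re : ℂ) := by
    rw [← Complex.ofReal_mul, Real.mul_self_sqrt h2.le]
  have h4 : ((√(hForm A e (u k) (u k)).re : ℝ) : ℂ) ≠ 0 := by
    rw [Complex.ofReal_ne_zero]; exact (Real.sqrt_pos.2 h2).ne'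
  simp only [Complex.real_smul, map_mul, Complex.conj_ofReal]
  rw [Complex.ofReal_inv]
  rw [← h3]
  field_simp

lemma stdSymp_unitaryCoord (he : e ≠ 0) {y : Fin 3 → V} (hy : ∀ k, gProj A e (y k) = y k)
    (h : Function.Injective (cplx A e y)) (v w : V) :
    stdSymp (unitaryCoord A e y v) (unitaryCoord A e y w) = gForm A e v w := by
  rw [stdSymp, sum_conj_unitaryCoord he hy h, hForm_im]

end Hermitian

/-! ### Continuity of the Hermitian structure and of the unitary coordinates. -/

section HermitianContinuity

variable {M : Type*} [TopologicalSpace M] [ChartedSpace E7 M] [IsManifold (𝓡 7) ∞ M]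
  {lam : ThreeForm M} {Y : Type*} [TopologicalSpace Y] {f : Y → M} {e : Y → E7} {y₀ : Y}

lemma continuousAt_hForm (hlam : IsG2Form lam) {v w : Y → E7}
    (he : ContinuousAt (fun y => tb (f y) (e y)) y₀) (he0 : e y₀ ≠ 0)
    (hv : ContinuousAt (fun y => tb (f y) (v y)) y₀)
    (hw : ContinuousAt (fun y => tb (f y) (w y)) y₀) :
    ContinuousAt (fun y => hForm (hlam.coordAt (f y)) (e y) (v y) (w y)) y₀ := by
  have h1 := continuousAt_lam hlam he hv (continuousAt_J hlam he he0 hw)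
  have h2 := continuousAt_lam hlam he hv hw
  simp only [hlam.lam_eq] at h1 h2
  have h3 : ContinuousAt (fun y => ((gForm (hlam.coordAt (f y)) (e y) (v y)
      (gJ (hlam.coordAt (f y)) (e y) (w y)) : ℝ) : ℂ) +
      ((gForm (hlam.coordAt (f y)) (e y) (v y) (w y) : ℝ) : ℂ) * Complex.I) y₀ := by
    have h1' : ContinuousAt (fun y => ((gForm (hlam.coordAt (f y)) (e y) (v y)
      (gJ (hlam.coordAt (f y)) (e y) (w y)) : ℝ) : ℂ)) y₀ :=
      Complex.continuous_ofReal.continuousAt.tendsto.comp h1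
    have h2' : ContinuousAt (fun y => ((gForm (hlam.coordAt (f y)) (e y) (v y) (w y) : ℝ) : ℂ)) y₀ :=
      Complex.continuous_ofReal.continuousAt.tendsto.comp h2
    exact h1'.add (h2'.mul continuousAt_const)
  refine h3.congr (Filter.Eventually.of_forall fun y => ?_)
  exact (Complex.mk_eq_add_mul_I _ _).symm

lemma continuousAt_csmul (hlam : IsG2Form lam) {t : Y → ℂ} {v : Y → E7}
    (he : ContinuousAt (fun y => tb (f y) (e y)) y₀) (he0 : e y₀ ≠ 0)
    (ht : ContinuousAt t y₀) (hv : ContinuousAt (fun y => tb (f y) (v y)) y₀) :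
    ContinuousAt (fun y => tb (f y) (csmul (hlam.coordAt (f y)) (e y) (t y) (v y))) y₀ :=
  continuousAt_tb_add
    (continuousAt_tb_smul (Complex.continuous_re.continuousAt.tendsto.comp ht) hv)
    (continuousAt_tb_smul (Complex.continuous_im.continuousAt.tendsto.comp ht)
      (continuousAt_J hlam he he0 hv))

lemma continuousAt_tb_sub {s t : Y → E7} (hs : ContinuousAt (fun y => tb (f y) (s y)) y₀)
    (ht : ContinuousAt (fun y => tb (f y) (t y)) y₀) :
    ContinuousAt (fun y => tb (f y) (s y - t y)) y₀ := by
  have h := continuousAt_tb_add hs (continuousAt_tb_smul (continuousAt_const (y := (-1 : ℝ))) ht)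
  refine h.congr (Filter.Eventually.of_forall fun y => ?_)
  change tb (f y) (s y + (-1 : ℝ) • t y) = tb (f y) (s y - t y)
  rw [neg_one_smul, sub_eq_add_neg]

lemma continuousAt_gVol (hlam : IsG2Form lam) {u v w : Y → E7}
    (he : ContinuousAt (fun y => tb (f y) (e y)) y₀) (he0 : e y₀ ≠ 0)
    (hu : ContinuousAt (fun y => tb (f y) (u y)) y₀)
    (hv : ContinuousAt (fun y => tb (f y) (v y)) y₀)
    (hw : ContinuousAt (fun y => tb (f y) (w y)) y₀) :
    ContinuousAt (fun y => gVol (hlam.coordAt (f y)) (e y) (u y) (v y) (w y)) y₀ := by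
  have hP {v : Y → E7} (hv : ContinuousAt (fun y => tb (f y) (v y)) y₀) :=
    continuousAt_gProj hlam he he0 hv
  have h1 := continuousAt_lam hlam (hP hu) (hP hv) (hP hw)
  have h2 := continuousAt_lam hlam (continuousAt_J hlam he he0 hu) (hP hv) (hP hw)
  simp only [hlam.lam_eq] at h1 h2
  have h3 := (Complex.continuous_ofReal.continuousAt.tendsto.comp h1).add
    ((Complex.continuous_ofReal.continuousAt.tendsto.comp h2.neg).mul
      (tendsto_const_nhds (x := Complex.I)))
  refine ContinuousAt.congr h3 (Filter.Eventually.of_forall fun y => ?_)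
  exact (Complex.mk_eq_add_mul_I _ _).symm

lemma continuousAt_unitaryCoord (hlam : IsG2Form lam)
    (he : ContinuousAt (fun y => tb (f y) (e y)) y₀) (he0 : e y₀ ≠ 0) {b : Fin 3 → Y → E7}
    (hb : ∀ k, ContinuousAt (fun y => tb (f y) (b k y)) y₀)
    (hb' : ∀ k, gProj (hlam.coordAt (f y₀)) (e y₀) (b k y₀) = b k y₀)
    (hinj : Function.Injective (cplx (hlam.coordAt (f y₀)) (e y₀) fun k => b k y₀)) {v : Y → E7}
    (hv : ContinuousAt (fun y => tb (f y) (v y)) y₀) :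
    ContinuousAt (fun y => unitaryCoord (hlam.coordAt (f y)) (e y) (fun k => b k y) (v y)) y₀ := by
  have hne (k : Fin 3) := hForm_gs_ne_zero he0 hb' hinj k
  have hne' (k : Fin 3) : hForm (hlam.coordAt (f y₀)) (e y₀)
      (gs (hlam.coordAt (f y₀)) (e y₀) (fun k => b k y₀) k)
      (gs (hlam.coordAt (f y₀)) (e y₀) (fun k => b k y₀) k) ≠ 0 := fun h0 => by
    have := hne k
    rw [h0] at this
    simp at this
  have h1 : ContinuousAt (fun y => tb (f y)
      (gs₁ (hlam.coordAt (f y)) (e y) fun k => b k y)) y₀ :=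
    continuousAt_tb_sub (hb 1) (continuousAt_csmul hlam he he0
      ((continuousAt_hForm hlam he he0 (hb 0) (hb 1)).div
        (continuousAt_hForm hlam he he0 (hb 0) (hb 0)) (hne' 0)) (hb 0))
  have h2 : ContinuousAt (fun y => tb (f y)
      (gs₂ (hlam.coordAt (f y)) (e y) fun k => b k y)) y₀ :=
    continuousAt_tb_sub (continuousAt_tb_sub (hb 2) (continuousAt_csmul hlam he he0
      ((continuousAt_hForm hlam he he0 (hb 0) (hb 2)).div
        (continuousAt_hForm hlam he he0 (hb 0) (hb 0)) (hne' 0)) (hb 0)))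
      (continuousAt_csmul hlam he he0 ((continuousAt_hForm hlam he he0 h1 (hb 2)).div
        (continuousAt_hForm hlam he he0 h1 h1) (hne' 1)) h1)
  have h3 (k : Fin 3) : ContinuousAt (fun y => tb (f y)
      (gs (hlam.coordAt (f y)) (e y) (fun k => b k y) k)) y₀ := by
    fin_cases k
    · exact hb 0
    · exact h1
    · exact h2
  refine continuousAt_pi.2 fun k => ?_
  have h4 := continuousAt_hForm hlam he he0 (h3 k) (h3 k)
  have h5 : ContinuousAt (fun y => (√(hForm (hlam.coordAt (f y)) (e y)
      (gs (hlam.coordAt (f y)) (e y) (fun k => b k y) k)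
      (gs (hlam.coordAt (f y)) (e y) (fun k => b k y) k)).re)⁻¹) y₀ :=
    (Real.continuous_sqrt.continuousAt.tendsto.comp
      (Complex.continuous_re.continuousAt.tendsto.comp h4)).inv₀ (Real.sqrt_pos.2 (hne k)).ne'
  exact h5.smul (continuousAt_hForm hlam he he0 (h3 k) hv)

end HermitianContinuity

/-! ### Frames along a connecting square -/

section Square

variable {M : Type*} [TopologicalSpace M] [ChartedSpace E7 M] [IsManifold (𝓡 7) ∞ M]
  {N₁ N₂ : Type*} [TopologicalSpace N₁] [ChartedSpace (EuclideanSpace ℝ (Fin 4)) N₁]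
  [IsManifold (𝓡 4) ∞ N₁] [TopologicalSpace N₂] [ChartedSpace (EuclideanSpace ℝ (Fin 4)) N₂]
  [IsManifold (𝓡 4) ∞ N₂]
  {lam : ThreeForm M} {i₁ : N₁ → M} {i₂ : N₂ → M} {γ₁ γ₂ : S1 → M}
  (u : ConnectingSquare i₁ i₂ γ₁ γ₂)

/-- The velocity of a connecting square, as a vector of the model space. -/
def ConnectingSquare.velE (p : I × I × S1) : E7 := u.vel p

lemma ConnectingSquare.velE_ne_zero (p : I × I × S1) : u.velE p ≠ 0 :=
  (u.knot p.1 p.2.1).immersed p.2.2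

lemma ConnectingSquare.continuous_tb : Continuous fun p => tb (u.map p) (u.velE p) := u.continuous

lemma ConnectingSquare.continuous_map : Continuous u.map :=
  (FiberBundle.continuous_proj E7 (TangentSpace (𝓡 7) : M → Type)).comp u.continuous_tb

variable {u}

lemma ConnectingSquare.map_eq {p q : I × I × S1} (hp : p.1 = 0 ∨ p.1 = 1) (h1 : q.1 = p.1)
    (h2 : q.2.2 = p.2.2) : u.map p = u.map q := by
  obtain ⟨a, b, z⟩ := p
  obtain ⟨a', b', z'⟩ := q
  obtain rfl : a' = a := h1
  obtain rfl : z' = z := h2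
  rcases hp with h | h
  · obtain rfl : a' = 0 := h
    rw [u.const_zero b, u.const_zero b']
  · obtain rfl : a' = 1 := h
    rw [u.const_one b, u.const_one b']

lemma ConnectingSquare.velE_eq {p q : I × I × S1} (hp : p.1 = 0 ∨ p.1 = 1) (h1 : q.1 = p.1)
    (h2 : q.2.2 = p.2.2) : u.velE p = u.velE q := by
  have h3 : (fun z => u.map (p.1, p.2.1, z)) = fun z => u.map (q.1, q.2.1, z) :=
    funext fun z => u.map_eq (p := (p.1, p.2.1, z)) (q := (q.1, q.2.1, z)) hp h1 rfl
  change (velocity (fun z => u.map (p.1, p.2.1, z)) p.2.2 : E7) =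
    (velocity (fun z => u.map (q.1, q.2.1, z)) q.2.2 : E7)
  rw [h2, h3]

lemma ConnectingSquare.velE_mem₁ (hi₁ : IsIsotropicEmbedding lam i₁) (a : I) (z : S1) :
    u.velE (a, 0, z) ∈ tanE i₁ (u.map (a, 0, z)) :=
  velocity_mem_tanE hi₁ (u.knot a 0).smooth (fun z => u.side₁ a z) z

lemma ConnectingSquare.velE_mem₂ (hi₂ : IsIsotropicEmbedding lam i₂) (a : I) (z : S1) :
    u.velE (a, 1, z) ∈ tanE i₂ (u.map (a, 1, z)) :=
  velocity_mem_tanE hi₂ (u.knot a 1).smooth (fun z => u.side₂ a z) z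

variable (u)

/-- The first Lagrangian subspace, as a subspace of the tangent space. -/
def ConnectingSquare.L₁ (hlam : IsG2Form lam) (p : I × I × S1) : Submodule ℝ E7 :=
  horL hlam i₁ (u.map p) (u.velE p)

/-- The second Lagrangian subspace, as a subspace of the tangent space. -/
def ConnectingSquare.L₂ (hlam : IsG2Form lam) (p : I × I × S1) : Submodule ℝ E7 :=
  horL hlam i₂ (u.map p) (u.velE p)

/-- The complex structure along the square. -/
def ConnectingSquare.J (hlam : IsG2Form lam) (p : I × I × S1) : E7 →ₗ[ℝ] E7 :=
  gJ (hlam.coordAt (u.map p)) (u.velE p)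

/-- The orthogonal projection along the square. -/
def ConnectingSquare.pr (hlam : IsG2Form lam) (p : I × I × S1) : E7 →ₗ[ℝ] E7 :=
  gProj (hlam.coordAt (u.map p)) (u.velE p)

variable {u}

lemma ConnectingSquare.secFramed₁ (hlam : IsG2Form lam) (hi₁ : IsIsotropicEmbedding lam i₁) :
    SecFramed (fun q : I × S1 => u.map (q.1, 0, q.2)) (fun q => u.L₁ hlam (q.1, 0, q.2)) 3 :=
  secFramed_horL hlam hi₁
    (u.continuous_tb.comp (by fun_prop : Continuous fun q : I × S1 => (q.1, (0 : I), q.2)))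
    (fun _ => u.velE_ne_zero _) (fun q => u.side₁ q.1 q.2) fun q => u.velE_mem₁ hi₁ q.1 q.2

lemma ConnectingSquare.secFramed₂ (hlam : IsG2Form lam) (hi₂ : IsIsotropicEmbedding lam i₂) :
    SecFramed (fun q : I × S1 => u.map (q.1, 1, q.2)) (fun q => u.L₂ hlam (q.1, 1, q.2)) 3 :=
  secFramed_horL hlam hi₂
    (u.continuous_tb.comp (by fun_prop : Continuous fun q : I × S1 => (q.1, (1 : I), q.2)))
    (fun _ => u.velE_ne_zero _) (fun q => u.side₂ q.1 q.2) fun q => u.velE_mem₂ hi₂ q.1 q.2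

lemma gVol_frameMul {V : Type*} [AddCommGroup V] [Module ℝ V] {A : V ≃ₗ[ℝ] (Fin 7 → ℝ)} {e : V}
    (he : e ≠ 0) (y : Fin 3 → V) (g : Matrix (Fin 3) (Fin 3) ℝ) :
    gVol A e (frameMul y g 0) (frameMul y g 1) (frameMul y g 2) =
      (g.det : ℂ) * gVol A e (y 0) (y 1) (y 2) := by
  have h1 (j : Fin 3) : gProj A e (frameMul y g j) =
      cplx A e (fun k => gProj A e (y k)) (fun i => (g i j : ℂ)) := by
    simp [frameMul, cplx_apply]
  have h2 := gVol_cplx (A := A) he (fun k => gProj_gProj he (y k)) (fun j i => (g i j : ℂ))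
  rw [← gVol_gProj_gProj_gProj he, h1, h1, h1, h2, gVol_gProj_gProj_gProj he, mul_comm]
  congr 1
  have h3 : (Matrix.of fun j i => (g i j : ℂ)) = (g.map (algebraMap ℝ ℂ)).transpose := by
    ext i j; simp
  rw [h3, Matrix.det_transpose, ← RingHom.mapMatrix_apply, ← RingHom.map_det]
  rfl

lemma gVol_ne_zero_of_horL (hlam : IsG2Form lam) (hi₁ : IsIsotropicEmbedding lam i₁) {x : M}
    {e : E7} (hx : x ∈ range i₁) (he : e ≠ 0) (hmem : e ∈ tanE i₁ x) {b : Fin 3 → E7}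
    (hb : LinearIndependent ℝ b) (hspan : Submodule.span ℝ (range b) = horL hlam i₁ x e) :
    gVol (hlam.coordAt x) e (b 0) (b 1) (b 2) ≠ 0 := by
  have hb1 (k : Fin 3) : b k ∈ horL hlam i₁ x e := hspan ▸ Submodule.subset_span ⟨k, rfl⟩
  have hb2 (k : Fin 3) := gProj_of_mem_horL hlam he (hb1 k)
  refine gVol_ne_zero he hb2 (cplx_injective_of_lagrangian he hb2 hb ?_)
  rw [hspan]
  exact fun v hv w hw => gForm_horL hlam hi₁ hx he hmem hv hw

/-- The first Lagrangian subbundle has a frame. -/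
theorem ConnectingSquare.exists_frame₁ (hlam : IsG2Form lam)
    (hi₁ : IsIsotropicEmbedding lam i₁) :
    ∃ B : I × S1 → Fin 3 → E7,
      (∀ k, Continuous fun q : I × S1 => tb (u.map (q.1, 0, q.2)) (B q k)) ∧
      ∀ q, LinearIndependent ℝ (B q) ∧
        Submodule.span ℝ (range (B q)) = u.L₁ hlam (q.1, 0, q.2) := by
  have hcm : Continuous fun q : I × S1 => u.map (q.1, 0, q.2) :=
    u.continuous_map.comp (by fun_prop)
  obtain ⟨n, ⟨P⟩⟩ := exists_finPartition hcm
  have hloc := (u.secFramed₁ hlam hi₁).map (fun q => P.emb q)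
    (fun s y₀ hs => P.continuousAt_emb (g := id) continuousAt_id hs)
    (fun q x _ h0 => by rw [← P.ret_emb q x, h0, map_zero])
  set ℓ : I × S1 → Submodule ℝ (Fin n → E7) := fun q => (u.L₁ hlam (q.1, 0, q.2)).map (P.emb q)
    with hℓ
  have hret (q : I × S1) (b : Fin 3 → Fin n → E7) (hb : LinearIndependent ℝ b)
      (hspan : Submodule.span ℝ (range b) = ℓ q) :
      LinearIndependent ℝ (fun k => P.ret q (b k)) ∧
        Submodule.span ℝ (range fun k => P.ret q (b k)) = u.L₁ hlam (q.1, 0, q.2) := by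
    constructor
    · refine hb.map (f := P.ret q) ?_
      rw [hspan, Submodule.disjoint_def]
      rintro _ ⟨v, -, rfl⟩ h0
      rw [LinearMap.mem_ker, P.ret_emb] at h0
      rw [h0, map_zero]
    · have h1 : (range fun k => P.ret q (b k)) = P.ret q '' range b := by
        rw [← range_comp]; rfl
      rw [h1, ← Submodule.map_span, hspan, hℓ]
      ext v
      simp only [Submodule.mem_map, exists_exists_and_eq_and, P.ret_emb, exists_eq_right]
  have hvol (q : I × S1) (b : Fin 3 → Fin n → E7) (hb : LinearIndependent ℝ b)
      (hspan : Submodule.span ℝ (range b) = ℓ q) :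
      (gVol (hlam.coordAt (u.map (q.1, 0, q.2))) (u.velE (q.1, 0, q.2)) (P.ret q (b 0))
        (P.ret q (b 1)) (P.ret q (b 2))).im ≠ 0 := by
    obtain ⟨h1, h2⟩ := hret q b hb hspan
    have h3 := gVol_ne_zero_of_horL hlam hi₁ (u.side₁ q.1 q.2) (u.velE_ne_zero _)
      (u.velE_mem₁ hi₁ q.1 q.2) h1 h2
    have h4 (k : Fin 3) : P.ret q (b k) ∈ u.L₁ hlam (q.1, 0, q.2) :=
      h2 ▸ Submodule.subset_span ⟨k, rfl⟩
    have h5 := gVol_re_horL hlam hi₁ (u.side₁ q.1 q.2) (u.velE_ne_zero _)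
      (u.velE_mem₁ hi₁ q.1 q.2) (h4 0) (h4 1) (h4 2)
    exact fun h6 => h3 (Complex.ext h5 h6)
  -- The orientation is given by Im Ω, which is nonzero on the bases because Ω is nonzero and its
  -- real part vanishes. The frame over a = 0 is afterwards extended in the direction of a.
  obtain ⟨b₀, hb₀, hb₀'⟩ := exists_circle_frame
    (hloc.comp (by fun_prop : Continuous fun z : S1 => ((0 : I), z)))
    (fun z b => (gVol (hlam.coordAt (u.map (0, 0, z))) (u.velE (0, 0, z)) (P.ret (0, z) (b 0))
        (P.ret (0, z) (b 1)) (P.ret (0, z) (b 2))).im)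
    (fun z b => hvol (0, z) b)
    (fun z b g => by
      have h1 := gVol_frameMul (A := hlam.coordAt (u.map (0, 0, z))) (u.velE_ne_zero (0, 0, z))
        (fun k => P.ret (0, z) (b k)) g
      have h2 (j : Fin 3) : frameMul (fun k => P.ret (0, z) (b k)) g j =
          P.ret (0, z) (frameMul b g j) := by simp [frameMul]
      rw [h2, h2, h2] at h1
      rw [h1, Complex.im_ofReal_mul])
    (fun b hb => by
      rw [continuous_iff_continuousAt]
      intro t₀
      have hc : Continuous fun t : I => ((t : ℝ) : S1) :=
        (AddCircle.continuous_mk' 1).comp continuous_subtype_val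
      have hg : Continuous fun t : I => ((0 : I), ((t : ℝ) : S1)) := by fun_prop
      have h1 (k : Fin 3) := P.continuousAt_ret (hg.continuousAt (x := t₀)) hcm
        (((continuous_apply k).comp hb).continuousAt (x := t₀))
      have h2 : ContinuousAt (fun t : I => tb (u.map (0, 0, ((t : ℝ) : S1)))
          (u.velE (0, 0, ((t : ℝ) : S1)))) t₀ :=
        (u.continuous_tb.comp
          (by fun_prop : Continuous fun t : I => ((0 : I), (0 : I), ((t : ℝ) : S1)))).continuousAt
      exact Complex.continuous_im.continuousAt.tendsto.comp
        (continuousAt_gVol hlam h2 (u.velE_ne_zero _) (h1 0) (h1 1) (h1 2)))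
  obtain ⟨b, hb, hb'⟩ := hloc.exists_frame_extension hb₀ hb₀'
  refine ⟨fun q k => P.ret q (b q k), fun k => ?_, fun q => hret q _ (hb' q).1 (hb' q).2⟩
  rw [continuous_iff_continuousAt]
  intro q₀
  exact P.continuousAt_ret (g := id) continuousAt_id hcm ((continuous_apply k).comp hb).continuousAt

end Square

/-! ### A unitary trivialization -/

section Unitary

variable {M : Type*} [TopologicalSpace M] [ChartedSpace E7 M] [IsManifold (𝓡 7) ∞ M]
  {N₁ N₂ : Type*} [TopologicalSpace N₁] [ChartedSpace (EuclideanSpace ℝ (Fin 4)) N₁]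
  [IsManifold (𝓡 4) ∞ N₁] [TopologicalSpace N₂] [ChartedSpace (EuclideanSpace ℝ (Fin 4)) N₂]
  [IsManifold (𝓡 4) ∞ N₂]
  {lam : ThreeForm M} {i₁ : N₁ → M} {i₂ : N₂ → M} {γ₁ γ₂ : S1 → M}
  {u : ConnectingSquare i₁ i₂ γ₁ γ₂}

/-- A complex frame over the side `b = 0` extends over the square; it does not depend
on `b` over the sides where the square does not. -/
theorem ConnectingSquare.exists_complex_frame [T2Space M] (hlam : IsG2Form lam)
    {B : I × S1 → Fin 3 → E7}
    (hB : ∀ k, Continuous fun q : I × S1 => tb (u.map (q.1, 0, q.2)) (B q k))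
    (hBpr : ∀ q k, u.pr hlam (q.1, 0, q.2) (B q k) = B q k)
    (hBinj : ∀ q : I × S1, Function.Injective
      (cplx (hlam.coordAt (u.map (q.1, 0, q.2))) (u.velE (q.1, 0, q.2)) (B q))) :
    ∃ y : I × I × S1 → Fin 3 → E7, (∀ k, Continuous fun p => tb (u.map p) (y p k)) ∧
      (∀ p k, u.pr hlam p (y p k) = y p k) ∧
      (∀ p, Function.Injective (cplx (hlam.coordAt (u.map p)) (u.velE p) (y p))) ∧
      ∀ p : I × I × S1, p.1 = 0 ∨ p.1 = 1 ∨ p.2.1 = 0 → y p = B (p.1, p.2.2) := by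
  have hc := u.continuous_map
  have : CompactSpace (range u.map) := isCompact_iff_compactSpace.1 (isCompact_range hc)
  -- The partition lives on the image of the square and not on the cube. Thus the embeddings depend
  -- only on the point of M and are constant in b wherever the square is.
  obtain ⟨n, ⟨P⟩⟩ := exists_finPartition (X := range u.map) (f := (Subtype.val : range u.map → M))
    continuous_subtype_val
  let r : I × I × S1 → range u.map := fun p => ⟨u.map p, p, rfl⟩
  have hr : Continuous r := hc.subtype_mk _
  let Jh : I × I × S1 → (Fin n → E7) →L[ℝ] (Fin n → E7) := fun p =>
    LinearMap.toContinuousLinearMap (P.emb (r p) ∘ₗ u.J hlam p ∘ₗ P.ret (r p))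
  let Ph : I × I × S1 → (Fin n → E7) →L[ℝ] (Fin n → E7) := fun p =>
    LinearMap.toContinuousLinearMap (P.emb (r p) ∘ₗ u.pr hlam p ∘ₗ P.ret (r p))
  have hJa (p) (x : Fin n → E7) : Jh p x = P.emb (r p) (u.J hlam p (P.ret (r p) x)) := rfl
  have hPa (p) (x : Fin n → E7) : Ph p x = P.emb (r p) (u.pr hlam p (P.ret (r p) x)) := rfl
  have hretc {p₀ : I × I × S1} (x : Fin n → E7) :
      ContinuousAt (fun p => tb (u.map p) (P.ret (r p) x)) p₀ :=
    P.continuousAt_ret hr.continuousAt continuous_subtype_val continuousAt_const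
  have hJc : Continuous Jh := by
    rw [continuous_iff_continuousAt]
    intro p₀
    rw [continuousAt_clm_apply]
    exact fun x => P.continuousAt_emb hr.continuousAt
      (continuousAt_J hlam u.continuous_tb.continuousAt (u.velE_ne_zero p₀) (hretc x))
  have hPc : Continuous Ph := by
    rw [continuous_iff_continuousAt]
    intro p₀
    rw [continuousAt_clm_apply]
    exact fun x => P.continuousAt_emb hr.continuousAt
      (continuousAt_gProj hlam u.continuous_tb.continuousAt (u.velE_ne_zero p₀) (hretc x))
  have hPP (p x) : Ph p (Ph p x) = Ph p x := by
    simp only [hPa, P.ret_emb]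
    exact congrArg _ (gProj_gProj (u.velE_ne_zero p) _)
  have hJP (p x) : Jh p (Ph p x) = Jh p x := by
    simp only [hPa, hJa, P.ret_emb]
    exact congrArg _ (gJ_gProj (u.velE_ne_zero p) _)
  have hPJ (p x) : Ph p (Jh p x) = Jh p x := by
    simp only [hPa, hJa, P.ret_emb]
    exact congrArg _ (gProj_gJ (u.velE_ne_zero p) _)
  have hJJ (p x) : Jh p (Jh p x) = -Ph p x := by
    simp only [hPa, hJa, P.ret_emb]
    rw [← map_neg]
    refine congrArg _ ?_
    exact (neg_eq_iff_eq_neg.2 (gProj_eq _)).symm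
  -- The average of P P and −J J is the part of the naive step P P from p to q that commutes with J;
  -- on the complement at p it is the identity when q = p.
  let K : I × I × S1 → I × I × S1 → (Fin n → E7) →L[ℝ] (Fin n → E7) := fun q p =>
    (2⁻¹ : ℝ) • (Ph q ∘L Ph p - Jh q ∘L Jh p)
  have hKa (q p x) : K q p x = (2⁻¹ : ℝ) • (Ph q (Ph p x) - Jh q (Jh p x)) := rfl
  have hPK (q p x) : Ph q (K q p x) = K q p x := by
    simp only [hKa, map_smul, map_sub, hPP, hPJ]
  have hKid (p x) (hx : Ph p x = x) : K p p x = x := by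
    rw [hKa, hx, hJJ, hx, sub_neg_eq_add, ← two_smul ℝ, smul_smul]
    norm_num
  have hKJ (q p x) : K q p (Jh p x) = Jh q (K q p x) := by
    rw [hKa, hPJ, hJJ, map_neg, sub_neg_eq_add, hKa, map_smul, map_sub, hJP, hJJ, sub_neg_eq_add,
      add_comm]
  -- The segment in the direction of b from height 0 to the point p, so that transport along it ends
  -- over p and depends continuously on p.
  let pt : I × I × S1 → I → I × I × S1 := fun p t => (p.1, t * p.2.1, p.2.2)
  have hpt : Continuous fun q : (I × I × S1) × I => pt q.1 q.2 := by fun_prop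
  obtain ⟨R, hRc, hRm, hRi, hRconst, hRJ⟩ := exists_transport (Y := I × I × S1)
    (fun y t s => K (pt y t) (pt y s))
    (by
      have h1 : Continuous fun q : (I × I × S1) × I × I => pt q.1 q.2.1 := by fun_prop
      have h2 : Continuous fun q : (I × I × S1) × I × I => pt q.1 q.2.2 := by fun_prop
      change Continuous fun q : (I × I × S1) × I × I => (2⁻¹ : ℝ) •
        (Ph (pt q.1 q.2.1) ∘L Ph (pt q.1 q.2.2) - Jh (pt q.1 q.2.1) ∘L Jh (pt q.1 q.2.2))
      exact (((hPc.comp h1).clm_comp (hPc.comp h2)).sub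
        ((hJc.comp h1).clm_comp (hJc.comp h2))).const_smul (2⁻¹ : ℝ))
    (fun y t => LinearMap.range (Ph (pt y t)).toLinearMap)
    (fun y t s x _ => ⟨_, hPK _ _ x⟩)
    (fun y t x hx => by
      obtain ⟨w, rfl⟩ := hx
      exact hKid _ _ (hPP _ _))
  have hp0 (p : I × I × S1) : pt p 0 = (p.1, 0, p.2.2) := by simp [pt]
  have hp1 (p : I × I × S1) : pt p 1 = p := by simp [pt]
  have hRm' (p x) (hx : Ph (p.1, 0, p.2.2) x = x) : Ph p (R p x) = R p x := by
    obtain ⟨w, hw⟩ := hRm p x ⟨x, by rw [hp0]; exact hx⟩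
    rw [hp1] at hw
    rw [← hw]
    exact hPP p w
  have hRi' (p x) (hx : Ph (p.1, 0, p.2.2) x = x) : R p x = 0 → x = 0 :=
    hRi p x ⟨x, by rw [hp0]; exact hx⟩
  have hRJ' (p x) (hx : Ph (p.1, 0, p.2.2) x = x) : R p (Jh (p.1, 0, p.2.2) x) = Jh p (R p x) := by
    have := hRJ p (fun t => Jh (pt p t)) (fun t s x _ => hKJ _ _ x) x ⟨x, by rw [hp0]; exact hx⟩
    simpa only [hp0, hp1] using this
  have hBfix (p : I × I × S1) (v : E7) (hv : u.pr hlam (p.1, 0, p.2.2) v = v) :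
      Ph (p.1, 0, p.2.2) (P.emb (r (p.1, 0, p.2.2)) v) = P.emb (r (p.1, 0, p.2.2)) v := by
    rw [hPa, P.ret_emb, hv]
  let T : I × I × S1 → E7 →ₗ[ℝ] E7 := fun p =>
    P.ret (r p) ∘ₗ (R p).toLinearMap ∘ₗ P.emb (r (p.1, 0, p.2.2))
  have hTa (p v) : T p v = P.ret (r p) (R p (P.emb (r (p.1, 0, p.2.2)) v)) := rfl
  have hTpr (p v) (hv : u.pr hlam (p.1, 0, p.2.2) v = v) : u.pr hlam p (T p v) = T p v := by
    rw [hTa]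
    have h1 := hRm' p _ (hBfix p v hv)
    conv_rhs => rw [← h1, hPa, P.ret_emb]
  have hTinj (p v) (hv : u.pr hlam (p.1, 0, p.2.2) v = v) (h0 : T p v = 0) : v = 0 := by
    have h1 := hRm' p _ (hBfix p v hv)
    rw [hPa, ← hTa, h0, map_zero, map_zero] at h1
    have h2 := hRi' p _ (hBfix p v hv) h1.symm
    rw [← P.ret_emb (r (p.1, 0, p.2.2)) v, h2, map_zero]
  have hTJ (p v) (hv : u.pr hlam (p.1, 0, p.2.2) v = v) :
      u.J hlam p (T p v) = T p (u.J hlam (p.1, 0, p.2.2) v) := by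
    have h1 := hRJ' p _ (hBfix p v hv)
    rw [hJa, P.ret_emb] at h1
    rw [hTa, hTa, h1, hJa, P.ret_emb]
  have hcplx (p : I × I × S1) (c : C3) :
      cplx (hlam.coordAt (u.map p)) (u.velE p) (fun k => T p (B (p.1, p.2.2) k)) c =
        T p (cplx (hlam.coordAt (u.map (p.1, 0, p.2.2))) (u.velE (p.1, 0, p.2.2))
          (B (p.1, p.2.2)) c) := by
    rw [cplx_apply, cplx_apply, map_sum]
    refine Finset.sum_congr rfl fun k _ => ?_
    rw [map_add, map_smul, map_smul]
    congr 2
    exact hTJ p _ (hBpr (p.1, p.2.2) k)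
  refine ⟨fun p k => T p (B (p.1, p.2.2) k), fun k => ?_, fun p k => hTpr p _ (hBpr (p.1, p.2.2) k),
    fun p => ?_, fun p hp => ?_⟩
  · rw [continuous_iff_continuousAt]
    intro p₀
    have hq : Continuous fun p : I × I × S1 => (p.1, (0 : I), p.2.2) := by fun_prop
    have hq' : Continuous fun p : I × I × S1 => (p.1, p.2.2) := by fun_prop
    have h1 := P.continuousAt_emb (hr.comp hq).continuousAt ((hB k).comp hq').continuousAt (y₀ := p₀)
    exact P.continuousAt_ret hr.continuousAt continuous_subtype_val (hRc.continuousAt.clm_apply h1)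
  · rw [injective_iff_map_eq_zero]
    intro c hc0
    rw [hcplx] at hc0
    have h1 := hTinj p _ (gProj_cplx (u.velE_ne_zero _) (hBpr (p.1, p.2.2)) c) hc0
    exact (injective_iff_map_eq_zero _).1 (hBinj (p.1, p.2.2)) c h1
  -- On the ends, and at b = 0, all data are constant along the segment, so the transport fixes the
  -- complement of the velocity.
  · have hcases : (p.1 = 0 ∨ p.1 = 1) ∨ ∀ t, pt p t = pt p 0 := by
      rcases hp with h | h | h
      · exact Or.inl (Or.inl h)
      · exact Or.inl (Or.inr h)
      · exact Or.inr fun t => by simp [pt, h]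
    have hm (t : I) : u.map (pt p t) = u.map (pt p 0) :=
      hcases.elim (fun h => u.map_eq (p := pt p t) (q := pt p 0) h rfl rfl) fun h => by rw [h]
    have hr' (t : I) : r (pt p t) = r (pt p 0) := Subtype.ext (hm t)
    have hv (t : I) : u.velE (pt p t) = u.velE (pt p 0) :=
      hcases.elim (fun h => u.velE_eq (p := pt p t) (q := pt p 0) h rfl rfl) fun h => by rw [h]
    have hJ' (t : I) : Jh (pt p t) = Jh (pt p 0) := by
      ext1 x
      rw [hJa, hJa, hr', ConnectingSquare.J, ConnectingSquare.J, hm, hv]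
    have hP' (t : I) : Ph (pt p t) = Ph (pt p 0) := by
      ext1 x
      rw [hPa, hPa, hr', ConnectingSquare.pr, ConnectingSquare.pr, hm, hv]
    have h1 := hRconst p (fun t s => by simp only [K, hJ' t, hJ' s, hP' t, hP' s])
    ext1 k
    have h2 := hBfix p _ (hBpr (p.1, p.2.2) k)
    have h3 := h1 (P.emb (r (p.1, 0, p.2.2)) (B (p.1, p.2.2) k)) ⟨_, by rw [hp0]; exact h2⟩
    have h4 := hr' 1
    rw [hp0, hp1] at h4
    change T p (B (p.1, p.2.2) k) = B (p.1, p.2.2) k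
    rw [hTa, h3, h4, P.ret_emb]

end Unitary

/-! ### Existence of trivializations -/

section RealSubspace

/-- The real subspace of `ℂ³`. -/
def realC3 : Submodule ℝ C3 where
  carrier := {c | ∀ k, (c k).im = 0}
  add_mem' ha hb k := by simp [ha k, hb k]
  zero_mem' k := by simp
  smul_mem' r c hc k := by simp [hc k]

lemma mem_realC3 {c : C3} : c ∈ realC3 ↔ ∀ k, (c k).im = 0 := Iff.rfl

lemma stdSymp_add_left (x x' y : C3) : stdSymp (x + x') y = stdSymp x y + stdSymp x' y := by
  simp only [stdSymp, Pi.add_apply, map_add, add_mul, Finset.sum_add_distrib, Complex.add_im]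

lemma stdSymp_add_right (x y y' : C3) : stdSymp x (y + y') = stdSymp x y + stdSymp x y' := by
  simp only [stdSymp, Pi.add_apply, mul_add, Finset.sum_add_distrib, Complex.add_im]

lemma stdSymp_smul_left (r : ℝ) (x y : C3) : stdSymp (r • x) y = r * stdSymp x y := by
  simp only [stdSymp, Pi.smul_apply, Complex.real_smul, map_mul, Complex.conj_ofReal, mul_assoc,
    ← Finset.mul_sum, Complex.im_ofReal_mul]

lemma stdSymp_smul_right (r : ℝ) (x y : C3) : stdSymp x (r • y) = r * stdSymp x y := by
  simp only [stdSymp, Pi.smul_apply, Complex.real_smul, mul_left_comm _ (r : ℂ), ← Finset.mul_sum,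
    Complex.im_ofReal_mul]

lemma stdSymp_comm (x y : C3) : stdSymp y x = -stdSymp x y := by
  simp only [stdSymp, Complex.im_sum, ← Finset.sum_neg_distrib]
  refine Finset.sum_congr rfl fun k _ => ?_
  simp; ring

lemma stdSymp_I_smul (x y : C3) : stdSymp (Complex.I • x) (Complex.I • y) = stdSymp x y := by
  simp only [stdSymp, Complex.im_sum]
  refine Finset.sum_congr rfl fun k _ => ?_
  simp

lemma stdSymp_self_I (x : C3) : stdSymp x (Complex.I • x) = ∑ k, Complex.normSq (x k) := by
  simp only [stdSymp, Complex.im_sum]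
  refine Finset.sum_congr rfl fun k _ => ?_
  simp [Complex.normSq_apply]

lemma stdSymp_eq_sum (x y : C3) :
    stdSymp x y = ∑ k, ((x k).re * (y k).im - (x k).im * (y k).re) := by
  simp only [stdSymp, Complex.im_sum]
  refine Finset.sum_congr rfl fun k _ => ?_
  simp; ring

/-- The shear of `ℂ³` which fixes the imaginary subspace. -/
def shear (S : Matrix (Fin 3) (Fin 3) ℝ) : C3 →ₗ[ℝ] C3 where
  toFun c k := ⟨(c k).re, (c k).im - S.mulVec (fun j => (c j).re) k⟩
  map_add' c d := by
    ext k
    apply Complex.ext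
    · simp
    · have : (fun j => ((c + d) j).re) = (fun j => (c j).re) + fun j => (d j).re := by
        ext j; simp
      rw [this, Matrix.mulVec_add]
      simp only [Pi.add_apply, Complex.add_im]
      ring
  map_smul' r c := by
    ext k
    apply Complex.ext
    · simp
    · have : (fun j => ((r • c) j).re) = r • fun j => (c j).re := by
        ext j; simp
      rw [this, Matrix.mulVec_smul]
      simp only [Pi.smul_apply, Complex.smul_im, RingHom.id_apply, smul_eq_mul]
      ring

lemma shear_apply (S : Matrix (Fin 3) (Fin 3) ℝ) (c : C3) (k : Fin 3) :
    shear S c k = ⟨(c k).re, (c k).im - S.mulVec (fun j => (c j).re) k⟩ := rfl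

lemma stdSymp_shear {S : Matrix (Fin 3) (Fin 3) ℝ} (hS : S.transpose = S) (x y : C3) :
    stdSymp (shear S x) (shear S y) = stdSymp x y := by
  have h (i j : Fin 3) : S i j = S j i := congrFun (congrFun hS j) i
  simp only [stdSymp_eq_sum, shear_apply, Matrix.mulVec, dotProduct, Fin.sum_univ_three]
  rw [h 1 0, h 2 0, h 2 1]
  ring

lemma shear_eq_zero {S : Matrix (Fin 3) (Fin 3) ℝ} {c : C3} (h : shear S c = 0) : c = 0 := by
  have hre : ∀ k, (c k).re = 0 := fun k => congrArg Complex.re (congrFun h k)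
  ext k
  refine Complex.ext (hre k) ?_
  have := congrArg Complex.im (congrFun h k)
  simpa [shear_apply, hre, Matrix.mulVec, dotProduct] using this

lemma continuous_shear : Continuous fun q : Matrix (Fin 3) (Fin 3) ℝ × C3 => shear q.1 q.2 := by
  refine continuous_pi fun k => ?_
  simp only [shear_apply, Complex.mk_eq_add_mul_I]
  have h1 : Continuous fun q : Matrix (Fin 3) (Fin 3) ℝ × C3 =>
      q.1.mulVec (fun j => (q.2 j).re) := by
    refine Continuous.matrix_mulVec continuous_fst ?_
    fun_prop
  have h2 : Continuous fun q : Matrix (Fin 3) (Fin 3) ℝ × C3 =>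
      q.1.mulVec (fun j => (q.2 j).re) k := (continuous_apply k).comp h1
  fun_prop

end RealSubspace

/-! ### Symplectic maps to ℂ³ and Lagrangian graphs. -/

section Algebra

variable {V : Type*} [AddCommGroup V] [Module ℝ V] {A : V ≃ₗ[ℝ] (Fin 7 → ℝ)} {e : V}

/-- The Hermitian form is real on a Lagrangian subspace, so Gram–Schmidt uses real coefficients and
does not leave the real span. -/
lemma unitaryCoord_real {y : Fin 3 → V}
    (hlag : ∀ v ∈ Submodule.span ℝ (range y), ∀ w ∈ Submodule.span ℝ (range y),
      gForm A e v w = 0) {v : V} (hv : v ∈ Submodule.span ℝ (range y)) :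
    unitaryCoord A e y v ∈ realC3 := by
  have hy (k) : y k ∈ Submodule.span ℝ (range y) := Submodule.subset_span ⟨k, rfl⟩
  have him {v w : V} (hv : v ∈ Submodule.span ℝ (range y)) (hw : w ∈ Submodule.span ℝ (range y)) :
      hForm A e v w = ((hForm A e v w).re : ℂ) := by
    apply Complex.ext
    · simp
    · rw [hForm_im, hlag v hv w hw, Complex.ofReal_im]
  have hcs {a b c : V} (ha : a ∈ Submodule.span ℝ (range y)) (hb : b ∈ Submodule.span ℝ (range y))
      (hc : c ∈ Submodule.span ℝ (range y)) :
      csmul A e (hForm A e a b / hForm A e c c) c ∈ Submodule.span ℝ (range y) := by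
    rw [him ha hb, him hc hc, ← Complex.ofReal_div, csmul, Complex.ofReal_re, Complex.ofReal_im,
      zero_smul, add_zero]
    exact Submodule.smul_mem _ _ hc
  have h1 : gs₁ A e y ∈ Submodule.span ℝ (range y) :=
    Submodule.sub_mem _ (hy 1) (hcs (hy 0) (hy 1) (hy 0))
  have h2 : gs₂ A e y ∈ Submodule.span ℝ (range y) :=
    Submodule.sub_mem _ (Submodule.sub_mem _ (hy 2) (hcs (hy 0) (hy 2) (hy 0)))
      (hcs h1 (hy 2) h1)
  have h3 (k) : gs A e y k ∈ Submodule.span ℝ (range y) := by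
    fin_cases k
    · exact hy 0
    · exact h1
    · exact h2
  intro k
  rw [unitaryCoord_apply, him (h3 k) hv, Complex.real_smul, ← Complex.ofReal_mul,
    Complex.ofReal_im]

/-- Symplectic maps to `ℂ³` have kernel spanned by `e`. -/
lemma mem_span_of_stdSymp (he : e ≠ 0) {T : V →ₗ[ℝ] C3}
    (hT : ∀ v w, stdSymp (T v) (T w) = gForm A e v w) {v : V} (h : T v = 0) :
    v ∈ Submodule.span ℝ {e} := by
  by_contra hv
  have h1 := gForm_gJ_pos (A := A) he hv
  rw [← hT, h] at h1
  simp [stdSymp] at h1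

lemma surjective_of_stdSymp (he : e ≠ 0) {T : V →ₗ[ℝ] C3}
    (hT : ∀ v w, stdSymp (T v) (T w) = gForm A e v w) : Function.Surjective T := by
  have hfin : Module.Finite ℝ V := Module.Finite.equiv A.symm
  have h := LinearMap.finrank_range_add_finrank_ker T
  have hk : Module.finrank ℝ (LinearMap.ker T) ≤ 1 := by
    rw [← finrank_span_singleton (K := ℝ) he]
    exact Submodule.finrank_mono fun v hv => mem_span_of_stdSymp he hT hv
  have h7 : Module.finrank ℝ V = 7 := by rw [A.finrank_eq]; simp
  have h6 : Module.finrank ℝ C3 = 6 := by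
    rw [Module.finrank_pi_fintype]; simp [Complex.finrank_real_complex]
  have h8 := Submodule.finrank_le (LinearMap.range T)
  rw [← LinearMap.range_eq_top]
  exact Submodule.eq_top_of_finrank_eq (by omega)

/-- The vector T e pairs to zero with the image of T, which is everything; pairing it with i T e
gives |T e|² = 0. -/
lemma apply_self_of_stdSymp (he : e ≠ 0) {T : V →ₗ[ℝ] C3}
    (hT : ∀ v w, stdSymp (T v) (T w) = gForm A e v w) : T e = 0 := by
  obtain ⟨w, hw⟩ := surjective_of_stdSymp he hT (Complex.I • T e)
  have h1 := hT e w
  rw [hw, stdSymp_self_I, gForm_self_left] at h1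
  ext k
  have h2 := (Finset.sum_eq_zero_iff_of_nonneg fun k _ => Complex.normSq_nonneg _).1 h1 k
    (Finset.mem_univ k)
  exact Complex.normSq_eq_zero.1 h2

/-- A Lagrangian subspace transversal to the imaginary subspace is the graph of a symmetric
matrix. -/
lemma exists_graph_matrix {L : Submodule ℝ C3} (hdim : Module.finrank ℝ L = 3)
    (hlag : ∀ x ∈ L, ∀ y ∈ L, stdSymp x y = 0) (htr : ∀ x ∈ L, (∀ k, (x k).re = 0) → x = 0) :
    ∃ S : Matrix (Fin 3) (Fin 3) ℝ, S.transpose = S ∧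
      ∀ x ∈ L, ∀ k, (x k).im = S.mulVec (fun j => (x j).re) k := by
  let ρ : L →ₗ[ℝ] (Fin 3 → ℝ) :=
    { toFun := fun x k => ((x : C3) k).re
      map_add' := fun x y => by ext k; simp
      map_smul' := fun r x => by ext k; simp }
  have hinj : Function.Injective ρ := by
    rw [injective_iff_map_eq_zero]
    exact fun x hx => Subtype.ext (htr x x.2 fun k => congrFun hx k)
  let E := LinearEquiv.ofInjectiveOfFinrankEq ρ hinj (by rw [hdim]; simp)
  have hE (x : L) : E x = ρ x := rfl
  let T : (Fin 3 → ℝ) →ₗ[ℝ] (Fin 3 → ℝ) :=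
    { toFun := fun v k => ((E.symm v : C3) k).im
      map_add' := fun x y => by ext k; simp
      map_smul' := fun r x => by ext k; simp }
  have hTx (x : C3) (hx : x ∈ L) (k) : (x k).im = T (fun j => (x j).re) k := by
    have h1 : E.symm (fun j => (x j).re) = ⟨x, hx⟩ := by
      rw [LinearEquiv.symm_apply_eq]; rfl
    change _ = ((E.symm (fun j => (x j).re) : C3) k).im
    rw [h1]
  refine ⟨LinearMap.toMatrix' T, ?_, fun x hx k => ?_⟩
  -- Isotropy of the graph of a linear map is the symmetry of its matrix.
  · have hsymm (v w : Fin 3 → ℝ) : v ⬝ᵥ T w = w ⬝ᵥ T v := by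
      have h1 := hlag _ (E.symm v).2 _ (E.symm w).2
      have hre (v : Fin 3 → ℝ) (k) : ((E.symm v : C3) k).re = v k :=
        congrFun (E.apply_symm_apply v) k
      have him (v : Fin 3 → ℝ) (k) : ((E.symm v : C3) k).im = T v k := rfl
      simp only [stdSymp_eq_sum, hre, him, Finset.sum_sub_distrib] at h1
      simp only [dotProduct]
      rw [sub_eq_zero.1 h1]
      exact Finset.sum_congr rfl fun k _ => mul_comm _ _
    ext i j
    have := hsymm (Pi.single i 1) (Pi.single j 1)
    simp only [single_one_dotProduct] at this
    rw [Matrix.transpose_apply, LinearMap.toMatrix'_apply, LinearMap.toMatrix'_apply]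
    simpa [Pi.single_apply, Function.comp_def] using this.symm
  · rw [LinearMap.toMatrix'_mulVec]
    exact hTx x hx k

/-- The graph matrices of a locally framed family depend continuously on the parameter. -/
lemma continuous_graph_matrix {Y : Type*} [TopologicalSpace Y] {L : Y → Submodule ℝ C3}
    (hL : LocFramed L 3) (htr : ∀ y, ∀ x ∈ L y, (∀ k, (x k).re = 0) → x = 0)
    {S : Y → Matrix (Fin 3) (Fin 3) ℝ}
    (hS : ∀ y, ∀ x ∈ L y, ∀ k, (x k).im = (S y).mulVec (fun j => (x j).re) k) : Continuous S := by
  rw [continuous_iff_continuousAt]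
  intro y₀
  obtain ⟨b, hb, hb'⟩ := hL y₀
  let X : Y → Matrix (Fin 3) (Fin 3) ℝ := fun y => Matrix.of fun j k => (b k y j).re
  let Z : Y → Matrix (Fin 3) (Fin 3) ℝ := fun y => Matrix.of fun j k => (b k y j).im
  have hbc (j k) : ContinuousAt (fun y => b k y j) y₀ := continuousAt_pi.1 (hb k) j
  have hX : ContinuousAt X y₀ := continuousAt_pi.2 fun j => continuousAt_pi.2 fun k =>
    Complex.continuous_re.continuousAt.tendsto.comp (hbc j k)
  have hZ : ContinuousAt Z y₀ := continuousAt_pi.2 fun j => continuousAt_pi.2 fun k =>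
    Complex.continuous_im.continuousAt.tendsto.comp (hbc j k)
  have hXdet (y) (hy : LinearIndependent ℝ (fun j => b j y) ∧
      Submodule.span ℝ (range fun j => b j y) = L y) : (X y).det ≠ 0 := by
    intro h0
    obtain ⟨v, hv0, hv⟩ := Matrix.exists_mulVec_eq_zero_iff.2 h0
    have h1 : ∑ k, v k • b k y = 0 := by
      refine htr y _ ?_ fun j => ?_
      · rw [← hy.2]
        exact Submodule.sum_mem _ fun k _ => Submodule.smul_mem _ _ (Submodule.subset_span ⟨k, rfl⟩)
      · have := congrFun hv j
        simp only [Matrix.mulVec, dotProduct, X, Matrix.of_apply] at this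
        simpa [Finset.sum_apply, mul_comm] using this
    exact hv0 (funext fun k => Fintype.linearIndependent_iff.1 hy.1 v h1 k)
  have hSX (y) (hy : LinearIndependent ℝ (fun j => b j y) ∧
      Submodule.span ℝ (range fun j => b j y) = L y) : S y * X y = Z y := by
    ext j k
    have := hS y (b k y) (hy.2 ▸ Submodule.subset_span ⟨k, rfl⟩) j
    simp only [Z, Matrix.of_apply, this, Matrix.mul_apply, Matrix.mulVec, dotProduct, X]
  -- The graph matrix in terms of a local frame with real parts X and imaginary parts Z; X is
  -- invertible by transversality to iℝ³.
  have h1 : ∀ᶠ y in 𝓝 y₀, Z y * (X y)⁻¹ = S y := by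
    filter_upwards [hb'] with y hy
    rw [← hSX y hy, Matrix.mul_nonsing_inv_cancel_right _ _ (isUnit_iff_ne_zero.2 (hXdet y hy))]
  refine ContinuousAt.congr ?_ h1
  have h2 : Continuous fun q : Matrix (Fin 3) (Fin 3) ℝ × Matrix (Fin 3) (Fin 3) ℝ => q.1 * q.2 :=
    continuous_fst.matrix_mul continuous_snd
  exact h2.continuousAt.tendsto.comp
    (hZ.prodMk (continuousAt_inv_matrix hX (hXdet y₀ hb'.self_of_nhds)))

end Algebra

/-! ### Trivializations as families of linear maps on the tangent spaces. -/

section Linear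

variable {M : Type*} [TopologicalSpace M] [ChartedSpace E7 M] [IsManifold (𝓡 7) ∞ M]
  {N₁ N₂ : Type*} [TopologicalSpace N₁] [ChartedSpace (EuclideanSpace ℝ (Fin 4)) N₁]
  [IsManifold (𝓡 4) ∞ N₁] [TopologicalSpace N₂] [ChartedSpace (EuclideanSpace ℝ (Fin 4)) N₂]
  [IsManifold (𝓡 4) ∞ N₂]
  {lam : ThreeForm M} {i₁ : N₁ → M} {i₂ : N₂ → M} {γ₁ γ₂ : S1 → M}
  {u : ConnectingSquare i₁ i₂ γ₁ γ₂}

/-- A trivialization, as a family of linear maps on the tangent spaces. -/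
def SympTrivialization.lin (Φ : SympTrivialization lam u) (p : I × I × S1) : E7 →ₗ[ℝ] C3 :=
  (Φ.equiv p).toLinearMap ∘ₗ (Submodule.mkQ (Submodule.span ℝ {u.vel p}))

lemma SympTrivialization.stdSymp_lin (hlam : IsG2Form lam) (Φ : SympTrivialization lam u)
    (p : I × I × S1) (v w : E7) :
    stdSymp (Φ.lin p v) (Φ.lin p w) = gForm (hlam.coordAt (u.map p)) (u.velE p) v w :=
  (Φ.symplectic p v w).trans (hlam.lam_eq _ _ _ _)

lemma SympTrivialization.lin_vel (Φ : SympTrivialization lam u) (p : I × I × S1) :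
    Φ.lin p (u.velE p) = 0 := by
  have h : (Submodule.Quotient.mk (u.vel p) : u.Fiber p) = 0 :=
    (Submodule.Quotient.mk_eq_zero _).2 (Submodule.mem_span_singleton_self _)
  exact (congrArg (Φ.equiv p) h).trans (map_zero _)

lemma SympTrivialization.continuousAt_lin (Φ : SympTrivialization lam u) {Y : Type*}
    [TopologicalSpace Y] {g : Y → I × I × S1} {s : Y → E7} {y₀ : Y} (hg : ContinuousAt g y₀)
    (hs : ContinuousAt (fun y => tb (u.map (g y)) (s y)) y₀) :
    ContinuousAt (fun y => Φ.lin (g y) (s y)) y₀ := by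
  let F : Y → TotalSpace E7 (u.map *ᵖ (TangentSpace (𝓡 7) : M → Type)) := fun y => ⟨g y, s y⟩
  have hF : ContinuousAt F y₀ := by
    rw [(inducing_pullbackTotalSpaceEmbedding E7 (TangentSpace (𝓡 7) : M → Type)
      (u.map)).continuousAt_iff]
    exact hg.prodMk hs
  exact Φ.continuous.continuousAt.tendsto.comp hF

lemma lin_gProj {V : Type*} [AddCommGroup V] [Module ℝ V] {A : V ≃ₗ[ℝ] (Fin 7 → ℝ)} {e : V}
    (he : e ≠ 0) {T : V →ₗ[ℝ] C3} (hT : T e = 0) (v : V) : T (gProj A e v) = T v := by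
  rw [gProj_apply he, map_sub, map_smul, hT, smul_zero, sub_zero]

lemma map_horL {N : Type*} [TopologicalSpace N] [ChartedSpace (EuclideanSpace ℝ (Fin 4)) N]
    (hlam : IsG2Form lam) (i : N → M) {x : M} {e : E7} (he : e ≠ 0) {T : E7 →ₗ[ℝ] C3}
    (hT : T e = 0) : (horL hlam i x e).map T = (tanE i x).map T := by
  rw [horL, ← Submodule.map_comp]
  congr 1
  ext1 v
  exact lin_gProj he hT v

lemma SympTrivialization.map_lagr {N : Type*} [TopologicalSpace N]
    [ChartedSpace (EuclideanSpace ℝ (Fin 4)) N] (hlam : IsG2Form lam)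
    (Φ : SympTrivialization lam u) (i : N → M) (p : I × I × S1) :
    (lagr i (u.map p) (u.vel p)).map (Φ.equiv p).toLinearMap =
      (horL hlam i (u.map p) (u.velE p)).map (Φ.lin p) := by
  rw [map_horL hlam i (u.velE_ne_zero p) (Φ.lin_vel p), lagr, ← Submodule.map_comp]
  rfl

lemma SympTrivialization.lagr₁_eq (hlam : IsG2Form lam) (Φ : SympTrivialization lam u)
    (p : I × I × S1) : Φ.lagr₁ p = (u.L₁ hlam p).map (Φ.lin p) := Φ.map_lagr hlam i₁ p

lemma SympTrivialization.lagr₂_eq (hlam : IsG2Form lam) (Φ : SympTrivialization lam u)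
    (p : I × I × S1) : Φ.lagr₂ p = (u.L₂ hlam p).map (Φ.lin p) := Φ.map_lagr hlam i₂ p

/-- A trivialization is given by a suitable family of linear maps. -/
theorem exists_sympTrivialization (hlam : IsG2Form lam) (T : I × I × S1 → E7 →ₗ[ℝ] C3)
    (hsymp : ∀ p v w, stdSymp (T p v) (T p w) = gForm (hlam.coordAt (u.map p)) (u.velE p) v w)
    (hcont : ∀ {Y : Type} [TopologicalSpace Y] {g : Y → I × I × S1} {s : Y → E7} {y₀ : Y},
      ContinuousAt g y₀ → ContinuousAt (fun y => tb (u.map (g y)) (s y)) y₀ →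
      ContinuousAt (fun y => T (g y) (s y)) y₀)
    (hconst : ∀ p : I × I × S1, p.1 = 0 ∨ p.1 = 1 → T p = T (p.1, 0, p.2.2))
    (hends : ∀ p : I × I × S1, p.1 = 0 ∨ p.1 = 1 →
      (u.L₁ hlam p).map (T p) = cmul Complex.I ((u.L₂ hlam p).map (T p))) :
    ∃ Φ : SympTrivialization lam u, ∀ p, Φ.lin p = T p := by
  have hT0 (p) : T p (u.velE p) = 0 := apply_self_of_stdSymp (u.velE_ne_zero p) (hsymp p)
  have hle (p) : Submodule.span ℝ {u.velE p} ≤ LinearMap.ker (T p) := by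
    rw [Submodule.span_singleton_le_iff_mem]; exact hT0 p
  let Q : ∀ p, (E7 ⧸ Submodule.span ℝ {u.velE p}) →ₗ[ℝ] C3 := fun p =>
    (Submodule.span ℝ {u.velE p}).liftQ (T p) (hle p)
  have hQ (p) : Function.Bijective (Q p) := by
    constructor
    · rw [injective_iff_map_eq_zero]
      intro x
      obtain ⟨v, rfl⟩ := Submodule.mkQ_surjective _ x
      intro hv
      have hv' : T p v = 0 := hv
      rw [Submodule.mkQ_apply, Submodule.Quotient.mk_eq_zero]
      exact mem_span_of_stdSymp (u.velE_ne_zero p) (hsymp p) hv'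
    · intro c
      obtain ⟨v, hv⟩ := surjective_of_stdSymp (u.velE_ne_zero p) (hsymp p) c
      exact ⟨Submodule.Quotient.mk v, hv⟩
  let Eq : ∀ p, u.Fiber p ≃ₗ[ℝ] C3 := fun p => LinearEquiv.ofBijective (Q p) (hQ p)
  have hmk (p) (v : E7) :
      Eq p (Submodule.Quotient.mk (v : TangentSpace (𝓡 7) (u.map p))) = T p v := rfl
  have hmap {N : Type _} [TopologicalSpace N] [ChartedSpace (EuclideanSpace ℝ (Fin 4)) N]
      (i : N → M) (p) : (lagr i (u.map p) (u.vel p)).map (Eq p).toLinearMap =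
        (horL hlam i (u.map p) (u.velE p)).map (T p) := by
    rw [map_horL hlam i (u.velE_ne_zero p) (hT0 p), lagr, ← Submodule.map_comp]
    rfl
  -- The same statement again, because the two submanifolds may belong to different universes.
  have hmap' {N : Type _} [TopologicalSpace N] [ChartedSpace (EuclideanSpace ℝ (Fin 4)) N]
      (i : N → M) (p) : (lagr i (u.map p) (u.vel p)).map (Eq p).toLinearMap =
        (horL hlam i (u.map p) (u.velE p)).map (T p) := by
    rw [map_horL hlam i (u.velE_ne_zero p) (hT0 p), lagr, ← Submodule.map_comp]
    rfl
  refine ⟨⟨Eq, ?_, fun p v w => ?_, fun b z v => ?_, fun b z v => ?_, fun p hp => ?_⟩, fun p => rfl⟩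
  · rw [continuous_iff_continuousAt]
    intro q₀
    refine hcont (Y := TotalSpace E7 (u.map *ᵖ (TangentSpace (𝓡 7) : M → Type)))
      (g := fun q => q.proj) (s := fun q => q.snd) ?_ ?_
    · exact (Pullback.continuous_proj E7 (TangentSpace (𝓡 7) : M → Type) u.map).continuousAt
    · exact (Pullback.continuous_lift E7 (TangentSpace (𝓡 7) : M → Type) u.map).continuousAt
  · exact (hsymp p v w).trans (hlam.lam_eq _ _ _ _).symm
  · exact DFunLike.congr_fun (hconst (0, b, z) (Or.inl rfl)) v
  · exact DFunLike.congr_fun (hconst (1, b, z) (Or.inr rfl)) v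
  · rw [hmap, hmap']
    exact hends p hp

end Linear

lemma finrank_map_of_injOn {V V' : Type*} [AddCommGroup V] [Module ℝ V] [AddCommGroup V']
    [Module ℝ V'] {L : Submodule ℝ V} {T : V →ₗ[ℝ] V'} (h : ∀ x ∈ L, T x = 0 → x = 0) :
    Module.finrank ℝ (L.map T) = Module.finrank ℝ L := by
  rw [← LinearMap.range_domRestrict]
  refine LinearMap.finrank_range_of_inj ?_
  rw [injective_iff_map_eq_zero]
  exact fun x hx => Subtype.ext (h x x.2 hx)

lemma finrank_realC3 : Module.finrank ℝ realC3 = 3 := by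
  let E : realC3 ≃ₗ[ℝ] (Fin 3 → ℝ) :=
    { toFun := fun c k => ((c : C3) k).re
      invFun := fun v => ⟨fun k => (v k : ℂ), fun k => Complex.ofReal_im _⟩
      map_add' := fun x y => by ext k; simp
      map_smul' := fun r x => by ext k; simp
      left_inv := fun c => by
        ext k
        exact Complex.ext (by simp) (by simp [mem_realC3.1 c.2 k])
      right_inv := fun v => by ext k; simp }
  rw [E.finrank_eq]; simp

lemma span_I_one :
    Submodule.span ℝ (range (Complex.I • (1 : Matrix (Fin 3) (Fin 3) ℂ)).transpose) =
      cmul Complex.I realC3 := by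
  have h (c : C3) (hc : c ∈ realC3) : Complex.I • c =
      ∑ k, (c k).re • (Complex.I • (1 : Matrix (Fin 3) (Fin 3) ℂ)).transpose k := by
    ext j
    have : c j = ((c j).re : ℂ) := Complex.ext (by simp) (by simp [mem_realC3.1 hc j])
    rw [Finset.sum_apply, Finset.sum_eq_single j]
    · simp only [Pi.smul_apply, Matrix.transpose_apply, Matrix.smul_apply, Matrix.one_apply_eq,
        smul_eq_mul, mul_one, Complex.real_smul]
      rw [mul_comm, ← this]
    · intro k _ hk
      simp [hk]
    · simp
  refine le_antisymm ?_ ?_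
  · rw [Submodule.span_le]
    rintro _ ⟨k, rfl⟩
    refine ⟨Pi.single k 1, fun j => ?_, ?_⟩
    · by_cases hj : j = k
      · subst hj; simp
      · simp [hj]
    · ext j
      simp [Matrix.transpose_apply, Matrix.one_apply, Pi.single_apply]
  · rintro _ ⟨c, hc, rfl⟩
    change Complex.I • c ∈ _
    rw [h c hc]
    exact Submodule.sum_mem _ fun k _ => Submodule.smul_mem _ _ (Submodule.subset_span ⟨k, rfl⟩)

/-! ### Existence of normalized trivializations. -/

section Existence

variable {M : Type*} [TopologicalSpace M] [ChartedSpace E7 M] [IsManifold (𝓡 7) ∞ M]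
  {N₁ N₂ : Type*} [TopologicalSpace N₁] [ChartedSpace (EuclideanSpace ℝ (Fin 4)) N₁]
  [IsManifold (𝓡 4) ∞ N₁] [TopologicalSpace N₂] [ChartedSpace (EuclideanSpace ℝ (Fin 4)) N₂]
  [IsManifold (𝓡 4) ∞ N₂]
  {lam : ThreeForm M} {i₁ : N₁ → M} {i₂ : N₂ → M} {γ₁ γ₂ : S1 → M}
  {u : ConnectingSquare i₁ i₂ γ₁ γ₂}

lemma ConnectingSquare.L₁_const (hlam : IsG2Form lam) {p q : I × I × S1} (hp : p.1 = 0 ∨ p.1 = 1)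
    (h1 : q.1 = p.1) (h2 : q.2.2 = p.2.2) : u.L₁ hlam p = u.L₁ hlam q := by
  rw [ConnectingSquare.L₁, ConnectingSquare.L₁, u.map_eq hp h1 h2, u.velE_eq hp h1 h2]

lemma ConnectingSquare.L₂_const (hlam : IsG2Form lam) {p q : I × I × S1} (hp : p.1 = 0 ∨ p.1 = 1)
    (h1 : q.1 = p.1) (h2 : q.2.2 = p.2.2) : u.L₂ hlam p = u.L₂ hlam q := by
  rw [ConnectingSquare.L₂, ConnectingSquare.L₂, u.map_eq hp h1 h2, u.velE_eq hp h1 h2]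

lemma finrank_tanE {N : Type*} [TopologicalSpace N] [ChartedSpace (EuclideanSpace ℝ (Fin 4)) N]
    [IsManifold (𝓡 4) ∞ N] {i : N → M} (hi : IsIsotropicEmbedding lam i) {x : M}
    (hx : x ∈ range i) : Module.finrank ℝ (tanE i x) = 4 := by
  obtain ⟨b, -, hb⟩ := exists_local_frame_tanE hi (f := fun _ : Unit => x) continuous_const
    (fun _ => hx) ()
  obtain ⟨h1, h2⟩ := hb.self_of_nhds
  rw [← h2, finrank_span_eq_card h1, Fintype.card_fin]

lemma mem_range_ends (p : I × I × S1) (hp : p.1 = 0 ∨ p.1 = 1) :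
    u.map p ∈ range i₁ ∧ u.map p ∈ range i₂ :=
  ⟨u.map_eq (q := (p.1, 0, p.2.2)) hp rfl rfl ▸ u.side₁ _ _,
    u.map_eq (q := (p.1, 1, p.2.2)) hp rfl rfl ▸ u.side₂ _ _⟩

lemma velE_mem_ends (hi₁ : IsIsotropicEmbedding lam i₁) (hi₂ : IsIsotropicEmbedding lam i₂)
    (p : I × I × S1) (hp : p.1 = 0 ∨ p.1 = 1) :
    u.velE p ∈ tanE i₁ (u.map p) ∧ u.velE p ∈ tanE i₂ (u.map p) := by
  constructor
  · rw [u.map_eq (q := (p.1, 0, p.2.2)) hp rfl rfl, u.velE_eq (q := (p.1, 0, p.2.2)) hp rfl rfl]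
    exact u.velE_mem₁ hi₁ _ _
  · rw [u.map_eq (q := (p.1, 1, p.2.2)) hp rfl rfl, u.velE_eq (q := (p.1, 1, p.2.2)) hp rfl rfl]
    exact u.velE_mem₂ hi₂ _ _

/-- The two Lagrangian subspaces over the ends are transversal. -/
lemma ConnectingSquare.eq_zero_of_mem (hlam : IsG2Form lam) (hi₁ : IsIsotropicEmbedding lam i₁)
    (hi₂ : IsIsotropicEmbedding lam i₂) (htrans : Transversal i₁ i₂) {p : I × I × S1}
    (hp : p.1 = 0 ∨ p.1 = 1) {v : E7} (h1 : v ∈ u.L₁ hlam p) (h2 : v ∈ u.L₂ hlam p) : v = 0 := by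
  obtain ⟨hr1, hr2⟩ := mem_range_ends (u := u) p hp
  obtain ⟨he1, he2⟩ := velE_mem_ends (u := u) hi₁ hi₂ p hp
  have hne := u.velE_ne_zero p
  have h := Submodule.finrank_sup_add_finrank_inf_eq (tanE i₁ (u.map p)) (tanE i₂ (u.map p))
  have htop : tanE i₁ (u.map p) ⊔ tanE i₂ (u.map p) = ⊤ := htrans _ ⟨hr1, hr2⟩
  rw [htop, finrank_top, finrank_euclideanSpace_fin, finrank_tanE hi₁ hr1,
    finrank_tanE hi₂ hr2] at h
  -- By transversality the dimension of the intersection is 4 + 4 − 7 = 1, so the tangent spaces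
  -- meet in the line of the velocity, to which the vectors of L₁ and L₂ are orthogonal.
  have hinf : Submodule.span ℝ {u.velE p} = tanE i₁ (u.map p) ⊓ tanE i₂ (u.map p) := by
    refine Submodule.eq_of_le_of_finrank_eq ?_ ?_
    · rw [Submodule.span_singleton_le_iff_mem]; exact ⟨he1, he2⟩
    · rw [finrank_span_singleton hne]; omega
  refine (gProj_mem_span_iff (A := hlam.coordAt (u.map p)) hne (gProj_of_mem_horL hlam hne h1)).1 ?_
  rw [hinf]
  exact ⟨horL_le hlam hne he1 h1, horL_le hlam hne he2 h2⟩

/-- Every connecting square has a normalized trivialization. -/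
theorem ConnectingSquare.exists_normalized [T2Space M] (u : ConnectingSquare i₁ i₂ γ₁ γ₂)
    (hlam : IsG2Form lam) (hi₁ : IsIsotropicEmbedding lam i₁) (hi₂ : IsIsotropicEmbedding lam i₂)
    (htrans : Transversal i₁ i₂) : ∃ Φ : SympTrivialization lam u, Φ.Normalized := by
  obtain ⟨B, hB, hBf⟩ := u.exists_frame₁ hlam hi₁
  have hBmem (q : I × S1) (k) : B q k ∈ u.L₁ hlam (q.1, 0, q.2) :=
    (hBf q).2 ▸ Submodule.subset_span ⟨k, rfl⟩
  have hBpr (q : I × S1) (k) : u.pr hlam (q.1, 0, q.2) (B q k) = B q k :=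
    gProj_of_mem_horL hlam (u.velE_ne_zero _) (hBmem q k)
  have hlag₁ (q : I × S1) : ∀ v ∈ Submodule.span ℝ (range (B q)),
      ∀ w ∈ Submodule.span ℝ (range (B q)),
      gForm (hlam.coordAt (u.map (q.1, 0, q.2))) (u.velE (q.1, 0, q.2)) v w = 0 := by
    rw [(hBf q).2]
    exact fun v hv w hw => gForm_horL hlam hi₁ (u.side₁ _ _) (u.velE_ne_zero _)
      (u.velE_mem₁ hi₁ _ _) hv hw
  obtain ⟨y, hy, hypr, hyinj, hyB⟩ := u.exists_complex_frame hlam hB hBpr fun q =>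
    cplx_injective_of_lagrangian (u.velE_ne_zero _) (hBpr q) (hBf q).1 (hlag₁ q)
  let Ψ : I × I × S1 → E7 →ₗ[ℝ] C3 := fun p =>
    unitaryCoord (hlam.coordAt (u.map p)) (u.velE p) (y p)
  have hΨsymp (p v w) : stdSymp (Ψ p v) (Ψ p w) =
      gForm (hlam.coordAt (u.map p)) (u.velE p) v w :=
    stdSymp_unitaryCoord (u.velE_ne_zero p) (hypr p) (hyinj p) v w
  have hΨcont {Y : Type} [TopologicalSpace Y] {g : Y → I × I × S1} {s : Y → E7} {y₀ : Y}
      (hg : ContinuousAt g y₀) (hs : ContinuousAt (fun y => tb (u.map (g y)) (s y)) y₀) :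
      ContinuousAt (fun y => Ψ (g y) (s y)) y₀ :=
    continuousAt_unitaryCoord hlam (f := fun t => u.map (g t)) (e := fun t => u.velE (g t))
      (b := fun k t => y (g t) k) (u.continuous_tb.continuousAt.tendsto.comp hg)
      (u.velE_ne_zero _) (fun k => (hy k).continuousAt.tendsto.comp hg) (hypr _) (hyinj _) hs
  have hΨconst (p q : I × I × S1) (hp : p.1 = 0 ∨ p.1 = 1) (h1 : q.1 = p.1) (h2 : q.2.2 = p.2.2) :
      Ψ p = Ψ q := by
    have h3 : y p = y q := by
      rw [hyB p (hp.imp_right Or.inl), hyB q, h1, h2]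
      rw [h1]; exact hp.imp_right Or.inl
    simp only [Ψ]
    rw [u.map_eq hp h1 h2, u.velE_eq hp h1 h2, h3]
  have hΨinj (p : I × I × S1) (v : E7) (hv : u.pr hlam p v = v) (h0 : Ψ p v = 0) : v = 0 :=
    (gProj_mem_span_iff (u.velE_ne_zero p) hv).1
      (mem_span_of_stdSymp (u.velE_ne_zero p) (hΨsymp p) h0)
  have hreal (q : I × S1) : (u.L₁ hlam (q.1, 0, q.2)).map (Ψ (q.1, 0, q.2)) = realC3 := by
    refine Submodule.eq_of_le_of_finrank_eq ?_ ?_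
    · rintro _ ⟨v, hv, rfl⟩
      have h1 : y (q.1, 0, q.2) = B q := hyB (q.1, 0, q.2) (Or.inr (Or.inr rfl))
      simp only [Ψ, h1]
      refine unitaryCoord_real (hlag₁ q) ?_
      rw [(hBf q).2]
      exact hv
    · have h := finrank_map_of_injOn (L := u.L₁ hlam (q.1, 0, q.2)) (T := Ψ (q.1, 0, q.2))
        fun v hv h0 => hΨinj _ v (gProj_of_mem_horL hlam (u.velE_ne_zero _) hv) h0
      rw [finrank_realC3, h]
      exact finrank_horL hlam hi₁ (u.side₁ _ _) (u.velE_ne_zero _) (u.velE_mem₁ hi₁ _ _)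
  have hreal' (p : I × I × S1) (hp : p.1 = 0 ∨ p.1 = 1) : (u.L₁ hlam p).map (Ψ p) = realC3 := by
    rw [u.L₁_const hlam (q := (p.1, 0, p.2.2)) hp rfl rfl, hΨconst p (p.1, 0, p.2.2) hp rfl rfl]
    exact hreal (p.1, p.2.2)
  -- the second Lagrangian subspace over the ends
  let Θ : I × I × S1 → E7 →ₗ[ℝ] C3 := fun p =>
    ((LinearMap.lsmul ℂ C3 Complex.I).restrictScalars ℝ) ∘ₗ Ψ p
  have hΘa (p v) : Θ p v = Complex.I • Ψ p v := rfl
  have hΘsymp (p v w) : stdSymp (Θ p v) (Θ p w) =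
      gForm (hlam.coordAt (u.map p)) (u.velE p) v w := by
    rw [hΘa, hΘa, stdSymp_I_smul, hΨsymp]
  have hΘinj (p : I × I × S1) (v : E7) (hv : u.pr hlam p v = v) (h0 : Θ p v = 0) : v = 0 :=
    hΨinj p v hv ((smul_eq_zero.1 h0).resolve_left Complex.I_ne_zero)
  have hΘcont {Y : Type} [TopologicalSpace Y] {g : Y → I × I × S1} {s : Y → E7} {y₀ : Y}
      (hg : ContinuousAt g y₀) (hs : ContinuousAt (fun y => tb (u.map (g y)) (s y)) y₀) :
      ContinuousAt (fun y => Θ (g y) (s y)) y₀ := (hΨcont hg hs).const_smul Complex.I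
  have hloc := (u.secFramed₂ hlam hi₂).map (fun q => Θ (q.1, 1, q.2))
    (fun s q₀ hs => hΘcont (g := fun q : I × S1 => (q.1, 1, q.2)) (by fun_prop) hs)
    (fun q x hx h0 => hΘinj _ x (gProj_of_mem_horL hlam (u.velE_ne_zero _) hx) h0)
  have htr (a : I) (ha : a = 0 ∨ a = 1) (z : S1) :
      ∀ x ∈ (u.L₂ hlam (a, 1, z)).map (Θ (a, 1, z)), (∀ k, (x k).re = 0) → x = 0 := by
    rintro _ ⟨v, hv, rfl⟩ h0
    have h1 : Ψ (a, 1, z) v ∈ realC3 := fun k => by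
      have := h0 k
      rw [hΘa] at this
      simpa using this
    rw [← hreal' (a, 1, z) ha] at h1
    obtain ⟨w, hw, hw'⟩ := h1
    have h2 : w - v = 0 := by
      refine hΨinj (a, 1, z) (w - v) ?_ (by rw [map_sub, hw', sub_self])
      rw [map_sub]
      exact congrArg₂ _ (gProj_of_mem_horL hlam (u.velE_ne_zero _) hw)
        (gProj_of_mem_horL hlam (u.velE_ne_zero _) hv)
    have h3 : w = v := sub_eq_zero.1 h2
    rw [u.eq_zero_of_mem hlam hi₁ hi₂ htrans ha (h3 ▸ hw) hv, map_zero]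
  -- In the coordinates Θ = iΨ the space L₁ is iℝ³ over the ends. There L₂ is Lagrangian and
  -- transversal to it, hence a graph over ℝ³.
  have hS (a : I) (ha : a = 0 ∨ a = 1) : ∃ S : S1 → Matrix (Fin 3) (Fin 3) ℝ, Continuous S ∧
      (∀ z, (S z).transpose = S z) ∧ ∀ z, ∀ x ∈ (u.L₂ hlam (a, 1, z)).map (Θ (a, 1, z)),
        ∀ k, (x k).im = (S z).mulVec (fun j => (x j).re) k := by
    have h1 := hloc.comp (by fun_prop : Continuous fun z : S1 => (a, z))
    have h2 (z : S1) := exists_graph_matrix (h1.finrank_eq z) (by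
      rintro _ ⟨v, hv, rfl⟩ _ ⟨w, hw, rfl⟩
      rw [hΘsymp]
      exact gForm_horL hlam hi₂ (u.side₂ _ _) (u.velE_ne_zero _) (u.velE_mem₂ hi₂ _ _) hv hw)
      (htr a ha z)
    choose S hS1 hS2 using h2
    exact ⟨S, continuous_graph_matrix h1 (htr a ha) hS2, hS1, hS2⟩
  obtain ⟨S₀, hS₀, hS₀t, hS₀'⟩ := hS 0 (Or.inl rfl)
  obtain ⟨S₁, hS₁, hS₁t, hS₁'⟩ := hS 1 (Or.inr rfl)
  -- Symmetric matrices form a vector space, so the families over the two ends can be joined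
  -- linearly in a. The result does not depend on b.
  let S : I × I × S1 → Matrix (Fin 3) (Fin 3) ℝ := fun p =>
    (1 - (p.1 : ℝ)) • S₀ p.2.2 + (p.1 : ℝ) • S₁ p.2.2
  have hSc : Continuous S := by fun_prop
  have hSt (p) : (S p).transpose = S p := by
    simp only [S, Matrix.transpose_add, Matrix.transpose_smul, hS₀t, hS₁t]
  have hSx (p : I × I × S1) (hp : p.1 = 0 ∨ p.1 = 1) : ∀ x ∈ (u.L₂ hlam p).map (Θ p),
      ∀ k, (x k).im = (S p).mulVec (fun j => (x j).re) k := by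
    rw [u.L₂_const hlam (q := (p.1, 1, p.2.2)) hp rfl rfl]
    have h1 : Θ p = Θ (p.1, 1, p.2.2) := by
      simp only [Θ, hΨconst p (p.1, 1, p.2.2) hp rfl rfl]
    rw [h1]
    rcases hp with h | h
    · have h2 : S p = S₀ p.2.2 := by simp [S, h]
      rw [h2, h]
      exact hS₀' p.2.2
    · have h2 : S p = S₁ p.2.2 := by simp [S, h]
      rw [h2, h]
      exact hS₁' p.2.2
  -- The shear is symplectic, fixes iℝ³ and maps the graph of S to ℝ³, which gives L₁ = i L₂ over
  -- the ends.
  let T : I × I × S1 → E7 →ₗ[ℝ] C3 := fun p => shear (S p) ∘ₗ Θ p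
  have hTa (p v) : T p v = shear (S p) (Θ p v) := rfl
  have hL₁ (p : I × I × S1) (hp : (u.L₁ hlam p).map (Ψ p) = realC3) :
      (u.L₁ hlam p).map (T p) = cmul Complex.I realC3 := by
    rw [cmul, ← hp, ← Submodule.map_comp]
    ext x
    simp only [Submodule.mem_map]
    refine exists_congr fun v => and_congr_right fun hv => ?_
    have h1 : Ψ p v ∈ realC3 := hp ▸ ⟨v, hv, rfl⟩
    have h2 : T p v = Complex.I • Ψ p v := by
      rw [hTa, hΘa]
      ext k
      have h3 : (fun j => ((Complex.I • Ψ p v) j).re) = 0 := by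
        ext j
        simpa using mem_realC3.1 h1 j
      rw [shear_apply, h3, Matrix.mulVec_zero, Pi.zero_apply, sub_zero]
    rw [h2]
    rfl
  have hL₂ (p : I × I × S1) (hp : p.1 = 0 ∨ p.1 = 1) : (u.L₂ hlam p).map (T p) = realC3 := by
    refine Submodule.eq_of_le_of_finrank_eq ?_ ?_
    · rintro _ ⟨v, hv, rfl⟩ k
      rw [hTa, shear_apply]
      exact sub_eq_zero.2 (hSx p hp _ ⟨v, hv, rfl⟩ k)
    · have h := finrank_map_of_injOn (L := u.L₂ hlam p) (T := T p) fun v hv h0 =>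
        hΘinj p v (gProj_of_mem_horL hlam (u.velE_ne_zero _) hv)
          (shear_eq_zero (S := S p) (by rw [← hTa]; exact h0))
      rw [finrank_realC3, h]
      exact finrank_horL hlam hi₂ (mem_range_ends p hp).2 (u.velE_ne_zero _)
        (velE_mem_ends hi₁ hi₂ p hp).2
  obtain ⟨Φ, hΦ⟩ := exists_sympTrivialization hlam T
    (fun p v w => by rw [hTa, hTa, stdSymp_shear (hSt p), hΘsymp])
    (fun {Y} _ {g s y₀} hg hs => by
      exact continuous_shear.continuousAt.tendsto.comp
        ((hSc.continuousAt.tendsto.comp hg).prodMk_nhds (hΘcont hg hs)))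
    (fun p hp => by
      simp only [T, Θ, hΨconst p (p.1, 0, p.2.2) hp rfl rfl]
      rfl)
    (fun p hp => by rw [hL₁ p (hreal' p hp), hL₂ p hp])
  refine ⟨Φ, ?_⟩
  have hℓ (z : S1) : Φ.boundaryMap (loopS z) = cmul Complex.I realC3 := by
    have h1 : Φ.boundaryMap (loopS z) = Φ.lagr₁ (0, 0, z) := by
      simp [SympTrivialization.boundaryMap, loopS]
    rw [h1, Φ.lagr₁_eq hlam, hΦ]
    exact hL₁ (0, 0, z) (hreal (0, z))
  -- Along S the subspace is the constant iℝ³, spanned by the columns of i·1. The square of the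
  -- determinant is i⁶ = −1, with the constant argument of half a turn.
  refine ⟨fun z => ?_, fun _ => Complex.I • 1, continuous_const, fun t => ?_, fun t => ?_, ?_⟩
  · beta_reduce
    rw [hℓ]
    rintro _ ⟨x, hx, rfl⟩ _ ⟨y, hy, rfl⟩
    change stdSymp (Complex.I • x) (Complex.I • y) = 0
    rw [stdSymp_I_smul, stdSymp_eq_sum]
    simp [mem_realC3.1 hx, mem_realC3.1 hy]
  · exact span_I_one.trans (hℓ _).symm
  · simp
  · refine ⟨fun _ => 1 / 2, continuous_const, fun t => ?_, by simp⟩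
    have h1 : (Complex.I • (1 : Matrix (Fin 3) (Fin 3) ℂ)).det ^ 2 = -1 := by
      rw [Matrix.det_smul, Matrix.det_one, mul_one, Fintype.card_fin, ← pow_mul]
      have : Complex.I ^ (3 * 2) = (Complex.I ^ 2) ^ 3 := by rw [← pow_mul]
      rw [this, Complex.I_sq]; norm_num
    beta_reduce
    rw [h1]
    have h2 : (2 * Real.pi * ((1 / 2 : ℝ) : ℂ) * Complex.I) = Real.pi * Complex.I := by
      push_cast; ring
    rw [h2, Complex.exp_pi_mul_I]
    simp

end Existence

/-! ### Continuous arguments. -/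

section Args

/-- `θ` is an argument of the nonzero complex number `w`. -/
def IsArg (θ : ℝ) (w : ℂ) : Prop := ∃ r : ℝ, 0 < r ∧ w = r * Complex.exp (θ * Complex.I)

lemma IsArg.ne_zero {θ : ℝ} {w : ℂ} (h : IsArg θ w) : w ≠ 0 := by
  obtain ⟨r, hr, rfl⟩ := h
  exact mul_ne_zero (by exact_mod_cast hr.ne') (Complex.exp_ne_zero _)

lemma IsArg.mul {θ θ' : ℝ} {w w' : ℂ} (h : IsArg θ w) (h' : IsArg θ' w') :
    IsArg (θ + θ') (w * w') := by
  obtain ⟨r, hr, rfl⟩ := h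
  obtain ⟨r', hr', rfl⟩ := h'
  refine ⟨r * r', mul_pos hr hr', ?_⟩
  push_cast
  rw [add_mul, Complex.exp_add]
  ring

lemma IsArg.inv {θ : ℝ} {w : ℂ} (h : IsArg θ w) : IsArg (-θ) w⁻¹ := by
  obtain ⟨r, hr, rfl⟩ := h
  refine ⟨r⁻¹, inv_pos.2 hr, ?_⟩
  push_cast
  rw [neg_mul, Complex.exp_neg, mul_inv]

lemma IsArg.div {θ θ' : ℝ} {w w' : ℂ} (h : IsArg θ w) (h' : IsArg θ' w') :
    IsArg (θ - θ') (w / w') := by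
  rw [div_eq_mul_inv, sub_eq_add_neg]
  exact h.mul h'.inv

lemma isArg_ofReal {r : ℝ} (hr : 0 < r) : IsArg 0 (r : ℂ) := ⟨r, hr, by simp⟩

lemma isArg_exp (θ : ℝ) : IsArg θ (Complex.exp (θ * Complex.I)) := ⟨1, one_pos, by simp⟩

lemma isArg_arg {w : ℂ} (h : w ≠ 0) : IsArg w.arg w :=
  ⟨‖w‖, norm_pos_iff.2 h, (Complex.norm_mul_exp_arg_mul_I w).symm⟩

lemma isArg_neg {r : ℝ} (hr : r < 0) : IsArg Real.pi (r : ℂ) :=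
  ⟨-r, neg_pos.2 hr, by simp [Complex.exp_pi_mul_I]⟩

lemma IsArg.pow {θ : ℝ} {w : ℂ} (h : IsArg θ w) (n : ℕ) : IsArg (n * θ) (w ^ n) := by
  obtain ⟨r, hr, rfl⟩ := h
  refine ⟨r ^ n, pow_pos hr n, ?_⟩
  push_cast
  rw [mul_pow, ← Complex.exp_nat_mul]
  congr 2
  ring

lemma IsArg.zpow {θ : ℝ} {w : ℂ} (h : IsArg θ w) (n : ℤ) : IsArg (n * θ) (w ^ n) := by
  obtain ⟨r, hr, rfl⟩ := h
  refine ⟨r ^ n, zpow_pos hr n, ?_⟩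
  push_cast
  rw [mul_zpow, ← Complex.exp_int_mul]
  congr 2
  ring

lemma IsArg.eq_norm {θ : ℝ} {w : ℂ} (h : IsArg θ w) :
    w = ‖w‖ * Complex.exp (θ * Complex.I) := by
  obtain ⟨r, hr, rfl⟩ := h
  simp [Complex.norm_exp_ofReal_mul_I, abs_of_pos hr]

lemma IsArg.exists_int {θ θ' : ℝ} {w : ℂ} (h : IsArg θ w) (h' : IsArg θ' w) :
    ∃ n : ℤ, θ - θ' = n * (2 * Real.pi) := by
  have h1 := h.eq_norm.symm.trans h'.eq_norm
  have h2 := mul_left_cancel₀ (by simpa using h.ne_zero) h1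
  obtain ⟨n, hn⟩ := Complex.exp_eq_exp_iff_exists_int.1 h2
  refine ⟨n, ?_⟩
  have h3 := congrArg Complex.im hn
  simp at h3
  linarith

lemma IsArg.add_int {θ : ℝ} {w : ℂ} (h : IsArg θ w) (n : ℤ) :
    IsArg (θ + n * (2 * Real.pi)) w := by
  obtain ⟨r, hr, rfl⟩ := h
  refine ⟨r, hr, ?_⟩
  have : ((θ + n * (2 * Real.pi) : ℝ) : ℂ) * Complex.I =
      θ * Complex.I + n * (2 * Real.pi * Complex.I) := by push_cast; ring
  rw [this, Complex.exp_add, Complex.exp_int_mul_two_pi_mul_I, mul_one]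

lemma IsArg.arg_eq {θ : ℝ} {w : ℂ} (h : IsArg θ w) (h' : θ ∈ Ioc (-Real.pi) Real.pi) :
    w.arg = θ := by
  obtain ⟨r, hr, rfl⟩ := h
  rw [Complex.arg_real_mul _ hr, Complex.arg_exp_mul_I]
  exact (toIocMod_eq_self _).2 (by rwa [show -Real.pi + 2 * Real.pi = Real.pi by ring])

/-- A continuous real function with integral values on a connected space is constant. -/
lemma eq_of_forall_exists_int {Y : Type*} [TopologicalSpace Y] [PreconnectedSpace Y] {g : Y → ℝ}
    (hg : Continuous g) (h : ∀ y, ∃ n : ℤ, g y = n) (y y' : Y) : g y = g y' := by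
  choose k hk using h
  have h1 : Continuous k := by
    rw [Int.isClosedEmbedding_coe_real.isInducing.continuous_iff]
    exact hg.congr hk
  rw [hk, hk, PreconnectedSpace.constant inferInstance h1 (x := y) (y := y')]

lemma arg_sub_arg_eq {Y : Type*} [TopologicalSpace Y] [PreconnectedSpace Y] {f : Y → ℂ}
    {θ θ' : Y → ℝ} (hθ : Continuous θ) (hθ' : Continuous θ') (h : ∀ y, IsArg (θ y) (f y))
    (h' : ∀ y, IsArg (θ' y) (f y)) (y y' : Y) : θ y - θ' y = θ y' - θ' y' := by
  have h1 := eq_of_forall_exists_int (g := fun y => (θ y - θ' y) / (2 * Real.pi))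
    ((hθ.sub hθ').div_const _) (fun y => by
      obtain ⟨n, hn⟩ := (h y).exists_int (h' y)
      exact ⟨n, by rw [hn]; field_simp⟩) y y'
  have h2 : (2 * Real.pi) ≠ 0 := by positivity
  exact (div_left_inj' h2).1 h1

/-- Homotopy lifting for arguments. -/
theorem exists_arg {Y : Type*} [TopologicalSpace Y] {f : I × Y → ℂ} (hf : Continuous f)
    (h0 : ∀ q, f q ≠ 0) {θ₀ : Y → ℝ} (hθ : Continuous θ₀) (h : ∀ y, IsArg (θ₀ y) (f (0, y))) :
    ∃ θ : I × Y → ℝ, Continuous θ ∧ (∀ q, IsArg (θ q) (f q)) ∧ ∀ y, θ (0, y) = θ₀ y := by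
  -- An argument is the imaginary part of a lift through the covering exp : ℂ → ℂ∖{0}; the given
  -- argument supplies the initial lift.
  let H : C(I × Y, {z : ℂ // z ≠ 0}) := ⟨fun q => ⟨f q, h0 q⟩, hf.subtype_mk _⟩
  have hf0 : Continuous fun y => f (0, y) := hf.comp (by fun_prop)
  let g : C(Y, ℂ) := ⟨fun y => (Real.log ‖f (0, y)‖ : ℂ) + θ₀ y * Complex.I, by
    have : Continuous fun y => Real.log ‖f (0, y)‖ :=
      hf0.norm.log fun y => norm_ne_zero_iff.2 (h0 _)
    fun_prop⟩
  have hg (y : Y) : H (0, y) = ⟨_, (g y).exp_ne_zero⟩ := by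
    apply Subtype.ext
    simp only [H, g, ContinuousMap.coe_mk]
    rw [Complex.exp_add, ← Complex.ofReal_exp, Real.exp_log (norm_pos_iff.2 (h0 _))]
    exact (h y).eq_norm
  let K := Complex.isCoveringMap_exp.liftHomotopy H g hg
  refine ⟨fun q => (K q).im, by fun_prop, fun q => ?_, fun y => ?_⟩
  · have h1 : f q = Complex.exp (K q) :=
      (congrArg Subtype.val
        (congrFun (Complex.isCoveringMap_exp.liftHomotopy_lifts H g hg) q)).symm
    refine ⟨Real.exp (K q).re, Real.exp_pos _, ?_⟩
    rw [h1, Complex.ofReal_exp, ← Complex.exp_add, Complex.re_add_im]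
  · have h1 : K (0, y) = g y := Complex.isCoveringMap_exp.liftHomotopy_zero H g hg y
    simp [h1, g]

end Args

/-! ### Deformation of a symplectic map to a complex linear one. -/

section Determinants

variable {V : Type*} [AddCommGroup V] [Module ℝ V] {A : V ≃ₗ[ℝ] (Fin 7 → ℝ)} {e : V}
  {T : V →ₗ[ℝ] C3}

variable (A e T) in
/-- The map `T - s i T J`; for `s = 1` it is, up to a factor, the `J`-linear part of `T`. -/
def linPart (s : ℝ) : V →ₗ[ℝ] C3 :=
  T - s • (((LinearMap.lsmul ℂ C3 Complex.I).restrictScalars ℝ) ∘ₗ T ∘ₗ gJ A e)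

lemma linPart_apply (s : ℝ) (v : V) :
    linPart A e T s v = T v - s • Complex.I • T (gJ A e v) := rfl

lemma linPart_zero : linPart A e T 0 = T := by simp [linPart]

variable (A e T) in
/-- The determinant of `T - s i T J` on a triple of vectors. -/
def linDet (s : ℝ) (x : Fin 3 → V) : ℂ := (Matrix.of fun k => linPart A e T s (x k)).det

lemma linDet_zero (x : Fin 3 → V) : linDet A e T 0 x = (Matrix.of fun k => T (x k)).det := by
  rw [linDet, linPart_zero]

lemma det_of_frameMul (S : V →ₗ[ℝ] C3) (x : Fin 3 → V) (g : Matrix (Fin 3) (Fin 3) ℝ) :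
    (Matrix.of fun k => S (frameMul x g k)).det = g.det * (Matrix.of fun k => S (x k)).det := by
  have h : (Matrix.of fun k => S (frameMul x g k)) =
      (g.map Complex.ofRealHom).transpose * Matrix.of fun k => S (x k) := by
    ext k j
    simp [frameMul, Matrix.mul_apply, map_sum, map_smul]
  rw [h, Matrix.det_mul, Matrix.det_transpose]
  congr 1
  exact (RingHom.map_det Complex.ofRealHom g).symm

lemma linDet_frameMul (s : ℝ) (x : Fin 3 → V) (g : Matrix (Fin 3) (Fin 3) ℝ) :
    linDet A e T s (frameMul x g) = g.det * linDet A e T s x :=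
  det_of_frameMul _ _ _

/-- A vanishing determinant gives v, w in the Lagrangian subspace, not both 0, with P + iQ = 0 for P
= T v + s T J w and Q = T w − s T J v. Then the pairing of P with Q is |Q|² ≥ 0. As T is symplectic
and the subspace Lagrangian, it is also −s(ω(v, J v) + ω(w, J w)) ≤ 0. Both vanish: if s ≠ 0 then v
= w = 0 by positivity; if s = 0 then T v = T w = 0. -/
lemma linDet_ne_zero (hT : ∀ v w, stdSymp (T v) (T w) = gForm A e v w)
    (he : e ≠ 0) {x : Fin 3 → V} (hx : ∀ k, gProj A e (x k) = x k)
    (hli : LinearIndependent ℝ x)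
    (hlag : ∀ v ∈ Submodule.span ℝ (range x), ∀ w ∈ Submodule.span ℝ (range x),
      gForm A e v w = 0) {s : ℝ} (hs : 0 ≤ s) : linDet A e T s x ≠ 0 := by
  intro hdet
  obtain ⟨c, hc0, hc⟩ := Matrix.exists_vecMul_eq_zero_iff.2 hdet
  set v := ∑ k, (c k).re • x k with hv
  set w := ∑ k, (c k).im • x k with hw
  have hvx : v ∈ Submodule.span ℝ (range x) :=
    Submodule.sum_mem _ fun k _ => Submodule.smul_mem _ _ (Submodule.subset_span ⟨k, rfl⟩)
  have hwx : w ∈ Submodule.span ℝ (range x) :=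
    Submodule.sum_mem _ fun k _ => Submodule.smul_mem _ _ (Submodule.subset_span ⟨k, rfl⟩)
  have hpv : gProj A e v = v := by simp [hv, hx]
  have hpw : gProj A e w = w := by simp [hw, hx]
  have h1 : linPart A e T s v + Complex.I • linPart A e T s w = 0 := by
    rw [← hc, hv, hw, map_sum, map_sum, Finset.smul_sum, ← Finset.sum_add_distrib]
    ext j
    simp only [Matrix.vecMul, dotProduct, Finset.sum_apply, Matrix.of_apply, Pi.add_apply,
      Pi.smul_apply, map_smul, smul_eq_mul, Complex.real_smul]
    refine Finset.sum_congr rfl fun k _ => ?_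
    conv_rhs => rw [← Complex.re_add_im (c k)]
    ring
  set P := T v + s • T (gJ A e w) with hP
  set Q := T w - s • T (gJ A e v) with hQ
  have h2 : P = -(Complex.I • Q) := by
    rw [eq_neg_iff_add_eq_zero, ← h1, hP, hQ, linPart_apply, linPart_apply]
    ext j
    simp only [Pi.add_apply, Pi.sub_apply, Pi.smul_apply, smul_eq_mul, Complex.real_smul]
    ring_nf
    rw [Complex.I_sq]
    ring
  have h3 : stdSymp P Q = ∑ k, Complex.normSq (Q k) := by
    rw [h2, ← stdSymp_self_I, stdSymp_comm, ← neg_one_smul ℝ (Complex.I • Q),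
      stdSymp_smul_right]
    ring
  have h4 : stdSymp P Q = -(s * (gForm A e v (gJ A e v) + gForm A e w (gJ A e w))) := by
    rw [hP, hQ, sub_eq_add_neg, ← neg_smul, stdSymp_add_left, stdSymp_add_right,
      stdSymp_add_right, stdSymp_smul_left, stdSymp_smul_left, stdSymp_smul_right,
      stdSymp_smul_right, hT, hT, hT, hT, hlag v hvx w hwx, gForm_gJ_gJ he, hlag w hwx v hvx,
      gForm_gJ_left he]
    ring
  have hpos {v : V} (hv : gProj A e v = v) : 0 ≤ gForm A e v (gJ A e v) := by
    by_cases h : v ∈ Submodule.span ℝ {e}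
    · rw [(gProj_mem_span_iff he hv).1 h, gForm_gJ_right he]; simp
    · exact (gForm_gJ_pos he h).le
  have hzero {v : V} (hv : gProj A e v = v) (h : gForm A e v (gJ A e v) = 0) : v = 0 := by
    by_contra h0
    exact (gForm_gJ_pos he fun h' => h0 ((gProj_mem_span_iff he hv).1 h')).ne' h
  have hQ0 : 0 ≤ ∑ k, Complex.normSq (Q k) := Finset.sum_nonneg fun k _ => Complex.normSq_nonneg _
  have h5 : s * (gForm A e v (gJ A e v) + gForm A e w (gJ A e w)) = 0 :=
    le_antisymm (by linarith) (mul_nonneg hs (add_nonneg (hpos hpv) (hpos hpw)))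
  have hvw : v = 0 ∧ w = 0 := by
    rcases mul_eq_zero.1 h5 with h | h
    · have h6 : ∑ k, Complex.normSq (Q k) = 0 := by rw [← h3, h4, h5, neg_zero]
      have h7 : Q = 0 := by
        ext k
        exact Complex.normSq_eq_zero.1 ((Finset.sum_eq_zero_iff_of_nonneg
          fun k _ => Complex.normSq_nonneg _).1 h6 k (Finset.mem_univ k))
      rw [h7, smul_zero, neg_zero] at h2
      rw [hP, h, zero_smul, add_zero] at h2
      rw [hQ, h, zero_smul, sub_zero] at h7
      exact ⟨(gProj_mem_span_iff he hpv).1 (mem_span_of_stdSymp he hT h2),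
        (gProj_mem_span_iff he hpw).1 (mem_span_of_stdSymp he hT h7)⟩
    · have h6 := hpos hpv
      have h7 := hpos hpw
      exact ⟨hzero hpv (by linarith), hzero hpw (by linarith)⟩
  apply hc0
  ext k
  exact Complex.ext (Fintype.linearIndependent_iff.1 hli _ hvw.1 k)
    (Fintype.linearIndependent_iff.1 hli _ hvw.2 k)

lemma linPart_one_gJ (hT : ∀ v w, stdSymp (T v) (T w) = gForm A e v w)
    (he : e ≠ 0) (v : V) :
    linPart A e T 1 (gJ A e v) = Complex.I • linPart A e T 1 v := by
  have h1 : T (gJ A e (gJ A e v)) = -T v := by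
    rw [← neg_neg (gJ A e (gJ A e v)), ← gProj_eq, map_neg,
      lin_gProj he (apply_self_of_stdSymp he hT)]
  rw [linPart_apply, linPart_apply, h1]
  ext j
  simp only [Pi.sub_apply, Pi.smul_apply, Pi.neg_apply, smul_eq_mul, one_smul]
  ring_nf
  rw [Complex.I_sq]
  ring

lemma linPart_one_self (hT : ∀ v w, stdSymp (T v) (T w) = gForm A e v w)
    (he : e ≠ 0) : linPart A e T 1 e = 0 := by
  rw [linPart_apply, gJ_self, apply_self_of_stdSymp he hT, map_zero, smul_zero, smul_zero, sub_zero]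

lemma linDet_one_mul_gVol (hT : ∀ v w, stdSymp (T v) (T w) = gForm A e v w)
    (he : e ≠ 0) {y : Fin 3 → V}
    (hvol : gVol A e (y 0) (y 1) (y 2) ≠ 0) (x : Fin 3 → V) :
    linDet A e T 1 x * gVol A e (y 0) (y 1) (y 2) =
      linDet A e T 1 y * gVol A e (x 0) (x 1) (x 2) := by
  have h := det_mul_gVol (T := linPart A e T 1) he (linPart_one_gJ hT he)
    (y := fun k => gProj A e (y k)) (fun k => gProj_gProj he _)
    (by rwa [gVol_gProj_gProj_gProj he]) x
  rw [gVol_gProj_gProj_gProj he] at h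
  simp only [lin_gProj he (linPart_one_self hT he)] at h
  exact h

/-- A vector v killed by the J-linear part satisfies T v = i T J v. Then ω(v, J v) = −|T J v|²,
against positivity unless v = 0. -/
lemma linDet_one_ne_zero (hT : ∀ v w, stdSymp (T v) (T w) = gForm A e v w)
    (he : e ≠ 0) {y : Fin 3 → V}
    (hvol : gVol A e (y 0) (y 1) (y 2) ≠ 0) : linDet A e T 1 y ≠ 0 := by
  intro hdet
  obtain ⟨c, hc0, hc⟩ := Matrix.exists_vecMul_eq_zero_iff.2 hdet
  set y' : Fin 3 → V := fun k => gProj A e (y k) with hy'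
  have hy'p (k) : gProj A e (y' k) = y' k := gProj_gProj he _
  have hinj := cplx_injective_of_gVol_ne_zero he hy'p (by rwa [gVol_gProj_gProj_gProj he])
  have h1 : linPart A e T 1 (cplx A e y' c) = 0 := by
    rw [← hc, cplx_apply, map_sum]
    ext j
    simp only [Matrix.vecMul, dotProduct, Finset.sum_apply, Matrix.of_apply, map_add, map_smul,
      linPart_one_gJ hT he, hy', lin_gProj he (linPart_one_self hT he), Pi.add_apply,
      Pi.smul_apply, smul_eq_mul, Complex.real_smul]
    refine Finset.sum_congr rfl fun k _ => ?_
    conv_rhs => rw [← Complex.re_add_im (c k)]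
    ring
  set v := cplx A e y' c with hv
  have h2 : T v = Complex.I • T (gJ A e v) := by
    rw [linPart_apply, one_smul] at h1
    exact sub_eq_zero.1 h1
  have h3 : gForm A e v (gJ A e v) = -∑ k, Complex.normSq (T (gJ A e v) k) := by
    rw [← hT, h2, ← stdSymp_self_I, stdSymp_comm]
  have h4 : v = 0 := by
    by_contra h0
    have h5 := gForm_gJ_pos (A := A) he fun h' => h0 ((gProj_mem_span_iff he (gProj_cplx he hy'p c)).1 h')
    have h6 : 0 ≤ ∑ k, Complex.normSq (T (gJ A e v) k) :=
      Finset.sum_nonneg fun k _ => Complex.normSq_nonneg _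
    linarith
  exact hc0 (hinj (by rw [map_zero]; exact h4))

variable (A e T) in
/-- The ratio of the determinant of the `J`-linear part of `T` and the complex volume form. -/
def volRatio : ℂ := by
  classical
  exact if h : ∃ y : Fin 3 → V, gVol A e (y 0) (y 1) (y 2) ≠ 0 then
    linDet A e T 1 h.choose / gVol A e (h.choose 0) (h.choose 1) (h.choose 2) else 0

lemma exists_gVol_ne_zero_fun (he : e ≠ 0) : ∃ y : Fin 3 → V, gVol A e (y 0) (y 1) (y 2) ≠ 0 := by
  obtain ⟨x, y, z, h⟩ := exists_gVol_ne_zero (A := A) he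
  exact ⟨![x, y, z], h⟩

/-- At s = 1 both determinants are alternating and J-linear. `linDet_one_mul_gVol` shows that their
quotient does not depend on the frame chosen in `volRatio`. -/
lemma linDet_one (hT : ∀ v w, stdSymp (T v) (T w) = gForm A e v w)
    (he : e ≠ 0) (x : Fin 3 → V) :
    linDet A e T 1 x = volRatio A e T * gVol A e (x 0) (x 1) (x 2) := by
  have h := exists_gVol_ne_zero_fun (A := A) he
  rw [volRatio, dif_pos h, div_mul_eq_mul_div, eq_div_iff h.choose_spec]
  exact linDet_one_mul_gVol hT he h.choose_spec x

lemma volRatio_ne_zero (hT : ∀ v w, stdSymp (T v) (T w) = gForm A e v w)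
    (he : e ≠ 0) : volRatio A e T ≠ 0 := by
  obtain ⟨y, hy⟩ := exists_gVol_ne_zero_fun (A := A) he
  have h1 := linDet_one_ne_zero hT he hy
  rw [linDet_one hT he] at h1
  exact left_ne_zero_of_mul h1

end Determinants

/-! ### Symplectic transvections along a Lagrangian subspace. -/

section Shear

variable {V : Type*} [AddCommGroup V] [Module ℝ V] {A : V ≃ₗ[ℝ] (Fin 7 → ℝ)} {e : V}

variable (A e) in
/-- The symplectic form as a bilinear map. -/
def gBil : V →ₗ[ℝ] V →ₗ[ℝ] ℝ :=
  LinearMap.mk₂ ℝ (gForm A e)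
    (fun v v' w => by
      rw [gForm_swap23 e w, gForm_add3, gForm_swap23 e v w, gForm_swap23 e v' w]; ring)
    (fun c v w => by rw [gForm_swap23 e w, gForm_smul3, gForm_swap23 e v w, smul_eq_mul]; ring)
    (fun v w w' => gForm_add3 e v w w') (fun c v w => gForm_smul3 e v w c)

lemma gBil_apply (v w : V) : gBil A e v w = gForm A e v w := rfl

lemma gBil_comm (v w : V) : gBil A e w v = -gBil A e v w := gForm_swap23 _ _ _

variable (A e) in
/-- The symplectic transvection along the span of `x` defined by the matrix `D`. -/
def sympShear (x : Fin 3 → V) (D : Matrix (Fin 3) (Fin 3) ℝ) : V →ₗ[ℝ] V :=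
  LinearMap.id - ∑ j, ∑ l, D j l • (gBil A e (x l)).smulRight (x j)

variable {x : Fin 3 → V}

lemma sympShear_apply (D : Matrix (Fin 3) (Fin 3) ℝ) (v : V) :
    sympShear A e x D v = v - ∑ j, ∑ l, (D j l * gBil A e (x l) v) • x j := by
  simp [sympShear, LinearMap.sum_apply, smul_smul]

lemma sympShear_smul (c : ℝ) (D : Matrix (Fin 3) (Fin 3) ℝ) (v : V) :
    sympShear A e x (c • D) v = v - c • (v - sympShear A e x D v) := by
  rw [sympShear_apply, sympShear_apply, sub_sub_cancel, Finset.smul_sum]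
  congr 1
  refine Finset.sum_congr rfl fun j _ => ?_
  rw [Finset.smul_sum]
  refine Finset.sum_congr rfl fun l _ => ?_
  rw [smul_smul, Matrix.smul_apply, smul_eq_mul, mul_assoc]

lemma gProj_sympShear (hp : ∀ k, gProj A e (x k) = x k) (D : Matrix (Fin 3) (Fin 3) ℝ) {v : V}
    (hv : gProj A e v = v) : gProj A e (sympShear A e x D v) = sympShear A e x D v := by
  simp [sympShear_apply, hp, hv]

lemma sympShear_self (hx : ∀ j k, gBil A e (x j) (x k) = 0)
    (D : Matrix (Fin 3) (Fin 3) ℝ) (k : Fin 3) :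
    sympShear A e x D (x k) = x k := by
  simp [sympShear_apply, hx]

lemma gBil_sympShear_left (hx : ∀ j k, gBil A e (x j) (x k) = 0)
    (D : Matrix (Fin 3) (Fin 3) ℝ) (k : Fin 3) (v : V) :
    gBil A e (x k) (sympShear A e x D v) = gBil A e (x k) v := by
  simp [sympShear_apply, map_sum, hx]

lemma sympShear_sympShear (hx : ∀ j k, gBil A e (x j) (x k) = 0)
    (D D' : Matrix (Fin 3) (Fin 3) ℝ) (v : V) :
    sympShear A e x D (sympShear A e x D' v) = sympShear A e x (D + D') v := by
  rw [sympShear_apply D, sympShear_apply (D + D')]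
  simp only [gBil_sympShear_left hx]
  rw [sympShear_apply D', sub_sub, ← Finset.sum_add_distrib]
  congr 1
  refine Finset.sum_congr rfl fun j _ => ?_
  rw [← Finset.sum_add_distrib]
  refine Finset.sum_congr rfl fun l _ => ?_
  rw [← add_smul, Matrix.add_apply]
  congr 1
  ring

/-- The quadratic correction vanishes because the span of x is isotropic, and the two linear ones
cancel because D is symmetric. -/
lemma gBil_sympShear (hx : ∀ j k, gBil A e (x j) (x k) = 0)
    {D : Matrix (Fin 3) (Fin 3) ℝ} (hD : D.transpose = D) (v w : V) :
    gBil A e (sympShear A e x D v) (sympShear A e x D w) = gBil A e v w := by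
  have h0 : gBil A e (sympShear A e x D v) (sympShear A e x D w) = gBil A e v w -
      ∑ j, ∑ l, (D j l * gBil A e (x l) w) * gBil A e v (x j) -
      ∑ j, ∑ l, (D j l * gBil A e (x l) v) * gBil A e (x j) w := by
    rw [sympShear_apply D v]
    rw [map_sub, LinearMap.sub_apply, map_sum, LinearMap.sum_apply]
    simp only [map_sum, LinearMap.sum_apply, map_smul, LinearMap.smul_apply, smul_eq_mul,
      gBil_sympShear_left hx]
    rw [sympShear_apply D w]
    simp only [map_sub, map_sum, map_smul, smul_eq_mul]
  rw [h0, sub_sub, sub_eq_self, Finset.sum_comm (f := fun j l => D j l * gBil A e (x l) v * _),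
    ← Finset.sum_add_distrib]
  refine Finset.sum_eq_zero fun j _ => ?_
  rw [← Finset.sum_add_distrib]
  refine Finset.sum_eq_zero fun l _ => ?_
  have h1 : D l j = D j l := congrFun (congrFun hD j) l
  rw [h1, gBil_comm (x j) v]
  ring

end Shear

/-! ### Pairs of Lagrangian subspaces interchanged by i. -/

section Ends

variable {V : Type*} [AddCommGroup V] [Module ℝ V] {A : V ≃ₗ[ℝ] (Fin 7 → ℝ)} {e : V}
  {T : V →ₗ[ℝ] C3}

lemma frameMul_apply (x : Fin 3 → V) (g : Matrix (Fin 3) (Fin 3) ℝ) (k : Fin 3) :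
    frameMul x g k = ∑ j, g j k • x j := rfl

/-- The determinant is the characteristic polynomial of κP at i. Its imaginary part only involves
the coefficients i³ and iκ²b, where b is the second elementary symmetric function of the eigenvalues
of P. -/
lemma det_one_add_I_re (P : Matrix (Fin 3) (Fin 3) ℝ) :
    ∃ b : ℝ, ∀ κ : ℝ, (Matrix.of fun k j : Fin 3 => (Pi.single k Complex.I - 
      fun j => ((κ * P j k : ℝ) : ℂ) : C3) j).det.im = -1 + κ ^ 2 * b := by
  refine ⟨P 0 0 * P 1 1 + P 0 0 * P 2 2 + P 1 1 * P 2 2 - P 0 1 * P 1 0 - P 0 2 * P 2 0 -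
    P 1 2 * P 2 1, fun κ => ?_⟩
  rw [Matrix.det_fin_three]
  simp [Pi.single_apply]
  ring

/-- The matrices of `J` with respect to a pair of Lagrangian subspaces interchanged by `i`. -/
lemma exists_gJ_matrices (he : e ≠ 0) (hT : ∀ v w, stdSymp (T v) (T w) = gForm A e v w)
    {x₁ x₂ : Fin 3 → V} (hx₁ : ∀ k, gProj A e (x₁ k) = x₁ k) (hx₂ : ∀ k, gProj A e (x₂ k) = x₂ k)
    (hT₁ : ∀ k, T (x₁ k) = Complex.I • T (x₂ k))
    (hdet : (Matrix.of fun k => T (x₂ k)).det ≠ 0) :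
    ∃ P Q : Matrix (Fin 3) (Fin 3) ℝ, ∀ k, gJ A e (x₂ k) = frameMul x₂ P k + frameMul x₁ Q k := by
  set U := Matrix.of fun k => T (x₂ k) with hU
  let c : Fin 3 → C3 := fun k => Matrix.vecMul (T (gJ A e (x₂ k))) U⁻¹
  have hc (k) : T (gJ A e (x₂ k)) = Matrix.vecMul (c k) U := by
    simp only [c]
    rw [Matrix.vecMul_vecMul, Matrix.nonsing_inv_mul _ (isUnit_iff_ne_zero.2 hdet),
      Matrix.vecMul_one]
  refine ⟨Matrix.of fun j k => (c k j).re, Matrix.of fun j k => (c k j).im, fun k => ?_⟩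
  rw [← sub_eq_zero]
  refine (gProj_mem_span_iff (A := A) he ?_).1 (mem_span_of_stdSymp he hT ?_)
  · simp [frameMul_apply, gProj_gJ he, hx₁, hx₂]
  · rw [map_sub, map_add, hc, sub_eq_zero]
    ext j
    simp only [frameMul_apply, map_sum, map_smul, hT₁, Matrix.vecMul, dotProduct, Pi.add_apply,
      Finset.sum_apply, Pi.smul_apply, Matrix.of_apply, smul_eq_mul, Complex.real_smul, hU]
    rw [← Finset.sum_add_distrib]
    refine Finset.sum_congr rfl fun l _ => ?_
    conv_lhs => rw [← Complex.re_add_im (c k l)]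
    ring

lemma gForm_span_eq_zero {x : Fin 3 → V} (h : ∀ j k, gBil A e (x j) (x k) = 0) {v w : V}
    (hv : v ∈ Submodule.span ℝ (range x)) (hw : w ∈ Submodule.span ℝ (range x)) :
    gForm A e v w = 0 := by
  obtain ⟨c, rfl⟩ := (Submodule.mem_span_range_iff_exists_fun ℝ).1 hv
  obtain ⟨d, rfl⟩ := (Submodule.mem_span_range_iff_exists_fun ℝ).1 hw
  rw [← gBil_apply]
  simp [map_sum, LinearMap.sum_apply, h]

/-- There is a symplectic transvection along the span of `x₂` which maps the image under `J` of the
span of `x₂` to the span of `x₁`. -/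
lemma exists_sympShear_gJ (he : e ≠ 0) (hT : ∀ v w, stdSymp (T v) (T w) = gForm A e v w)
    {x₁ x₂ : Fin 3 → V} (hx₁ : ∀ k, gProj A e (x₁ k) = x₁ k) (hx₂ : ∀ k, gProj A e (x₂ k) = x₂ k)
    (hT₁ : ∀ k, T (x₁ k) = Complex.I • T (x₂ k)) (hli : LinearIndependent ℝ x₂)
    (hlag : ∀ j k, gBil A e (x₂ j) (x₂ k) = 0) :
    ∃ P Q D : Matrix (Fin 3) (Fin 3) ℝ, D.transpose = D ∧ Q.det ≠ 0 ∧
      (∀ k, sympShear A e x₂ D (gJ A e (x₂ k)) = frameMul x₁ Q k) ∧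
      ∀ k, gJ A e (x₂ k) - sympShear A e x₂ D (gJ A e (x₂ k)) = frameMul x₂ P k := by
  have hdet : (Matrix.of fun k => T (x₂ k)).det ≠ 0 := by
    rw [← linDet_zero (A := A) (e := e)]
    exact linDet_ne_zero hT he hx₂ hli (fun v hv w hw => gForm_span_eq_zero hlag hv hw) le_rfl
  obtain ⟨P, Q, hPQ⟩ := exists_gJ_matrices he hT hx₁ hx₂ hT₁ hdet
  have hlag₁ (j k) : gBil A e (x₁ j) (x₁ k) = 0 := by
    rw [gBil_apply, ← hT, hT₁, hT₁, stdSymp_I_smul, hT, ← gBil_apply, hlag]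
  set h : Matrix (Fin 3) (Fin 3) ℝ := Matrix.of fun l k => gBil A e (x₂ l) (gJ A e (x₂ k)) with hh
  set G : Matrix (Fin 3) (Fin 3) ℝ := Matrix.of fun l k => gBil A e (x₂ l) (x₁ k) with hG
  have hGQ : h = G * Q := by
    ext l k
    simp only [hh, hG, Matrix.of_apply, Matrix.mul_apply]
    rw [hPQ k]
    simp [frameMul_apply, map_sum, hlag, mul_comm]
  -- The matrix h represents the form ω(·, J ·) on the span of x₂, which is positive definite.
  have hhdet : h.det ≠ 0 := by
    intro h0
    obtain ⟨v, hv0, hv⟩ := Matrix.exists_mulVec_eq_zero_iff.2 h0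
    have h1 : gBil A e (∑ l, v l • x₂ l) (gJ A e (∑ l, v l • x₂ l)) = 0 := by
      have h2 : gBil A e (∑ l, v l • x₂ l) (gJ A e (∑ l, v l • x₂ l)) = v ⬝ᵥ h.mulVec v := by
        simp only [map_sum, LinearMap.sum_apply, map_smul, LinearMap.smul_apply, smul_eq_mul,
          dotProduct, Matrix.mulVec, hh, Matrix.of_apply, Finset.mul_sum]
        rw [Finset.sum_comm]
        refine Finset.sum_congr rfl fun l _ => Finset.sum_congr rfl fun k _ => ?_
        ring
      rw [h2, hv, dotProduct_zero]
    have h3 : ∑ l, v l • x₂ l = 0 := by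
      by_contra h4
      have hp : gProj A e (∑ l, v l • x₂ l) = ∑ l, v l • x₂ l := by simp [hx₂]
      exact (gForm_gJ_pos he fun h' => h4 ((gProj_mem_span_iff he hp).1 h')).ne' h1
    exact hv0 (funext fun k => Fintype.linearIndependent_iff.1 hli _ h3 k)
  have hsymm : h.transpose = h := by
    ext l k
    exact gForm_gJ_comm he _ _
  -- The J-image of the span of x₂ is isotropic; with J x₂ = x₂ P + x₁ Q this becomes the symmetry
  -- of Pᵀh, that is, of the matrix P h⁻¹ below.
  have hPh : P.transpose * h = h * P := by
    have h1 (l k) : (P.transpose * h) l k = (P.transpose * h) k l := by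
      have e1 (l k) : (P.transpose * h) l k = gBil A e (frameMul x₂ P l) (gJ A e (x₂ k)) := by
        simp [Matrix.mul_apply, frameMul_apply, map_sum, LinearMap.sum_apply, hh]
      have e2 : gBil A e (gJ A e (x₂ l)) (gJ A e (x₂ k)) = 0 :=
        (gForm_gJ_gJ he _ _).trans (hlag l k)
      have e4 (l k) : gBil A e (frameMul x₂ P l) (gJ A e (x₂ k)) =
          gBil A e (frameMul x₂ P l) (frameMul x₁ Q k) := by
        rw [hPQ k, map_add, gBil_apply _ (frameMul x₂ P k), gForm_span_eq_zero hlag, zero_add]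
        · exact span_frameMul_le _ _ (Submodule.subset_span ⟨_, rfl⟩)
        · exact span_frameMul_le _ _ (Submodule.subset_span ⟨_, rfl⟩)
      rw [e1, e1, ← sub_eq_zero, ← e2]
      conv_rhs => rw [hPQ l]
      rw [map_add, LinearMap.add_apply, sub_eq_add_neg]
      congr 1
      rw [hPQ k, map_add, gBil_apply _ (frameMul x₁ Q k), gForm_span_eq_zero hlag₁, add_zero,
        gBil_comm (frameMul x₂ P k) (frameMul x₁ Q l), e4]
      · exact span_frameMul_le _ _ (Submodule.subset_span ⟨_, rfl⟩)
      · exact span_frameMul_le _ _ (Submodule.subset_span ⟨_, rfl⟩)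
    calc P.transpose * h = (P.transpose * h).transpose := by ext l k; exact h1 l k
      _ = h * P := by rw [Matrix.transpose_mul, Matrix.transpose_transpose, hsymm]
  have hunit : IsUnit h.det := isUnit_iff_ne_zero.2 hhdet
  -- The choice D = P h⁻¹ makes the transvection subtract exactly the x₂-component of J x₂ and leave
  -- the x₁-component.
  have hP (k) : gJ A e (x₂ k) - sympShear A e x₂ (P * h⁻¹) (gJ A e (x₂ k)) = frameMul x₂ P k := by
    rw [sympShear_apply, sub_sub_cancel, frameMul_apply]
    refine Finset.sum_congr rfl fun j _ => ?_
    rw [← Finset.sum_smul]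
    congr 1
    have : (P * h⁻¹ * h) j k = P j k := by
      rw [Matrix.mul_assoc, Matrix.nonsing_inv_mul _ hunit, Matrix.mul_one]
    rw [← this, Matrix.mul_apply]
    rfl
  refine ⟨P, Q, P * h⁻¹, ?_, ?_, fun k => ?_, hP⟩
  · rw [Matrix.transpose_mul, Matrix.transpose_nonsing_inv, hsymm]
    calc h⁻¹ * P.transpose = h⁻¹ * (P.transpose * h) * h⁻¹ := by
          rw [Matrix.mul_assoc, Matrix.mul_assoc, Matrix.mul_nonsing_inv _ hunit, Matrix.mul_one]
      _ = P * h⁻¹ := by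
          rw [hPh, ← Matrix.mul_assoc, Matrix.nonsing_inv_mul _ hunit, Matrix.one_mul]
  · rw [hGQ, Matrix.det_mul] at hhdet
    exact right_ne_zero_of_mul hhdet
  · have h1 := hP k
    rw [sub_eq_iff_eq_add, hPQ k] at h1
    rw [hPQ k]
    exact (add_left_cancel h1).symm

end Ends

section Ends

variable {V : Type*} [AddCommGroup V] [Module ℝ V] {A : V ≃ₗ[ℝ] (Fin 7 → ℝ)} {e : V}
  {T : V →ₗ[ℝ] C3}

lemma det_I_smul (x : Fin 3 → C3) :
    (Matrix.of fun k => Complex.I • x k).det = Complex.I ^ 3 * (Matrix.of x).det := by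
  have h : (Matrix.of fun k => Complex.I • x k) = Complex.I • Matrix.of x := rfl
  rw [h, Matrix.det_smul, Fintype.card_fin]

lemma frameMul_one_add_smul (x : Fin 3 → V) (s : ℝ) (Q : Matrix (Fin 3) (Fin 3) ℝ) (k : Fin 3) :
    frameMul x (1 + s • Q) k = x k + s • frameMul x Q k := by
  simp only [frameMul_apply, Matrix.add_apply, Matrix.smul_apply, add_smul, smul_eq_mul, mul_smul,
    Finset.sum_add_distrib, Finset.smul_sum]
  congr 1
  simp [Matrix.one_apply]

lemma frameMul_add_smul_one (x : Fin 3 → V) (s : ℝ) (Q : Matrix (Fin 3) (Fin 3) ℝ) (k : Fin 3) :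
    frameMul x (Q + s • 1) k = frameMul x Q k + s • x k := by
  simp only [frameMul_apply, Matrix.add_apply, Matrix.smul_apply, add_smul, smul_eq_mul, mul_smul,
    Finset.sum_add_distrib]
  congr 1
  simp [Matrix.one_apply]

lemma map_frameMul {V' : Type*} [AddCommGroup V'] [Module ℝ V'] (S : V →ₗ[ℝ] V') (x : Fin 3 → V)
    (Q : Matrix (Fin 3) (Fin 3) ℝ) (k : Fin 3) :
    S (frameMul x Q k) = frameMul (fun j => S (x j)) Q k := by
  simp [frameMul_apply]

lemma frameMul_I_smul (x : Fin 3 → C3) (Q : Matrix (Fin 3) (Fin 3) ℝ) (k : Fin 3) :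
    frameMul (fun j => Complex.I • x j) Q k = Complex.I • frameMul x Q k := by
  simp only [frameMul_apply, Finset.smul_sum]
  refine Finset.sum_congr rfl fun j _ => smul_comm _ _ _

/-- If `J` interchanges the two Lagrangian subspaces, the ratio of determinants is positive. -/
lemma isArg_linDet_ratio
    {x y : Fin 3 → V} (hx : ∀ k, gProj A e (x k) = x k)
    (hT₁ : ∀ k, T (y k) = Complex.I • T (x k)) {Q : Matrix (Fin 3) (Fin 3) ℝ} (hQ : Q.det ≠ 0)
    (hJ : ∀ k, gJ A e (x k) = frameMul y Q k) (h₁ : ∀ s : I, linDet A e T s x ≠ 0)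
    (h₂ : ∀ s : I, linDet A e T s y ≠ 0) (s : I) :
    IsArg 0 (Complex.I ^ 3 * linDet A e T s x / linDet A e T s y) := by
  set U := (Matrix.of fun k => T (x k)).det with hU
  have hU0 : U ≠ 0 := by
    have := h₁ 0
    rwa [Icc.coe_zero, linDet_zero] at this
  have hI : Complex.I ^ 3 ≠ 0 := pow_ne_zero _ Complex.I_ne_zero
  have hTJ (k) : T (gJ A e (x k)) = Complex.I • T (frameMul x Q k) := by
    rw [hJ, map_frameMul, map_frameMul]
    simp only [hT₁]
    exact frameMul_I_smul _ _ _
  -- Since T J x = i T (x Q), the two determinants are those of the real matrices 1 + sQ and Q + s,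
  -- up to constant factors. So the ratio is real, never 0, and equal to 1 at s = 0.
  have e₁ (s : ℝ) : linDet A e T s x = (1 + s • Q).det * U := by
    rw [hU, ← det_of_frameMul, linDet]
    congr 2
    ext k : 1
    rw [frameMul_one_add_smul, linPart_apply, hTJ, map_add, map_smul, smul_smul Complex.I,
      Complex.I_mul_I, neg_one_smul, smul_neg, sub_neg_eq_add]
  have e₂ (s : ℝ) : Q.det * linDet A e T s y = Complex.I ^ 3 * ((Q + s • 1).det * U) := by
    rw [hU, ← det_of_frameMul, ← linDet_frameMul, ← det_I_smul, linDet]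
    congr 2
    ext k : 1
    rw [frameMul_add_smul_one, linPart_apply, ← hJ, hTJ, gJ_gJ_of_gProj (hx k), map_neg, map_add,
      map_smul, smul_neg, smul_neg, sub_neg_eq_add, smul_add, smul_comm s]
  have hne (s : I) : (Q + (s : ℝ) • 1).det ≠ 0 := by
    intro h0
    have h1 := e₂ s
    rw [h0] at h1
    simp only [Complex.ofReal_zero, zero_mul, mul_zero] at h1
    exact mul_ne_zero (by exact_mod_cast hQ) (h₂ s) h1
  have hne' (s : I) : (1 + (s : ℝ) • Q).det ≠ 0 := by
    intro h0
    have h1 := e₁ s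
    rw [h0] at h1
    simp only [Complex.ofReal_zero, zero_mul] at h1
    exact h₁ s h1
  set ρ : I → ℝ := fun s => (1 + (s : ℝ) • Q).det * Q.det / (Q + (s : ℝ) • 1).det with hρ
  have key (s : I) : Complex.I ^ 3 * linDet A e T s x / linDet A e T s y = ρ s := by
    have h1 := e₂ s
    have hQ' : (Q.det : ℂ) ≠ 0 := by exact_mod_cast hQ
    have hne'' : ((Q + (s : ℝ) • 1).det : ℂ) ≠ 0 := by exact_mod_cast hne s
    rw [e₁, hρ, div_eq_iff (h₂ s)]
    push_cast
    rw [div_mul_eq_mul_div, eq_div_iff hne'', mul_assoc _ (Q.det : ℂ), h1]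
    ring
  have hcont : Continuous ρ := by
    refine Continuous.div ?_ ?_ hne
    · refine Continuous.mul (Continuous.matrix_det ?_) continuous_const
      fun_prop
    · refine Continuous.matrix_det ?_
      fun_prop
  have hρ0 (s) : ρ s ≠ 0 := div_ne_zero (mul_ne_zero (hne' s) hQ) (hne s)
  rw [key]
  refine isArg_ofReal ?_
  by_contra hs
  obtain ⟨t, ht⟩ := mem_range_of_exists_le_of_exists_ge hcont ⟨s, not_lt.1 hs⟩
    ⟨0, (by simp [hρ, hQ] : (0 : ℝ) ≤ ρ 0)⟩
  exact hρ0 t ht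

lemma arg_neg_I_mul (r : ℝ) (hr : r ≠ 0) :
    ((-Complex.I) * (r : ℂ)).arg = if 0 < r then -(Real.pi / 2) else Real.pi / 2 := by
  split_ifs with h
  · rw [Complex.arg_mul_real h, Complex.arg_neg_I]
  · have h' : 0 < -r := neg_pos.2 (lt_of_le_of_ne (not_lt.1 h) hr)
    have : (-Complex.I) * (r : ℂ) = Complex.I * ((-r : ℝ) : ℂ) := by push_cast; ring
    rw [this, Complex.arg_mul_real h', Complex.arg_I]

/-- The change of the argument of the ratio of the determinants `linDet` for two Lagrangian
subspaces interchanged by `i`. -/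
theorem exists_arg_linDet_ratio (he : e ≠ 0) (hT : ∀ v w, stdSymp (T v) (T w) = gForm A e v w)
    {x₁ x₂ : Fin 3 → V} (hx₁ : ∀ k, gProj A e (x₁ k) = x₁ k) (hx₂ : ∀ k, gProj A e (x₂ k) = x₂ k)
    (hT₁ : ∀ k, T (x₁ k) = Complex.I • T (x₂ k)) (hli : LinearIndependent ℝ x₂)
    (hlag : ∀ j k, gBil A e (x₂ j) (x₂ k) = 0)
    (hre₁ : (gVol A e (x₁ 0) (x₁ 1) (x₁ 2)).re = 0)
    (hre₂ : (gVol A e (x₂ 0) (x₂ 1) (x₂ 2)).re = 0) :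
    ∃ θ : I → ℝ, Continuous θ ∧ θ 0 = 0 ∧
      (∀ s : I, IsArg (θ s) (Complex.I ^ 3 * linDet A e T s x₂ / linDet A e T s x₁)) ∧
      θ 1 = if 0 < (gVol A e (x₁ 0) (x₁ 1) (x₁ 2)).im * (gVol A e (x₂ 0) (x₂ 1) (x₂ 2)).im
        then -(Real.pi / 2) else Real.pi / 2 := by
  obtain ⟨P, Q, D, hD, hQ, hJQ, hJP⟩ := exists_sympShear_gJ he hT hx₁ hx₂ hT₁ hli hlag
  have hlag₁ (j k) : gBil A e (x₁ j) (x₁ k) = 0 := by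
    rw [gBil_apply, ← hT, hT₁, hT₁, stdSymp_I_smul, hT, ← gBil_apply, hlag]
  set S : ℝ → V →ₗ[ℝ] V := fun c => sympShear A e x₂ (c • D) with hS
  have hSS (c c' : ℝ) (v : V) : S c (S c' v) = S (c + c') v := by
    simp only [hS]
    rw [sympShear_sympShear hlag, ← add_smul]
  have hS0 (v : V) : S 0 v = v := by simp [hS, sympShear_apply]
  have hSx (c : ℝ) (k) : S c (x₂ k) = x₂ k := sympShear_self hlag _ _
  have hSa (c : ℝ) (v : V) : S c v = v - c • (v - S 1 v) := by
    simp only [hS]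
    rw [sympShear_smul, one_smul]
  have hSb (c : ℝ) (v w : V) : gBil A e (S c v) (S c w) = gBil A e v w :=
    gBil_sympShear hlag (by rw [Matrix.transpose_smul, hD]) v w
  -- A homotopy of the whole situation. At κ = 1 it is the given pair; at κ = 0 the moving subspace
  -- is the J-image of the span of x₂. The transvections fix x₂, and `Tκ` is composed so that its
  -- values on x₂ and y stay fixed.
  set y : ℝ → Fin 3 → V := fun κ k => S (κ - 1) (x₁ k) with hy
  have hSy (κ : ℝ) (k) : S (1 - κ) (y κ k) = x₁ k := by
    simp only [hy]
    rw [hSS, show 1 - κ + (κ - 1) = 0 by ring, hS0]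
  have hyp (κ : ℝ) (k) : gProj A e (y κ k) = y κ k := gProj_sympShear hx₂ _ (hx₁ k)
  have hy1 : y 1 = x₁ := by
    ext k
    simp only [hy, sub_self, hS0]
  have hylag (κ : ℝ) (j k) : gBil A e (y κ j) (y κ k) = 0 := by
    simp only [hy]
    rw [hSb, hlag₁]
  set Tκ : ℝ → V →ₗ[ℝ] C3 := fun κ => T ∘ₗ S (1 - κ) with hTκ
  have hTκs (κ : ℝ) (v w : V) : stdSymp (Tκ κ v) (Tκ κ w) = gForm A e v w := by
    simp only [hTκ, LinearMap.comp_apply]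
    rw [hT]
    exact hSb _ v w
  have hT1 : Tκ 1 = T := by
    ext v : 1
    simp only [hTκ, LinearMap.comp_apply, sub_self, hS0]
  have hTx (κ : ℝ) (k) : Tκ κ (x₂ k) = T (x₂ k) := by
    simp only [hTκ, LinearMap.comp_apply, hSx]
  have hTy (κ : ℝ) (k) : Tκ κ (y κ k) = Complex.I • T (x₂ k) := by
    simp only [hTκ, LinearMap.comp_apply, hSy, hT₁]
  have hyli (κ : ℝ) : LinearIndependent ℝ (y κ) := by
    rw [Fintype.linearIndependent_iff]
    intro g hg
    refine Fintype.linearIndependent_iff.1 hli g ?_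
    have h1 : Complex.I • T (∑ k, g k • x₂ k) = 0 := by
      have h2 := congrArg (Tκ κ) hg
      rw [map_zero, map_sum] at h2
      rw [← h2, map_sum, Finset.smul_sum]
      refine Finset.sum_congr rfl fun k _ => ?_
      rw [map_smul, map_smul, hTy, smul_comm]
    refine (gProj_mem_span_iff (A := A) he (by simp [hx₂])).1
      (mem_span_of_stdSymp he hT ((smul_eq_zero.1 h1).resolve_left Complex.I_ne_zero))
  have hne₁ (κ : ℝ) (s : I) : linDet A e (Tκ κ) s x₂ ≠ 0 :=
    linDet_ne_zero (hTκs κ) he hx₂ hli (fun v hv w hw => gForm_span_eq_zero hlag hv hw) s.2.1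
  have hne₂ (κ : ℝ) (s : I) : linDet A e (Tκ κ) s (y κ) ≠ 0 :=
    linDet_ne_zero (hTκs κ) he (hyp κ) (hyli κ)
      (fun v hv w hw => gForm_span_eq_zero (hylag κ) hv hw) s.2.1
  have hI : Complex.I ^ 3 ≠ 0 := pow_ne_zero _ Complex.I_ne_zero
  set H : I × I → ℂ := fun q =>
    Complex.I ^ 3 * linDet A e (Tκ q.1) q.2 x₂ / linDet A e (Tκ q.1) q.2 (y q.1) with hH
  have hHne (q) : H q ≠ 0 := div_ne_zero (mul_ne_zero hI (hne₁ _ _)) (hne₂ _ _)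
  have hTexp (κ : ℝ) (v : V) : Tκ κ v = T v - (1 - κ) • T (v - S 1 v) := by
    simp only [hTκ, LinearMap.comp_apply]
    rw [hSa, map_sub, map_smul]
  have hyexp (κ : ℝ) (k) : y κ k = x₁ k + (1 - κ) • (x₁ k - S 1 (x₁ k)) := by
    simp only [hy]
    rw [hSa, ← neg_sub 1 κ, neg_smul, sub_neg_eq_add]
  have hHc : Continuous H := by
    refine Continuous.div (Continuous.mul continuous_const (Continuous.matrix_det ?_))
      (Continuous.matrix_det ?_) (fun q => hne₂ _ _)
    · refine continuous_matrix fun k j => ?_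
      simp only [Matrix.of_apply, linPart_apply, hTexp, Pi.sub_apply, Pi.smul_apply]
      fun_prop
    · refine continuous_matrix fun k j => ?_
      simp only [Matrix.of_apply, linPart_apply, hTexp, hyexp, map_add, map_smul, map_sub,
        Pi.sub_apply, Pi.smul_apply, Pi.add_apply]
      fun_prop
  have hy0 (k) : gJ A e (x₂ k) = frameMul (y 0) Q k := by
    have h1 : frameMul (y 0) Q k = S (-1) (frameMul x₁ Q k) := by
      rw [map_frameMul]
      simp only [hy, zero_sub]
    rw [h1, ← hJQ]
    have h2 : sympShear A e x₂ D (gJ A e (x₂ k)) = S 1 (gJ A e (x₂ k)) := by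
      simp only [hS, one_smul]
    rw [h2, hSS, neg_add_cancel, hS0]
  -- For κ = 0 the ratio is positive for every s, so the argument 0 is available there, and it is
  -- continued in the direction of κ.
  obtain ⟨θ, hθc, hθ, hθ0⟩ := exists_arg hHc hHne (θ₀ := fun _ => 0) continuous_const fun s => by
    have h1 := isArg_linDet_ratio hx₂ (y := y 0) (fun k => by rw [hTy, hTx]) hQ hy0
      (hne₁ 0) (hne₂ 0) s
    simpa only [hH, Icc.coe_zero] using h1
  -- On the side s = 0 the ratio is constantly 1. Hence the argument is 0 at the corner (1, 0), and
  -- its change along κ = 1 is obtained from the side s = 1.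
  have hH1 (κ : I) : H (κ, 0) = 1 := by
    have h1 : linDet A e (Tκ κ) (0 : ℝ) (y κ) =
        Complex.I ^ 3 * linDet A e (Tκ κ) (0 : ℝ) x₂ := by
      rw [linDet_zero, linDet_zero, ← det_I_smul]
      simp only [hTy, hTx]
    have h2 := hne₁ κ 0
    rw [Icc.coe_zero] at h2
    simp only [hH, Icc.coe_zero]
    rw [h1, div_self (mul_ne_zero hI h2)]
  have hθ1 : θ (1, 0) = 0 := by
    have h1 := arg_sub_arg_eq (Y := I) (f := fun _ => 1) (θ := fun κ => θ (κ, 0))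
      (θ' := fun _ => 0) (by fun_prop) continuous_const (fun κ => by rw [← hH1 κ]; exact hθ _)
      (fun _ => by simpa using isArg_ofReal one_pos) 1 0
    simpa [hθ0] using h1
  -- the side `s = 1`
  have hvol₂ : gVol A e (x₂ 0) (x₂ 1) (x₂ 2) ≠ 0 :=
    gVol_ne_zero he hx₂ (cplx_injective_of_lagrangian he hx₂ hli
      fun v hv w hw => gForm_span_eq_zero hlag hv hw)
  have hHs (κ : I) : H (κ, 1) = Complex.I ^ 3 * gVol A e (x₂ 0) (x₂ 1) (x₂ 2) /
      gVol A e (y κ 0) (y κ 1) (y κ 2) := by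
    simp only [hH, Icc.coe_one]
    rw [linDet_one (hTκs κ) he, linDet_one (hTκs κ) he, mul_left_comm,
      mul_div_mul_left _ _ (volRatio_ne_zero (hTκs κ) he)]
  let N : ℝ → Fin 3 → C3 := fun κ k => Pi.single k Complex.I - fun j => ((κ * P j k : ℝ) : ℂ)
  have hvoly (κ : ℝ) : Q.det * gVol A e (y κ 0) (y κ 1) (y κ 2) =
      gVol A e (x₂ 0) (x₂ 1) (x₂ 2) * (Matrix.of (N κ)).det := by
    have h1 (k) : frameMul (y κ) Q k = cplx A e x₂ (N κ k) := by
      have h2 : frameMul (y κ) Q k = S (κ - 1) (frameMul x₁ Q k) := by rw [map_frameMul]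
      have h3 : sympShear A e x₂ D (gJ A e (x₂ k)) = S 1 (gJ A e (x₂ k)) := by
        simp only [hS, one_smul]
      have h4 := hJP k
      rw [h3] at h4
      rw [h2, ← hJQ, h3, hSS, sub_add_cancel, hSa, h4, map_sub]
      congr 1
      · have h5 := cplx_smul hx₂ Complex.I (Pi.single k 1)
        rw [cplx_single, Complex.I_re, Complex.I_im, zero_smul, one_smul, zero_add] at h5
        rw [← h5, ← Pi.single_smul', smul_eq_mul, mul_one]
      · simp [cplx_apply, frameMul_apply, Finset.smul_sum, smul_smul]
    rw [← gVol_cplx he hx₂, ← gVol_frameMul he, h1, h1, h1]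
  obtain ⟨b, hb⟩ := det_one_add_I_re P
  have hbN (κ : ℝ) : (Matrix.of (N κ)).det.im = -1 + κ ^ 2 * b := hb κ
  have hQ' : (Q.det : ℂ) ≠ 0 := by exact_mod_cast hQ
  have hN0 (κ : I) : (Matrix.of (N κ)).det ≠ 0 := by
    intro h0
    have h1 := hvoly κ
    rw [h0, mul_zero] at h1
    have h2 := (mul_eq_zero.1 h1).resolve_left hQ'
    have h3 := hHs κ
    rw [h2, div_zero] at h3
    exact hHne _ h3
  have hHN (κ : I) : H (κ, 1) = Complex.I ^ 3 * Q.det / (Matrix.of (N κ)).det := by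
    have h1 : gVol A e (y κ 0) (y κ 1) (y κ 2) =
        gVol A e (x₂ 0) (x₂ 1) (x₂ 2) * (Matrix.of (N κ)).det / Q.det := by
      rw [← hvoly, mul_div_cancel_left₀ _ hQ']
    rw [hHs, h1]
    have := hN0 κ
    field_simp
  have hre (κ : I) : (H (κ, 1)).re =
      Q.det * (1 - (κ : ℝ) ^ 2 * b) / Complex.normSq (Matrix.of (N κ)).det := by
    rw [hHN, Complex.I_pow_three, Complex.div_re]
    simp [hbN]
    ring
  set v₁ := (gVol A e (x₁ 0) (x₁ 1) (x₁ 2)).im with hv₁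
  set v₂ := (gVol A e (x₂ 0) (x₂ 1) (x₂ 2)).im with hv₂
  have hg₁ : gVol A e (x₁ 0) (x₁ 1) (x₁ 2) = v₁ * Complex.I :=
    Complex.ext (by simp [hre₁]) (by simp [hv₁])
  have hg₂ : gVol A e (x₂ 0) (x₂ 1) (x₂ 2) = v₂ * Complex.I :=
    Complex.ext (by simp [hre₂]) (by simp [hv₂])
  have hH11 : H (1, 1) = (-Complex.I) * ((v₂ / v₁ : ℝ) : ℂ) := by
    rw [hHs, Icc.coe_one, hy1, hg₁, hg₂, Complex.I_pow_three, ← mul_assoc,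
      mul_div_mul_right _ _ Complex.I_ne_zero]
    push_cast
    ring
  have hv0 : v₂ / v₁ ≠ 0 := by
    intro h0
    rw [h0] at hH11
    exact hHne (1, 1) (by simpa using hH11)
  -- At κ = 1 both volumes are imaginary, so H(1, 1) is imaginary; the formula for the real part
  -- then leaves only b = 1.
  have hb1 : b = 1 := by
    have h1 := hre 1
    rw [hH11] at h1
    simp only [Complex.mul_re, Complex.neg_re, Complex.I_re, Complex.ofReal_re, Complex.ofReal_im,
      mul_zero, neg_zero, zero_mul, sub_zero, Icc.coe_one, one_pow, one_mul] at h1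
    rcases div_eq_zero_iff.1 h1.symm with h2 | h2
    · have := (mul_eq_zero.1 h2).resolve_left hQ
      linarith
    · exact absurd (Complex.normSq_eq_zero.1 h2) (hN0 1)
  have hQpos : 0 < Q.det := by
    obtain ⟨r, hr, hr'⟩ := hθ (0, 1)
    rw [hθ0] at hr'
    have h1 := congrArg Complex.re hr'
    rw [hre] at h1
    simp at h1
    have h2 : 0 < Q.det / Complex.normSq (Matrix.of (N 0)).det := by rw [h1]; exact hr
    exact (div_pos_iff_of_pos_right (Complex.normSq_pos.2 (by simpa using hN0 0))).1 h2
  -- For κ < 1 the real part is positive, and H(1, 1) is imaginary and nonzero. So the principal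
  -- argument is continuous along this side and ends at ±π/2.
  have hslit (κ : I) : H (κ, 1) ∈ Complex.slitPlane := by
    rcases lt_or_eq_of_le κ.2.2 with h | h
    · left
      rw [hre, hb1]
      have h1 : (κ : ℝ) ^ 2 < 1 := by have := κ.2.1; nlinarith
      exact div_pos (mul_pos hQpos (by linarith)) (Complex.normSq_pos.2 (hN0 κ))
    · right
      have h1 : κ = 1 := Subtype.ext h
      rw [h1, hH11]
      simpa using hv0
  have hθ11 : θ (1, 1) = (H (1, 1)).arg := by
    have h1 := arg_sub_arg_eq (Y := I) (f := fun κ => H (κ, 1)) (θ := fun κ => θ (κ, 1))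
      (θ' := fun κ => (H (κ, 1)).arg) (by fun_prop)
      (continuous_iff_continuousAt.2 fun κ =>
        (Complex.continuousAt_arg (hslit κ)).comp (f := fun κ => H (κ, 1))
          (hHc.comp (by fun_prop)).continuousAt)
      (fun κ => hθ _) (fun κ => isArg_arg (hHne _)) 1 0
    have h2 : (H (0, 1)).arg = 0 := by
      have := hθ (0, 1)
      rw [hθ0] at this
      exact this.arg_eq ⟨by linarith [Real.pi_pos], Real.pi_pos.le⟩
    rw [h2, hθ0] at h1
    linarith
  refine ⟨fun s => θ (1, s), by fun_prop, hθ1, fun s => ?_, ?_⟩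
  · have h1 := hθ (1, s)
    simp only [hH, Icc.coe_one, hT1, hy1] at h1
    exact h1
  · change θ (1, 1) = _
    rw [hθ11, hH11, arg_neg_I_mul _ hv0]
    have h1 : 0 < v₂ / v₁ ↔ 0 < v₁ * v₂ := by
      have h3 : v₁ ≠ 0 := fun h => hv0 (by rw [h, div_zero])
      have h4 : v₁ * v₂ = v₂ / v₁ * v₁ ^ 2 := by field_simp
      rw [h4, mul_pos_iff_of_pos_right (by positivity)]
    simp only [h1]

end Ends

/-! ### The sign of the relative position of two special Lagrangian subspaces. -/

section EndIndex

variable {V : Type*} [AddCommGroup V] [Module ℝ V] {A : V ≃ₗ[ℝ] (Fin 7 → ℝ)} {e : V}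
  {T : V →ₗ[ℝ] C3}

variable (A e) in
/-- The quantity whose sign gives the relative position of two Lagrangian subspaces with the bases
`x₁` and `x₂`. -/
def framePairing (x₁ x₂ : Fin 3 → V) : ℝ :=
  (gVol A e (x₁ 0) (x₁ 1) (x₁ 2)).im * (gVol A e (x₂ 0) (x₂ 1) (x₂ 2)).im *
    (Matrix.of fun j k => gForm A e (x₂ j) (x₁ k)).det

/-- The matrix is the Hermitian Gram matrix of the vectors T x₂, which is real because x₂ spans an
isotropic subspace. Its determinant is therefore |det(T x₂)|². -/
lemma det_gForm_pos (hT : ∀ v w, stdSymp (T v) (T w) = gForm A e v w) {x₁ x₂ : Fin 3 → V}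
    (hT₁ : ∀ k, T (x₁ k) = Complex.I • T (x₂ k)) (hlag : ∀ j k, gBil A e (x₂ j) (x₂ k) = 0)
    (hdet : (Matrix.of fun k => T (x₂ k)).det ≠ 0) :
    0 < (Matrix.of fun j k => gForm A e (x₂ j) (x₁ k)).det := by
  set G : Matrix (Fin 3) (Fin 3) ℝ := Matrix.of fun j k => gForm A e (x₂ j) (x₁ k) with hG
  set U := Matrix.of fun k => T (x₂ k) with hU
  have h1 : G.map Complex.ofRealHom = U.map (starRingEnd ℂ) * U.transpose := by
    ext j k
    have h2 : (∑ l, starRingEnd ℂ (T (x₂ j) l) * T (x₂ k) l).im = 0 :=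
      (hT _ _).trans (hlag j k)
    have h3 : gForm A e (x₂ j) (x₁ k) = (∑ l, starRingEnd ℂ (T (x₂ j) l) * T (x₂ k) l).re := by
      rw [← hT, hT₁, stdSymp]
      have : ∑ l, starRingEnd ℂ (T (x₂ j) l) * (Complex.I • T (x₂ k)) l =
          Complex.I * ∑ l, starRingEnd ℂ (T (x₂ j) l) * T (x₂ k) l := by
        rw [Finset.mul_sum]
        refine Finset.sum_congr rfl fun l _ => ?_
        simp only [Pi.smul_apply, smul_eq_mul]
        ring
      rw [this]
      simp only [Complex.I_mul_im]
    simp only [hG, hU, Matrix.map_apply, Matrix.of_apply, Matrix.mul_apply,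
      Matrix.transpose_apply, h3, Complex.ofRealHom_eq_coe]
    exact Complex.ext (by simp) (by simpa using h2.symm)
  have h2 : (G.det : ℂ) = Complex.normSq U.det := by
    have h3 := congrArg Matrix.det h1
    rw [Matrix.det_mul, Matrix.det_transpose] at h3
    have h4 : (U.map (starRingEnd ℂ)).det = starRingEnd ℂ U.det :=
      (RingHom.map_det (starRingEnd ℂ) U).symm
    have h5 : (G.map Complex.ofRealHom).det = (G.det : ℂ) := (RingHom.map_det Complex.ofRealHom G).symm
    rw [h4, h5] at h3
    rw [h3, Complex.normSq_eq_conj_mul_self]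
  have h3 : G.det = Complex.normSq U.det := by exact_mod_cast h2
  rw [h3]
  exact Complex.normSq_pos.2 hdet

/-- Comparison of the arguments of the determinants for two Lagrangian subspaces interchanged
by `i`. -/
theorem arg_sub_arg_linDet (he : e ≠ 0) (hT : ∀ v w, stdSymp (T v) (T w) = gForm A e v w)
    {L₁ L₂ : Submodule ℝ V} (hp₁ : ∀ v ∈ L₁, gProj A e v = v) (hp₂ : ∀ v ∈ L₂, gProj A e v = v)
    (hlag : ∀ v ∈ L₂, ∀ w ∈ L₂, gForm A e v w = 0)
    (hre₁ : ∀ u ∈ L₁, ∀ v ∈ L₁, ∀ w ∈ L₁, (gVol A e u v w).re = 0)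
    (hre₂ : ∀ u ∈ L₂, ∀ v ∈ L₂, ∀ w ∈ L₂, (gVol A e u v w).re = 0)
    (hL : L₁.map T = cmul Complex.I (L₂.map T)) {x₁ x₂ : Fin 3 → V}
    (hs₁ : Submodule.span ℝ (range x₁) = L₁)
    (hli₂ : LinearIndependent ℝ x₂) (hs₂ : Submodule.span ℝ (range x₂) = L₂) {θ₁ θ₂ : I → ℝ}
    (hc₁ : Continuous θ₁) (hc₂ : Continuous θ₂) (h1₁ : θ₁ 1 = 0) (h1₂ : θ₂ 1 = 0)
    (hθ₁ : ∀ s : I, IsArg (θ₁ s) (linDet A e T s x₁ / linDet A e T 1 x₁))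
    (hθ₂ : ∀ s : I, IsArg (θ₂ s) (linDet A e T s x₂ / linDet A e T 1 x₂)) :
    θ₂ 0 - θ₁ 0 = if 0 < framePairing A e x₁ x₂ then Real.pi / 2 else -(Real.pi / 2) := by
  have hm₁ (k) : x₁ k ∈ L₁ := hs₁ ▸ Submodule.subset_span ⟨k, rfl⟩
  have hm₂ (k) : x₂ k ∈ L₂ := hs₂ ▸ Submodule.subset_span ⟨k, rfl⟩
  have hex (k) : ∃ v ∈ L₁, T v = Complex.I • T (x₂ k) := by
    have h1 : Complex.I • T (x₂ k) ∈ L₁.map T := by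
      rw [hL]
      exact ⟨T (x₂ k), ⟨x₂ k, hm₂ k, rfl⟩, rfl⟩
    exact h1
  choose y hy hyT using hex
  -- Here y is the basis of L₁ with T y = i T x₂. Passing from x₁ to y costs the real factor det g,
  -- which cancels in the quotients and enters the pairing as a square.
  obtain ⟨g, hg⟩ := exists_frameMul_eq (b := x₁) (c := y) fun k => by rw [hs₁]; exact hy k
  have hlag' (j k) : gBil A e (x₂ j) (x₂ k) = 0 := hlag _ (hm₂ j) _ (hm₂ k)
  have hp₂' (k) := hp₂ _ (hm₂ k)
  have hp₁' (k) := hp₁ _ (hy k)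
  obtain ⟨θ, hθc, hθ0, hθ, hθ1⟩ := exists_arg_linDet_ratio he hT hp₁' hp₂' hyT hli₂
    hlag' (hre₁ _ (hy 0) _ (hy 1) _ (hy 2)) (hre₂ _ (hm₂ 0) _ (hm₂ 1) _ (hm₂ 2))
  have hne₂ (s : I) : linDet A e T s x₂ ≠ 0 :=
    linDet_ne_zero hT he hp₂' hli₂ (fun v hv w hw => gForm_span_eq_zero hlag' hv hw) s.2.1
  have hne₁ (s : I) : linDet A e T s y ≠ 0 := fun h => (hθ s).ne_zero (by rw [h, div_zero])
  have hgy (s : ℝ) : linDet A e T s y = g.det * linDet A e T s x₁ := by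
    rw [hg, linDet_frameMul]
  have hg0 : (g.det : ℂ) ≠ 0 := by
    have h1 := hne₁ 1
    rw [hgy] at h1
    exact left_ne_zero_of_mul h1
  have hx₁ (s : I) : linDet A e T s x₁ ≠ 0 := by
    have h1 := hne₁ s
    rw [hgy] at h1
    exact right_ne_zero_of_mul h1
  have hx₁1 : linDet A e T 1 x₁ ≠ 0 := by simpa using hx₁ 1
  have hx₂1 : linDet A e T 1 x₂ ≠ 0 := by simpa using hne₂ 1
  -- The factor between the two normalizations of the ratio. It does not depend on s, so it shifts
  -- the argument by a constant only.
  set c : ℂ := g.det * linDet A e T 1 x₁ / (Complex.I ^ 3 * linDet A e T 1 x₂) with hc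
  have hI : Complex.I ^ 3 ≠ 0 := pow_ne_zero _ Complex.I_ne_zero
  have hc0 : c ≠ 0 := div_ne_zero (mul_ne_zero hg0 hx₁1) (mul_ne_zero hI hx₂1)
  have key (s : I) : IsArg (θ s + c.arg)
      (linDet A e T s x₂ / linDet A e T 1 x₂ / (linDet A e T s x₁ / linDet A e T 1 x₁)) := by
    have h1 := (hθ s).mul (isArg_arg hc0)
    convert h1 using 1
    rw [hgy, hc]
    have := hx₁ s
    field_simp
  have h1 := arg_sub_arg_eq (hc₂.sub hc₁) (hθc.add continuous_const)
    (fun s => (hθ₂ s).div (hθ₁ s)) key 0 1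
  simp only [Pi.sub_apply, Pi.add_apply, hθ0, h1₁, h1₂] at h1
  have h2 : θ₂ 0 - θ₁ 0 = -θ 1 := by linarith
  rw [h2, hθ1]
  have hdet : (Matrix.of fun k => T (x₂ k)).det ≠ 0 := by
    have := hne₂ 0
    rwa [Icc.coe_zero, linDet_zero] at this
  have hpos := det_gForm_pos hT hyT hlag' hdet
  have hg0' : g.det ≠ 0 := by exact_mod_cast hg0
  have h3 : 0 < (gVol A e (y 0) (y 1) (y 2)).im * (gVol A e (x₂ 0) (x₂ 1) (x₂ 2)).im ↔
      0 < framePairing A e x₁ x₂ := by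
    rw [← mul_pos_iff_of_pos_right hpos]
    have h4 : (gVol A e (y 0) (y 1) (y 2)).im = g.det * (gVol A e (x₁ 0) (x₁ 1) (x₁ 2)).im := by
      rw [hg, gVol_frameMul he, Complex.im_ofReal_mul]
    have h5 : (Matrix.of fun j k => gForm A e (x₂ j) (y k)) =
        (Matrix.of fun j k => gForm A e (x₂ j) (x₁ k)) * g := by
      ext j k
      rw [hg]
      simp only [← gBil_apply, Matrix.of_apply, Matrix.mul_apply, frameMul_apply, map_sum,
        map_smul, smul_eq_mul]
      exact Finset.sum_congr rfl fun l _ => mul_comm _ _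
    rw [h4, h5, Matrix.det_mul, ← mul_pos_iff_of_pos_left (b := framePairing A e x₁ x₂)
      (show 0 < g.det ^ 2 by positivity)]
    exact iff_of_eq (congrArg (0 < ·) (by rw [framePairing]; ring))
  simp only [h3]
  split_ifs <;> ring

end EndIndex

/-! ### The determinants of a trivialization along the square. -/

section SquareDet

variable {M : Type*} [TopologicalSpace M] [ChartedSpace E7 M] [IsManifold (𝓡 7) ∞ M]
  {N₁ N₂ : Type*} [TopologicalSpace N₁] [ChartedSpace (EuclideanSpace ℝ (Fin 4)) N₁]
  [IsManifold (𝓡 4) ∞ N₁] [TopologicalSpace N₂] [ChartedSpace (EuclideanSpace ℝ (Fin 4)) N₂]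
  [IsManifold (𝓡 4) ∞ N₂]
  {lam : ThreeForm M} {i₁ : N₁ → M} {i₂ : N₂ → M} {γ₁ γ₂ : S1 → M}
  {u : ConnectingSquare i₁ i₂ γ₁ γ₂}

/-- The determinant `linDet` of a trivialization. -/
def SympTrivialization.det (Φ : SympTrivialization lam u) (hlam : IsG2Form lam) (s : ℝ)
    (p : I × I × S1) (x : Fin 3 → E7) : ℂ :=
  linDet (hlam.coordAt (u.map p)) (u.velE p) (Φ.lin p) s x

/-- The ratio `volRatio` of a trivialization. -/
def SympTrivialization.ratio (Φ : SympTrivialization lam u) (hlam : IsG2Form lam)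
    (p : I × I × S1) : ℂ :=
  volRatio (hlam.coordAt (u.map p)) (u.velE p) (Φ.lin p)

variable (Φ : SympTrivialization lam u) (hlam : IsG2Form lam)

lemma SympTrivialization.lin_const {p q : I × I × S1} (hp : p.1 = 0 ∨ p.1 = 1) (h1 : q.1 = p.1)
    (h2 : q.2.2 = p.2.2) : Φ.lin p = Φ.lin q := by
  obtain ⟨a, b, z⟩ := p
  obtain ⟨a', b', z'⟩ := q
  obtain rfl : a' = a := h1
  obtain rfl : z' = z := h2
  ext v : 1
  rcases hp with h | h
  · obtain rfl : a' = 0 := h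
    exact (Φ.const_zero b z' v).trans (Φ.const_zero b' z' v).symm
  · obtain rfl : a' = 1 := h
    exact (Φ.const_one b z' v).trans (Φ.const_one b' z' v).symm

lemma SympTrivialization.ratio_const {p q : I × I × S1} (hp : p.1 = 0 ∨ p.1 = 1) (h1 : q.1 = p.1)
    (h2 : q.2.2 = p.2.2) : Φ.ratio hlam p = Φ.ratio hlam q := by
  rw [SympTrivialization.ratio, SympTrivialization.ratio, u.map_eq hp h1 h2, u.velE_eq hp h1 h2,
    Φ.lin_const hp h1 h2]

lemma SympTrivialization.ratio_ne_zero (p : I × I × S1) : Φ.ratio hlam p ≠ 0 :=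
  volRatio_ne_zero (Φ.stdSymp_lin hlam p) (u.velE_ne_zero p)

lemma SympTrivialization.det_one (p : I × I × S1) (x : Fin 3 → E7) :
    Φ.det hlam 1 p x =
      Φ.ratio hlam p * gVol (hlam.coordAt (u.map p)) (u.velE p) (x 0) (x 1) (x 2) :=
  linDet_one (Φ.stdSymp_lin hlam p) (u.velE_ne_zero p) x

lemma SympTrivialization.continuousAt_det {Y : Type*} [TopologicalSpace Y] {g : Y → I × I × S1}
    {s : Y → ℝ} {x : Fin 3 → Y → E7} {y₀ : Y} (hg : ContinuousAt g y₀) (hs : ContinuousAt s y₀)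
    (hx : ∀ k, ContinuousAt (fun y => tb (u.map (g y)) (x k y)) y₀) :
    ContinuousAt (fun y => Φ.det hlam (s y) (g y) fun k => x k y) y₀ := by
  have hvel : ContinuousAt (fun y => tb (u.map (g y)) (u.velE (g y))) y₀ :=
    u.continuous_tb.continuousAt.comp hg
  have h1 (k : Fin 3) : ContinuousAt (fun y => Φ.lin (g y) (x k y) -
      s y • Complex.I • Φ.lin (g y) (gJ (hlam.coordAt (u.map (g y))) (u.velE (g y)) (x k y))) y₀ :=
    (Φ.continuousAt_lin hg (hx k)).sub (hs.smul ((Φ.continuousAt_lin hg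
      (continuousAt_J hlam hvel (u.velE_ne_zero _) (hx k))).const_smul Complex.I))
  have h2 : ContinuousAt (fun y => Matrix.of fun k => linPart (hlam.coordAt (u.map (g y)))
      (u.velE (g y)) (Φ.lin (g y)) (s y) (x k y)) y₀ :=
    tendsto_pi_nhds.2 fun k => h1 k
  exact (Continuous.matrix_det continuous_id).continuousAt.comp h2

/-- The ratio does not depend on the frame, so near a given point it can be computed from a
continuous frame on which the volume form is nonzero. -/
lemma SympTrivialization.continuous_ratio : Continuous (Φ.ratio hlam) := by
  rw [continuous_iff_continuousAt]
  intro p₀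
  obtain ⟨y, hy⟩ := exists_gVol_ne_zero_fun (A := hlam.coordAt (u.map p₀)) (u.velE_ne_zero p₀)
  set x₀ := u.map p₀
  have hmem : u.map p₀ ∈ (chartAt E7 x₀).source := mem_chart_source E7 x₀
  let b : Fin 3 → I × I × S1 → E7 := fun k p => trivSymm x₀ (u.map p) (trivAt x₀ x₀ (y k))
  have hb (k) : ContinuousAt (fun p => tb (u.map p) (b k p)) p₀ :=
    continuousAt_tb_trivSymm hmem u.continuous_map.continuousAt continuousAt_const
  have hb0 (k) : b k p₀ = y k := trivSymm_trivAt hmem _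
  have hvol := continuousAt_gVol hlam u.continuous_tb.continuousAt (u.velE_ne_zero p₀)
    (hb 0) (hb 1) (hb 2)
  have hne : gVol (hlam.coordAt (u.map p₀)) (u.velE p₀) (b 0 p₀) (b 1 p₀) (b 2 p₀) ≠ 0 := by
    rw [hb0, hb0, hb0]
    exact hy
  have hdet := Φ.continuousAt_det hlam (g := id) (s := fun _ => 1) continuousAt_id
    continuousAt_const hb
  refine (hdet.div hvol hne).congr ?_
  filter_upwards [hvol.eventually_ne hne] with p hp
  exact (div_eq_iff hp).2 (Φ.det_one hlam p fun k => b k p)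

/-- The argument of the quotient `det s x / det 1 x` for the bases `x` of a family of Lagrangian
subspaces. -/
lemma SympTrivialization.exists_arg_det {Y : Type*} [TopologicalSpace Y] {g : Y → I × I × S1}
    (hg : Continuous g) {ℓ : Y → Submodule ℝ E7} (hℓ : SecFramed (fun y => u.map (g y)) ℓ 3)
    (hp : ∀ y, ∀ v ∈ ℓ y, gProj (hlam.coordAt (u.map (g y))) (u.velE (g y)) v = v)
    (hlag : ∀ y, ∀ v ∈ ℓ y, ∀ w ∈ ℓ y,
      gForm (hlam.coordAt (u.map (g y))) (u.velE (g y)) v w = 0) :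
    ∃ θ : I × Y → ℝ, Continuous θ ∧ (∀ y, θ (1, y) = 0) ∧ ∀ (s : I) y (x : Fin 3 → E7),
      LinearIndependent ℝ x → Submodule.span ℝ (range x) = ℓ y →
      IsArg (θ (s, y)) (Φ.det hlam s (g y) x / Φ.det hlam 1 (g y) x) := by
  have hne (s : I) (y) (x : Fin 3 → E7) (hx : LinearIndependent ℝ x)
      (hx' : Submodule.span ℝ (range x) = ℓ y) : Φ.det hlam s (g y) x ≠ 0 :=
    linDet_ne_zero (Φ.stdSymp_lin hlam _) (u.velE_ne_zero _)
      (fun k => hp y _ (hx' ▸ Submodule.subset_span ⟨k, rfl⟩)) hx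
      (fun v hv w hw => hlag y v (hx' ▸ hv) w (hx' ▸ hw)) s.2.1
  choose c hc hc' using fun y => hℓ.exists_frame y
  -- The parameter s is reversed, so that lifting starts at s = 1, where the quotient is 1. The
  -- bases c need not be continuous, but the quotient is independent of the basis.
  let f : I × Y → ℂ := fun q =>
    Φ.det hlam (unitInterval.symm q.1) (g q.2) (c q.2) / Φ.det hlam 1 (g q.2) (c q.2)
  have hf (q : I × Y) (x : Fin 3 → E7) (hx : LinearIndependent ℝ x)
      (hx' : Submodule.span ℝ (range x) = ℓ q.2) :
      f q = Φ.det hlam (unitInterval.symm q.1) (g q.2) x / Φ.det hlam 1 (g q.2) x := by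
    obtain ⟨m, hm⟩ := exists_frameMul_eq (b := c q.2) (c := x) fun k => by
      rw [hc', ← hx']
      exact Submodule.subset_span ⟨k, rfl⟩
    have h1 (s : ℝ) : Φ.det hlam s (g q.2) x = m.det * Φ.det hlam s (g q.2) (c q.2) := by
      rw [hm]
      exact linDet_frameMul _ _ _
    have h2 : (m.det : ℂ) ≠ 0 := by
      have h3 := hne 1 q.2 x hx hx'
      rw [h1] at h3
      exact left_ne_zero_of_mul h3
    rw [h1, h1, mul_div_mul_left _ _ h2]
  have hne1 (y) (x : Fin 3 → E7) (hx : LinearIndependent ℝ x)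
      (hx' : Submodule.span ℝ (range x) = ℓ y) : Φ.det hlam 1 (g y) x ≠ 0 := by
    simpa using hne 1 y x hx hx'
  have hfc : Continuous f := by
    rw [continuous_iff_continuousAt]
    intro q₀
    obtain ⟨b, hb, hb'⟩ := hℓ q₀.2
    have hb2 (j) : ContinuousAt (fun q : I × Y => tb (u.map (g q.2)) (b j q.2)) q₀ :=
      ContinuousAt.comp (f := fun q : I × Y => q.2) (hb j) continuousAt_snd
    have hg2 : ContinuousAt (fun q : I × Y => g q.2) q₀ := (hg.comp continuous_snd).continuousAt
    have h0 := hb'.self_of_nhds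
    have h1 := (Φ.continuousAt_det hlam (s := fun q : I × Y => (unitInterval.symm q.1 : ℝ)) hg2
      (by fun_prop) hb2).div
      (Φ.continuousAt_det hlam (s := fun q : I × Y => 1) hg2 continuousAt_const hb2)
      (hne1 q₀.2 _ h0.1 h0.2)
    refine h1.congr ?_
    filter_upwards [continuousAt_snd.eventually hb'] with q hq
    exact (hf q _ hq.1 hq.2).symm
  have hf0 (q) : f q ≠ 0 := div_ne_zero (hne _ _ _ (hc _) (hc' _)) (hne1 _ _ (hc _) (hc' _))
  obtain ⟨θ, hθc, hθ, hθ0⟩ := exists_arg hfc hf0 (θ₀ := fun _ => 0) continuous_const fun y => by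
    have h1 : f (0, y) = 1 := by
      simp only [f, unitInterval.symm_zero, Icc.coe_one]
      exact div_self (hne1 _ _ (hc _) (hc' _))
    rw [h1]
    simpa using isArg_ofReal one_pos
  refine ⟨fun q => θ (unitInterval.symm q.1, q.2), by fun_prop, fun y => ?_, fun s y x hx hx' => ?_⟩
  · simp only [unitInterval.symm_one]
    exact hθ0 y
  · have h1 := hθ (unitInterval.symm s, y)
    rw [hf _ x hx hx'] at h1
    simpa only [unitInterval.symm_symm] using h1

/-- The argument of the square of the determinant of a basis of a Lagrangian subspace. -/
lemma SympTrivialization.isArg_det_sq {p : I × I × S1} {L : Submodule ℝ E7}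
    (hp : ∀ v ∈ L, gProj (hlam.coordAt (u.map p)) (u.velE p) v = v)
    (hL : Module.finrank ℝ L = 3)
    (hre : ∀ x ∈ L, ∀ y ∈ L, ∀ z ∈ L,
      (gVol (hlam.coordAt (u.map p)) (u.velE p) x y z).re = 0)
    {B : Matrix (Fin 3) (Fin 3) ℂ}
    (hB : Submodule.span ℝ (range B.transpose) = L.map (Φ.lin p)) {θ α : ℝ}
    (hθ : ∀ x : Fin 3 → E7, LinearIndependent ℝ x → Submodule.span ℝ (range x) = L →
      IsArg θ (Φ.det hlam 0 p x / Φ.det hlam 1 p x))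
    (hα : IsArg α (Φ.ratio hlam p ^ 2)) :
    IsArg (2 * θ + α + Real.pi) (B.det ^ 2) := by
  have hex (k) : ∃ v ∈ L, Φ.lin p v = B.transpose k := by
    have h1 : B.transpose k ∈ L.map (Φ.lin p) := hB ▸ Submodule.subset_span ⟨k, rfl⟩
    exact h1
  choose x hx hxB using hex
  have hinj (v : E7) (hv : v ∈ L) (h0 : Φ.lin p v = 0) : v = 0 :=
    (gProj_mem_span_iff (u.velE_ne_zero p) (hp v hv)).1
      (mem_span_of_stdSymp (u.velE_ne_zero p) (Φ.stdSymp_lin hlam p) h0)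
  have hspan : Submodule.span ℝ (range x) = L := by
    refine le_antisymm (Submodule.span_le.2 (by rintro _ ⟨k, rfl⟩; exact hx k)) fun v hv => ?_
    have h1 : Φ.lin p v ∈ Submodule.span ℝ (range B.transpose) := hB ▸ ⟨v, hv, rfl⟩
    obtain ⟨c, hc⟩ := (Submodule.mem_span_range_iff_exists_fun ℝ).1 h1
    have h2 : v - ∑ k, c k • x k = 0 := by
      refine hinj _ (L.sub_mem hv (L.sum_mem fun k _ => L.smul_mem _ (hx k))) ?_
      rw [map_sub, map_sum, ← hc, sub_eq_zero]
      refine Finset.sum_congr rfl fun k _ => ?_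
      rw [map_smul, hxB]
    rw [sub_eq_zero.1 h2]
    exact Submodule.sum_mem _ fun k _ => Submodule.smul_mem _ _ (Submodule.subset_span ⟨k, rfl⟩)
  have hli : LinearIndependent ℝ x := by
    rw [linearIndependent_iff_card_eq_finrank_span, Set.finrank, hspan, hL, Fintype.card_fin]
  have h0 : Φ.det hlam 0 p x = B.det := by
    rw [SympTrivialization.det, linDet_zero, ← Matrix.det_transpose B]
    congr 1
    ext k j
    rw [Matrix.of_apply, hxB]
  have h1 := hθ x hli hspan
  have hne : Φ.det hlam 1 p x ≠ 0 := fun h => h1.ne_zero (by rw [h, div_zero])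
  set w := gVol (hlam.coordAt (u.map p)) (u.velE p) (x 0) (x 1) (x 2) with hw
  have hw0 : w ≠ 0 := by
    rw [Φ.det_one hlam] at hne
    exact right_ne_zero_of_mul hne
  have hwre : w.re = 0 := hre _ (hx 0) _ (hx 1) _ (hx 2)
  have hwim : w.im ≠ 0 := fun h => hw0 (Complex.ext hwre h)
  have h2 : B.det = Φ.det hlam 0 p x / Φ.det hlam 1 p x * (Φ.ratio hlam p * w) := by
    rw [← Φ.det_one hlam, div_mul_cancel₀ _ hne, h0]
  -- The volume form is imaginary on the subspace, so its square is negative; this is the source of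
  -- the summand π, the same for all special Lagrangian subspaces.
  have h3 : w ^ 2 = ((-(w.im ^ 2) : ℝ) : ℂ) := by
    apply Complex.ext <;> simp [pow_two, hwre]
  have h4 : IsArg Real.pi (w ^ 2) := by
    rw [h3]
    exact isArg_neg (by have := sq_pos_of_ne_zero hwim; linarith)
  rw [h2, mul_pow, mul_pow, add_assoc]
  exact (h1.pow 2).mul (hα.mul h4)

end SquareDet

/-! ### Complex multiples of subspaces. -/

section Cmul

lemma cmul_cmul (c c' : ℂ) (L : Submodule ℝ C3) : cmul c (cmul c' L) = cmul (c * c') L := by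
  rw [cmul, cmul, cmul, ← Submodule.map_comp]
  congr 1
  exact LinearMap.ext fun x => smul_smul c c' x

lemma cmul_one (L : Submodule ℝ C3) : cmul 1 L = L := by
  have h : (LinearMap.lsmul ℂ C3 1).restrictScalars ℝ = LinearMap.id :=
    LinearMap.ext fun x => one_smul ℂ x
  rw [cmul, h, Submodule.map_id]

lemma cmul_neg (c : ℂ) (L : Submodule ℝ C3) : cmul (-c) L = cmul c L := by
  have h : (LinearMap.lsmul ℂ C3 (-c)).restrictScalars ℝ =
      -(LinearMap.lsmul ℂ C3 c).restrictScalars ℝ :=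
    LinearMap.ext fun x => neg_smul c x
  rw [cmul, h, Submodule.map_neg, cmul]

lemma span_cmul (c : ℂ) (b : Fin 3 → C3) :
    Submodule.span ℝ (range fun k => c • b k) = cmul c (Submodule.span ℝ (range b)) := by
  rw [cmul, Submodule.map_span, ← range_comp]
  rfl

lemma stdSymp_smul_smul (c : ℂ) (x y : C3) :
    stdSymp (c • x) (c • y) = Complex.normSq c * stdSymp x y := by
  have h : ∑ j, starRingEnd ℂ ((c • x) j) * (c • y) j =
      (Complex.normSq c : ℂ) * ∑ j, starRingEnd ℂ (x j) * y j := by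
    rw [Finset.mul_sum, Complex.normSq_eq_conj_mul_self]
    refine Finset.sum_congr rfl fun j _ => ?_
    simp only [Pi.smul_apply, smul_eq_mul, map_mul]
    ring
  rw [stdSymp, h, Complex.im_ofReal_mul, stdSymp]

lemma LocFramed.cmul {Y : Type*} [TopologicalSpace Y] {ℓ : Y → Submodule ℝ C3} {k : ℕ}
    (h : LocFramed ℓ k) {c : Y → ℂ} (hc : Continuous c) (h0 : ∀ y, c y ≠ 0) :
    LocFramed (fun y => cmul (c y) (ℓ y)) k := by
  intro y₀
  obtain ⟨b, hb, hb'⟩ := h y₀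
  refine ⟨fun j y => c y • b j y, fun j => hc.continuousAt.smul (hb j), ?_⟩
  filter_upwards [hb'] with y hy
  constructor
  · have h1 := hy.1.map' ((LinearMap.lsmul ℂ C3 (c y)).restrictScalars ℝ) (by
      rw [LinearMap.ker_eq_bot]
      exact smul_right_injective C3 (h0 y))
    exact h1
  · rw [← hy.2, G2Loop.cmul, Submodule.map_span, ← range_comp]
    rfl

lemma LocFramed.of_eventuallyEq {Y W : Type*} [TopologicalSpace Y] [NormedAddCommGroup W]
    [NormedSpace ℝ W] {ℓ : Y → Submodule ℝ W} {k : ℕ}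
    (h : ∀ y₀, ∃ ℓ', LocFramed ℓ' k ∧ ∀ᶠ y in 𝓝 y₀, ℓ y = ℓ' y) : LocFramed ℓ k := by
  intro y₀
  obtain ⟨ℓ', h1, h2⟩ := h y₀
  obtain ⟨b, hb, hb'⟩ := h1 y₀
  refine ⟨b, hb, ?_⟩
  filter_upwards [h2, hb'] with y hy hy'
  rw [hy]
  exact hy'

end Cmul

/-! ### The boundary map is a continuous family of Lagrangian subspaces. -/

section Boundary

variable {M : Type*} [TopologicalSpace M] [ChartedSpace E7 M] [IsManifold (𝓡 7) ∞ M]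
  {N₁ N₂ : Type*} [TopologicalSpace N₁] [ChartedSpace (EuclideanSpace ℝ (Fin 4)) N₁]
  [IsManifold (𝓡 4) ∞ N₁] [TopologicalSpace N₂] [ChartedSpace (EuclideanSpace ℝ (Fin 4)) N₂]
  [IsManifold (𝓡 4) ∞ N₂]
  {lam : ThreeForm M} {i₁ : N₁ → M} {i₂ : N₂ → M} {γ₁ γ₂ : S1 → M}
  {u : ConnectingSquare i₁ i₂ γ₁ γ₂} (Φ : SympTrivialization lam u)

lemma SympTrivialization.lagr₁_const (hlam : IsG2Form lam) {p q : I × I × S1}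
    (hp : p.1 = 0 ∨ p.1 = 1) (h1 : q.1 = p.1) (h2 : q.2.2 = p.2.2) :
    Φ.lagr₁ p = Φ.lagr₁ q := by
  rw [Φ.lagr₁_eq hlam, Φ.lagr₁_eq hlam, u.L₁_const hlam hp h1 h2, Φ.lin_const hp h1 h2]

lemma SympTrivialization.lagr₂_const (hlam : IsG2Form lam) {p q : I × I × S1}
    (hp : p.1 = 0 ∨ p.1 = 1) (h1 : q.1 = p.1) (h2 : q.2.2 = p.2.2) :
    Φ.lagr₂ p = Φ.lagr₂ q := by
  rw [Φ.lagr₂_eq hlam, Φ.lagr₂_eq hlam, u.L₂_const hlam hp h1 h2, Φ.lin_const hp h1 h2]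

/-- The rotation on the sides, starting from the first Lagrangian subspace. -/
def rot₁ (b : ℝ) : ℂ := Complex.exp (Complex.I * Real.pi / 2 * b)

/-- The rotation on the sides, ending with the second Lagrangian subspace. -/
def rot₂ (b : ℝ) : ℂ := Complex.exp (-(Complex.I * Real.pi / 2 * (1 - b)))

/-- As L₁ = i L₂ over the ends, rotating away from L₁ and rotating towards L₂ give the same
subspaces; the sign is invisible to subspaces. -/
lemma rot₁_mul_I (b : ℝ) : rot₁ b * Complex.I = -rot₂ b := by
  have h1 : Complex.I * Real.pi / 2 * b =
      -(Complex.I * Real.pi / 2 * (1 - b)) + Real.pi / 2 * Complex.I := by ring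
  rw [rot₁, rot₂, h1, Complex.exp_add, Complex.exp_pi_div_two_mul_I, mul_assoc, Complex.I_mul_I]
  ring

/-- Together with `SympTrivialization.boundaryMap_of_ne_zero` this replaces the definition by cases
with two formulas on open sets covering the torus, so that the corners need no separate argument. -/
lemma SympTrivialization.boundaryMap_of_ne_one (hlam : IsG2Form lam) {q : Torus}
    (h : q.1.1.2 ≠ 1) :
    Φ.boundaryMap q = cmul (rot₁ q.1.1.2) (Φ.lagr₁ (q.1.1.1, 0, q.2)) := by
  obtain ⟨⟨⟨a, b⟩, hab⟩, z⟩ := q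
  simp only at h hab ⊢
  rcases eq_or_ne b 0 with rfl | hb
  · simp [SympTrivialization.boundaryMap, rot₁, cmul_one]
  have hab' : a = 0 ∨ a = 1 := by tauto
  rw [← Φ.lagr₁_const hlam (p := (a, b, z)) (q := (a, 0, z)) hab' rfl rfl]
  rcases eq_or_ne a 1 with rfl | ha
  · simp only [SympTrivialization.boundaryMap, hb, h, if_false, if_true]
    rfl
  · simp only [SympTrivialization.boundaryMap, hb, h, ha, if_false]
    have h1 : Φ.lagr₁ (a, b, z) = cmul Complex.I (Φ.lagr₂ (a, b, z)) := Φ.ends _ hab'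
    rw [h1, cmul_cmul, rot₁_mul_I, cmul_neg]
    rfl

lemma SympTrivialization.boundaryMap_of_ne_zero (hlam : IsG2Form lam) {q : Torus}
    (h : q.1.1.2 ≠ 0) :
    Φ.boundaryMap q = cmul (rot₂ q.1.1.2) (Φ.lagr₂ (q.1.1.1, 1, q.2)) := by
  obtain ⟨⟨⟨a, b⟩, hab⟩, z⟩ := q
  simp only at h hab ⊢
  rcases eq_or_ne b 1 with rfl | hb
  · simp [SympTrivialization.boundaryMap, rot₂, cmul_one]
  have hab' : a = 0 ∨ a = 1 := by tauto
  rw [← Φ.lagr₂_const hlam (p := (a, b, z)) (q := (a, 1, z)) hab' rfl rfl]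
  rcases eq_or_ne a 1 with rfl | ha
  · simp only [SympTrivialization.boundaryMap, hb, h, if_false, if_true]
    have h1 : Φ.lagr₁ (1, b, z) = cmul Complex.I (Φ.lagr₂ (1, b, z)) := Φ.ends _ hab'
    rw [h1, cmul_cmul, ← cmul_neg (rot₂ _), ← rot₁_mul_I]
    rfl
  · simp only [SympTrivialization.boundaryMap, hb, h, ha, if_false]
    rfl

lemma SympTrivialization.lin_injOn (hlam : IsG2Form lam) {p : I × I × S1} {v : E7}
    (hv : gProj (hlam.coordAt (u.map p)) (u.velE p) v = v) (h0 : Φ.lin p v = 0) : v = 0 :=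
  (gProj_mem_span_iff (u.velE_ne_zero p) hv).1
    (mem_span_of_stdSymp (u.velE_ne_zero p) (Φ.stdSymp_lin hlam p) h0)

lemma SympTrivialization.locFramed_lagr₁ (hlam : IsG2Form lam)
    (hi₁ : IsIsotropicEmbedding lam i₁) :
    LocFramed (fun q : I × S1 => Φ.lagr₁ (q.1, 0, q.2)) 3 := by
  have h := (u.secFramed₁ hlam hi₁).map (fun q : I × S1 => Φ.lin (q.1, 0, q.2))
    (fun s y₀ hs => Φ.continuousAt_lin (g := fun q : I × S1 => (q.1, 0, q.2)) (by fun_prop) hs)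
    (fun q x hx h0 => Φ.lin_injOn hlam (gProj_of_mem_horL hlam (u.velE_ne_zero _) hx) h0)
  simpa only [Φ.lagr₁_eq hlam] using h

lemma SympTrivialization.locFramed_lagr₂ (hlam : IsG2Form lam)
    (hi₂ : IsIsotropicEmbedding lam i₂) :
    LocFramed (fun q : I × S1 => Φ.lagr₂ (q.1, 1, q.2)) 3 := by
  have h := (u.secFramed₂ hlam hi₂).map (fun q : I × S1 => Φ.lin (q.1, 1, q.2))
    (fun s y₀ hs => Φ.continuousAt_lin (g := fun q : I × S1 => (q.1, 1, q.2)) (by fun_prop) hs)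
    (fun q x hx h0 => Φ.lin_injOn hlam (gProj_of_mem_horL hlam (u.velE_ne_zero _) hx) h0)
  simpa only [Φ.lagr₂_eq hlam] using h

lemma SympTrivialization.locFramed_boundaryMap (hlam : IsG2Form lam)
    (hi₁ : IsIsotropicEmbedding lam i₁) (hi₂ : IsIsotropicEmbedding lam i₂) :
    LocFramed Φ.boundaryMap 3 := by
  have hc : Continuous fun q : Torus => (q.1.1.1, q.2) := by fun_prop
  have hb : Continuous fun q : Torus => q.1.1.2 := by fun_prop
  refine LocFramed.of_eventuallyEq fun q₀ => ?_
  by_cases h : q₀.1.1.2 = 1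
  · refine ⟨_, ((Φ.locFramed_lagr₂ hlam hi₂).comp hc).cmul (c := fun q : Torus => rot₂ q.1.1.2)
      (by unfold rot₂; fun_prop) fun q => Complex.exp_ne_zero _, ?_⟩
    have h1 : q₀.1.1.2 ≠ 0 := by rw [h]; exact one_ne_zero
    filter_upwards [hb.continuousAt.eventually_ne h1] with q hq
    exact Φ.boundaryMap_of_ne_zero hlam hq
  · refine ⟨_, ((Φ.locFramed_lagr₁ hlam hi₁).comp hc).cmul (c := fun q : Torus => rot₁ q.1.1.2)
      (by unfold rot₁; fun_prop) fun q => Complex.exp_ne_zero _, ?_⟩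
    filter_upwards [hb.continuousAt.eventually_ne h] with q hq
    exact Φ.boundaryMap_of_ne_one hlam hq

lemma SympTrivialization.stdSymp_boundaryMap (hlam : IsG2Form lam)
    (hi₁ : IsIsotropicEmbedding lam i₁) (hi₂ : IsIsotropicEmbedding lam i₂) (q : Torus) :
    ∀ x ∈ Φ.boundaryMap q, ∀ y ∈ Φ.boundaryMap q, stdSymp x y = 0 := by
  by_cases h : q.1.1.2 = 1
  · rw [Φ.boundaryMap_of_ne_zero hlam (by rw [h]; exact one_ne_zero), Φ.lagr₂_eq hlam]
    rintro _ ⟨_, ⟨v, hv, rfl⟩, rfl⟩ _ ⟨_, ⟨w, hw, rfl⟩, rfl⟩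
    refine (stdSymp_smul_smul _ _ _).trans ?_
    rw [Φ.stdSymp_lin hlam, gForm_horL hlam hi₂ (u.side₂ _ _) (u.velE_ne_zero _)
      (u.velE_mem₂ hi₂ _ _) hv hw, mul_zero]
  · rw [Φ.boundaryMap_of_ne_one hlam h, Φ.lagr₁_eq hlam]
    rintro _ ⟨_, ⟨v, hv, rfl⟩, rfl⟩ _ ⟨_, ⟨w, hw, rfl⟩, rfl⟩
    refine (stdSymp_smul_smul _ _ _).trans ?_
    rw [Φ.stdSymp_lin hlam, gForm_horL hlam hi₁ (u.side₁ _ _) (u.velE_ne_zero _)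
      (u.velE_mem₁ hi₁ _ _) hv hw, mul_zero]

end Boundary

/-! ### The contribution of an end to the index. -/

section Index

variable {M : Type*} [TopologicalSpace M] [ChartedSpace E7 M] [IsManifold (𝓡 7) ∞ M]
  {N₁ N₂ : Type*} [TopologicalSpace N₁] [ChartedSpace (EuclideanSpace ℝ (Fin 4)) N₁]
  [IsManifold (𝓡 4) ∞ N₁] [TopologicalSpace N₂] [ChartedSpace (EuclideanSpace ℝ (Fin 4)) N₂]
  [IsManifold (𝓡 4) ∞ N₂]
  {lam : ThreeForm M} {i₁ : N₁ → M} {i₂ : N₂ → M} {γ₁ γ₂ : S1 → M}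

lemma exists_frame_horL (hlam : IsG2Form lam) (hi₁ : IsIsotropicEmbedding lam i₁) {x : M} {e : E7}
    (hr : x ∈ range i₁) (hne : e ≠ 0) (he : e ∈ tanE i₁ x) :
    ∃ b : Fin 3 → E7, LinearIndependent ℝ b ∧ Submodule.span ℝ (range b) = horL hlam i₁ x e :=
  (secFramed_horL (Y := Unit) (f := fun _ => x) (e := fun _ => e) hlam hi₁
    continuous_const (fun _ => hne) (fun _ => hr) (fun _ => he)).exists_frame ()

lemma gProj_smul_left {V : Type*} [AddCommGroup V] [Module ℝ V] (A : V ≃ₗ[ℝ] (Fin 7 → ℝ)) (e : V)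
    {c : ℝ} (hc : 0 < c) : gProj A (c • e) = gProj A e := by
  ext v : 1
  rw [gProj_eq, gProj_eq, gJ_smul hc]

lemma horL_smul (hlam : IsG2Form lam) (i₁ : N₁ → M) (x : M) (e : E7) {c : ℝ} (hc : 0 < c) :
    horL hlam i₁ x (c • e) = horL hlam i₁ x e := by
  rw [horL, horL, gProj_smul_left _ _ hc]

open Classical in
/-- The contribution to the index of an intersection loop with velocity `e` at the point `x`. -/
def endIndex (hlam : IsG2Form lam) (i₁ : N₁ → M) (i₂ : N₂ → M) (x : M) (e : E7) : ℤ :=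
  if ∃ x₁ x₂ : Fin 3 → E7,
      (LinearIndependent ℝ x₁ ∧ Submodule.span ℝ (range x₁) = horL hlam i₁ x e) ∧
      (LinearIndependent ℝ x₂ ∧ Submodule.span ℝ (range x₂) = horL hlam i₂ x e) ∧
      0 < framePairing (hlam.coordAt x) e x₁ x₂ then 1 else 2

variable {u : ConnectingSquare i₁ i₂ γ₁ γ₂} (Φ : SympTrivialization lam u)

/-- The values 1 and 2 of `endIndex` encode the signs as 3 − 2n = ±1; the 3 later cancels against
the rotation of a complex 3-space by a quarter turn. The argument difference does not involve the
bases, so the sign used in `endIndex` is the same for all of them. -/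
lemma SympTrivialization.arg_sub_arg (hlam : IsG2Form lam) (hi₁ : IsIsotropicEmbedding lam i₁)
    (hi₂ : IsIsotropicEmbedding lam i₂) {p : I × I × S1} (hp : p.1 = 0 ∨ p.1 = 1) {θ₁ θ₂ : I → ℝ}
    (hc₁ : Continuous θ₁) (hc₂ : Continuous θ₂) (h1₁ : θ₁ 1 = 0) (h1₂ : θ₂ 1 = 0)
    (hθ₁ : ∀ (s : I) (x : Fin 3 → E7), LinearIndependent ℝ x →
      Submodule.span ℝ (range x) = u.L₁ hlam p → IsArg (θ₁ s) (Φ.det hlam s p x / Φ.det hlam 1 p x))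
    (hθ₂ : ∀ (s : I) (x : Fin 3 → E7), LinearIndependent ℝ x →
      Submodule.span ℝ (range x) = u.L₂ hlam p →
        IsArg (θ₂ s) (Φ.det hlam s p x / Φ.det hlam 1 p x)) :
    θ₂ 0 - θ₁ 0 = (3 - 2 * endIndex hlam i₁ i₂ (u.map p) (u.velE p)) * (Real.pi / 2) := by
  obtain ⟨hr1, hr2⟩ := mem_range_ends (u := u) p hp
  obtain ⟨he1, he2⟩ := velE_mem_ends (u := u) hi₁ hi₂ p hp
  have hne := u.velE_ne_zero p
  have key (x₁ x₂ : Fin 3 → E7) (h₁ : LinearIndependent ℝ x₁)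
      (h₁' : Submodule.span ℝ (range x₁) = u.L₁ hlam p) (h₂ : LinearIndependent ℝ x₂)
      (h₂' : Submodule.span ℝ (range x₂) = u.L₂ hlam p) :=
    arg_sub_arg_linDet hne (Φ.stdSymp_lin hlam p)
      (fun v hv => gProj_of_mem_horL hlam hne hv) (fun v hv => gProj_of_mem_horL hlam hne hv)
      (fun v hv w hw => gForm_horL hlam hi₂ hr2 hne he2 hv hw)
      (fun x hx y hy z hz => gVol_re_horL hlam hi₁ hr1 hne he1 hx hy hz)
      (fun x hx y hy z hz => gVol_re_horL hlam hi₂ hr2 hne he2 hx hy hz)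
      (((Φ.lagr₁_eq hlam p).symm.trans (Φ.ends p hp)).trans
        (congrArg (cmul Complex.I) (Φ.lagr₂_eq hlam p)))
      h₁' h₂ h₂' hc₁ hc₂ h1₁ h1₂ (fun s => hθ₁ s x₁ h₁ h₁') (fun s => hθ₂ s x₂ h₂ h₂')
  unfold endIndex
  split_ifs with h
  · obtain ⟨x₁, x₂, h₁, h₂, hpos⟩ := h
    rw [key x₁ x₂ h₁.1 h₁.2 h₂.1 h₂.2, if_pos hpos]
    push_cast
    ring
  · obtain ⟨x₁, h₁, h₁'⟩ := exists_frame_horL hlam hi₁ hr1 hne he1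
    obtain ⟨x₂, h₂, h₂'⟩ := exists_frame_horL hlam hi₂ hr2 hne he2
    rw [key x₁ x₂ h₁ h₁' h₂ h₂',
      if_neg fun hpos => h ⟨x₁, x₂, ⟨h₁, h₁'⟩, ⟨h₂, h₂'⟩, hpos⟩]
    push_cast
    ring

/-- J and the projection depend only on the direction of e, and the pairing is multiplied by c³. -/
lemma endIndex_smul (hlam : IsG2Form lam) (x : M) (e : E7) {c : ℝ} (hc : 0 < c) :
    endIndex hlam i₁ i₂ x (c • e) = endIndex hlam i₁ i₂ x e := by
  have hJ : gJ (hlam.coordAt x) (c • e) = gJ (hlam.coordAt x) e := gJ_smul hc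
  have hP := gProj_smul_left (hlam.coordAt x) e hc
  have hV (v w z : E7) : gVol (hlam.coordAt x) (c • e) v w z = gVol (hlam.coordAt x) e v w z := by
    rw [gVol, gVol, hJ, hP]
  have hF (x₁ x₂ : Fin 3 → E7) : 0 < framePairing (hlam.coordAt x) (c • e) x₁ x₂ ↔
      0 < framePairing (hlam.coordAt x) e x₁ x₂ := by
    have h1 : (Matrix.of fun j k => gForm (hlam.coordAt x) (c • e) (x₂ j) (x₁ k)) =
        c • Matrix.of fun j k => gForm (hlam.coordAt x) e (x₂ j) (x₁ k) := by
      ext j k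
      simp [gForm_smul1]
    rw [framePairing, framePairing, hV, hV, h1, Matrix.det_smul, Fintype.card_fin,
      mul_left_comm, mul_pos_iff_of_pos_left (by positivity)]
  classical
  unfold endIndex
  refine if_congr (exists_congr fun x₁ => exists_congr fun x₂ => ?_) rfl rfl
  rw [horL_smul hlam _ x e hc, horL_smul hlam _ x e hc, hF]

end Index

/-! ### The degree of maps to the boundary of the square. -/

section Centre

/-- The position of a point of the boundary of the square with respect to the centre. -/
def centre (p : Bdry) : ℂ := ((p.1.1 : ℝ) - 1 / 2 : ℂ) + ((p.1.2 : ℝ) - 1 / 2 : ℂ) * Complex.I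

lemma centre_re (p : Bdry) : (centre p).re = (p.1.1 : ℝ) - 1 / 2 := by simp [centre]

lemma centre_im (p : Bdry) : (centre p).im = (p.1.2 : ℝ) - 1 / 2 := by simp [centre]

lemma continuous_centre : Continuous centre := by unfold centre; fun_prop

lemma centre_ne_zero (p : Bdry) : centre p ≠ 0 := by
  intro h
  have h1 := centre_re p
  have h2 := centre_im p
  rw [h, Complex.zero_re] at h1
  rw [h, Complex.zero_im] at h2
  obtain ⟨⟨a, b⟩, hab⟩ := p
  simp only at h1 h2 hab
  rcases hab with rfl | rfl | rfl | rfl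
  · norm_num at h1
  · norm_num at h1
  · norm_num at h2
  · norm_num at h2

/-- A map to the circle which is constant off the side `a = 1`. -/
def sideTurn (p : Bdry) : ℂ :=
  if p.1.1 = 1 then Complex.exp ((2 * Real.pi * (p.1.2 : ℝ) : ℝ) * Complex.I) else 1

lemma sideTurn_of_ne (p : Bdry) (h : p.1.1 = 0 ∨ p.1.2 = 0 ∨ p.1.2 = 1) : sideTurn p = 1 := by
  unfold sideTurn
  split_ifs with h1
  · rcases h with h | h | h
    · rw [h] at h1
      exact absurd h1 zero_ne_one
    · simp [h]
    · rw [h]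
      simp
  · rfl

lemma continuous_sideTurn : Continuous sideTurn := by
  have h1 : IsClosed {p : Bdry | p.1.1 = 1} := isClosed_eq (by fun_prop) continuous_const
  have h2 : IsClosed {p : Bdry | p.1.1 = 0 ∨ p.1.2 = 0 ∨ p.1.2 = 1} :=
    (isClosed_eq (by fun_prop) continuous_const).union
      ((isClosed_eq (by fun_prop) continuous_const).union
        (isClosed_eq (by fun_prop) continuous_const))
  have h3 : {p : Bdry | p.1.1 = 1} ∪ {p : Bdry | p.1.1 = 0 ∨ p.1.2 = 0 ∨ p.1.2 = 1} = univ := by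
    ext p
    have := p.2
    simp only [mem_union, mem_ofPred_eq, mem_univ, iff_true]
    tauto
  rw [← continuousOn_univ, ← h3]
  refine ContinuousOn.union_of_isClosed ?_ ?_ h1 h2
  · refine (Continuous.continuousOn (f := fun p : Bdry =>
      Complex.exp ((2 * Real.pi * (p.1.2 : ℝ) : ℝ) * Complex.I)) (by fun_prop)).congr fun p hp => ?_
    simp only [mem_ofPred_eq] at hp
    simp [sideTurn, hp]
  · exact continuousOn_const.congr fun p hp => sideTurn_of_ne p hp

/-- The vectors −`sideTurn` and `centre` never point in opposite directions, so their quotient has a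
continuous principal argument. In particular, a turn spread over the whole boundary can be
concentrated on the side a = 1. -/
lemma neg_sideTurn_div_mem (p : Bdry) : -sideTurn p / centre p ∈ Complex.slitPlane := by
  have key : 0 < (-sideTurn p * starRingEnd ℂ (centre p)).re ∨
      (-sideTurn p * starRingEnd ℂ (centre p)).im ≠ 0 := by
    by_cases h : p.1.1 = 0 ∨ p.1.2 = 0 ∨ p.1.2 = 1
    · rw [sideTurn_of_ne p h]
      simp only [neg_mul, one_mul, Complex.neg_re, Complex.conj_re, Complex.neg_im,
        Complex.conj_im, neg_neg, centre_re, centre_im]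
      rcases h with h | h | h
      · left; rw [h]; norm_num
      · right; rw [h]; norm_num
      · right; rw [h]; norm_num
    · have h1 : p.1.1 = 1 := by have := p.2; tauto
      have hb0 : (0 : ℝ) < p.1.2 := lt_of_le_of_ne p.1.2.2.1 fun h' => h (by
        right; left; exact Subtype.ext h'.symm)
      have hb1 : (p.1.2 : ℝ) < 1 := lt_of_le_of_ne p.1.2.2.2 fun h' => h (by
        right; right; exact Subtype.ext h')
      set b : ℝ := (p.1.2 : ℝ)
      have h2 : sideTurn p = Complex.exp ((2 * Real.pi * b : ℝ) * Complex.I) := by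
        simp [sideTurn, h1, b]
      have h3 : -sideTurn p = Complex.exp ((2 * Real.pi * (b - 1 / 2) : ℝ) * Complex.I) := by
        have : ((2 * Real.pi * b : ℝ) : ℂ) * Complex.I =
            (2 * Real.pi * (b - 1 / 2) : ℝ) * Complex.I + Real.pi * Complex.I := by
          push_cast; ring
        rw [h2, this, Complex.exp_add, Complex.exp_pi_mul_I, mul_neg_one, neg_neg]
      have hre : (-sideTurn p).re = Real.cos (2 * Real.pi * (b - 1 / 2)) := by
        rw [h3, Complex.exp_ofReal_mul_I_re]
      have him : (-sideTurn p).im = Real.sin (2 * Real.pi * (b - 1 / 2)) := by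
        rw [h3, Complex.exp_ofReal_mul_I_im]
      set t : ℝ := 2 * Real.pi * (b - 1 / 2) with ht
      have hpi := Real.pi_pos
      have e1 : (-sideTurn p * starRingEnd ℂ (centre p)).re =
          Real.cos t * (1 / 2) + Real.sin t * (b - 1 / 2) := by
        rw [Complex.mul_re, Complex.conj_re, Complex.conj_im, hre, him, centre_re, centre_im, h1]
        simp only [Icc.coe_one]
        ring
      have e2 : (-sideTurn p * starRingEnd ℂ (centre p)).im =
          Real.sin t * (1 / 2) - Real.cos t * (b - 1 / 2) := by
        rw [Complex.mul_im, Complex.conj_re, Complex.conj_im, hre, him, centre_re, centre_im, h1]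
        simp only [Icc.coe_one]
        ring
      rw [e1, e2]
      by_contra! hcon
      obtain ⟨hc1, hc2⟩ := hcon
      have hsc := Real.sin_sq_add_cos_sq t
      -- the imaginary part vanishes, so that the two directions agree up to sign
      have h5 : Real.sin t = 2 * (b - 1 / 2) * Real.cos t := by linarith
      have h6 : Real.cos t ≤ 0 := by
        rw [h5] at hc1
        by_contra! hpos
        have := mul_nonneg hpos.le (sq_nonneg (b - 1 / 2))
        nlinarith
      have h7 : Real.cos t ≠ 0 := by
        intro h0
        rw [h0, mul_zero] at h5
        rw [h0, h5] at hsc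
        norm_num at hsc
      have h8 : Real.cos t < 0 := lt_of_le_of_ne h6 h7
      -- As |t| ≤ π, sin t has the sign of b − 1/2 or vanishes, which contradicts `h5` together with
      -- cos t < 0; at b = 1/2 the cosine is 1.
      rcases lt_trichotomy b (1 / 2) with hb | hb | hb
      · have : Real.sin t ≤ 0 :=
          Real.sin_nonpos_of_nonpos_of_neg_pi_le (by rw [ht]; nlinarith) (by rw [ht]; nlinarith)
        nlinarith
      · rw [ht, hb] at h8
        norm_num at h8
      · have : 0 ≤ Real.sin t :=
          Real.sin_nonneg_of_nonneg_of_le_pi (by rw [ht]; nlinarith) (by rw [ht]; nlinarith)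
        nlinarith
  have hn : 0 < Complex.normSq (centre p) := Complex.normSq_pos.2 (centre_ne_zero p)
  have h1 : -sideTurn p / centre p =
      ((Complex.normSq (centre p))⁻¹ : ℝ) * (-sideTurn p * starRingEnd ℂ (centre p)) := by
    rw [div_eq_mul_inv, Complex.inv_def]
    push_cast
    ring
  rw [h1, Complex.mem_slitPlane_iff, Complex.re_ofReal_mul, Complex.im_ofReal_mul]
  exact key.imp (fun h => mul_pos (inv_pos.2 hn) h) (fun h => mul_ne_zero (inv_pos.2 hn).ne' h)

lemma exists_arg_centre : ∃ ρ : Bdry → ℝ, Continuous ρ ∧ ∀ p,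
    IsArg (ρ p) (sideTurn p / centre p) := by
  refine ⟨fun p => (-sideTurn p / centre p).arg + Real.pi, ?_, fun p => ?_⟩
  · refine Continuous.add (continuous_iff_continuousAt.2 fun p => ?_) continuous_const
    exact ContinuousAt.comp (f := fun p => -sideTurn p / centre p)
      (Complex.continuousAt_arg (neg_sideTurn_div_mem p))
      ((continuous_sideTurn.neg.div continuous_centre centre_ne_zero).continuousAt)
  · have h1 := (isArg_arg (Complex.slitPlane_ne_zero (neg_sideTurn_div_mem p))).mul
      (isArg_neg (show (-1 : ℝ) < 0 by norm_num))
    convert h1 using 1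
    push_cast
    ring

end Centre

/-! ### The effect of the rotation on the determinant. -/

section Rotation

lemma isArg_rot₁ (b : ℝ) : IsArg (Real.pi / 2 * b) (rot₁ b) := by
  convert isArg_exp (Real.pi / 2 * b) using 1
  rw [rot₁]
  congr 1
  push_cast
  ring

lemma exists_of_span_cmul {c : ℂ} (hc : c ≠ 0) {L : Submodule ℝ C3} {B : Matrix (Fin 3) (Fin 3) ℂ}
    (hB : Submodule.span ℝ (range B.transpose) = cmul c L) :
    ∃ B' : Matrix (Fin 3) (Fin 3) ℂ, Submodule.span ℝ (range B'.transpose) = L ∧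
      B.det ^ 2 = c ^ 6 * B'.det ^ 2 := by
  refine ⟨c⁻¹ • B, ?_, ?_⟩
  · have h1 := span_cmul c⁻¹ B.transpose
    rw [hB, cmul_cmul, inv_mul_cancel₀ hc, cmul_one] at h1
    exact h1
  · rw [Matrix.det_smul, Fintype.card_fin, mul_pow, ← mul_assoc, ← pow_mul, ← mul_pow,
      mul_inv_cancel₀ hc, one_pow, one_mul]

end Rotation

/-! ### The argument of det² over the torus. -/

section BoundaryArg

variable {M : Type*} [TopologicalSpace M] [ChartedSpace E7 M] [IsManifold (𝓡 7) ∞ M]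
  {N₁ N₂ : Type*} [TopologicalSpace N₁] [ChartedSpace (EuclideanSpace ℝ (Fin 4)) N₁]
  [IsManifold (𝓡 4) ∞ N₁] [TopologicalSpace N₂] [ChartedSpace (EuclideanSpace ℝ (Fin 4)) N₂]
  [IsManifold (𝓡 4) ∞ N₂]
  {lam : ThreeForm M} {i₁ : N₁ → M} {i₂ : N₂ → M} {γ₁ γ₂ : S1 → M}
  {u : ConnectingSquare i₁ i₂ γ₁ γ₂} (Φ : SympTrivialization lam u) (hlam : IsG2Form lam)

lemma SympTrivialization.det_const {p q : I × I × S1} (hp : p.1 = 0 ∨ p.1 = 1) (h1 : q.1 = p.1)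
    (h2 : q.2.2 = p.2.2) (s : ℝ) (x : Fin 3 → E7) : Φ.det hlam s p x = Φ.det hlam s q x := by
  rw [SympTrivialization.det, SympTrivialization.det, u.map_eq hp h1 h2, u.velE_eq hp h1 h2,
    Φ.lin_const hp h1 h2]

lemma SympTrivialization.exists_arg_det₁ (hi₁ : IsIsotropicEmbedding lam i₁) :
    ∃ θ : I × I × S1 → ℝ, Continuous θ ∧ (∀ y, θ (1, y) = 0) ∧
      ∀ (s : I) (y : I × S1) (x : Fin 3 → E7), LinearIndependent ℝ x →
      Submodule.span ℝ (range x) = u.L₁ hlam (y.1, 0, y.2) →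
      IsArg (θ (s, y)) (Φ.det hlam s (y.1, 0, y.2) x / Φ.det hlam 1 (y.1, 0, y.2) x) :=
  Φ.exists_arg_det hlam (g := fun y : I × S1 => (y.1, 0, y.2)) (by fun_prop)
    (u.secFramed₁ hlam hi₁)
    (fun _ _ hv => gProj_of_mem_horL hlam (u.velE_ne_zero _) hv)
    (fun _ _ hv _ hw => gForm_horL hlam hi₁ (u.side₁ _ _) (u.velE_ne_zero _)
      (u.velE_mem₁ hi₁ _ _) hv hw)

lemma SympTrivialization.exists_arg_det₂ (hi₂ : IsIsotropicEmbedding lam i₂) :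
    ∃ θ : I × I × S1 → ℝ, Continuous θ ∧ (∀ y, θ (1, y) = 0) ∧
      ∀ (s : I) (y : I × S1) (x : Fin 3 → E7), LinearIndependent ℝ x →
      Submodule.span ℝ (range x) = u.L₂ hlam (y.1, 1, y.2) →
      IsArg (θ (s, y)) (Φ.det hlam s (y.1, 1, y.2) x / Φ.det hlam 1 (y.1, 1, y.2) x) :=
  Φ.exists_arg_det hlam (g := fun y : I × S1 => (y.1, 1, y.2)) (by fun_prop)
    (u.secFramed₂ hlam hi₂)
    (fun _ _ hv => gProj_of_mem_horL hlam (u.velE_ne_zero _) hv)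
    (fun _ _ hv _ hw => gForm_horL hlam hi₂ (u.side₂ _ _) (u.velE_ne_zero _)
      (u.velE_mem₂ hi₂ _ _) hv hw)

lemma SympTrivialization.isArg_det_sq₁ (hi₁ : IsIsotropicEmbedding lam i₁) {a : I} {z : S1}
    {B : Matrix (Fin 3) (Fin 3) ℂ}
    (hB : Submodule.span ℝ (range B.transpose) = Φ.lagr₁ (a, 0, z)) {θ α : ℝ}
    (hθ : ∀ x : Fin 3 → E7, LinearIndependent ℝ x →
      Submodule.span ℝ (range x) = u.L₁ hlam (a, 0, z) →
      IsArg θ (Φ.det hlam ((0 : I) : ℝ) (a, 0, z) x / Φ.det hlam 1 (a, 0, z) x))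
    (hα : IsArg α (Φ.ratio hlam (a, 0, z) ^ 2)) : IsArg (2 * θ + α + Real.pi) (B.det ^ 2) :=
  Φ.isArg_det_sq hlam (L := u.L₁ hlam (a, 0, z))
    (fun _ hv => gProj_of_mem_horL hlam (u.velE_ne_zero _) hv)
    (finrank_horL hlam hi₁ (u.side₁ _ _) (u.velE_ne_zero _) (u.velE_mem₁ hi₁ _ _))
    (fun _ hx _ hy _ hz => gVol_re_horL hlam hi₁ (u.side₁ _ _) (u.velE_ne_zero _)
      (u.velE_mem₁ hi₁ _ _) hx hy hz) (hB.trans (Φ.lagr₁_eq hlam _))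
    (fun x hx hx' => by simpa only [Icc.coe_zero] using hθ x hx hx') hα

lemma SympTrivialization.isArg_det_sq₂ (hi₂ : IsIsotropicEmbedding lam i₂) {a : I} {z : S1}
    {B : Matrix (Fin 3) (Fin 3) ℂ}
    (hB : Submodule.span ℝ (range B.transpose) = Φ.lagr₂ (a, 1, z)) {θ α : ℝ}
    (hθ : ∀ x : Fin 3 → E7, LinearIndependent ℝ x →
      Submodule.span ℝ (range x) = u.L₂ hlam (a, 1, z) →
      IsArg θ (Φ.det hlam ((0 : I) : ℝ) (a, 1, z) x / Φ.det hlam 1 (a, 1, z) x))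
    (hα : IsArg α (Φ.ratio hlam (a, 1, z) ^ 2)) : IsArg (2 * θ + α + Real.pi) (B.det ^ 2) :=
  Φ.isArg_det_sq hlam (L := u.L₂ hlam (a, 1, z))
    (fun _ hv => gProj_of_mem_horL hlam (u.velE_ne_zero _) hv)
    (finrank_horL hlam hi₂ (u.side₂ _ _) (u.velE_ne_zero _) (u.velE_mem₂ hi₂ _ _))
    (fun _ hx _ hy _ hz => gVol_re_horL hlam hi₂ (u.side₂ _ _) (u.velE_ne_zero _)
      (u.velE_mem₂ hi₂ _ _) hx hy hz) (hB.trans (Φ.lagr₂_eq hlam _))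
    (fun x hx hx' => by simpa only [Icc.coe_zero] using hθ x hx hx') hα

lemma hasWinding_iff {f : I → ℂ} {k : ℤ} : HasWinding f k ↔ ∃ θ : I → ℝ, Continuous θ ∧
    (∀ t, IsArg (2 * Real.pi * θ t) (f t)) ∧ θ 1 - θ 0 = k := by
  constructor
  · rintro ⟨h0, θ, hθ, h, hk⟩
    refine ⟨θ, hθ, fun t => ⟨‖f t‖, norm_pos_iff.2 (h0 t), ?_⟩, hk⟩
    rw [h t]
    simp [Complex.norm_exp]
  · rintro ⟨θ, hθ, h, hk⟩
    refine ⟨fun t => (h t).ne_zero, θ, hθ, fun t => ?_, hk⟩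
    have h1 := (h t).eq_norm
    push_cast at h1
    exact h1

lemma HasWinding.unique {f : I → ℂ} {k k' : ℤ} (h : HasWinding f k) (h' : HasWinding f k') :
    k = k' := by
  obtain ⟨θ, hθ, hf, hk⟩ := hasWinding_iff.1 h
  obtain ⟨θ', hθ', hf', hk'⟩ := hasWinding_iff.1 h'
  have h1 := arg_sub_arg_eq (hθ.const_mul (2 * Real.pi)) (hθ'.const_mul (2 * Real.pi)) hf hf' 1 0
  have h2 : (2 * Real.pi) * ((k : ℝ) - k') = 0 := by
    rw [← hk, ← hk']
    linarith
  have h3 := (mul_eq_zero.1 h2).resolve_left (by positivity)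
  exact_mod_cast sub_eq_zero.1 h3

/-- The square of the ratio of a normalized trivialization has a continuous argument. -/
lemma SympTrivialization.exists_arg_ratio (hi₁ : IsIsotropicEmbedding lam i₁)
    (hnorm : Φ.Normalized) :
    ∃ α : I × I × S1 → ℝ, Continuous α ∧ ∀ p, IsArg (α p) (Φ.ratio hlam p ^ 2) := by
  obtain ⟨θ, hθc, -, hθ⟩ := Φ.exists_arg_det₁ hlam hi₁
  obtain ⟨-, B, -, hB, hwind⟩ := hnorm
  obtain ⟨w, hwc, hw, hw01⟩ := hasWinding_iff.1 hwind
  have hc := Φ.continuous_ratio hlam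
  have hne (p) : Φ.ratio hlam p ^ 2 ≠ 0 := pow_ne_zero _ (Φ.ratio_ne_zero hlam p)
  have h0 (t : I) : IsArg (2 * Real.pi * w t - 2 * θ (0, 0, ((t : ℝ) : S1)) - Real.pi)
      (Φ.ratio hlam (0, 0, ((t : ℝ) : S1)) ^ 2) := by
    have h1 : Submodule.span ℝ (range (B t).transpose) = Φ.lagr₁ (0, 0, ((t : ℝ) : S1)) := by
      refine (hB t).trans ?_
      simp [SympTrivialization.boundaryMap, loopS]
    have h2 := isArg_arg (hne (0, 0, ((t : ℝ) : S1)))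
    obtain ⟨n, hn⟩ := (hw t).exists_int (Φ.isArg_det_sq₁ hlam hi₁ h1
      (fun x hx hx' => hθ 0 (0, ((t : ℝ) : S1)) x hx hx') h2)
    convert h2.add_int n using 1
    linarith
  -- Normalization says that det² of L₁ has winding number 0 along S. As θ is a function on the
  -- circle, the remaining argument of the squared ratio closes up.
  obtain ⟨α₀, hα₀, hα₀'⟩ := exists_circle_descent
    (f := fun t : I => 2 * Real.pi * w t - 2 * θ (0, 0, ((t : ℝ) : S1)) - Real.pi)
    (by
      have : Continuous fun t : I => ((t : ℝ) : S1) :=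
        (AddCircle.continuous_mk' 1).comp continuous_subtype_val
      fun_prop)
    (by
      have h1 : ((1 : ℝ) : S1) = ((0 : ℝ) : S1) := by simp
      have h2 : w 1 = w 0 := by
        rw [Int.cast_zero] at hw01
        linarith
      simp only [Icc.coe_zero, Icc.coe_one, h1, h2])
  have hα₀ (z : S1) : IsArg (α₀ z) (Φ.ratio hlam (0, 0, z) ^ 2) := by
    obtain ⟨t, rfl⟩ := exists_unitInterval_coe z
    rw [hα₀']
    exact h0 t
  -- The argument is continued from S over the side b = 0 and then in the direction of b.
  obtain ⟨α₁, hα₁c, hα₁, -⟩ := exists_arg (f := fun q : I × S1 => Φ.ratio hlam (q.1, 0, q.2) ^ 2)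
    ((hc.comp (by fun_prop)).pow 2) (fun q => hne _) ‹Continuous α₀› hα₀
  obtain ⟨α₂, hα₂c, hα₂, -⟩ := exists_arg
    (f := fun q : I × I × S1 => Φ.ratio hlam (q.2.1, q.1, q.2.2) ^ 2)
    ((hc.comp (by fun_prop)).pow 2) (fun q => hne _) hα₁c hα₁
  exact ⟨fun p => α₂ (p.2.1, p.1, p.2.2), by fun_prop, fun p => hα₂ _⟩

/-- The argument of the square of the determinant of a basis of the subspaces over the boundary of
the square, corrected by a power of the position. -/
theorem SympTrivialization.exists_arg_boundary (hi₁ : IsIsotropicEmbedding lam i₁)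
    (hi₂ : IsIsotropicEmbedding lam i₂) (hnorm : Φ.Normalized) {z₀ z₁ : S1} {n₀ n₁ : ℤ}
    (h₀ : endIndex hlam i₁ i₂ (u.map (0, 0, z₀)) (u.velE (0, 0, z₀)) = n₀)
    (h₁ : endIndex hlam i₁ i₂ (u.map (1, 0, z₁)) (u.velE (1, 0, z₁)) = n₁) :
    ∃ G : Torus → ℝ, Continuous G ∧ ∀ (q : Torus) (B : Matrix (Fin 3) (Fin 3) ℂ),
      Submodule.span ℝ (range B.transpose) = Φ.boundaryMap q →
      IsArg (G q) (B.det ^ 2 * (centre q.1)⁻¹ ^ (n₁ - n₀)) := by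
  obtain ⟨θ₁, hc₁, h1₁, hθ₁⟩ := Φ.exists_arg_det₁ hlam hi₁
  obtain ⟨θ₂, hc₂, h1₂, hθ₂⟩ := Φ.exists_arg_det₂ hlam hi₂
  obtain ⟨α, hαc, hα⟩ := Φ.exists_arg_ratio hlam hi₁ hnorm
  obtain ⟨ρ, hρc, hρ⟩ := exists_arg_centre
  have hend (a : I) (ha : a = 0 ∨ a = 1) (z : S1) : θ₂ (0, a, z) - θ₁ (0, a, z) =
      (3 - 2 * endIndex hlam i₁ i₂ (u.map (a, 0, z)) (u.velE (a, 0, z))) * (Real.pi / 2) := by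
    refine Φ.arg_sub_arg hlam hi₁ hi₂ (p := (a, 0, z)) ha (θ₁ := fun s => θ₁ (s, a, z))
      (θ₂ := fun s => θ₂ (s, a, z)) (by fun_prop) (by fun_prop) (h1₁ _) (h1₂ _)
      (fun s x hx hx' => hθ₁ s (a, z) x hx hx') (fun s x hx hx' => ?_)
    have h := hθ₂ s (a, z) x hx (hx'.trans (u.L₂_const hlam ha rfl rfl))
    rw [Φ.det_const hlam (p := (a, 0, z)) (q := (a, 1, z)) ha rfl rfl s,
      Φ.det_const hlam (p := (a, 0, z)) (q := (a, 1, z)) ha rfl rfl 1]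
    exact h
  -- The difference takes discrete values and is continuous, so it is constant along the circle; one
  -- point of each knot therefore determines its contribution.
  have hconst (a : I) (ha : a = 0 ∨ a = 1) (z z' : S1) : θ₂ (0, a, z) - θ₁ (0, a, z) =
      θ₂ (0, a, z') - θ₁ (0, a, z') := by
    have h := eq_of_forall_exists_int (Y := S1)
      (g := fun z => 3 / 2 - (θ₂ (0, a, z) - θ₁ (0, a, z)) / Real.pi) (by fun_prop)
      (fun z => ⟨endIndex hlam i₁ i₂ (u.map (a, 0, z)) (u.velE (a, 0, z)), by
        rw [hend a ha z]
        field_simp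
        ring⟩) z z'
    have h2 : (θ₂ (0, a, z) - θ₁ (0, a, z)) / Real.pi =
        (θ₂ (0, a, z') - θ₁ (0, a, z')) / Real.pi := by linarith
    exact (div_left_inj' Real.pi_ne_zero).1 h2
  have hz₀ (z : S1) : θ₂ (0, 0, z) - θ₁ (0, 0, z) = (3 - 2 * n₀) * (Real.pi / 2) := by
    rw [hconst 0 (Or.inl rfl) z z₀, hend 0 (Or.inl rfl), h₀]
  have hz₁ (z : S1) : θ₂ (0, 1, z) - θ₁ (0, 1, z) = (3 - 2 * n₁) * (Real.pi / 2) := by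
    rw [hconst 1 (Or.inr rfl) z z₁, hend 1 (Or.inr rfl), h₁]
  -- The argument is interpolated between 2θ₁ and 2θ₂. On the side a = 0 the interpolation grows by
  -- (3 − 2n₀)π instead of the 3π of the rotation, which the term 2πn₀b repairs; at b = 1 this term
  -- is a harmless multiple of 2π. On the side a = 1 the defect 2π(n₁ − n₀)b remains. It is the turn
  -- of `sideTurn`, and ρ compares that turn with `centre`.
  refine ⟨fun q => (1 - (q.1.1.2 : ℝ)) * (2 * θ₁ (0, q.1.1.1, q.2)) +
    (q.1.1.2 : ℝ) * (2 * θ₂ (0, q.1.1.1, q.2)) + α (q.1.1.1, q.1.1.2, q.2) + Real.pi +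
    2 * Real.pi * n₀ * (q.1.1.2 : ℝ) + ((n₁ - n₀ : ℤ) : ℝ) * ρ q.1, by fun_prop,
    fun q B hB => ?_⟩
  obtain ⟨⟨⟨a, b⟩, hab⟩, z⟩ := q
  have hcen : sideTurn ⟨(a, b), hab⟩ = 1 → IsArg (((n₁ - n₀ : ℤ) : ℝ) * ρ ⟨(a, b), hab⟩)
      ((centre ⟨(a, b), hab⟩)⁻¹ ^ (n₁ - n₀)) := by
    intro h
    have h1 := (hρ ⟨(a, b), hab⟩).zpow (n₁ - n₀)
    rwa [h, one_div] at h1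
  rcases eq_or_ne b 1 with rfl | hb
  · -- the side `b = 1`
    have h1 : Φ.boundaryMap (⟨(a, 1), hab⟩, z) = Φ.lagr₂ (a, 1, z) := by
      simp [SympTrivialization.boundaryMap]
    have h2 := ((Φ.isArg_det_sq₂ hlam hi₂ (hB.trans h1)
      (fun x hx hx' => hθ₂ 0 (a, z) x hx hx') (hα _)).mul
        (hcen (sideTurn_of_ne _ (Or.inr (Or.inr rfl))))).add_int n₀
    convert h2 using 1
    simp only [Icc.coe_one]
    ring
  rw [Φ.boundaryMap_of_ne_one hlam hb] at hB
  obtain ⟨B', hB', hdet⟩ := exists_of_span_cmul (Complex.exp_ne_zero _) hB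
  have h2 := ((isArg_rot₁ b).pow 6).mul (Φ.isArg_det_sq₁ hlam hi₁ hB'
    (fun x hx hx' => hθ₁ 0 (a, z) x hx hx') (hα _))
  have hdet' : B.det ^ 2 = rot₁ b ^ 6 * B'.det ^ 2 := hdet
  rw [← hdet'] at h2
  have hαb (ha : a = 0 ∨ a = 1) : IsArg (α (a, b, z)) (Φ.ratio hlam (a, 0, z) ^ 2) := by
    rw [← Φ.ratio_const hlam (p := (a, b, z)) (q := (a, 0, z)) ha rfl rfl]
    exact hα _
  have h2' (ha : a = 0 ∨ a = 1) := ((isArg_rot₁ b).pow 6).mul (Φ.isArg_det_sq₁ hlam hi₁ hB'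
    (fun x hx hx' => hθ₁ 0 (a, z) x hx hx') (hαb ha))
  rw [← hdet'] at h2'
  rcases eq_or_ne b 0 with rfl | hb0
  · -- the side `b = 0`
    have h3 := h2.mul (hcen (sideTurn_of_ne _ (Or.inr (Or.inl rfl))))
    convert h3 using 1
    simp only [Icc.coe_zero]
    push_cast
    ring
  rcases (show a = 0 ∨ a = 1 by tauto) with rfl | rfl
  · have h3 := (h2' (Or.inl rfl)).mul (hcen (sideTurn_of_ne _ (Or.inl rfl)))
    convert h3 using 1
    have h4 := hz₀ z
    have h5 : θ₂ (0, 0, z) = θ₁ (0, 0, z) + (3 - 2 * n₀) * (Real.pi / 2) := by linarith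
    simp only [h5]
    push_cast
    ring
  · have h6 : sideTurn ⟨(1, b), hab⟩ = Complex.exp ((2 * Real.pi * (b : ℝ) : ℝ) * Complex.I) := by
      simp [sideTurn]
    have h7 := ((hρ ⟨(1, b), hab⟩).div (isArg_exp (2 * Real.pi * (b : ℝ)))).zpow (n₁ - n₀)
    rw [h6, div_right_comm, div_self (Complex.exp_ne_zero _), one_div] at h7
    have h3 := (h2' (Or.inr rfl)).mul h7
    convert h3 using 1
    have h4 := hz₁ z
    have h5 : θ₂ (0, 1, z) = θ₁ (0, 1, z) + (3 - 2 * n₁) * (Real.pi / 2) := by linarith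
    simp only [h5]
    push_cast
    ring

end BoundaryArg

/-! ### A cycle of intersection number one. -/

section Cycle

/-- The radial projection of the unit circle to the boundary of the square. -/
lemma exists_square_loop : ∃ f : I → Bdry, Continuous f ∧ f 0 = f 1 ∧
    ∀ t : I, IsArg (2 * Real.pi * t) (centre (f t)) := by
  let m : I → ℝ := fun t => max |Real.cos (2 * Real.pi * t)| |Real.sin (2 * Real.pi * t)|
  have hm (t) : 0 < m t := by
    have h := Real.sin_sq_add_cos_sq (2 * Real.pi * t)
    by_contra! h0
    have h1 := abs_nonpos_iff.1 ((le_max_left _ _).trans h0)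
    have h2 := abs_nonpos_iff.1 ((le_max_right _ _).trans h0)
    rw [h1, h2] at h
    norm_num at h
  have hmem {m c : ℝ} (hm : 0 < m) (h : |c| ≤ m) : 1 / 2 + c / (2 * m) ∈ I := by
    obtain ⟨h1, h2⟩ := abs_le.1 h
    have h3 : c / (2 * m) ≤ 1 / 2 := by rw [div_le_div_iff₀ (by positivity) two_pos]; linarith
    have h4 : -(1 / 2) ≤ c / (2 * m) := by
      rw [neg_le, ← neg_div, div_le_div_iff₀ (by positivity) two_pos]; linarith
    constructor <;> linarith
  have hb {m c : ℝ} (hm : 0 < m) (h : |c| = m) :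
      1 / 2 + c / (2 * m) = 0 ∨ 1 / 2 + c / (2 * m) = 1 := by
    rcases abs_cases c with ⟨h1, -⟩ | ⟨h1, -⟩
    · right
      rw [← h1.symm.trans h]
      have : c ≠ 0 := by rintro rfl; simp at h; exact hm.ne h
      field_simp
      norm_num
    · left
      rw [← h1.symm.trans h]
      have : c ≠ 0 := by rintro rfl; simp at h; exact hm.ne h
      field_simp
      norm_num
  have hcont : Continuous m := by fun_prop
  let f : I → Bdry := fun t => ⟨(⟨_, hmem (hm t) (le_max_left _ _)⟩,
    ⟨_, hmem (hm t) (le_max_right _ _)⟩), by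
      rcases max_choice |Real.cos (2 * Real.pi * t)| |Real.sin (2 * Real.pi * t)| with h | h
      · rcases hb (hm t) h.symm with h' | h'
        · exact Or.inl (Subtype.ext h')
        · exact Or.inr (Or.inl (Subtype.ext h'))
      · rcases hb (hm t) h.symm with h' | h'
        · exact Or.inr (Or.inr (Or.inl (Subtype.ext h')))
        · exact Or.inr (Or.inr (Or.inr (Subtype.ext h')))⟩
  have h2m (t : I) : 2 * m t ≠ 0 := (mul_pos two_pos (hm t)).ne'
  refine ⟨f, ?_, ?_, fun t => ?_⟩
  · refine Continuous.subtype_mk (Continuous.prodMk (Continuous.subtype_mk ?_ _)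
      (Continuous.subtype_mk ?_ _)) _
    · exact continuous_const.add (Continuous.div (by fun_prop) (by fun_prop) h2m)
    · exact continuous_const.add (Continuous.div (by fun_prop) (by fun_prop) h2m)
  · have h1 : m 0 = m 1 := by simp [m]
    refine Subtype.ext (Prod.ext (Subtype.ext ?_) (Subtype.ext ?_))
    · change 1 / 2 + Real.cos (2 * Real.pi * (0 : I)) / (2 * m 0) =
        1 / 2 + Real.cos (2 * Real.pi * (1 : I)) / (2 * m 1)
      rw [h1]
      simp
    · change 1 / 2 + Real.sin (2 * Real.pi * (0 : I)) / (2 * m 0) =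
        1 / 2 + Real.sin (2 * Real.pi * (1 : I)) / (2 * m 1)
      rw [h1]
      simp
  · refine ⟨(2 * m t)⁻¹, inv_pos.2 (mul_pos two_pos (hm t)), Complex.ext ?_ ?_⟩
    · rw [centre_re, Complex.re_ofReal_mul, Complex.exp_ofReal_mul_I_re]
      change 1 / 2 + Real.cos (2 * Real.pi * t) / (2 * m t) - 1 / 2 = _
      rw [div_eq_inv_mul]
      ring
    · rw [centre_im, Complex.im_ofReal_mul, Complex.exp_ofReal_mul_I_im]
      change 1 / 2 + Real.sin (2 * Real.pi * t) / (2 * m t) - 1 / 2 = _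
      rw [div_eq_inv_mul]
      ring

theorem exists_pairsWithS : ∃ P : OneCycle, P.PairsWithS 1 := by
  obtain ⟨f, hf, hf01, hfa⟩ := exists_square_loop
  obtain ⟨g, hg, hgf⟩ := exists_circle_descent hf hf01
  -- Only the first component matters for the degree; the second could be any loop.
  refine ⟨⟨1, fun _ => ⟨fun z => (g z, z), by fun_prop⟩, fun _ => 1⟩, fun _ => 1, fun _ => ?_, by simp⟩
  refine hasWinding_iff.2 ⟨fun t => t, continuous_subtype_val, fun t => ?_, by simp⟩
  have h1 := hfa t
  rw [← hgf t] at h1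
  exact h1

end Cycle

/-! ### Velocities of reparametrized knots. -/

section Reparametrization

variable {M : Type*} [TopologicalSpace M] [ChartedSpace E7 M]

/-- Since φ increases by 1 over a period, it takes an integral value at some s, where γ' passes
through γ 0; the chain rule gives the factor φ'(s) > 0. -/
lemma SameKnot.exists_velocity {γ γ' : S1 → M} (h : SameKnot γ γ') (hγ : IsSingularKnot γ) :
    ∃ (z : S1) (c : ℝ), 0 < c ∧ γ' z = γ 0 ∧
      (velocity γ' z : E7) = c • (velocity γ 0 : E7) := by
  obtain ⟨φ, hφ, hφ', hφ1, hφγ⟩ := h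
  obtain ⟨s, -, hs⟩ : (⌈φ 0⌉ : ℝ) ∈ φ '' Icc 0 1 := by
    refine intermediate_value_Icc zero_le_one hφ.continuous.continuousOn
      ⟨Int.le_ceil _, ?_⟩
    have h1 := hφ1 0
    rw [zero_add] at h1
    rw [h1]
    exact (Int.ceil_lt_add_one _).le
  have hcast (n : ℤ) : ((n : ℝ) : S1) = 0 := by
    rw [AddCircle.coe_eq_zero_iff]
    exact ⟨n, by simp⟩
  refine ⟨(s : S1), deriv φ s, hφ' s, by rw [hφγ, hs, hcast], ?_⟩
  let F : ℝ → M := fun r => γ (0 + (r : S1))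
  let ψ : ℝ → ℝ := fun r => φ (s + r) - ⌈φ 0⌉
  have hψ0 : ψ 0 = 0 := by simp [ψ, hs]
  have hfun : (fun r : ℝ => γ' ((s : S1) + (r : S1))) = F ∘ ψ := by
    funext r
    have h1 : ((s : S1) + (r : S1)) = ((s + r : ℝ) : S1) := (AddCircle.coe_add 1 s r).symm
    simp only [Function.comp_apply, F, ψ]
    rw [h1, hφγ, AddCircle.coe_sub, hcast, sub_zero, zero_add]
  have hψd : HasDerivAt ψ (deriv φ s) 0 := by
    have h1 : HasDerivAt φ (deriv φ s) (s + 0) := by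
      rw [add_zero]
      exact (hφ.differentiable (by simp)).differentiableAt.hasDerivAt
    exact ((h1.comp_const_add s 0)).sub_const _
  have hF : MDifferentiableAt 𝓘(ℝ, ℝ) (𝓡 7) F (ψ 0) := by
    have h1 : F = fun r : ℝ => γ (r : S1) := by
      funext r
      simp only [F, zero_add]
    rw [h1]
    exact (hγ.smooth.mdifferentiable (by simp)) _
  have hψm : MDifferentiableAt 𝓘(ℝ, ℝ) 𝓘(ℝ, ℝ) ψ 0 := hψd.differentiableAt.mdifferentiableAt
  have h0 (r : ℝ) (hr : r = 0) (w : ℝ) : (mfderiv 𝓘(ℝ, ℝ) (𝓡 7) F r w : E7) =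
      (mfderiv 𝓘(ℝ, ℝ) (𝓡 7) F 0 w : E7) := by
    subst hr
    rfl
  change (mfderiv 𝓘(ℝ, ℝ) (𝓡 7) (fun r : ℝ => γ' ((s : S1) + (r : S1))) 0 (1 : ℝ) : E7) =
    deriv φ s • (mfderiv 𝓘(ℝ, ℝ) (𝓡 7) F 0 (1 : ℝ) : E7)
  rw [hfun]
  have h2 := mfderiv_comp (0 : ℝ) hF hψm
  have h3 : (mfderiv 𝓘(ℝ, ℝ) (𝓡 7) (F ∘ ψ) 0 (1 : ℝ) : E7) =
      (mfderiv 𝓘(ℝ, ℝ) (𝓡 7) F (ψ 0) (mfderiv 𝓘(ℝ, ℝ) 𝓘(ℝ, ℝ) ψ 0 (1 : ℝ) : ℝ) : E7) := by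
    rw [h2]
    rfl
  have h4 : (mfderiv 𝓘(ℝ, ℝ) 𝓘(ℝ, ℝ) ψ 0 (1 : ℝ) : ℝ) = deriv φ s * 1 :=
    ((congrArg (fun L : ℝ →L[ℝ] ℝ => L 1) (mfderiv_eq_fderiv (f := ψ) (x := 0))).trans
      (fderiv_apply_one_eq_deriv.trans hψd.deriv)).trans (mul_one _).symm
  exact h3.trans ((congrArg
    (fun w : ℝ => (mfderiv 𝓘(ℝ, ℝ) (𝓡 7) F (ψ 0) w : E7)) h4).trans ((h0 _ hψ0 _).trans
      (map_smul (mfderiv 𝓘(ℝ, ℝ) (𝓡 7) F 0) (deriv φ s) (1 : ℝ))))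

end Reparametrization

/-! ### Evaluation of the Maslov class and of the index. -/

section Maslov

variable {M : Type*} [TopologicalSpace M] [ChartedSpace E7 M] [IsManifold (𝓡 7) ∞ M]
  {N₁ N₂ : Type*} [TopologicalSpace N₁] [ChartedSpace (EuclideanSpace ℝ (Fin 4)) N₁]
  [IsManifold (𝓡 4) ∞ N₁] [TopologicalSpace N₂] [ChartedSpace (EuclideanSpace ℝ (Fin 4)) N₂]
  [IsManifold (𝓡 4) ∞ N₂]
  {lam : ThreeForm M} {i₁ : N₁ → M} {i₂ : N₂ → M} {γ₁ γ₂ : S1 → M}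
  {u : ConnectingSquare i₁ i₂ γ₁ γ₂}

/-- The Maslov class of the boundary map of a normalized trivialization is a multiple of the
degree of the projection to the boundary of the square. -/
theorem SympTrivialization.isMaslov_iff (Φ : SympTrivialization lam u) (hlam : IsG2Form lam)
    (hi₁ : IsIsotropicEmbedding lam i₁) (hi₂ : IsIsotropicEmbedding lam i₂)
    (hnorm : Φ.Normalized) {z₀ z₁ : S1} {n₀ n₁ : ℤ}
    (h₀ : endIndex hlam i₁ i₂ (u.map (0, 0, z₀)) (u.velE (0, 0, z₀)) = n₀)
    (h₁ : endIndex hlam i₁ i₂ (u.map (1, 0, z₁)) (u.velE (1, 0, z₁)) = n₁)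
    (ℓ : C(S1, Torus)) {d : ℤ}
    (hd : HasWinding (fun t : I => centre (ℓ ((t : ℝ) : S1)).1) d) (k : ℤ) :
    IsMaslov (fun z => Φ.boundaryMap (ℓ z)) k ↔ k = (n₁ - n₀) * d := by
  obtain ⟨G, hG, hGB⟩ := Φ.exists_arg_boundary hlam hi₁ hi₂ hnorm h₀ h₁
  obtain ⟨w, hwc, hw, hw01⟩ := hasWinding_iff.1 hd
  have hcoe : Continuous fun t : I => ((t : ℝ) : S1) :=
    (AddCircle.continuous_mk' 1).comp continuous_subtype_val
  -- The function G closes up along the loop, so all winding comes from the power of `centre` which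
  -- is multiplied back: n₁ − n₀ times the degree d.
  have key (B : I → Matrix (Fin 3) (Fin 3) ℂ)
      (hB : ∀ t : I, Submodule.span ℝ (range (B t).transpose) =
        Φ.boundaryMap (ℓ ((t : ℝ) : S1))) :
      HasWinding (fun t => (B t).det ^ 2) ((n₁ - n₀) * d) := by
    refine hasWinding_iff.2 ⟨fun t => G (ℓ ((t : ℝ) : S1)) / (2 * Real.pi) + (n₁ - n₀ : ℤ) * w t,
      ?_, fun t => ?_, ?_⟩
    · have := hG.comp (ℓ.continuous.comp hcoe)
      simp only [Function.comp_def] at this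
      fun_prop
    · have h1 := (hGB _ (B t) (hB t)).mul ((hw t).zpow (n₁ - n₀))
      have h2 := centre_ne_zero (ℓ ((t : ℝ) : S1)).1
      have h3 : (B t).det ^ 2 * (centre (ℓ ((t : ℝ) : S1)).1)⁻¹ ^ (n₁ - n₀) *
          centre (ℓ ((t : ℝ) : S1)).1 ^ (n₁ - n₀) = (B t).det ^ 2 := by
        rw [mul_assoc, ← mul_zpow, inv_mul_cancel₀ h2, one_zpow, mul_one]
      rw [h3] at h1
      convert h1 using 1
      field_simp
    · have h1 : ((1 : ℝ) : S1) = ((0 : ℝ) : S1) := by simp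
      simp only [Icc.coe_zero, Icc.coe_one, h1]
      rw [add_sub_add_left_eq_sub, ← mul_sub, hw01]
      push_cast
      ring
  constructor
  · rintro ⟨-, B, -, hB, hk⟩
    exact hk.unique (key B hB)
  · rintro rfl
    refine ⟨fun z => Φ.stdSymp_boundaryMap hlam hi₁ hi₂ (ℓ z), ?_⟩
    have hloc : LocFramed (fun t : I => Φ.boundaryMap (ℓ ((t : ℝ) : S1))) 3 :=
      (Φ.locFramed_boundaryMap hlam hi₁ hi₂).comp (ℓ.continuous.comp hcoe)
    obtain ⟨b₀, hb₀, hb₀'⟩ := hloc.exists_frame 0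
    obtain ⟨b, hb, -, hb'⟩ := hloc.exists_path_frame hb₀ hb₀'
    refine ⟨fun t => (Matrix.of (b t)).transpose, ?_, fun t => (hb' t).2,
      key _ fun t => (hb' t).2⟩
    exact Continuous.matrix_transpose hb

/-- The relative index, expressed by the position of the submanifolds along the two loops. -/
theorem isRelativeIndex_iff (Φ : SympTrivialization lam u) (hlam : IsG2Form lam)
    (hi₁ : IsIsotropicEmbedding lam i₁) (hi₂ : IsIsotropicEmbedding lam i₂)
    (hγ₁ : IsSingularKnot γ₁) (hγ₂ : IsSingularKnot γ₂) (hnorm : Φ.Normalized) {P : OneCycle}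
    (hP : P.PairsWithS 1) (k : ℤ) :
    IsRelativeIndex u Φ P k ↔ k = endIndex hlam i₁ i₂ (γ₁ 0) (velocity γ₁ 0) -
      endIndex hlam i₁ i₂ (γ₂ 0) (velocity γ₂ 0) := by
  -- The contributions are evaluated where the ends of the square pass through γ₁ 0 and γ₂ 0. There
  -- the velocities differ from those of γ₁ and γ₂ by positive factors, so the result no longer
  -- depends on the square.
  obtain ⟨z₁, c₁, hc₁, hz₁, hv₁⟩ := u.end_one.exists_velocity hγ₁
  obtain ⟨z₀, c₀, hc₀, hz₀, hv₀⟩ := u.end_zero.exists_velocity hγ₂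
  have h₁ : endIndex hlam i₁ i₂ (u.map (1, 0, z₁)) (u.velE (1, 0, z₁)) =
      endIndex hlam i₁ i₂ (γ₁ 0) (velocity γ₁ 0) := by
    rw [← endIndex_smul hlam (γ₁ 0) (velocity γ₁ 0) hc₁, hz₁]
    exact congrArg _ hv₁
  have h₀ : endIndex hlam i₁ i₂ (u.map (0, 0, z₀)) (u.velE (0, 0, z₀)) =
      endIndex hlam i₁ i₂ (γ₂ 0) (velocity γ₂ 0) := by
    rw [← endIndex_smul hlam (γ₂ 0) (velocity γ₂ 0) hc₀, hz₀]
    exact congrArg _ hv₀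
  set m := endIndex hlam i₁ i₂ (γ₁ 0) (velocity γ₁ 0) -
    endIndex hlam i₁ i₂ (γ₂ 0) (velocity γ₂ 0) with hm
  obtain ⟨d, hd, hd1⟩ := hP
  have key (j) (k : ℤ) : IsMaslov (fun z => Φ.boundaryMap (P.loop j z)) k ↔ k = m * d j :=
    Φ.isMaslov_iff hlam hi₁ hi₂ hnorm h₀ h₁ (P.loop j) (hd j) k
  have hsum : ∑ j, P.coeff j * (m * d j) = m := by
    calc ∑ j, P.coeff j * (m * d j) = m * ∑ j, P.coeff j * d j := by
          rw [Finset.mul_sum]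
          exact Finset.sum_congr rfl fun j _ => by ring
      _ = m := by rw [hd1, mul_one]
  constructor
  · rintro ⟨n, hn, rfl⟩
    rw [← hsum]
    exact Finset.sum_congr rfl fun j _ => by rw [(key j _).1 (hn j)]
  · rintro rfl
    exact ⟨fun j => m * d j, fun j => (key j _).2 rfl, hsum⟩

end Maslov

end G2Loop

end

open G2Loop in
theorem mainTheorem3 {M N₁ N₂ : Type*}
    [TopologicalSpace M] [T2Space M] [SecondCountableTopology M]
    [ChartedSpace E7 M] [IsManifold (𝓡 7) ∞ M]
    [TopologicalSpace N₁] [ChartedSpace (EuclideanSpace ℝ (Fin 4)) N₁] [IsManifold (𝓡 4) ∞ N₁]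
    [TopologicalSpace N₂] [ChartedSpace (EuclideanSpace ℝ (Fin 4)) N₂] [IsManifold (𝓡 4) ∞ N₂]
    (lam : ThreeForm M) (hlam : IsG2Form lam)
    (i₁ : N₁ → M) (hi₁ : IsIsotropicEmbedding lam i₁)
    (i₂ : N₂ → M) (hi₂ : IsIsotropicEmbedding lam i₂)
    (htrans : Transversal i₁ i₂)
    (γ₁ γ₂ : S1 → M) (hγ₁ : IsSingularKnot γ₁) (hγ₂ : IsSingularKnot γ₂)
    (hγ₁' : Set.range γ₁ ⊆ Set.range i₁ ∩ Set.range i₂)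
    (hγ₂' : Set.range γ₂ ⊆ Set.range i₁ ∩ Set.range i₂)
    (hu : Nonempty (ConnectingSquare i₁ i₂ γ₁ γ₂)) :
    (∀ u : ConnectingSquare i₁ i₂ γ₁ γ₂, ∃ Φ : SympTrivialization lam u, Φ.Normalized) ∧
    (∃ P : OneCycle, P.PairsWithS 1) ∧
    ∃! m : ℤ, ∀ (u : ConnectingSquare i₁ i₂ γ₁ γ₂) (Φ : SympTrivialization lam u) (P : OneCycle),
      Φ.Normalized → P.PairsWithS 1 → IsRelativeIndex u Φ P m := by
  refine ⟨fun u => u.exists_normalized hlam hi₁ hi₂ htrans, exists_pairsWithS, ?_⟩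
  -- The value is explicit and the same for all choices; uniqueness only needs one square, one
  -- normalized trivialization and one cycle.
  refine ⟨endIndex hlam i₁ i₂ (γ₁ 0) (velocity γ₁ 0) -
    endIndex hlam i₁ i₂ (γ₂ 0) (velocity γ₂ 0), fun u Φ P hΦ hP =>
      (isRelativeIndex_iff Φ hlam hi₁ hi₂ hγ₁ hγ₂ hΦ hP _).2 rfl, fun m hm => ?_⟩
  obtain ⟨u⟩ := hu
  obtain ⟨Φ, hΦ⟩ := u.exists_normalized hlam hi₁ hi₂ htrans
  obtain ⟨P, hP⟩ := exists_pairsWithS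
  exact (isRelativeIndex_iff Φ hlam hi₁ hi₂ hγ₁ hγ₂ hΦ hP _).1 (hm u Φ P hΦ hP)
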